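/- Theorem 1.8. The extension $\mathrm{Vect}_{\mathbb R}\to\mathrm{SuperVect}_{\mathbb C}$ is Galois. In detail. Let $\mathrm{Pres}_{\mathbb R}$ be the bicategory of $\mathbb R$-linear locally presentable categories, $\mathbb R$-linear cocontinuous functors and natural transformations. An object $\mathcal V$ of $\mathrm{Pres}_{\mathbb R}$ is *finite-dimensional* if there are finitely many objects $S_1,\dots,S_n\in\mathcal V$ that generate $\mathcal V$ under small colimits, such that every $\hom(S_k,S_l)$ is a finite-dimensional real vector space and every functor $\hom(S_k,-):\mathcal V\to\mathrm{Vect}_{\mathbb R}$ is cocontinuous. Write $\mathcal C=\mathrm{Vect}_{\mathbb R}$, with its usual symmetric monoidal structure. Let $\mathcal D=\mathrm{SuperVect}_{\mathbb C}$ be the category of complex representations of $\mathbb Z/2$ with its usual monoidal structure and with the symmetry $x\otimes y\mapsto(-1)^{pq}\,y\otimes x$ for $x,y$ homogeneous of parities $p,q$ (the parity is even or odd according to whether the generator of $\mathbb Z/2$ acts by $+1$ or by $-1$). Let $i:\mathcal C\to\mathcal D$ be the symmetric monoidal functor that sends $V$ to the purely even supervector space $\mathbb C\otimes_{\mathbb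 R}V$. * For a symmetric monoidal category $\mathcal E\in\{\mathcal C,\mathcal D\}$, an *$\mathcal E$-module* is a $\mathcal V\in\mathrm{Pres}_{\mathbb R}$ with an action $\mathcal E\times\mathcal V\to\mathcal V$ (with coherent associativity and unit isomorphisms) that is $\mathbb R$-linear and cocontinuous in each variable. The modules over $\mathcal E$, the $\mathbb R$-linear cocontinuous strong module functors and the module transformations form a bicategory. * $\mathrm{Aut}=\mathrm{Aut}_{\mathbb R}(\mathcal D)$ is the $2$-group of $\mathbb R$-linear symmetric monoidal autoequivalences $g$ of $\mathcal D$ equipped with a monoidal isomorphism $g\circ i\cong i$; its morphisms are the invertible monoidal transformations compatible with these isomorphisms, and its multiplication is composition. * A *$\mathcal D\rtimes\mathrm{Aut}$-module* is a $\mathcal D$-module $\mathcal W$ with an action of $\mathrm{Aut}$ by $\mathbb R$-linear cocontinuous functors for which the $\mathcal D$-action is coherently $\mathrm{Aut}$-equivariant, $g(d\cdot w)\cong g(d)\cdot g(w)$. Equivalently, it is a module over the monoidal category with objects the pairs $(d,g)$ and with tensor product $(d,g)\otimes(d',g')=(d\otimes g(d'),\,g\circ g')$, the action being $\mathbb R$-linear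 and cocontinuous in the module variable and in $d$. The $1$-morphisms are the $\mathbb R$-linear cocontinuous strong module functors, and the $2$-morphisms are the module transformations. * The *fixed points* $\mathcal W^{\mathrm{Aut}}$ of a $\mathcal D\rtimes\mathrm{Aut}$-module $\mathcal W$ are the category of objects $w\in\mathcal W$ with isomorphisms $g\cdot w\cong w$ that are natural in $g\in\mathrm{Aut}$ and compatible with the unit and the multiplication of $\mathrm{Aut}$; the morphisms are those of $\mathcal W$ that commute with these isomorphisms. The category $\mathcal C$ acts on $\mathcal W^{\mathrm{Aut}}$ through $i$ and the given isomorphisms $g\circ i\cong i$. Let $\mathrm{MOD}_{\mathcal C}$ and $\mathrm{MOD}_{\mathcal D\rtimes\mathrm{Aut}}$ be the bicategories of all $\mathcal C$-modules and of all $\mathcal D\rtimes\mathrm{Aut}$-modules, or, alternatively, their full sub-bicategories on the modules whose underlying category is finite-dimensional. Then, in both cases, taking fixed points is a well-defined pseudofunctor $(-)^{\mathrm{Aut}}:\mathrm{MOD}_{\mathcal D\rtimes\mathrm{Aut}}\to\mathrm{MOD}_{\mathcal C}$, and base change is an inverse to it. That is, there are a pseudofunctor $F:\mathrm{MOD}_{\mathcal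 C}\to\mathrm{MOD}_{\mathcal D\rtimes\mathrm{Aut}}$ and pseudonatural equivalences $$\iota:\mathrm{id}\simeq F(-)^{\mathrm{Aut}},\qquad F\bigl((-)^{\mathrm{Aut}}\bigr)\simeq\mathrm{id},$$ such that for every $\mathcal V\in\mathrm{MOD}_{\mathcal C}$ the functor $\mathcal V\times\mathcal D\to F(\mathcal V)$, $(v,d)\mapsto d\cdot\iota(v)$, exhibits $F(\mathcal V)$ as the relative tensor product $\mathcal V\boxtimes_{\mathcal C}\mathcal D$. The last condition means that, for every $\mathcal U\in\mathrm{Pres}_{\mathbb R}$, composition with this functor is an equivalence from the category of $\mathbb R$-linear cocontinuous functors $F(\mathcal V)\to\mathcal U$ to the category of $\mathcal C$-balanced functors $\mathcal V\times\mathcal D\to\mathcal U$ that are $\mathbb R$-linear and cocontinuous in each variable. In particular, $-\boxtimes_{\mathbb R}\mathrm{SuperVect}_{\mathbb C}$ is an equivalence of bicategories from $\mathrm{Vect}_{\mathbb R}$-modules to $\mathrm{SuperVect}_{\mathbb C}$-modules with a compatible action of $\mathrm{Aut}_{\mathbb R}(\mathrm{SuperVect}_{\mathbb C})$, with inverse $(-)^{\mathrm{Aut}}$.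 -/

import Mathlib

open CategoryTheory Limits Opposite

noncomputable section

namespace CatGalois

universe v u v₁ u₁ v₂ u₂ v₃ u₃

/-- A category enriched in real vector spaces (with small hom-spaces). -/
structure LinCat where
  carrier : Type 1
  [cat : Category.{0} carrier]
  [preadditive : Preadditive carrier]
  [linear : Linear ℝ carrier]

attribute [instance] LinCat.cat LinCat.preadditive LinCat.linear

/-- An `ℝ`-linear functor preserving all small colimits. -/
structure IsCocontLinear {X : Type u₁} [Category.{v₁} X] [Preadditive X] [Linear ℝ X]
    {Y : Type u₂} [Category.{v₂} Y] [Preadditive Y] [Linear ℝ Y] (F : X ⥤ Y) : Prop where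
  additive : F.Additive
  linear : F.Linear ℝ
  cocontinuous : PreservesColimitsOfSize.{0, 0} F

section LinMod

open MonoidalCategory (MonoidalLeftAction)
open MonoidalCategory.MonoidalLeftAction Bicategory

variable (E : Type u) [Category.{v} E] [MonoidalCategory E]

/-- A real linear category with an action of the monoidal category `E` by linear functors. -/
structure LinMod extends LinCat where
  [action : MonoidalCategory.MonoidalLeftAction E carrier]
  action_add : ∀ (e : E) {X Y : carrier} (f g : X ⟶ Y), e ⊴ₗ (f + g) = e ⊴ₗ f + e ⊴ₗ g
  action_smul : ∀ (e : E) {X Y : carrier} (r : ℝ) (f : X ⟶ Y), e ⊴ₗ (r • f) = r • e ⊴ₗ f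

attribute [instance] LinMod.action

variable {E}

/-- A strong `E`-module functor. -/
structure LinMod.Hom (V W : LinMod E) where
  functor : V.carrier ⥤ W.carrier
  [leftLinear : functor.LeftLinear E]

attribute [instance] LinMod.Hom.leftLinear

open Functor.LaxLeftLinear Functor.OplaxLeftLinear

/-- An `E`-module natural transformation. -/
@[ext]
structure LinMod.Hom₂ {V W : LinMod E} (F G : LinMod.Hom V W) where
  trans : F.functor ⟶ G.functor
  comm : ∀ (e : E) (X : V.carrier),
    μₗ F.functor e X ≫ trans.app (e ⊙ₗ X) = e ⊴ₗ trans.app X ≫ μₗ G.functor e X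

lemma LinMod.Hom₂.comm_assoc {V W : LinMod E} {F G : LinMod.Hom V W} (a : LinMod.Hom₂ F G) (e : E)
    (X : V.carrier) {Z : W.carrier} (h : G.functor.obj (e ⊙ₗ X) ⟶ Z) :
    μₗ F.functor e X ≫ a.trans.app (e ⊙ₗ X) ≫ h =
      e ⊴ₗ a.trans.app X ≫ μₗ G.functor e X ≫ h := by
  simpa only [Category.assoc] using congrArg (· ≫ h) (a.comm e X)

instance leftLinearId (V : Type u₁) [Category.{v₁} V] [MonoidalLeftAction E V] :
    (𝟭 V).LeftLinear E where
  μₗ e X := 𝟙 _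
  δₗ e X := 𝟙 _
  μₗ_comp_δₗ := by simp
  δₗ_comp_μₗ := by simp

instance leftLinearComp {V : Type u₁} [Category.{v₁} V] [MonoidalLeftAction E V]
    {W : Type u₂} [Category.{v₂} W] [MonoidalLeftAction E W]
    {Z : Type u₃} [Category.{v₃} Z] [MonoidalLeftAction E Z] (F : V ⥤ W) (G : W ⥤ Z)
    [F.LeftLinear E] [G.LeftLinear E] : (F ⋙ G).LeftLinear E where
  μₗ e X := μₗ G e (F.obj X) ≫ G.map (μₗ F e X)
  δₗ e X := G.map (δₗ F e X) ≫ δₗ G e (F.obj X)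
  μₗ_naturality_left f X := by simp [← Functor.map_comp]
  μₗ_naturality_right f X := by simp [← Functor.map_comp]
  μₗ_associativity c c' d := by
    simp only [Functor.comp_obj, Functor.comp_map, Category.assoc, ← Functor.map_comp,
      μₗ_associativity, actionHomRight_comp, μₗ_naturality_right_assoc]
    simp
  μₗ_unitality d := by simp [← Functor.map_comp]
  δₗ_naturality_left f X := by simp [← Functor.map_comp_assoc]
  δₗ_naturality_right f X := by
    simp only [Functor.comp_obj, Functor.comp_map, Category.assoc, ← Functor.map_comp_assoc,
      δₗ_naturality_right]
    simp
  δₗ_associativity c c' d := by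
    simp only [Functor.comp_obj, Functor.comp_map, Category.assoc, ← Functor.map_comp_assoc,
      δₗ_associativity, actionHomRight_comp]
    simp [← δₗ_naturality_right_assoc]
  δₗ_unitality_inv d := by
    dsimp only [Functor.comp_obj]
    rw [δₗ_unitality_inv G, δₗ_unitality_inv F]
    simp
  μₗ_comp_δₗ := by simp [← Functor.map_comp_assoc]
  δₗ_comp_μₗ := by simp [← Functor.map_comp]

instance : CategoryStruct (LinMod E) where
  Hom := LinMod.Hom
  id V := { functor := 𝟭 V.carrier }
  comp F G := { functor := F.functor ⋙ G.functor }

instance (V W : LinMod E) : Category (V ⟶ W) where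
  Hom F G := LinMod.Hom₂ F G
  id F := { trans := 𝟙 _, comm := by simp }
  comp a b := { trans := a.trans ≫ b.trans, comm := by simp [a.comm_assoc, b.comm] }

@[ext] lemma LinMod.hom₂_ext {V W : LinMod E} {F G : V ⟶ W} {a b : F ⟶ G}
    (h : ∀ X, a.trans.app X = b.trans.app X) : a = b :=
  LinMod.Hom₂.ext (NatTrans.ext (funext h))

@[simp] lemma LinMod.id₂_trans {V W : LinMod E} (F : V ⟶ W) :
    LinMod.Hom₂.trans (𝟙 F) = 𝟙 F.functor := rfl
@[simp] lemma LinMod.comp₂_trans {V W : LinMod E} {F G H : V ⟶ W} (a : F ⟶ G) (b : G ⟶ H) :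
    (a ≫ b).trans = a.trans ≫ b.trans := rfl
@[simp] lemma LinMod.id_functor (V : LinMod E) :
    LinMod.Hom.functor (𝟙 V) = 𝟭 V.carrier := rfl
@[simp] lemma LinMod.comp_functor {V W Z : LinMod E} (F : V ⟶ W) (G : W ⟶ Z) :
    (F ≫ G).functor = F.functor ⋙ G.functor := rfl

/-- Invertible module transformations from invertible natural transformations. -/
@[simps]
def LinMod.isoMk {V W : LinMod E} {F G : V ⟶ W} (e : F.functor ≅ G.functor)
    (h : ∀ (c : E) (X : V.carrier),
      μₗ F.functor c X ≫ e.hom.app (c ⊙ₗ X) = c ⊴ₗ e.hom.app X ≫ μₗ G.functor c X) : F ≅ G where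
  hom := { trans := e.hom, comm := h }
  inv :=
    { trans := e.inv
      comm := fun c X => by
        rw [← cancel_mono (e.hom.app (c ⊙ₗ X)), Category.assoc, Category.assoc, h]
        simp [← actionHomRight_comp_assoc] }
  hom_inv_id := by ext; simp
  inv_hom_id := by ext; simp

@[simp] lemma μₗ_id (V : Type u₁) [Category.{v₁} V] [MonoidalLeftAction E V] (e : E) (X : V) :
    μₗ (𝟭 V) e X = 𝟙 _ := rfl
@[simp] lemma μₗ_comp {V : Type u₁} [Category.{v₁} V] [MonoidalLeftAction E V]
    {W : Type u₂} [Category.{v₂} W] [MonoidalLeftAction E W]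
    {Z : Type u₃} [Category.{v₃} Z] [MonoidalLeftAction E Z] (F : V ⥤ W) (G : W ⥤ Z)
    [F.LeftLinear E] [G.LeftLinear E] (e : E) (X : V) :
    μₗ (F ⋙ G) e X = μₗ G e (F.obj X) ≫ G.map (μₗ F e X) := rfl

/-- Left whiskering of a module transformation. -/
def LinMod.whiskerLeft₂ {V W Z : LinMod E} (F : V ⟶ W) {G H : W ⟶ Z} (a : G ⟶ H) :
    F ≫ G ⟶ F ≫ H :=
  LinMod.Hom₂.mk (F := F ≫ G) (G := F ≫ H) (Functor.whiskerLeft F.functor a.trans)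
    (fun e X => by simp [LinMod.Hom₂.comm_assoc])

/-- Right whiskering of a module transformation. -/
def LinMod.whiskerRight₂ {V W Z : LinMod E} {F G : V ⟶ W} (a : F ⟶ G) (H : W ⟶ Z) :
    F ≫ H ⟶ G ≫ H :=
  LinMod.Hom₂.mk (F := F ≫ H) (G := G ≫ H) (Functor.whiskerRight a.trans H.functor)
    (fun e X => by simp [← Functor.map_comp, LinMod.Hom₂.comm])

@[simp] lemma LinMod.whiskerLeft₂_trans {V W Z : LinMod E} (F : V ⟶ W) {G H : W ⟶ Z}
    (a : G ⟶ H) : (whiskerLeft₂ F a).trans = Functor.whiskerLeft F.functor a.trans := rfl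
@[simp] lemma LinMod.whiskerRight₂_trans {V W Z : LinMod E} {F G : V ⟶ W} (a : F ⟶ G)
    (H : W ⟶ Z) : (whiskerRight₂ a H).trans = Functor.whiskerRight a.trans H.functor := rfl

/-- The bicategory of `E`-module categories, strong module functors, module transformations. -/
instance : Bicategory (LinMod E) where
  whiskerLeft F _ _ a := LinMod.whiskerLeft₂ F a
  whiskerRight a H := LinMod.whiskerRight₂ a H
  associator F G H := LinMod.isoMk (F := (F ≫ G) ≫ H) (G := F ≫ G ≫ H)
    (Functor.associator _ _ _) (by simp)
  leftUnitor {V _} F := LinMod.isoMk (F := 𝟙 V ≫ F) (G := F) (Functor.leftUnitor _) (by simp)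
  rightUnitor {_ W} F := LinMod.isoMk (F := F ≫ 𝟙 W) (G := F) (Functor.rightUnitor _) (by simp)
  id_whiskerRight _ _ := by apply LinMod.hom₂_ext; intro X; simp
  comp_whiskerRight _ _ _ := by apply LinMod.hom₂_ext; intro X; simp
  whisker_exchange _ _ := by apply LinMod.hom₂_ext; intro X; simp
  pentagon _ _ _ _ := by apply LinMod.hom₂_ext; intro X; simp
  triangle _ _ := by apply LinMod.hom₂_ext; intro X; simp

@[simp] lemma LinMod.whiskerLeft_trans {V W Z : LinMod E} (F : V ⟶ W) {G H : W ⟶ Z} (a : G ⟶ H) :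
    (F ◁ a).trans = Functor.whiskerLeft F.functor a.trans := rfl
@[simp] lemma LinMod.whiskerRight_trans {V W Z : LinMod E} {F G : V ⟶ W} (a : F ⟶ G) (H : W ⟶ Z) :
    (a ▷ H).trans = Functor.whiskerRight a.trans H.functor := rfl

end LinMod

section SubBicategory

open Bicategory

/-- A locally full sub-bicategory: a class of objects and a class of 1-morphisms that contains
identities and is closed under composition, with all 2-morphisms. -/
structure SubBicategory (B : Type u) [Bicategory.{v, u₁} B] where
  obj : B → Prop
  hom : ∀ {a b : B}, (a ⟶ b) → Prop
  id_mem : ∀ a : B, hom (𝟙 a)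
  comp_mem : ∀ {a b c : B} (f : a ⟶ b) (g : b ⟶ c), hom f → hom g → hom (f ≫ g)

variable {B : Type u} [Bicategory.{v, u₁} B]

namespace SubBicategory

/-- The objects of a sub-bicategory. -/
structure Carrier (S : SubBicategory B) where
  of : B
  mem : S.obj of

/-- The 1-morphisms of a sub-bicategory. -/
structure Hom {S : SubBicategory B} (a b : S.Carrier) where
  of : a.of ⟶ b.of
  mem : S.hom of

/-- The 2-morphisms of a sub-bicategory. -/
@[ext]
structure Hom₂ {S : SubBicategory B} {a b : S.Carrier} (f g : Hom a b) where
  of : f.of ⟶ g.of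

variable {S : SubBicategory B}

instance : CategoryStruct S.Carrier where
  Hom := Hom
  id a := ⟨𝟙 a.of, S.id_mem _⟩
  comp f g := ⟨f.of ≫ g.of, S.comp_mem _ _ f.mem g.mem⟩

instance (a b : S.Carrier) : Category (a ⟶ b) where
  Hom f g := Hom₂ f g
  id f := ⟨𝟙 f.of⟩
  comp x y := ⟨x.of ≫ y.of⟩

@[ext] lemma hom₂_ext {a b : S.Carrier} {f g : a ⟶ b} {x y : f ⟶ g} (h : x.of = y.of) : x = y :=
  Hom₂.ext h

@[simp] lemma id_of (a : S.Carrier) : Hom.of (𝟙 a) = 𝟙 a.of := rfl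
@[simp] lemma comp_of {a b c : S.Carrier} (f : a ⟶ b) (g : b ⟶ c) :
    (f ≫ g).of = f.of ≫ g.of := rfl
@[simp] lemma id₂_of {a b : S.Carrier} (f : a ⟶ b) : Hom₂.of (𝟙 f) = 𝟙 f.of := rfl
@[simp] lemma comp₂_of {a b : S.Carrier} {f g h : a ⟶ b} (x : f ⟶ g) (y : g ⟶ h) :
    (x ≫ y).of = x.of ≫ y.of := rfl

/-- A 2-morphism of a sub-bicategory. -/
abbrev mk₂ {a b : S.Carrier} {f g : a ⟶ b} (x : f.of ⟶ g.of) : f ⟶ g := Hom₂.mk x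

/-- Invertible 2-morphisms of a sub-bicategory. -/
@[simps]
def isoMk {a b : S.Carrier} {f g : a ⟶ b} (e : f.of ≅ g.of) : f ≅ g where
  hom := mk₂ e.hom
  inv := mk₂ e.inv
  hom_inv_id := by ext; simp
  inv_hom_id := by ext; simp

instance : Bicategory S.Carrier where
  whiskerLeft f g h x := mk₂ (f := f ≫ g) (g := f ≫ h) (f.of ◁ Hom₂.of x)
  whiskerRight {_ _ _ f g} x h := mk₂ (f := f ≫ h) (g := g ≫ h) (Hom₂.of x ▷ h.of)
  associator f g h := isoMk (f := (f ≫ g) ≫ h) (g := f ≫ g ≫ h) (α_ f.of g.of h.of)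
  leftUnitor {a _} f := isoMk (f := 𝟙 a ≫ f) (g := f) (λ_ f.of)
  rightUnitor {_ b} f := isoMk (f := f ≫ 𝟙 b) (g := f) (ρ_ f.of)
  whisker_exchange x y := by ext; exact whisker_exchange (Hom₂.of x) (Hom₂.of y)

end SubBicategory

variable {B' : Type u₂} [Bicategory.{v₁, v₂} B']

/-- The restriction of a pseudofunctor to sub-bicategories. -/
def restrictPseudofunctor (F : Pseudofunctor B B') (S : SubBicategory B) (S' : SubBicategory B')
    (hobj : ∀ a, S.obj a → S'.obj (F.obj a))
    (hhom : ∀ {a b : B} (f : a ⟶ b), S.obj a → S.obj b → S.hom f → S'.hom (F.map f)) :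
    Pseudofunctor S.Carrier S'.Carrier where
  obj a := ⟨F.obj a.of, hobj _ a.mem⟩
  map {a b} f := SubBicategory.Hom.mk (F.map f.of) (hhom _ a.mem b.mem f.mem)
  map₂ x := SubBicategory.mk₂ (F.map₂ x.of)
  mapId a := SubBicategory.isoMk (F.mapId a.of)
  mapComp f g := SubBicategory.isoMk (F.mapComp f.of g.of)
  map₂_whisker_left f _ _ x := SubBicategory.hom₂_ext (F.map₂_whisker_left f.of x.of)
  map₂_whisker_right x f := SubBicategory.hom₂_ext (F.map₂_whisker_right x.of f.of)
  map₂_associator f g h := SubBicategory.hom₂_ext (F.map₂_associator f.of g.of h.of)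
  map₂_left_unitor f := SubBicategory.hom₂_ext (F.map₂_left_unitor f.of)
  map₂_right_unitor f := SubBicategory.hom₂_ext (F.map₂_right_unitor f.of)
  map₂_id f := by ext; exact F.map₂_id _
  map₂_comp f g := by ext; exact F.map₂_comp _ _

end SubBicategory

section FixedPoints

open MonoidalCategory Functor.LaxMonoidal Functor.OplaxMonoidal Functor.LaxLeftLinear
  Functor.OplaxLeftLinear MonoidalLeftAction

variable {E : Type u} [Category.{v} E] [MonoidalCategory E]
  {G : Type u₁} [Category.{v₁} G] [MonoidalCategory G]
  {C : Type u₂} [Category.{v₂} C] [MonoidalCategory C]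

/-- A homotopy fixed point for the action of `G` on `W` obtained by restricting an action of `E`
along a monoidal functor `J : G ⥤ E`: an object `pt` with coherent isomorphisms `g • pt ≅ pt`. -/
structure FixedPt (J : G ⥤ E) [J.Monoidal] (W : LinMod E) where
  pt : W.carrier
  iso : ∀ g : G, J.obj g ⊙ₗ pt ≅ pt
  naturality : ∀ {g h : G} (γ : g ⟶ h), J.map γ ⊵ₗ pt ≫ (iso h).hom = (iso g).hom
  unit : (iso (𝟙_ G)).hom = η J ⊵ₗ pt ≫ (λₗ pt).hom
  mul : ∀ g h : G, (iso (g ⊗ h)).hom =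
    δ J g h ⊵ₗ pt ≫ (αₗ (J.obj g) (J.obj h) pt).hom ≫ J.obj g ⊴ₗ (iso h).hom ≫ (iso g).hom

namespace FixedPt

variable {J : G ⥤ E} [J.Monoidal] {W : LinMod E}

/-- Morphisms of fixed points: morphisms compatible with the isomorphisms `g • pt ≅ pt`. -/
def homs (X Y : FixedPt J W) : Submodule ℝ (X.pt ⟶ Y.pt) where
  carrier := {f | ∀ g : G, J.obj g ⊴ₗ f ≫ (Y.iso g).hom = (X.iso g).hom ≫ f}
  zero_mem' g := by
    have h := W.action_smul (J.obj g) (0 : ℝ) (0 : X.pt ⟶ Y.pt)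
    simp only [zero_smul] at h
    simp [h]
  add_mem' {f f'} hf hf' g := by
    simp only [Set.mem_ofPred_eq] at hf hf'
    simp [W.action_add, hf g, hf' g]
  smul_mem' r f hf g := by
    simp only [Set.mem_ofPred_eq] at hf
    simp [W.action_smul, hf g]

instance : Category (FixedPt J W) where
  Hom X Y := homs X Y
  id X := ⟨𝟙 X.pt, fun g => by simp⟩
  comp {X Y Z} f f' := ⟨f.1 ≫ f'.1, fun g => by
    have h := f.2 g
    have h' := f'.2 g
    simp [h', reassoc_of% h]⟩

/-- The underlying morphism. -/
def val {X Y : FixedPt J W} (f : X ⟶ Y) : X.pt ⟶ Y.pt := Subtype.val (p := (· ∈ homs X Y)) f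

lemma val_comm {X Y : FixedPt J W} (f : X ⟶ Y) (g : G) :
    J.obj g ⊴ₗ val f ≫ (Y.iso g).hom = (X.iso g).hom ≫ val f := f.2 g

/-- Constructor for morphisms of fixed points. -/
def homMk {X Y : FixedPt J W} (f : X.pt ⟶ Y.pt)
    (h : ∀ g : G, J.obj g ⊴ₗ f ≫ (Y.iso g).hom = (X.iso g).hom ≫ f) : X ⟶ Y :=
  Subtype.mk (p := (· ∈ homs X Y)) f h

@[ext] lemma hom_ext {X Y : FixedPt J W} {f f' : X ⟶ Y} (h : val f = val f') : f = f' :=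
  Subtype.ext h

@[simp] lemma val_homMk {X Y : FixedPt J W} (f : X.pt ⟶ Y.pt)
    (h : ∀ g : G, J.obj g ⊴ₗ f ≫ (Y.iso g).hom = (X.iso g).hom ≫ f) : val (homMk f h) = f := rfl
@[simp] lemma val_id (X : FixedPt J W) : val (𝟙 X) = 𝟙 X.pt := rfl
@[simp] lemma val_comp {X Y Z : FixedPt J W} (f : X ⟶ Y) (f' : Y ⟶ Z) :
    val (f ≫ f') = val f ≫ val f' := rfl

/-- Constructor for isomorphisms of fixed points. -/
@[simps]
def isoMk {X Y : FixedPt J W} (e : X.pt ≅ Y.pt)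
    (h : ∀ g : G, J.obj g ⊴ₗ e.hom ≫ (Y.iso g).hom = (X.iso g).hom ≫ e.hom) : X ≅ Y where
  hom := homMk e.hom h
  inv := homMk e.inv fun g => by
    rw [← cancel_mono e.hom, Category.assoc, Category.assoc, ← h]
    simp [← actionHomRight_comp_assoc]

instance : Preadditive (FixedPt J W) where
  homGroup X Y := inferInstanceAs (AddCommGroup (homs X Y))
  add_comp X Y Z f f' k := by ext; exact Preadditive.add_comp _ _ _ _ _ _
  comp_add X Y Z f k k' := by ext; exact Preadditive.comp_add _ _ _ _ _ _

instance : Linear ℝ (FixedPt J W) where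
  homModule X Y := inferInstanceAs (Module ℝ (homs X Y))
  smul_comp X Y Z r f k := by ext; exact Linear.smul_comp _ _ _ _ _ _
  comp_smul X Y Z f r k := by ext; exact Linear.comp_smul _ _ _ _ _ _

/-- The functor forgetting the fixed point structure. -/
@[simps]
def forget (J : G ⥤ E) [J.Monoidal] (W : LinMod E) : FixedPt J W ⥤ W.carrier where
  obj X := X.pt
  map f := val f

end FixedPt

/-- Coherent isomorphisms `J g ⊗ K c ≅ K c ⊗ J g` for monoidal functors `J` and `K` with the same
target; they make the restrictions to `G` and `C` of any action of `E` commute. -/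
structure Commutation (J : G ⥤ E) [J.Monoidal] (K : C ⥤ E) [K.Monoidal] where
  σ : ∀ (g : G) (c : C), J.obj g ⊗ K.obj c ≅ K.obj c ⊗ J.obj g
  naturality_left : ∀ {g h : G} (γ : g ⟶ h) (c : C),
    J.map γ ▷ K.obj c ≫ (σ h c).hom = (σ g c).hom ≫ K.obj c ◁ J.map γ
  naturality_right : ∀ (g : G) {c d : C} (f : c ⟶ d),
    J.obj g ◁ K.map f ≫ (σ g d).hom = (σ g c).hom ≫ K.map f ▷ J.obj g
  unit_left : ∀ c : C, (σ (𝟙_ G) c).hom ≫ K.obj c ◁ η J ≫ (ρ_ (K.obj c)).hom =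
    η J ▷ K.obj c ≫ (λ_ (K.obj c)).hom
  unit_right : ∀ g : G, (σ g (𝟙_ C)).hom ≫ η K ▷ J.obj g ≫ (λ_ (J.obj g)).hom =
    J.obj g ◁ η K ≫ (ρ_ (J.obj g)).hom
  mul_left : ∀ (g h : G) (c : C), (σ (g ⊗ h) c).hom ≫ K.obj c ◁ δ J g h =
    δ J g h ▷ K.obj c ≫ (α_ _ _ _).hom ≫ J.obj g ◁ (σ h c).hom ≫ (α_ _ _ _).inv ≫
      (σ g c).hom ▷ J.obj h ≫ (α_ _ _ _).hom
  mul_right : ∀ (g : G) (c d : C), (σ g (c ⊗ d)).hom ≫ δ K c d ▷ J.obj g =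
    J.obj g ◁ δ K c d ≫ (α_ _ _ _).inv ≫ (σ g c).hom ▷ K.obj d ≫ (α_ _ _ _).hom ≫
      K.obj c ◁ (σ g d).hom ≫ (α_ _ _ _).inv

/-- Restriction of an action along a monoidal functor. -/
abbrev restrictAction (K : C ⥤ E) [K.Monoidal] (V : Type u₃) [Category.{v₃} V]
    [MonoidalLeftAction E V] : MonoidalLeftAction C V where
  actionObj c X := K.obj c ⊙ₗ X
  actionHomLeft f X := K.map f ⊵ₗ X
  actionHomRight c _ _ f := K.obj c ⊴ₗ f
  actionAssocIso c d X :=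
    { hom := δ K c d ⊵ₗ X ≫ (αₗ (K.obj c) (K.obj d) X).hom
      inv := (αₗ (K.obj c) (K.obj d) X).inv ≫ μ K c d ⊵ₗ X
      hom_inv_id := by simp [← comp_actionHomLeft]
      inv_hom_id := by simp [← comp_actionHomLeft_assoc] }
  actionUnitIso X :=
    { hom := η K ⊵ₗ X ≫ (λₗ X).hom
      inv := (λₗ X).inv ≫ ε K ⊵ₗ X
      hom_inv_id := by simp [← comp_actionHomLeft]
      inv_hom_id := by simp [← comp_actionHomLeft_assoc] }
  actionHom_comp f₁ f₂ g₁ g₂ := by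
    simp only [K.map_comp, comp_actionHomLeft, actionHomRight_comp, Category.assoc]
    rw [action_exchange_assoc]
  actionAssocIso_hom_naturality {c₁ c₂ c₃ c₄ d₁ d₂} f g h := by
    have h₁ := actionAssocIso_hom_naturality (K.map f) (K.map g) h
    simp only [actionHom_def, Category.assoc] at h₁
    simp only [Category.assoc]
    rw [action_exchange_assoc, ← comp_actionHomLeft_assoc, ← δ_natural, comp_actionHomLeft_assoc,
      h₁]
  actionUnitIso_hom_naturality f := by
    simp only [Category.assoc]
    rw [action_exchange_assoc, actionUnitIso_hom_naturality]
  whiskerLeft_actionHomLeft c c' c'' f d := by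
    simp only [Category.assoc]
    have h₁ := whiskerLeft_actionHomLeft (K.obj c) (K.map f) d
    rw [← Category.assoc (K.obj c ⊴ₗ _), ← Category.assoc (αₗ _ _ _).hom, ← h₁,
      ← comp_actionHomLeft, ← comp_actionHomLeft, Functor.Monoidal.map_whiskerLeft]
  whiskerRight_actionHomLeft {c c'} c'' f d := by
    simp only [Category.assoc]
    have h₁ := whiskerRight_actionHomLeft (K.obj c'') (K.map f) d
    rw [← Category.assoc (K.map f ⊵ₗ _), ← Category.assoc (αₗ _ _ _).hom, ← h₁,
      ← comp_actionHomLeft, ← comp_actionHomLeft, Functor.Monoidal.map_whiskerRight]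
  associator_actionHom c₁ c₂ c₃ d := by
    have h₁ := associator_actionHom (K.obj c₁) (K.obj c₂) (K.obj c₃) d
    have h₂ := congrArg (· ⊵ₗ d) (Functor.OplaxMonoidal.associativity K c₁ c₂ c₃)
    simp only [comp_actionHomLeft, whiskerLeft_actionHomLeft, whiskerRight_actionHomLeft,
      Category.assoc] at h₂
    simp only [Category.assoc, actionHomRight_comp]
    have h₃ := h₂ =≫ ((αₗ (K.obj c₁) (K.obj c₂ ⊗ K.obj c₃) d).hom ≫
      K.obj c₁ ⊴ₗ (αₗ (K.obj c₂) (K.obj c₃) d).hom)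
    simp only [Category.assoc, h₁, Iso.inv_hom_id_assoc] at h₃
    rw [← h₃]
  leftUnitor_actionHom c d := by
    have h₂ := congrArg (· ⊵ₗ d) (Functor.OplaxMonoidal.left_unitality_hom K c)
    simp only [comp_actionHomLeft, whiskerRight_actionHomLeft, Category.assoc,
      leftUnitor_actionHom] at h₂
    simp only [Category.assoc]
    simpa using h₂.symm
  rightUnitor_actionHom c d := by
    have h₂ := congrArg (· ⊵ₗ d) (Functor.OplaxMonoidal.right_unitality_hom K c)
    simp only [comp_actionHomLeft, whiskerLeft_actionHomLeft, Category.assoc,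
      rightUnitor_actionHom] at h₂
    simp only [Category.assoc, actionHomRight_comp]
    simpa using h₂.symm

/-- The isomorphism `e • X ≅ e' • X` induced by `e ≅ e'`. -/
@[simps]
def leftIso {V : Type u₃} [Category.{v₃} V] [MonoidalLeftAction E V] {e e' : E} (f : e ≅ e')
    (X : V) : e ⊙ₗ X ≅ e' ⊙ₗ X where
  hom := f.hom ⊵ₗ X
  inv := f.inv ⊵ₗ X

/-- The isomorphism `e • X ≅ e • Y` induced by `X ≅ Y`. -/
@[simps]
def rightIso {V : Type u₃} [Category.{v₃} V] [MonoidalLeftAction E V] (e : E) {X Y : V}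
    (f : X ≅ Y) : e ⊙ₗ X ≅ e ⊙ₗ Y where
  hom := e ⊴ₗ f.hom
  inv := e ⊴ₗ f.inv

section

variable {J : G ⥤ E} [J.Monoidal] {K : C ⥤ E} [K.Monoidal] (κ : Commutation J K) {W : LinMod E}

/-- The isomorphisms `g • (c • X) ≅ c • (g • X) ≅ c • X` for a fixed point `X`. -/
def Commutation.smulIso (c : C) (X : FixedPt J W) (g : G) :
    J.obj g ⊙ₗ K.obj c ⊙ₗ X.pt ≅ K.obj c ⊙ₗ X.pt :=
  (αₗ (J.obj g) (K.obj c) X.pt).symm ≪≫ leftIso (κ.σ g c) X.pt ≪≫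
    αₗ (K.obj c) (J.obj g) X.pt ≪≫ rightIso (K.obj c) (X.iso g)

lemma Commutation.smulIso_hom (c : C) (X : FixedPt J W) (g : G) :
    (κ.smulIso c X g).hom = (αₗ (J.obj g) (K.obj c) X.pt).inv ≫ (κ.σ g c).hom ⊵ₗ X.pt ≫
      (αₗ (K.obj c) (J.obj g) X.pt).hom ≫ K.obj c ⊴ₗ (X.iso g).hom := rfl

/-- The action of `C` on the fixed points of `G`, on objects. -/
@[simps]
def Commutation.smulPt (c : C) (X : FixedPt J W) : FixedPt J W where
  pt := K.obj c ⊙ₗ X.pt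
  iso g := κ.smulIso c X g
  naturality {g h} γ := by
    have h₁ := congrArg (· ⊵ₗ X.pt) (κ.naturality_left γ c)
    simp only [comp_actionHomLeft, whiskerLeft_actionHomLeft] at h₁
    simp only [smulIso_hom, actionHomLeft_action,
      Category.assoc, Iso.hom_inv_id_assoc, reassoc_of% h₁, Iso.inv_hom_id_assoc,
      ← actionHomRight_comp, X.naturality]
  unit := by
    have h₁ := congrArg (· ⊵ₗ X.pt) (κ.unit_left c)
    simp only [comp_actionHomLeft, whiskerLeft_actionHomLeft, Category.assoc,
      rightUnitor_actionHom, leftUnitor_actionHom, Iso.inv_hom_id_assoc] at h₁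
    simp only [smulIso_hom, X.unit,
      actionHomRight_comp, actionHomLeft_action, Category.assoc, h₁]
  mul g h := by
    have h₁ := congrArg (· ⊵ₗ X.pt) (κ.mul_left g h c)
    simp only [comp_actionHomLeft, whiskerLeft_actionHomLeft, Category.assoc] at h₁
    have h₂ := h₁ =≫ ((αₗ (K.obj c) (J.obj g ⊗ J.obj h) X.pt).hom ≫
      K.obj c ⊴ₗ (αₗ (J.obj g) (J.obj h) X.pt).hom ≫
      K.obj c ⊴ₗ J.obj g ⊴ₗ (X.iso h).hom ≫ K.obj c ⊴ₗ (X.iso g).hom)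
    simp only [Category.assoc, Iso.inv_hom_id_assoc, associator_actionHom_assoc] at h₂
    have h₃ := associator_actionHom (J.obj g) (J.obj h) (K.obj c) X.pt
    have h₄ : (α_ (J.obj g) (K.obj c) (J.obj h)).inv ⊵ₗ X.pt ≫
        (αₗ (J.obj g ⊗ K.obj c) (J.obj h) X.pt).hom =
        (αₗ _ _ _).hom ≫ J.obj g ⊴ₗ (αₗ _ _ _).hom ≫ (αₗ _ _ _).inv := by
      rw [← cancel_epi ((α_ (J.obj g) (K.obj c) (J.obj h)).hom ⊵ₗ X.pt)]
      simp
    have h₅ : ((κ.σ g c).hom ▷ J.obj h) ⊵ₗ X.pt ≫ (αₗ (K.obj c ⊗ J.obj g) (J.obj h) X.pt).hom =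
        (αₗ _ _ _).hom ≫ (κ.σ g c).hom ⊵ₗ (J.obj h ⊙ₗ X.pt) := by simp
    have h₆ : (αₗ (K.obj c) (J.obj g) (J.obj h ⊙ₗ X.pt)).hom ≫
        K.obj c ⊴ₗ J.obj g ⊴ₗ (X.iso h).hom =
        (K.obj c ⊗ J.obj g) ⊴ₗ (X.iso h).hom ≫ (αₗ _ _ _).hom := by simp
    have h₇ : J.obj g ⊴ₗ K.obj c ⊴ₗ (X.iso h).hom ≫ (αₗ (J.obj g) (K.obj c) X.pt).inv =
        (αₗ _ _ _).inv ≫ (J.obj g ⊗ K.obj c) ⊴ₗ (X.iso h).hom := by simp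
    have h₈ : (α_ (J.obj g) (J.obj h) (K.obj c)).hom ⊵ₗ X.pt ≫
        (αₗ (J.obj g) (J.obj h ⊗ K.obj c) X.pt).hom =
        (αₗ _ _ _).hom ≫ (αₗ _ _ _).hom ≫ J.obj g ⊴ₗ (αₗ _ _ _).inv := by
      rw [← reassoc_of% h₃, ← actionHomRight_comp]
      simp
    simp only [smulIso_hom, X.mul,
      actionHomRight_comp, actionHomLeft_action, Category.assoc]
    rw [h₂, reassoc_of% h₅, reassoc_of% h₆, ← action_exchange_assoc, reassoc_of% h₄,
      reassoc_of% h₇, reassoc_of% h₈]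
    simp only [Iso.inv_hom_id_assoc]

lemma Commutation.smulHomLeft_comm {c d : C} (f : c ⟶ d) (X : FixedPt J W) (g : G) :
    J.obj g ⊴ₗ K.map f ⊵ₗ X.pt ≫ (κ.smulIso d X g).hom =
      (κ.smulIso c X g).hom ≫ K.map f ⊵ₗ X.pt := by
  have h₁ := congrArg (· ⊵ₗ X.pt) (κ.naturality_right g f)
  simp only [comp_actionHomLeft, whiskerLeft_actionHomLeft, Category.assoc] at h₁
  have h₂ := h₁ =≫ (αₗ _ _ _).hom
  have h₃ : (K.map f ▷ J.obj g) ⊵ₗ X.pt ≫ (αₗ (K.obj d) (J.obj g) X.pt).hom =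
      (αₗ _ _ _).hom ≫ K.map f ⊵ₗ (J.obj g ⊙ₗ X.pt) := by simp
  simp only [Category.assoc, h₃] at h₂
  rw [← cancel_epi (αₗ _ _ _).hom]
  simp only [smulIso_hom, Category.assoc, Iso.hom_inv_id_assoc, reassoc_of% h₂, action_exchange]

/-- The action of `C` on the fixed points of `G`, on morphisms of `C`. -/
def Commutation.smulHomLeft {c d : C} (f : c ⟶ d) (X : FixedPt J W) :
    κ.smulPt c X ⟶ κ.smulPt d X :=
  FixedPt.homMk (K.map f ⊵ₗ X.pt) (κ.smulHomLeft_comm f X)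

lemma Commutation.smulHomRight_comm (c : C) {X Y : FixedPt J W} (f : X ⟶ Y) (g : G) :
    J.obj g ⊴ₗ K.obj c ⊴ₗ FixedPt.val f ≫ (κ.smulIso c Y g).hom =
      (κ.smulIso c X g).hom ≫ K.obj c ⊴ₗ FixedPt.val f := by
  have h₁ : J.obj g ⊴ₗ K.obj c ⊴ₗ (FixedPt.val f) ≫ (αₗ (J.obj g) (K.obj c) Y.pt).inv =
      (αₗ _ _ _).inv ≫ (J.obj g ⊗ K.obj c) ⊴ₗ (FixedPt.val f) := by simp
  have h₂ : (K.obj c ⊗ J.obj g) ⊴ₗ (FixedPt.val f) ≫ (αₗ _ _ _).hom =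
    (αₗ _ _ _).hom ≫ K.obj c ⊴ₗ J.obj g ⊴ₗ (FixedPt.val f) := by simp
  simp only [smulIso_hom, Category.assoc, reassoc_of% h₁, action_exchange_assoc,
    reassoc_of% h₂, ← actionHomRight_comp, FixedPt.val_comm]

/-- The action of `C` on the fixed points of `G`, on morphisms of fixed points. -/
def Commutation.smulHomRight (c : C) {X Y : FixedPt J W} (f : X ⟶ Y) :
    κ.smulPt c X ⟶ κ.smulPt c Y :=
  FixedPt.homMk (K.obj c ⊴ₗ FixedPt.val f) (κ.smulHomRight_comm c f)

lemma Commutation.smulAssoc_comm (c d : C) (X : FixedPt J W) (g : G) :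
    J.obj g ⊴ₗ (δ K c d ⊵ₗ X.pt ≫ (αₗ (K.obj c) (K.obj d) X.pt).hom) ≫
        (κ.smulIso c (κ.smulPt d X) g).hom =
      (κ.smulIso (c ⊗ d) X g).hom ≫ δ K c d ⊵ₗ X.pt ≫ (αₗ (K.obj c) (K.obj d) X.pt).hom := by
  have h₁ := congrArg (· ⊵ₗ X.pt) (κ.mul_right g c d)
  simp only [comp_actionHomLeft, whiskerLeft_actionHomLeft, Category.assoc] at h₁
  have h₂ : (δ K c d ▷ J.obj g) ⊵ₗ X.pt ≫ (αₗ (K.obj c ⊗ K.obj d) (J.obj g) X.pt).hom =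
      (αₗ _ _ _).hom ≫ δ K c d ⊵ₗ (J.obj g ⊙ₗ X.pt) := by simp
  have h₃ : (K.obj c ⊗ K.obj d) ⊴ₗ (X.iso g).hom ≫ (αₗ (K.obj c) (K.obj d) X.pt).hom =
      (αₗ _ _ _).hom ≫ K.obj c ⊴ₗ K.obj d ⊴ₗ (X.iso g).hom := by simp
  have h₄ : (α_ (K.obj c) (K.obj d) (J.obj g)).inv ⊵ₗ X.pt ≫
      (αₗ (K.obj c ⊗ K.obj d) (J.obj g) X.pt).hom ≫ (αₗ _ _ _).hom =
      (αₗ _ _ _).hom ≫ K.obj c ⊴ₗ (αₗ _ _ _).hom := by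
    rw [← cancel_epi ((α_ (K.obj c) (K.obj d) (J.obj g)).hom ⊵ₗ X.pt)]
    simp
  have h₅ : (α_ (K.obj c) (J.obj g) (K.obj d)).hom ⊵ₗ X.pt ≫
      (αₗ (K.obj c) (J.obj g ⊗ K.obj d) X.pt).hom =
      (αₗ _ _ _).hom ≫ (αₗ _ _ _).hom ≫ K.obj c ⊴ₗ (αₗ _ _ _).inv := by
    rw [← associator_actionHom_assoc, ← actionHomRight_comp]
    simp
  have h₆ : ((κ.σ g c).hom ▷ K.obj d) ⊵ₗ X.pt ≫ (αₗ (K.obj c ⊗ J.obj g) (K.obj d) X.pt).hom =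
      (αₗ _ _ _).hom ≫ (κ.σ g c).hom ⊵ₗ (K.obj d ⊙ₗ X.pt) := by simp
  have h₇ : (α_ (J.obj g) (K.obj c) (K.obj d)).inv ⊵ₗ X.pt ≫
      (αₗ (J.obj g ⊗ K.obj c) (K.obj d) X.pt).hom =
      (αₗ _ _ _).hom ≫ J.obj g ⊴ₗ (αₗ _ _ _).hom ≫ (αₗ _ _ _).inv := by
    rw [← cancel_epi ((α_ (J.obj g) (K.obj c) (K.obj d)).hom ⊵ₗ X.pt)]
    simp
  have h₀ : (κ.smulIso c (κ.smulPt d X) g).hom = (αₗ (J.obj g) (K.obj c) (K.obj d ⊙ₗ X.pt)).inv ≫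
      (κ.σ g c).hom ⊵ₗ (K.obj d ⊙ₗ X.pt) ≫ (αₗ (K.obj c) (J.obj g) (K.obj d ⊙ₗ X.pt)).hom ≫
      K.obj c ⊴ₗ (κ.smulIso d X g).hom := rfl
  refine (congrArg (_ ≫ ·) h₀).trans ?_
  simp only [smulIso_hom, Category.assoc, actionHomRight_comp]
  rw [action_exchange_assoc, h₃, ← reassoc_of% h₂, reassoc_of% h₁, reassoc_of% h₄,
    reassoc_of% h₅, reassoc_of% h₆, reassoc_of% h₇]
  simp only [Iso.inv_hom_id_assoc]
  exact Category.assoc _ _ _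

/-- The associativity constraint of the action of `C` on the fixed points of `G`. -/
def Commutation.smulAssoc (c d : C) (X : FixedPt J W) :
    κ.smulPt (c ⊗ d) X ≅ κ.smulPt c (κ.smulPt d X) :=
  FixedPt.isoMk (((restrictAction K W.carrier).actionAssocIso c d X.pt))
    (κ.smulAssoc_comm c d X)

lemma Commutation.smulUnit_comm (X : FixedPt J W) (g : G) :
    J.obj g ⊴ₗ (η K ⊵ₗ X.pt ≫ (λₗ X.pt).hom) ≫ (X.iso g).hom =
      (κ.smulIso (𝟙_ C) X g).hom ≫ η K ⊵ₗ X.pt ≫ (λₗ X.pt).hom := by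
  have h₁ := congrArg (· ⊵ₗ X.pt) (κ.unit_right g)
  simp only [comp_actionHomLeft, whiskerLeft_actionHomLeft, Category.assoc,
    rightUnitor_actionHom, leftUnitor_actionHom, Iso.inv_hom_id_assoc] at h₁
  have h₂ : (η K ▷ J.obj g) ⊵ₗ X.pt ≫ (αₗ (𝟙_ E) (J.obj g) X.pt).hom =
    (αₗ _ _ _).hom ≫ η K ⊵ₗ (J.obj g ⊙ₗ X.pt) := by simp
  have h₃ := actionUnitIso_hom_naturality (C := E) (X.iso g).hom
  rw [reassoc_of% h₂] at h₁
  simp only [smulIso_hom, Category.assoc, actionHomRight_comp]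
  rw [action_exchange_assoc, ← h₃, reassoc_of% h₁, Iso.inv_hom_id_assoc]

/-- The unit constraint of the action of `C` on the fixed points of `G`. -/
def Commutation.smulUnit (X : FixedPt J W) : κ.smulPt (𝟙_ C) X ≅ X :=
  FixedPt.isoMk (((restrictAction K W.carrier).actionUnitIso X.pt))
    (κ.smulUnit_comm X)

/-- The action of `C` on the fixed points of `G`. -/
@[reducible]
def Commutation.smul : MonoidalLeftAction C (FixedPt J W) where
  actionObj c X := κ.smulPt c X
  actionHomLeft f X := κ.smulHomLeft f X
  actionHomRight c _ _ f := κ.smulHomRight c f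
  actionHom f g := κ.smulHomLeft f _ ≫ κ.smulHomRight _ g
  actionAssocIso c d X := κ.smulAssoc c d X
  actionUnitIso X := κ.smulUnit X
  actionHomRight_id c X := FixedPt.hom_ext ((restrictAction K W.carrier).actionHomRight_id c X.pt)
  id_actionHomLeft c X := FixedPt.hom_ext ((restrictAction K W.carrier).id_actionHomLeft c X.pt)
  actionHom_comp f₁ f₂ g₁ g₂ := FixedPt.hom_ext
    ((restrictAction K W.carrier).actionHom_comp f₁ f₂ (FixedPt.val g₁) (FixedPt.val g₂))
  actionAssocIso_hom_naturality f g h := FixedPt.hom_ext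
    ((restrictAction K W.carrier).actionAssocIso_hom_naturality f g (FixedPt.val h))
  actionUnitIso_hom_naturality f := FixedPt.hom_ext
    ((restrictAction K W.carrier).actionUnitIso_hom_naturality (FixedPt.val f))
  whiskerLeft_actionHomLeft c _ _ f X := FixedPt.hom_ext
    ((restrictAction K W.carrier).whiskerLeft_actionHomLeft c f X.pt)
  whiskerRight_actionHomLeft c f X := FixedPt.hom_ext
    ((restrictAction K W.carrier).whiskerRight_actionHomLeft c f X.pt)
  associator_actionHom c₁ c₂ c₃ X := FixedPt.hom_ext
    ((restrictAction K W.carrier).associator_actionHom c₁ c₂ c₃ X.pt)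
  leftUnitor_actionHom c X := FixedPt.hom_ext
    ((restrictAction K W.carrier).leftUnitor_actionHom c X.pt)
  rightUnitor_actionHom c X := FixedPt.hom_ext
    ((restrictAction K W.carrier).rightUnitor_actionHom c X.pt)

end

end FixedPoints

section FixFunctor

open MonoidalCategory Functor.LaxMonoidal Functor.OplaxMonoidal Functor.LaxLeftLinear
  Functor.OplaxLeftLinear MonoidalLeftAction

variable {E : Type u} [Category.{v} E] [MonoidalCategory E]
  {G : Type 1} [Category.{v₁} G] [MonoidalCategory G]
  {C : Type u₂} [Category.{v₂} C] [MonoidalCategory C]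
  {J : G ⥤ E} [J.Monoidal] {K : C ⥤ E} [K.Monoidal] (κ : Commutation J K)

/-- The fixed points of `G` in an `E`-module, as a `C`-module. -/
def fixObj (W : LinMod E) : LinMod C :=
  letI := κ.smul (W := W)
  { carrier := FixedPt J W
    action := κ.smul
    action_add := fun c _ _ f g => FixedPt.hom_ext
      (W.action_add (K.obj c) (FixedPt.val f) (FixedPt.val g))
    action_smul := fun c _ _ r f => FixedPt.hom_ext
      (W.action_smul (K.obj c) r (FixedPt.val f)) }

variable {V W : LinMod E}

/-- The isomorphism `g • F(X) ≅ F(g • X) ≅ F(X)` for a fixed point `X`. -/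
def fixIso (F : V ⟶ W) (X : FixedPt J V) (g : G) :
    J.obj g ⊙ₗ F.functor.obj X.pt ≅ F.functor.obj X.pt :=
  Functor.LeftLinear.μₗIso F.functor (J.obj g) X.pt ≪≫ F.functor.mapIso (X.iso g)

lemma fixIso_hom (F : V ⟶ W) (X : FixedPt J V) (g : G) :
    (fixIso F X g).hom = μₗ F.functor (J.obj g) X.pt ≫ F.functor.map (X.iso g).hom := rfl

/-- The image of a fixed point under a module functor. -/
def fixMapPt (F : V ⟶ W) (X : FixedPt J V) : FixedPt J W where
  pt := F.functor.obj X.pt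
  iso g := fixIso F X g
  naturality γ := by
    simp [fixIso_hom, ← X.naturality γ]
  unit := by simp [fixIso_hom, X.unit]
  mul g h := by
    simp only [fixIso_hom, X.mul g h,
      Functor.map_comp, actionHomRight_comp, Category.assoc, ← μₗ_naturality_left_assoc,
      μₗ_associativity_assoc, μₗ_naturality_right_assoc]

lemma fixFunctor_comm (F : V ⟶ W) {X Y : FixedPt J V} (f : X ⟶ Y) (g : G) :
    J.obj g ⊴ₗ F.functor.map (FixedPt.val f) ≫ (fixIso F Y g).hom =
      (fixIso F X g).hom ≫ F.functor.map (FixedPt.val f) := by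
  simp only [fixIso_hom, Category.assoc, ← Functor.map_comp, μₗ_naturality_right_assoc,
    ← FixedPt.val_comm]

/-- The functor on fixed points induced by a module functor. -/
def fixFunctor (F : V ⟶ W) : FixedPt J V ⥤ FixedPt J W where
  obj X := fixMapPt F X
  map {X Y} f := FixedPt.homMk (X := fixMapPt F X) (Y := fixMapPt F Y)
    (F.functor.map (FixedPt.val f)) (fixFunctor_comm F f)
  map_id X := FixedPt.hom_ext (F.functor.map_id X.pt)
  map_comp f g := FixedPt.hom_ext (F.functor.map_comp (FixedPt.val f) (FixedPt.val g))

lemma fixLinearity_comm (F : V ⟶ W) (c : C) (X : FixedPt J V) (g : G) :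
    J.obj g ⊴ₗ μₗ F.functor (K.obj c) X.pt ≫ (fixIso F (κ.smulPt c X) g).hom =
      (κ.smulIso c (fixMapPt F X) g).hom ≫ μₗ F.functor (K.obj c) X.pt := by
  have h₁ : (fixIso F (κ.smulPt c X) g).hom =
      μₗ F.functor (J.obj g) (K.obj c ⊙ₗ X.pt) ≫ F.functor.map (κ.smulIso c X g).hom := rfl
  have h₂ : (κ.smulIso c (fixMapPt F X) g).hom =
      (αₗ (J.obj g) (K.obj c) (F.functor.obj X.pt)).inv ≫
      (κ.σ g c).hom ⊵ₗ (F.functor.obj X.pt) ≫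
      (αₗ (K.obj c) (J.obj g) (F.functor.obj X.pt)).hom ≫
      K.obj c ⊴ₗ (μₗ F.functor (J.obj g) X.pt ≫ F.functor.map (X.iso g).hom) := rfl
  refine (congrArg (_ ≫ ·) h₁).trans (Eq.trans ?_ (congrArg (· ≫ _) h₂).symm)
  change J.obj g ⊴ₗ μₗ F.functor (K.obj c) X.pt ≫
    μₗ F.functor (J.obj g) (K.obj c ⊙ₗ X.pt) ≫ F.functor.map (κ.smulIso c X g).hom =
    ((αₗ (J.obj g) (K.obj c) (F.functor.obj X.pt)).inv ≫
      (κ.σ g c).hom ⊵ₗ (F.functor.obj X.pt) ≫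
      (αₗ (K.obj c) (J.obj g) (F.functor.obj X.pt)).hom ≫
      K.obj c ⊴ₗ (μₗ F.functor (J.obj g) X.pt ≫ F.functor.map (X.iso g).hom)) ≫
      μₗ F.functor (K.obj c) X.pt
  simp only [Commutation.smulIso_hom, Functor.map_comp, actionHomRight_comp, Category.assoc,
    μₗ_associativity_inv_assoc, μₗ_naturality_right]
  rw [← μₗ_naturality_left_assoc, μₗ_associativity_assoc]

/-- The isomorphism `c • F(X) ≅ F(c • X)` for a fixed point `X`. -/
def fixLinearity (F : V ⟶ W) (c : C) (X : FixedPt J V) :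
    κ.smulPt c (fixMapPt F X) ≅ fixMapPt F (κ.smulPt c X) :=
  FixedPt.isoMk (Functor.LeftLinear.μₗIso F.functor (K.obj c) X.pt)
    (fixLinearity_comm κ F c X)

section

variable {V : Type u₁} [Category.{v₁} V] [MonoidalLeftAction E V] {W : Type u₃} [Category.{v₃} W]
  [MonoidalLeftAction E W] (K) (F : V ⥤ W) [F.LeftLinear E]

lemma restrict_μₗ_associativity (c c' : C) (d : V) :
    μₗ F (K.obj (c ⊗ c')) d ≫ F.map (δ K c c' ⊵ₗ d ≫ (αₗ (K.obj c) (K.obj c') d).hom) =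
      (δ K c c' ⊵ₗ F.obj d ≫ (αₗ (K.obj c) (K.obj c') (F.obj d)).hom) ≫
        K.obj c ⊴ₗ μₗ F (K.obj c') d ≫ μₗ F (K.obj c) (K.obj c' ⊙ₗ d) := by
  rw [Functor.map_comp, ← μₗ_naturality_left_assoc, μₗ_associativity, Category.assoc]

lemma restrict_μₗ_unitality (d : V) :
    η K ⊵ₗ F.obj d ≫ (λₗ (F.obj d)).hom =
      μₗ F (K.obj (𝟙_ C)) d ≫ F.map (η K ⊵ₗ d ≫ (λₗ d).hom) := by
  rw [Functor.map_comp, ← μₗ_naturality_left_assoc, μₗ_unitality]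

lemma restrict_δₗ_associativity (c c' : C) (d : V) :
    δₗ F (K.obj (c ⊗ c')) d ≫ δ K c c' ⊵ₗ F.obj d ≫ (αₗ (K.obj c) (K.obj c') (F.obj d)).hom =
      F.map (δ K c c' ⊵ₗ d ≫ (αₗ (K.obj c) (K.obj c') d).hom) ≫
        δₗ F (K.obj c) (K.obj c' ⊙ₗ d) ≫ K.obj c ⊴ₗ δₗ F (K.obj c') d := by
  rw [← δₗ_naturality_left_assoc, δₗ_associativity, Functor.map_comp, Category.assoc]

lemma restrict_δₗ_unitality_inv (d : V) :
    (λₗ (F.obj d)).inv ≫ ε K ⊵ₗ F.obj d =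
      F.map ((λₗ d).inv ≫ ε K ⊵ₗ d) ≫ δₗ F (K.obj (𝟙_ C)) d := by
  rw [Functor.map_comp, Category.assoc, δₗ_naturality_left, δₗ_unitality_inv, Category.assoc]

end

/-- The functor on fixed points induced by an `E`-module functor is a `C`-module functor. -/
def fixMap (F : V ⟶ W) : fixObj κ V ⟶ fixObj κ W :=
  LinMod.Hom.mk (V := fixObj κ V) (W := fixObj κ W) (fixFunctor F) (leftLinear :=
    { μₗ := fun c X => (fixLinearity κ F c X).hom
      δₗ := fun c X => (fixLinearity κ F c X).inv
      μₗ_naturality_left := fun f X => FixedPt.hom_ext (μₗ_naturality_left F.functor (K.map f) X.pt)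
      μₗ_naturality_right := fun c _ _ f => FixedPt.hom_ext
        (μₗ_naturality_right F.functor (K.obj c) (FixedPt.val f))
      μₗ_associativity := fun c c' d => FixedPt.hom_ext
        (restrict_μₗ_associativity K F.functor c c' d.pt)
      μₗ_unitality := fun d => FixedPt.hom_ext
        (restrict_μₗ_unitality K F.functor d.pt)
      δₗ_naturality_left := fun f X => FixedPt.hom_ext (δₗ_naturality_left F.functor (K.map f) X.pt)
      δₗ_naturality_right := fun c _ _ f => FixedPt.hom_ext
        (δₗ_naturality_right F.functor (K.obj c) (FixedPt.val f))
      δₗ_associativity := fun c c' d => FixedPt.hom_ext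
        (restrict_δₗ_associativity K F.functor c c' d.pt)
      δₗ_unitality_inv := fun d => FixedPt.hom_ext
        (restrict_δₗ_unitality_inv K F.functor d.pt)
      μₗ_comp_δₗ := fun c d => (fixLinearity κ F c d).hom_inv_id
      δₗ_comp_μₗ := fun c d => (fixLinearity κ F c d).inv_hom_id })

lemma fixMap₂_comm {F F' : V ⟶ W} (a : F ⟶ F') (X : FixedPt J V) (g : G) :
    J.obj g ⊴ₗ a.trans.app X.pt ≫ (fixIso F' X g).hom =
      (fixIso F X g).hom ≫ a.trans.app X.pt := by
  simp only [fixIso_hom, Category.assoc, ← LinMod.Hom₂.comm_assoc, NatTrans.naturality]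

/-- The module transformation on fixed points induced by a module transformation. -/
def fixMap₂ {F F' : V ⟶ W} (a : F ⟶ F') : fixMap κ F ⟶ fixMap κ F' :=
  LinMod.Hom₂.mk (F := fixMap κ F) (G := fixMap κ F')
    { app := fun X : FixedPt J V =>
        FixedPt.homMk (X := fixMapPt F X) (Y := fixMapPt F' X) (a.trans.app X.pt)
          (fixMap₂_comm a X)
      naturality := fun _ _ f =>
        FixedPt.hom_ext (a.trans.naturality (FixedPt.val f)) }
    (fun c (X : FixedPt J V) => FixedPt.hom_ext (a.comm (K.obj c) X.pt))

lemma fixMapId_comm (X : FixedPt J V) (g : G) :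
    J.obj g ⊴ₗ 𝟙 X.pt ≫ (X.iso g).hom = (fixIso (𝟙 V) X g).hom ≫ 𝟙 X.pt := by
  have h : (fixIso (𝟙 V) X g).hom = 𝟙 _ ≫ (X.iso g).hom := rfl
  refine Eq.trans ?_ (congrArg (· ≫ _) h).symm
  rw [actionHomRight_id, Category.id_comp]
  exact (Category.comp_id (X.iso g).hom).symm

lemma fixMapComp_comm {Z : LinMod E} (F : V ⟶ W) (F' : W ⟶ Z) (X : FixedPt J V) (g : G) :
    J.obj g ⊴ₗ 𝟙 (F'.functor.obj (F.functor.obj X.pt)) ≫ (fixIso F' (fixMapPt F X) g).hom =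
      (fixIso (F ≫ F') X g).hom ≫ 𝟙 (F'.functor.obj (F.functor.obj X.pt)) := by
  have h : (fixIso (F ≫ F') X g).hom =
      (μₗ F'.functor (J.obj g) (F.functor.obj X.pt) ≫
        F'.functor.map (μₗ F.functor (J.obj g) X.pt)) ≫
        F'.functor.map (F.functor.map (X.iso g).hom) := rfl
  have h' : (fixIso F' (fixMapPt F X) g).hom =
      μₗ F'.functor (J.obj g) (F.functor.obj X.pt) ≫ F'.functor.map
        (μₗ F.functor (J.obj g) X.pt ≫ F.functor.map (X.iso g).hom) := rfl
  refine (congrArg (_ ≫ ·) h').trans (Eq.trans ?_ (congrArg (· ≫ _) h).symm)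
  rw [actionHomRight_id]
  refine (Category.id_comp _).trans (Eq.trans ?_ (Category.comp_id _).symm)
  rw [Functor.map_comp, Category.assoc]

/-- The compatibility of fixed points with identities. -/
def fixMapId (V : LinMod E) : fixMap κ (𝟙 V) ≅ 𝟙 (fixObj κ V) :=
  LinMod.isoMk (F := fixMap κ (𝟙 V)) (G := 𝟙 (fixObj κ V))
    (NatIso.ofComponents (fun X : FixedPt J V =>
      FixedPt.isoMk (X := fixMapPt (𝟙 V) X) (Y := X) (Iso.refl X.pt) (fixMapId_comm X))
      (fun {X Y : FixedPt J V} (f : X ⟶ Y) => FixedPt.hom_ext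
        ((Category.comp_id (FixedPt.val f)).trans (Category.id_comp (FixedPt.val f)).symm)))
    (fun c (X : FixedPt J V) => FixedPt.hom_ext
      (show 𝟙 (K.obj c ⊙ₗ X.pt) ≫ 𝟙 _ = K.obj c ⊴ₗ 𝟙 X.pt ≫ 𝟙 _ by simp))

/-- The compatibility of fixed points with composition. -/
def fixMapComp {V W Z : LinMod E} (F : V ⟶ W) (F' : W ⟶ Z) :
    fixMap κ (F ≫ F') ≅ fixMap κ F ≫ fixMap κ F' :=
  LinMod.isoMk (F := fixMap κ (F ≫ F')) (G := fixMap κ F ≫ fixMap κ F')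
    (NatIso.ofComponents (fun X : FixedPt J V =>
      FixedPt.isoMk (X := fixMapPt (F ≫ F') X) (Y := fixMapPt F' (fixMapPt F X))
        (Iso.refl _) (fixMapComp_comm F F' X))
      (fun {X Y : FixedPt J V} (f : X ⟶ Y) => FixedPt.hom_ext
        ((Category.comp_id _).trans (Category.id_comp _).symm)))
    (fun c (X : FixedPt J V) => FixedPt.hom_ext
      (show (μₗ F'.functor (K.obj c) (F.functor.obj X.pt) ≫
          F'.functor.map (μₗ F.functor (K.obj c) X.pt)) ≫ 𝟙 _ =
        K.obj c ⊴ₗ 𝟙 (F'.functor.obj (F.functor.obj X.pt)) ≫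
          μₗ F'.functor (K.obj c) (F.functor.obj X.pt) ≫
          F'.functor.map (μₗ F.functor (K.obj c) X.pt) by simp))

/-- Taking fixed points, as a pseudofunctor from `E`-modules to `C`-modules. -/
def fixPseudofunctor : Pseudofunctor (LinMod E) (LinMod C) where
  obj V := fixObj κ V
  map F := fixMap κ F
  map₂ a := fixMap₂ κ a
  map₂_id F := LinMod.hom₂_ext fun X => FixedPt.hom_ext rfl
  map₂_comp a b := LinMod.hom₂_ext fun X => FixedPt.hom_ext rfl
  mapId V := fixMapId κ V
  mapComp F F' := fixMapComp κ F F'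
  map₂_whisker_left F _ _ a := LinMod.hom₂_ext fun (X : FixedPt J _) => FixedPt.hom_ext
    (show a.trans.app (F.functor.obj X.pt) = 𝟙 _ ≫ a.trans.app (F.functor.obj X.pt) ≫ 𝟙 _ by simp)
  map₂_whisker_right a F := LinMod.hom₂_ext fun (X : FixedPt J _) => FixedPt.hom_ext
    (show F.functor.map (a.trans.app X.pt) = 𝟙 _ ≫ F.functor.map (a.trans.app X.pt) ≫ 𝟙 _ by simp)
  map₂_associator F F' F'' := LinMod.hom₂_ext fun (X : FixedPt J _) => FixedPt.hom_ext
    (show 𝟙 (F''.functor.obj (F'.functor.obj (F.functor.obj X.pt))) =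
      𝟙 _ ≫ F''.functor.map (𝟙 _) ≫ 𝟙 _ ≫ 𝟙 _ ≫ 𝟙 _ by simp)
  map₂_left_unitor F := LinMod.hom₂_ext fun (X : FixedPt J _) => FixedPt.hom_ext
    (show 𝟙 (F.functor.obj X.pt) = 𝟙 _ ≫ F.functor.map (𝟙 _) ≫ 𝟙 _ by simp)
  map₂_right_unitor F := LinMod.hom₂_ext fun (X : FixedPt J _) => FixedPt.hom_ext
    (show 𝟙 (F.functor.obj X.pt) = 𝟙 _ ≫ 𝟙 _ ≫ 𝟙 _ by simp)

end FixFunctor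

section Aut

open MonoidalCategory Functor.LaxMonoidal Functor.OplaxMonoidal

variable {C : Type 1} [Category.{0} C] [MonoidalCategory C]
  {D : Type 1} [Category.{0} D] [MonoidalCategory D] [BraidedCategory D]
  [Preadditive D] [Linear ℝ D] (i : C ⥤ D) [i.Monoidal]

/-- A `C`-linear symmetric monoidal `ℝ`-linear autoequivalence of `D`, where `D` is an algebra over
`C` through the monoidal functor `i : C ⥤ D`: an autoequivalence with a monoidal isomorphism
`i ⋙ functor ≅ i`. -/
structure Aut where
  functor : D ⥤ D
  [braided : functor.Braided]
  [isEquivalence : functor.IsEquivalence]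
  [additive : functor.Additive]
  [linear : functor.Linear ℝ]
  triangle : i ⋙ functor ≅ i
  [triangle_isMonoidal : NatTrans.IsMonoidal triangle.hom]

variable {i}

namespace Aut

attribute [instance] braided isEquivalence additive linear triangle_isMonoidal

/-- An invertible monoidal transformation of autoequivalences, compatible with the
`C`-linear structures. -/
@[ext]
structure Hom (g h : Aut i) where
  trans : g.functor ⟶ h.functor
  [isIso : IsIso trans]
  [isMonoidal : NatTrans.IsMonoidal trans]
  comm : ∀ c : C, trans.app (i.obj c) ≫ h.triangle.hom.app c = g.triangle.hom.app c

attribute [instance] Hom.isIso Hom.isMonoidal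
instance : Category (Aut i) where
  Hom g h := Hom g h
  id g := { trans := 𝟙 _, comm := by simp }
  comp a b := { trans := a.trans ≫ b.trans, comm := fun c => by simp [b.comm, ← a.comm] }

@[ext] lemma hom_ext {g h : Aut i} {a b : g ⟶ h} (w : a.trans = b.trans) : a = b := Hom.ext w

@[simp] lemma id_trans (g : Aut i) : Hom.trans (𝟙 g) = 𝟙 g.functor := rfl
@[simp] lemma comp_trans {g h k : Aut i} (a : g ⟶ h) (b : h ⟶ k) :
    (a ≫ b).trans = a.trans ≫ b.trans := rfl

/-- Isomorphisms of autoequivalences. -/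
@[simps]
def isoMk {g h : Aut i} (e : g.functor ≅ h.functor) (he : NatTrans.IsMonoidal e.hom)
    (comm : ∀ c : C, e.hom.app (i.obj c) ≫ h.triangle.hom.app c = g.triangle.hom.app c) :
    g ≅ h where
  hom := { trans := e.hom, comm := comm }
  inv := { trans := e.inv, comm := fun c => by simp [← comm c] }
  hom_inv_id := by ext1; simp
  inv_hom_id := by ext1; simp

/-- The composition `g ∘ h` of autoequivalences. -/
@[simps! functor]
abbrev mul (g h : Aut i) : Aut i where
  functor := h.functor ⋙ g.functor
  triangle := (Functor.associator i h.functor g.functor).symm ≪≫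
    Functor.isoWhiskerRight h.triangle g.functor ≪≫ g.triangle
  triangle_isMonoidal := by dsimp; infer_instance

/-- The identity autoequivalence. -/
@[simps! functor]
abbrev one : Aut i where
  functor := 𝟭 D
  triangle := Functor.rightUnitor i

@[simp] lemma mul_triangle (g h : Aut i) (c : C) : (mul g h).triangle.hom.app c =
    g.functor.map (h.triangle.hom.app c) ≫ g.triangle.hom.app c := by
  simp [mul]

@[simp] lemma one_triangle (c : C) : (one (i := i)).triangle.hom.app c = 𝟙 _ := rfl

instance : MonoidalCategoryStruct (Aut i) where
  tensorObj g h := mul g h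
  tensorUnit := one
  whiskerLeft g {h k} a :=
    { trans := Functor.whiskerRight a.trans g.functor
      comm := fun c => by simp [← Functor.map_comp_assoc, a.comm] }
  whiskerRight {g h} a k :=
    { trans := Functor.whiskerLeft k.functor a.trans
      comm := fun c => by simp [← a.comm] }
  associator g h k := isoMk (g := mul (mul g h) k) (h := mul g (mul h k))
    (Functor.associator k.functor h.functor g.functor).symm (by dsimp; infer_instance) (by simp)
  leftUnitor g := isoMk (g := mul one g) (h := g) (Functor.rightUnitor _) inferInstance (by simp)
  rightUnitor g := isoMk (g := mul g one) (h := g) (Functor.leftUnitor _) inferInstance (by simp)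
  tensorHom {g g' h h'} a b :=
    { trans := Functor.whiskerLeft h.functor a.trans ≫ Functor.whiskerRight b.trans g'.functor
      comm := fun c => by simp [← Functor.map_comp_assoc, b.comm, ← a.comm] }

@[simp] lemma tensor_functor (g h : Aut i) : (g ⊗ h).functor = h.functor ⋙ g.functor := rfl
@[simp] lemma unit_functor : (𝟙_ (Aut i)).functor = 𝟭 D := rfl

lemma hom_ext' {g h : Aut i} {a b : g ⟶ h} (w : ∀ X, a.trans.app X = b.trans.app X) : a = b :=
  Hom.ext (NatTrans.ext (funext w))

section
variable {g h k : Aut i} (X : D)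
lemma whiskerLeft_app (g : Aut i) (a : h ⟶ k) :
    (g ◁ a).trans.app X = g.functor.map (a.trans.app X) := rfl
lemma whiskerRight_app (a : g ⟶ h) (k : Aut i) :
    (a ▷ k).trans.app X = a.trans.app (k.functor.obj X) := rfl
lemma tensorHom_app {g' h' : Aut i} (a : g ⟶ g') (b : h ⟶ h') : (a ⊗ₘ b).trans.app X =
    a.trans.app (h.functor.obj X) ≫ g'.functor.map (b.trans.app X) := rfl
lemma associator_app : (α_ g h k).hom.trans.app X = 𝟙 _ := rfl
lemma leftUnitor_app : (λ_ g).hom.trans.app X = 𝟙 _ := rfl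
lemma rightUnitor_app : (ρ_ g).hom.trans.app X = 𝟙 _ := rfl
end

instance : MonoidalCategory (Aut i) where
  tensorHom_def _ _ := rfl
  id_tensorHom_id _ _ := by apply hom_ext'; intro X; simp [tensorHom_app]
  tensorHom_comp_tensorHom _ _ _ _ := by apply hom_ext'; intro X; simp [tensorHom_app]
  whiskerLeft_id _ _ := by apply hom_ext'; intro X; simp [whiskerLeft_app]
  id_whiskerRight _ _ := by apply hom_ext'; intro X; simp [whiskerRight_app]
  associator_naturality _ _ _ := by
    apply hom_ext'; intro X; simp [tensorHom_app, associator_app]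
  leftUnitor_naturality _ := by
    apply hom_ext'; intro X; simp [whiskerLeft_app, leftUnitor_app]
  rightUnitor_naturality _ := by
    apply hom_ext'; intro X; simp [whiskerRight_app, rightUnitor_app]
  pentagon _ _ _ _ := by
    apply hom_ext'; intro X; simp [whiskerRight_app, whiskerLeft_app, associator_app]
  triangle _ _ := by
    apply hom_ext'; intro X
    simp [whiskerRight_app, whiskerLeft_app, associator_app, leftUnitor_app, rightUnitor_app]

end Aut

variable (i) in
/-- The semidirect product `D ⋊ Aut`, with `(d, g) ⊗ (d', g') = (d ⊗ g(d'), g ∘ g')`. -/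
structure SemiProd where
  fst : D
  snd : Aut i

namespace SemiProd

/-- A morphism of the semidirect product is a pair of morphisms. -/
@[ext]
structure Hom (x y : SemiProd i) where
  fst : x.fst ⟶ y.fst
  snd : x.snd ⟶ y.snd

instance : Category (SemiProd i) where
  Hom := Hom
  id x := ⟨𝟙 _, 𝟙 _⟩
  comp f g := ⟨f.fst ≫ g.fst, f.snd ≫ g.snd⟩

lemma hom_ext {x y : SemiProd i} {f f' : x ⟶ y} (h₁ : f.fst = f'.fst)
    (h₂ : f.snd = f'.snd) : f = f' := Hom.ext h₁ h₂

@[simp] lemma id_fst (x : SemiProd i) : Hom.fst (𝟙 x) = 𝟙 x.fst := rfl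
@[simp] lemma id_snd (x : SemiProd i) : Hom.snd (𝟙 x) = 𝟙 x.snd := rfl
@[simp] lemma comp_fst {x y z : SemiProd i} (f : x ⟶ y) (g : y ⟶ z) :
    (f ≫ g).fst = f.fst ≫ g.fst := rfl
@[simp] lemma comp_snd {x y z : SemiProd i} (f : x ⟶ y) (g : y ⟶ z) :
    (f ≫ g).snd = f.snd ≫ g.snd := rfl

/-- Isomorphisms of the semidirect product. -/
@[simps]
def isoMk {x y : SemiProd i} (e : x.fst ≅ y.fst) (e' : x.snd ≅ y.snd) : x ≅ y where
  hom := ⟨e.hom, e'.hom⟩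
  inv := ⟨e.inv, e'.inv⟩
  hom_inv_id := hom_ext (by simp) (by simp)
  inv_hom_id := hom_ext (by simp) (by simp)

instance : MonoidalCategoryStruct (SemiProd i) where
  tensorObj x y := ⟨x.fst ⊗ x.snd.functor.obj y.fst, x.snd ⊗ y.snd⟩
  tensorUnit := ⟨𝟙_ D, 𝟙_ (Aut i)⟩
  whiskerLeft x _ _ f := ⟨x.fst ◁ x.snd.functor.map f.fst, x.snd ◁ f.snd⟩
  whiskerRight f y := ⟨f.fst ⊗ₘ f.snd.trans.app y.fst, f.snd ▷ y.snd⟩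
  tensorHom {_ x' _ _} f f' :=
    ⟨f.fst ⊗ₘ (f.snd.trans.app _ ≫ x'.snd.functor.map f'.fst), f.snd ⊗ₘ f'.snd⟩
  associator x y z := isoMk
    (α_ x.fst (x.snd.functor.obj y.fst) (x.snd.functor.obj (y.snd.functor.obj z.fst)) ≪≫
      whiskerLeftIso x.fst (Functor.Monoidal.μIso x.snd.functor y.fst (y.snd.functor.obj z.fst)))
    (α_ x.snd y.snd z.snd)
  leftUnitor x := isoMk (λ_ x.fst) (λ_ x.snd)
  rightUnitor x := isoMk
    (whiskerLeftIso x.fst (Functor.Monoidal.εIso x.snd.functor).symm ≪≫ ρ_ x.fst) (ρ_ x.snd)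

end SemiProd

end Aut

section SemiProd

open MonoidalCategory Functor.LaxMonoidal Functor.OplaxMonoidal

variable {C : Type 1} [Category.{0} C] [MonoidalCategory C]
  {D : Type 1} [Category.{0} D] [MonoidalCategory D]

namespace SemiProd

lemma assoc_naturality_aux {F F' H H' : D ⥤ D} [F.Monoidal] [F'.Monoidal] (a : F ⟶ F')
    [NatTrans.IsMonoidal a] (b : H ⟶ H') {x x' y y' z z' : D} (f₁ : x ⟶ x') (f₂ : y ⟶ y')
    (f₃ : z ⟶ z') :
    ((f₁ ⊗ₘ (a.app y ≫ F'.map f₂)) ⊗ₘ ((a.app (H.obj z) ≫ F'.map (b.app z)) ≫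
      F'.map (H'.map f₃))) ≫ (α_ x' (F'.obj y') (F'.obj (H'.obj z'))).hom ≫
        x' ◁ μ F' y' (H'.obj z') =
      ((α_ x (F.obj y) (F.obj (H.obj z))).hom ≫ x ◁ μ F y (H.obj z)) ≫
        (f₁ ⊗ₘ (a.app (y ⊗ H.obj z) ≫ F'.map (f₂ ⊗ₘ (b.app z ≫ H'.map f₃)))) := by
  rw [associator_naturality_assoc, Category.assoc, ← id_tensorHom, ← id_tensorHom,
    tensorHom_comp_tensorHom, Category.assoc (α_ x _ _).hom, tensorHom_comp_tensorHom,
    Category.comp_id,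
    Category.id_comp, NatTrans.IsMonoidal.tensor_assoc, ← μ_natural, Functor.map_comp]
  simp

lemma rightUnitor_naturality_aux {F F' : D ⥤ D} [F.Monoidal] [F'.Monoidal] (a : F ⟶ F')
    [NatTrans.IsMonoidal a] {x x' : D} (f : x ⟶ x') :
    (f ⊗ₘ a.app (𝟙_ D)) ≫ x' ◁ η F' ≫ (ρ_ x').hom = (x ◁ η F ≫ (ρ_ x).hom) ≫ f := by
  have h : a.app (𝟙_ D) ≫ η F' = η F := by
    rw [← cancel_epi (ε F), NatTrans.IsMonoidal.unit_assoc]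
    simp
  rw [← id_tensorHom, tensorHom_comp_tensorHom_assoc, h]
  simp [tensorHom_def']

lemma pentagon_aux {F H : D ⥤ D} [F.Monoidal] [H.Monoidal] (w x y z : D) :
    (((α_ w (F.obj x) (F.obj (H.obj y))).hom ≫ w ◁ μ F x (H.obj y)) ⊗ₘ
        𝟙 (F.obj (H.obj z))) ≫
      ((α_ w (F.obj (x ⊗ H.obj y)) (F.obj (H.obj z))).hom ≫ w ◁ μ F (x ⊗ H.obj y) (H.obj z)) ≫
      w ◁ F.map ((α_ x (H.obj y) (H.obj z)).hom ≫ x ◁ μ H y z) =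
    ((α_ (w ⊗ F.obj x) (F.obj (H.obj y)) (F.obj (H.obj z))).hom ≫
      (w ⊗ F.obj x) ◁ (μ F (H.obj y) (H.obj z) ≫ F.map (μ H y z))) ≫
      (α_ w (F.obj x) (F.obj (H.obj (y ⊗ z)))).hom ≫ w ◁ μ F x (H.obj (y ⊗ z)) := by
  have h := Functor.LaxMonoidal.associativity F x (H.obj y) (H.obj z)
  simp only [tensorHom_id, comp_whiskerRight, Category.assoc, Functor.map_comp,
    MonoidalCategory.whiskerLeft_comp, whisker_assoc, tensor_whiskerLeft, Iso.inv_hom_id_assoc]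
  simp only [← MonoidalCategory.whiskerLeft_comp, ← MonoidalCategory.whiskerLeft_comp_assoc,
    reassoc_of% h]
  simp only [MonoidalCategory.whiskerLeft_comp, pentagon_assoc, Category.assoc,
    μ_natural_right]

lemma triangle_aux (F : D ⥤ D) [F.Monoidal] (x y : D) :
    ((α_ x (F.obj (𝟙_ D)) (F.obj y)).hom ≫ x ◁ μ F (𝟙_ D) y) ≫ x ◁ F.map (λ_ y).hom =
      (x ◁ η F ≫ (ρ_ x).hom) ⊗ₘ 𝟙 (F.obj y) := by
  have h := Functor.LaxMonoidal.left_unitality F y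
  have h' : μ F (𝟙_ D) y ≫ F.map (λ_ y).hom = η F ▷ F.obj y ≫ (λ_ (F.obj y)).hom := by
    rw [h]; simp only [Functor.Monoidal.whiskerRight_η_ε_assoc]
  rw [Category.assoc, ← MonoidalCategory.whiskerLeft_comp, h']
  simp [-Functor.LaxMonoidal.left_unitality]

variable [BraidedCategory D] [Preadditive D] [Linear ℝ D] {i : C ⥤ D} [i.Monoidal]

instance : MonoidalCategory (SemiProd i) where
  tensorHom_def {x x' y y'} f g := hom_ext
    (show f.fst ⊗ₘ (f.snd.trans.app _ ≫ x'.snd.functor.map g.fst) =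
      (f.fst ⊗ₘ f.snd.trans.app y.fst) ≫ x'.fst ◁ x'.snd.functor.map g.fst by
      simp [← id_tensorHom]) (tensorHom_def f.snd g.snd)
  id_tensorHom_id x y := hom_ext
    (show 𝟙 x.fst ⊗ₘ (𝟙 _ ≫ x.snd.functor.map (𝟙 y.fst)) = 𝟙 _ by simp) (id_tensorHom_id x.snd y.snd)
  tensorHom_comp_tensorHom {x y z x' y' z'} f₁ f₂ g₁ g₂ := hom_ext
    (show (f₁.fst ⊗ₘ (f₁.snd.trans.app x'.fst ≫ y.snd.functor.map f₂.fst)) ≫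
        (g₁.fst ⊗ₘ (g₁.snd.trans.app y'.fst ≫ z.snd.functor.map g₂.fst)) =
      (f₁.fst ≫ g₁.fst) ⊗ₘ ((f₁.snd.trans.app x'.fst ≫ g₁.snd.trans.app x'.fst) ≫
        z.snd.functor.map (f₂.fst ≫ g₂.fst)) by simp)
    (tensorHom_comp_tensorHom f₁.snd f₂.snd g₁.snd g₂.snd)
  whiskerLeft_id x y := hom_ext
    (show x.fst ◁ x.snd.functor.map (𝟙 y.fst) = 𝟙 _ by simp) (whiskerLeft_id x.snd y.snd)
  id_whiskerRight x y := hom_ext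
    (show 𝟙 x.fst ⊗ₘ 𝟙 (x.snd.functor.obj y.fst) = 𝟙 _ by simp) (id_whiskerRight x.snd y.snd)
  associator_naturality {_ _ _ _ _ _} f₁ f₂ f₃ := hom_ext
    (assoc_naturality_aux f₁.snd.trans f₂.snd.trans f₁.fst f₂.fst f₃.fst)
    (associator_naturality f₁.snd f₂.snd f₃.snd)
  leftUnitor_naturality {x y} f := hom_ext
    (show (𝟙_ D) ◁ f.fst ≫ (λ_ y.fst).hom = (λ_ x.fst).hom ≫ f.fst by simp)
    (leftUnitor_naturality f.snd)
  rightUnitor_naturality {x y} f := hom_ext (rightUnitor_naturality_aux f.snd.trans f.fst)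
    (rightUnitor_naturality f.snd)
  pentagon w x y z := hom_ext
    (pentagon_aux (F := w.snd.functor) (H := x.snd.functor) w.fst x.fst y.fst
      (y.snd.functor.obj z.fst))
    (pentagon w.snd x.snd y.snd z.snd)
  triangle x y := hom_ext (triangle_aux x.snd.functor x.fst y.fst)
    (triangle x.snd y.snd)

end SemiProd
end SemiProd

section SemiProd

open MonoidalCategory Functor.LaxMonoidal Functor.OplaxMonoidal

variable {C : Type 1} [Category.{0} C] [MonoidalCategory C]
  {D : Type 1} [Category.{0} D] [MonoidalCategory D]

namespace SemiProd

lemma IsMonoidal_η {C : Type 1} [Category.{0} C] [MonoidalCategory C] {F F' : C ⥤ D} [F.Monoidal]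
    [F'.Monoidal] (a : F ⟶ F') [NatTrans.IsMonoidal a] : a.app (𝟙_ C) ≫ η F' = η F := by
  rw [← cancel_epi (ε F), NatTrans.IsMonoidal.unit_assoc]
  simp

lemma inclG_assoc_aux (F H : D ⥤ D) [F.Monoidal] [H.Monoidal] :
    (((λ_ (F.obj (𝟙_ D))).hom ≫ η F) ⊗ₘ 𝟙 (F.obj (H.obj (𝟙_ D)))) ≫
        ((λ_ (F.obj (H.obj (𝟙_ D)))).hom ≫ F.map (η H) ≫ η F) ≫ 𝟙 _ =
      ((α_ (𝟙_ D) (F.obj (𝟙_ D)) (F.obj (H.obj (𝟙_ D)))).hom ≫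
        𝟙_ D ◁ μ F (𝟙_ D) (H.obj (𝟙_ D))) ≫
        𝟙_ D ◁ F.map ((λ_ (H.obj (𝟙_ D))).hom ≫ η H) ≫ (λ_ (F.obj (𝟙_ D))).hom ≫ η F := by
  have h : μ F (𝟙_ D) (H.obj (𝟙_ D)) ≫ F.map (λ_ (H.obj (𝟙_ D))).hom =
      η F ▷ F.obj (H.obj (𝟙_ D)) ≫ (λ_ (F.obj (H.obj (𝟙_ D)))).hom := by
    rw [Functor.LaxMonoidal.left_unitality F]
    simp only [Functor.Monoidal.whiskerRight_η_ε_assoc]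
  rw [leftUnitor_naturality_assoc, Functor.map_comp, Category.assoc (α_ _ _ _).hom,
    leftUnitor_naturality_assoc, Category.assoc (F.map _), reassoc_of% h]
  simp [-Functor.LaxMonoidal.left_unitality]

lemma IsMonoidal_δ {C : Type 1} [Category.{0} C] [MonoidalCategory C] {F F' : C ⥤ D} [F.Monoidal]
    [F'.Monoidal] (a : F ⟶ F') [NatTrans.IsMonoidal a] (c d : C) :
    a.app (c ⊗ d) ≫ δ F' c d = δ F c d ≫ (a.app c ⊗ₘ a.app d) := by
  rw [← cancel_epi (μ F c d), NatTrans.IsMonoidal.tensor_assoc]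
  simp

lemma commutation_unit_aux {x : D} {y : D} {z : D} (t : y ⟶ x) (e : x ⟶ 𝟙_ D) (e₁ : y ⟶ z)
    (e₂ : z ⟶ 𝟙_ D) (h : t ≫ e = e₁ ≫ e₂) :
    ((λ_ y).hom ≫ t ≫ (ρ_ x).inv) ≫ ((e ≫ 𝟙 _) ⊗ₘ (𝟙 _ ≫ 𝟙 (𝟙_ D))) ≫ (λ_ (𝟙_ D)).hom =
      𝟙_ D ◁ e₁ ≫ 𝟙_ D ◁ e₂ ≫ (ρ_ (𝟙_ D)).hom := by
  rw [← MonoidalCategory.whiskerLeft_comp_assoc, ← h, ← unitors_equal, leftUnitor_naturality]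
  simp only [Category.comp_id, tensorHom_id, Category.assoc]
  rw [unitors_equal, rightUnitor_naturality]
  simp

lemma commutation_mul_left_aux (F : D ⥤ D) [F.Monoidal] {y y' : D} (a : y' ⟶ y)
    (b : F.obj y ⟶ y) :
    ((λ_ (F.obj y')).hom ≫ (F.map a ≫ b) ≫ (ρ_ y).inv) ≫ y ◁ (ε F ≫ (λ_ (F.obj (𝟙_ D))).inv) =
      ((ε F ≫ (λ_ (F.obj (𝟙_ D))).inv) ⊗ₘ 𝟙 (F.obj y')) ≫
        ((α_ (𝟙_ D) (F.obj (𝟙_ D)) (F.obj y')).hom ≫ 𝟙_ D ◁ μ F (𝟙_ D) y') ≫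
        𝟙_ D ◁ F.map ((λ_ y').hom ≫ a ≫ (ρ_ y).inv) ≫
        (𝟙_ D ◁ δ F y (𝟙_ D) ≫ (α_ (𝟙_ D) (F.obj y) (F.obj (𝟙_ D))).inv) ≫
        (((λ_ (F.obj y)).hom ≫ b ≫ (ρ_ y).inv) ⊗ₘ (𝟙 _ ≫ 𝟙 (F.obj (𝟙_ D)))) ≫
        (α_ y (𝟙_ D) (F.obj (𝟙_ D))).hom ≫ y ◁ 𝟙 _ := by
  have h₁ : μ F (𝟙_ D) y' ≫ F.map (λ_ y').hom = η F ▷ F.obj y' ≫ (λ_ (F.obj y')).hom := by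
    rw [Functor.LaxMonoidal.left_unitality F]
    simp only [Functor.Monoidal.whiskerRight_η_ε_assoc]
  have h₂ : F.map (ρ_ y).inv ≫ δ F y (𝟙_ D) = (ρ_ (F.obj y)).inv ≫ F.obj y ◁ ε F := by
    rw [Functor.OplaxMonoidal.right_unitality F]
    simp only [Category.assoc, Functor.Monoidal.whiskerLeft_η_ε, Category.comp_id]
  have h₃ : μ F (𝟙_ D) y' ≫ F.map ((λ_ y').hom ≫ a ≫ (ρ_ y).inv) ≫ δ F y (𝟙_ D) =
      η F ▷ F.obj y' ≫ (λ_ (F.obj y')).hom ≫ F.map a ≫ (ρ_ (F.obj y)).inv ≫ F.obj y ◁ ε F := by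
    rw [Functor.map_comp, Functor.map_comp, Category.assoc, Category.assoc, h₂, reassoc_of% h₁]
  have h₄ : 𝟙_ D ◁ μ F (𝟙_ D) y' ≫ 𝟙_ D ◁ F.map ((λ_ y').hom ≫ a ≫ (ρ_ y).inv) ≫
      𝟙_ D ◁ δ F y (𝟙_ D) = 𝟙_ D ◁ (η F ▷ F.obj y' ≫ (λ_ (F.obj y')).hom ≫ F.map a ≫
        (ρ_ (F.obj y)).inv ≫ F.obj y ◁ ε F) := by
    simp only [← MonoidalCategory.whiskerLeft_comp, h₃]
  simp only [Category.assoc, Category.comp_id, tensorHom_id, MonoidalCategory.whiskerLeft_id]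
  rw [reassoc_of% h₄]
  simp [-Functor.LaxMonoidal.left_unitality, -Functor.LaxMonoidal.right_unitality,
    -Functor.OplaxMonoidal.left_unitality, -Functor.OplaxMonoidal.right_unitality]
  have h₅ : (λ_ (F.obj y)).inv ≫ (ρ_ (𝟙_ D ⊗ F.obj y)).inv ≫ (α_ (𝟙_ D) (F.obj y) (𝟙_ D)).hom ≫
      (λ_ (F.obj y ⊗ 𝟙_ D)).hom = (ρ_ (F.obj y)).inv := by monoidal_coherence
  rw [reassoc_of% h₅, whisker_exchange_assoc, rightUnitor_inv_naturality_assoc]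

lemma commutation_mul_right_aux (F : D ⥤ D) [F.Monoidal] {x y z : D} (e : z ⟶ x ⊗ y)
    (t : F.obj z ⟶ z) (a : F.obj x ⟶ x) (b : F.obj y ⟶ y)
    (h : t ≫ e = F.map e ≫ δ F x y ≫ (a ⊗ₘ b)) :
    ((λ_ (F.obj z)).hom ≫ t ≫ (ρ_ z).inv) ≫ ((e ≫ 𝟙 _) ⊗ₘ (𝟙 _ ≫ 𝟙 (𝟙_ D))) =
      𝟙_ D ◁ F.map (e ≫ 𝟙 _) ≫
        (𝟙_ D ◁ δ F x y ≫ (α_ (𝟙_ D) (F.obj x) (F.obj y)).inv) ≫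
        (((λ_ (F.obj x)).hom ≫ a ≫ (ρ_ x).inv) ⊗ₘ (𝟙 _ ≫ 𝟙 (F.obj y))) ≫
        ((α_ x (𝟙_ D) (F.obj y)).hom ≫ x ◁ 𝟙 _) ≫
        x ◁ ((λ_ (F.obj y)).hom ≫ b ≫ (ρ_ y).inv) ≫
        x ◁ 𝟙 (y ⊗ 𝟙_ D) ≫ (α_ x y (𝟙_ D)).inv := by
  simp only [Category.comp_id, tensorHom_id, Category.assoc]
  rw [← rightUnitor_inv_naturality, reassoc_of% h]
  simp only [comp_whiskerRight, MonoidalCategory.whiskerLeft_comp, Category.assoc,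
    MonoidalCategory.tensorHom_def]
  simp [-Functor.LaxMonoidal.left_unitality, -Functor.LaxMonoidal.right_unitality,
    -Functor.OplaxMonoidal.left_unitality, -Functor.OplaxMonoidal.right_unitality]

variable [BraidedCategory D] [Preadditive D] [Linear ℝ D] (i : C ⥤ D) [i.Monoidal]

/-- The inclusion `d ↦ (d, 1)` of `D` into the semidirect product. -/
def inclD : D ⥤ SemiProd i where
  obj d := ⟨d, 𝟙_ _⟩
  map f := ⟨f, 𝟙 _⟩
  map_comp _ _ := hom_ext rfl (Category.comp_id _).symm

/-- The inclusion `g ↦ (1, g)` of `Aut` into the semidirect product. -/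
def inclG : Aut i ⥤ SemiProd i where
  obj g := ⟨𝟙_ D, g⟩
  map f := ⟨𝟙 _, f⟩
  map_comp _ _ := hom_ext (Category.comp_id _).symm rfl

/-- The monoidal structure of the inclusion of `D`. -/
def inclDCore : (inclD i).CoreMonoidal where
  εIso := Iso.refl _
  μIso d d' := isoMk (Iso.refl (d ⊗ d')) (λ_ (𝟙_ (Aut i)))
  μIso_hom_natural_left f d' := hom_ext
    (show (f ⊗ₘ 𝟙 d') ≫ 𝟙 _ = 𝟙 _ ≫ f ▷ d' by simp)
    (Aut.hom_ext' fun X => show 𝟙 X ≫ 𝟙 X = 𝟙 X ≫ 𝟙 X by simp)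
  μIso_hom_natural_right d f := hom_ext
    (show d ◁ f ≫ 𝟙 _ = 𝟙 _ ≫ d ◁ f by simp)
    (Aut.hom_ext' fun X => show 𝟙 X ≫ 𝟙 X = 𝟙 X ≫ 𝟙 X by simp)
  associativity X Y Z := hom_ext
    (show (𝟙 (X ⊗ Y) ⊗ₘ 𝟙 Z) ≫ 𝟙 _ ≫ (α_ X Y Z).hom =
      ((α_ X Y Z).hom ≫ X ◁ 𝟙 (Y ⊗ Z)) ≫ X ◁ 𝟙 (Y ⊗ Z) ≫ 𝟙 _ by simp)
    (Aut.hom_ext' fun X => show 𝟙 X ≫ 𝟙 X ≫ 𝟙 X = 𝟙 X ≫ 𝟙 X ≫ 𝟙 X by simp)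
  left_unitality X := hom_ext
    (show (λ_ X).hom = (𝟙 _ ⊗ₘ 𝟙 _) ≫ 𝟙 (𝟙_ D ⊗ X) ≫ (λ_ X).hom by simp)
    (Aut.hom_ext' fun X => show 𝟙 X = 𝟙 X ≫ 𝟙 X ≫ 𝟙 X by simp)
  right_unitality X := hom_ext
    (show X ◁ 𝟙 _ ≫ (ρ_ X).hom = X ◁ 𝟙 (𝟙_ D) ≫ 𝟙 (X ⊗ 𝟙_ D) ≫ (ρ_ X).hom by simp)
    (Aut.hom_ext' fun X => show 𝟙 X = 𝟙 X ≫ 𝟙 X ≫ 𝟙 X by simp)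

instance : (inclD i).Monoidal := (inclDCore i).toMonoidal

/-- The monoidal structure of the inclusion of `Aut`. -/
def inclGCore : (inclG i).CoreMonoidal where
  εIso := Iso.refl _
  μIso g h := isoMk
    (λ_ (g.functor.obj (𝟙_ D)) ≪≫ (Functor.Monoidal.εIso g.functor).symm) (Iso.refl (g ⊗ h))
  μIso_hom_natural_left {g g'} f h := hom_ext
    (show (𝟙 _ ⊗ₘ f.trans.app (𝟙_ D)) ≫ (λ_ (g'.functor.obj (𝟙_ D))).hom ≫ η g'.functor =
      ((λ_ (g.functor.obj (𝟙_ D))).hom ≫ η g.functor) ≫ 𝟙 _ by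
      have h := IsMonoidal_η f.trans
      rw [id_tensorHom, leftUnitor_naturality_assoc, h, Category.comp_id])
    (Aut.hom_ext' fun X => show f.trans.app _ ≫ 𝟙 _ = 𝟙 _ ≫ f.trans.app _ by simp)
  μIso_hom_natural_right {h h'} g f := hom_ext
    (show 𝟙_ D ◁ g.functor.map (𝟙 _) ≫ (λ_ (g.functor.obj (𝟙_ D))).hom ≫ η g.functor =
      ((λ_ (g.functor.obj (𝟙_ D))).hom ≫ η g.functor) ≫ 𝟙 _ by simp)
    (Aut.hom_ext' fun X => show g.functor.map (f.trans.app X) ≫ 𝟙 _ =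
      𝟙 _ ≫ g.functor.map (f.trans.app X) by simp)
  associativity g h k := hom_ext
    (show (((λ_ (g.functor.obj (𝟙_ D))).hom ≫ η g.functor) ⊗ₘ 𝟙 _) ≫
        ((λ_ (g.functor.obj (h.functor.obj (𝟙_ D)))).hom ≫
          g.functor.map (η h.functor) ≫ η g.functor) ≫ 𝟙 _ =
      ((α_ _ _ _).hom ≫ 𝟙_ D ◁ μ g.functor (𝟙_ D) (h.functor.obj (𝟙_ D))) ≫
        𝟙_ D ◁ g.functor.map ((λ_ (h.functor.obj (𝟙_ D))).hom ≫ η h.functor) ≫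
          (λ_ (g.functor.obj (𝟙_ D))).hom ≫ η g.functor by
      exact inclG_assoc_aux g.functor h.functor)
    (Aut.hom_ext' fun X => show 𝟙 _ ≫ 𝟙 _ ≫ 𝟙 _ = 𝟙 _ ≫ g.functor.map (𝟙 _) ≫ 𝟙 _ by simp)
  left_unitality g := hom_ext
    (show (λ_ (𝟙_ D)).hom = (𝟙 _ ⊗ₘ 𝟙 _) ≫ ((λ_ (𝟙_ D)).hom ≫ 𝟙 _) ≫ 𝟙 _ by simp)
    (Aut.hom_ext' fun X => show 𝟙 _ = 𝟙 _ ≫ 𝟙 _ ≫ 𝟙 _ by simp)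
  right_unitality g := hom_ext
    (show 𝟙_ D ◁ η g.functor ≫ (ρ_ _).hom = 𝟙_ D ◁ g.functor.map (𝟙 _) ≫
      ((λ_ (g.functor.obj (𝟙_ D))).hom ≫ η g.functor) ≫ 𝟙 _ by
      rw [CategoryTheory.Functor.map_id, whiskerLeft_id, Category.comp_id, Category.id_comp,
        ← unitors_equal, leftUnitor_naturality])
    (Aut.hom_ext' fun X => show 𝟙 _ = g.functor.map (𝟙 _) ≫ 𝟙 _ ≫ 𝟙 _ by simp)

instance : (inclG i).Monoidal := (inclGCore i).toMonoidal

/-- The composite `C ⥤ D ⥤ D ⋊ Aut`. -/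
abbrev inclC : C ⥤ SemiProd i := i ⋙ inclD i

/-- The first component of the isomorphism `(1, g) ⊗ (i c, 1) ≅ (i c, 1) ⊗ (1, g)`. -/
def σ₁ (g : Aut i) (c : C) : 𝟙_ D ⊗ g.functor.obj (i.obj c) ≅ i.obj c ⊗ 𝟙_ D :=
  λ_ _ ≪≫ g.triangle.app c ≪≫ (ρ_ _).symm

/-- The canonical isomorphisms `(1, g) ⊗ (i c, 1) ≅ (i c, 1) ⊗ (1, g)`, given by the `C`-linear
structure of the autoequivalence `g`. -/
def commutation : Commutation (inclG i) (inclC i) where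
  σ g c := isoMk (σ₁ i g c) (ρ_ g ≪≫ (λ_ g).symm)
  naturality_left {g h} γ c := hom_ext
    (show (𝟙 _ ⊗ₘ γ.trans.app (i.obj c)) ≫ (σ₁ i h c).hom = (σ₁ i g c).hom ≫ _ ◁ 𝟙 (𝟙_ D) by
      simp [σ₁, ← γ.comm, -Functor.LaxMonoidal.left_unitality,
        -Functor.OplaxMonoidal.right_unitality,
        -Functor.OplaxMonoidal.left_unitality])
    (Aut.hom_ext' fun X => show γ.trans.app X ≫ 𝟙 _ ≫ 𝟙 _ = (𝟙 _ ≫ 𝟙 _) ≫ γ.trans.app X by simp)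
  naturality_right g {c d} f := hom_ext
    (show 𝟙_ D ◁ g.functor.map (i.map f) ≫ (σ₁ i g d).hom =
      (σ₁ i g c).hom ≫ (i.map f ⊗ₘ 𝟙 _) by
      have h := g.triangle.hom.naturality f
      simp only [Functor.comp_map] at h
      simp [σ₁, reassoc_of% h, -Functor.LaxMonoidal.left_unitality,
        -Functor.OplaxMonoidal.right_unitality,
        -Functor.OplaxMonoidal.left_unitality])
    (Aut.hom_ext' fun X => show g.functor.map (𝟙 X) ≫ 𝟙 _ ≫ 𝟙 _ = (𝟙 _ ≫ 𝟙 _) ≫ 𝟙 _ by simp)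
  unit_left c := hom_ext
    (show ((λ_ (i.obj c)).hom ≫ 𝟙 (i.obj c) ≫ (ρ_ (i.obj c)).inv) ≫ i.obj c ◁ 𝟙 (𝟙_ D) ≫
        i.obj c ◁ 𝟙 (𝟙_ D) ≫ (ρ_ (i.obj c)).hom =
      (𝟙 (𝟙_ D) ⊗ₘ 𝟙 (i.obj c)) ≫ (λ_ (i.obj c)).hom by simp)
    (Aut.hom_ext' fun X => show (𝟙 X ≫ 𝟙 X) ≫ 𝟙 X ≫ 𝟙 X = 𝟙 X ≫ 𝟙 X by simp)
  unit_right g := hom_ext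
    (commutation_unit_aux (g.triangle.hom.app (𝟙_ C)) (η i) (g.functor.map (η i ≫ 𝟙 _))
      (η g.functor) (by
        have h := IsMonoidal_η g.triangle.hom
        rw [Functor.OplaxMonoidal.comp_η] at h
        rwa [Category.comp_id]))
    (Aut.hom_ext' fun X => show (𝟙 _ ≫ 𝟙 _) ≫ (𝟙 _ ≫ 𝟙 _) ≫ 𝟙 _ =
      g.functor.map (𝟙 X ≫ 𝟙 X) ≫ 𝟙 _ by simp)
  mul_left g h c := hom_ext
    (by
      have h := commutation_mul_left_aux g.functor (h.triangle.hom.app c) (g.triangle.hom.app c)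
      rw [← Aut.mul_triangle] at h
      exact h)
    (Aut.hom_ext' fun X => show (𝟙 _ ≫ 𝟙 _) ≫ 𝟙 _ =
      𝟙 _ ≫ 𝟙 _ ≫ g.functor.map (𝟙 _ ≫ 𝟙 _) ≫ 𝟙 _ ≫ (𝟙 _ ≫ 𝟙 _) ≫ 𝟙 _ by simp)
  mul_right g c d := hom_ext
    (commutation_mul_right_aux g.functor (δ i c d) (g.triangle.hom.app (c ⊗ d))
      (g.triangle.hom.app c) (g.triangle.hom.app d) (by
        have h := IsMonoidal_δ g.triangle.hom c d
        rw [Functor.OplaxMonoidal.comp_δ, Category.assoc] at h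
        exact h))
    (Aut.hom_ext' fun X => show (𝟙 _ ≫ 𝟙 _) ≫ 𝟙 _ ≫ 𝟙 _ =
      g.functor.map (𝟙 X ≫ 𝟙 X) ≫ 𝟙 _ ≫ (𝟙 _ ≫ 𝟙 _) ≫ 𝟙 _ ≫ (𝟙 _ ≫ 𝟙 _) ≫ 𝟙 _ by simp)

end SemiProd
end SemiProd

section Super

open MonoidalCategory TensorProduct

/-- Complex supervector spaces. As a monoidal category, these are the complex representations of
the group with two elements. -/
def SuperVect : Type 1 := Action (ModuleCat.{0} ℂ) (Multiplicative (ZMod 2))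

namespace SuperVect

instance : Category.{0} SuperVect :=
  inferInstanceAs (Category (Action (ModuleCat.{0} ℂ) (Multiplicative (ZMod 2))))
instance : MonoidalCategory SuperVect :=
  inferInstanceAs (MonoidalCategory (Action (ModuleCat.{0} ℂ) (Multiplicative (ZMod 2))))
instance : Preadditive SuperVect :=
  inferInstanceAs (Preadditive (Action (ModuleCat.{0} ℂ) (Multiplicative (ZMod 2))))
instance : Linear ℂ SuperVect :=
  inferInstanceAs (Linear ℂ (Action (ModuleCat.{0} ℂ) (Multiplicative (ZMod 2))))
instance : Linear ℝ SuperVect where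
  homModule X Y := inferInstanceAs (Module ℝ (RestrictScalars ℝ ℂ (X ⟶ Y)))
  smul_comp X Y Z r f g := Linear.smul_comp (R := ℂ) X Y Z (r : ℂ) f g
  comp_smul X Y Z f r g := Linear.comp_smul (R := ℂ) X Y Z f (r : ℂ) g

/-- The parity automorphism `(-1)^f`. -/
def parity (X : SuperVect) : X.V →ₗ[ℂ] X.V := (X.ρ (Multiplicative.ofAdd 1)).hom

lemma parity_parity (X : SuperVect) (x : X.V) : parity X (parity X x) = x := by
  have h := X.ρ.map_mul (Multiplicative.ofAdd 1) (Multiplicative.ofAdd 1)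
  have h' : (Multiplicative.ofAdd (1 : ZMod 2)) * Multiplicative.ofAdd 1 = 1 := rfl
  rw [h', map_one] at h
  exact (congrArg (fun f : End X.V => f.hom x) h).symm

/-- The symmetry: the flip of tensor factors multiplied by `(1 + (-1)^p + (-1)^q - (-1)^(p+q)) / 2`,
that is, by the Koszul sign `(-1)^(pq)`, on elements of parities `p` and `q`. -/
def swap (X Y : SuperVect) : X.V ⊗[ℂ] Y.V →ₗ[ℂ] Y.V ⊗[ℂ] X.V :=
  (1 / 2 : ℂ) • (TensorProduct.comm ℂ X.V Y.V).toLinearMap ∘ₗ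
    (LinearMap.id + TensorProduct.map (parity X) LinearMap.id +
      TensorProduct.map LinearMap.id (parity Y) - TensorProduct.map (parity X) (parity Y))

lemma swap_tmul (X Y : SuperVect) (x : X.V) (y : Y.V) : swap X Y (x ⊗ₜ y) =
    (1 / 2 : ℂ) • (y ⊗ₜ x + y ⊗ₜ parity X x + parity Y y ⊗ₜ x - parity Y y ⊗ₜ parity X x) := by
  simp [swap]

lemma swap_swap (X Y : SuperVect) (t : X.V ⊗[ℂ] Y.V) : swap Y X (swap X Y t) = t := by
  induction t with
  | zero => simp
  | add s t hs ht => rw [map_add, map_add, hs, ht]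
  | tmul x y =>
    simp only [swap_tmul, map_smul, map_add, map_sub, parity_parity]
    module

lemma parity_comm {X Y : SuperVect} (f : X ⟶ Y) (x : X.V) :
    f.hom.hom (parity X x) = parity Y (f.hom.hom x) :=
  congrArg (fun g => ModuleCat.Hom.hom g x) (f.comm (Multiplicative.ofAdd 1))

lemma swap_comm (X Y : SuperVect) (g : Multiplicative (ZMod 2)) :
    (X ⊗ Y).ρ g ≫ ModuleCat.ofHom (swap X Y) = ModuleCat.ofHom (swap X Y) ≫ (Y ⊗ X).ρ g := by
  have hp : ∀ (Z : SuperVect) (z : Z.V),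
      parity Z ((Z.ρ g).hom z) = (Z.ρ g).hom (parity Z z) := fun Z z => by
    have h := (Z.ρ.map_mul (Multiplicative.ofAdd 1) g).symm.trans
      ((congrArg Z.ρ (mul_comm _ _)).trans (Z.ρ.map_mul g (Multiplicative.ofAdd 1)))
    exact congrArg (fun f : End Z.V => f.hom z) h
  refine ModuleCat.MonoidalCategory.tensor_ext fun x y => ?_
  change swap X Y ((X.ρ g).hom x ⊗ₜ (Y.ρ g).hom y) =
    (TensorProduct.map (Y.ρ g).hom (X.ρ g).hom) (swap X Y (x ⊗ₜ y))
  simp only [swap_tmul, map_smul, map_add, map_sub, TensorProduct.map_tmul, hp]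

/-- The symmetry of supervector spaces. -/
def superBraiding (X Y : SuperVect) : X ⊗ Y ≅ Y ⊗ X :=
  Action.mkIso
    { hom := ModuleCat.ofHom (swap X Y)
      inv := ModuleCat.ofHom (swap Y X)
      hom_inv_id := ModuleCat.hom_ext (LinearMap.ext (swap_swap X Y))
      inv_hom_id := ModuleCat.hom_ext (LinearMap.ext (swap_swap Y X)) }
    (swap_comm X Y)

instance : BraidedCategory SuperVect where
  braiding := superBraiding
  braiding_naturality_right X {Y Z} f := Action.Hom.ext <| by
    refine ModuleCat.MonoidalCategory.tensor_ext fun x y => ?_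
    change swap X Z (x ⊗ₜ f.hom.hom y) =
      (TensorProduct.map f.hom.hom LinearMap.id) (swap X Y (x ⊗ₜ y))
    simp only [swap_tmul, map_smul, map_add, map_sub, TensorProduct.map_tmul, parity_comm,
      LinearMap.id_apply]
  braiding_naturality_left {X Y} f Z := Action.Hom.ext <| by
    refine ModuleCat.MonoidalCategory.tensor_ext fun x y => ?_
    change swap Y Z (f.hom.hom x ⊗ₜ y) =
      (TensorProduct.map LinearMap.id f.hom.hom) (swap X Z (x ⊗ₜ y))
    simp only [swap_tmul, map_smul, map_add, map_sub, TensorProduct.map_tmul, parity_comm,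
      LinearMap.id_apply]
  hexagon_forward X Y Z := Action.Hom.ext <| by
    refine ModuleCat.MonoidalCategory.tensor_ext₃' fun x y z => ?_
    change TensorProduct.assoc ℂ Y.V Z.V X.V (swap X (Y ⊗ Z) (x ⊗ₜ (y ⊗ₜ z))) =
      (TensorProduct.map LinearMap.id (swap X Z)) (TensorProduct.assoc ℂ Y.V X.V Z.V
        (TensorProduct.map (swap X Y) LinearMap.id ((x ⊗ₜ y) ⊗ₜ z)))
    have h : swap X (Y ⊗ Z) (x ⊗ₜ (y ⊗ₜ z)) = ((1 / 2 : ℂ) • ((y ⊗ₜ z) ⊗ₜ x +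
        (y ⊗ₜ z) ⊗ₜ parity X x + (parity Y y ⊗ₜ parity Z z) ⊗ₜ x -
        (parity Y y ⊗ₜ parity Z z) ⊗ₜ parity X x) : (Y.V ⊗[ℂ] Z.V) ⊗[ℂ] X.V) :=
      swap_tmul X (Y ⊗ Z) x (y ⊗ₜ z)
    refine (congrArg (TensorProduct.assoc ℂ Y.V Z.V X.V) h).trans ?_
    simp only [swap_tmul, map_smul, map_add, map_sub, TensorProduct.map_tmul,
      LinearMap.id_apply, TensorProduct.assoc_tmul, ← smul_tmul', add_tmul, sub_tmul,
      parity_parity, tmul_add, tmul_sub, tmul_smul]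
    module
  hexagon_reverse X Y Z := Action.Hom.ext <| by
    refine ModuleCat.MonoidalCategory.tensor_ext₃ fun x y z => ?_
    change (TensorProduct.assoc ℂ Z.V X.V Y.V).symm (swap (X ⊗ Y) Z ((x ⊗ₜ y) ⊗ₜ z)) =
      (TensorProduct.map (swap X Z) LinearMap.id) ((TensorProduct.assoc ℂ X.V Z.V Y.V).symm
        (TensorProduct.map LinearMap.id (swap Y Z) (x ⊗ₜ (y ⊗ₜ z))))
    have h : swap (X ⊗ Y) Z ((x ⊗ₜ y) ⊗ₜ z) = ((1 / 2 : ℂ) • (z ⊗ₜ (x ⊗ₜ y) +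
        z ⊗ₜ (parity X x ⊗ₜ parity Y y) + parity Z z ⊗ₜ (x ⊗ₜ y) -
        parity Z z ⊗ₜ (parity X x ⊗ₜ parity Y y)) : Z.V ⊗[ℂ] (X.V ⊗[ℂ] Y.V)) :=
      swap_tmul (X ⊗ Y) Z (x ⊗ₜ y) z
    refine (congrArg (TensorProduct.assoc ℂ Z.V X.V Y.V).symm h).trans ?_
    simp only [swap_tmul, map_smul, map_add, map_sub, TensorProduct.map_tmul,
      LinearMap.id_apply, TensorProduct.assoc_symm_tmul, ← smul_tmul', add_tmul, sub_tmul,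
      parity_parity, tmul_add, tmul_sub, tmul_smul]
    module

instance : SymmetricCategory SuperVect where
  symmetry X Y := (superBraiding X Y).hom_inv_id

end SuperVect
end Super

section Unit

open MonoidalCategory TensorProduct Functor.LaxMonoidal Functor.OplaxMonoidal

namespace SuperVect

/-- The purely even supervector space on a complex vector space. -/
def even : ModuleCat.{0} ℂ ⥤ SuperVect where
  obj V := Action.trivial _ V
  map f := { hom := f, comm := fun _ => rfl }

/-- The symmetric monoidal structure on `even`. -/
def evenCore : even.CoreMonoidal where
  εIso := Action.mkIso (Iso.refl _) (fun _ => rfl)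
  μIso V W := Action.mkIso (M := even.obj V ⊗ even.obj W) (N := even.obj (V ⊗ W)) (Iso.refl (V ⊗ W))
    (fun g => by
      refine ModuleCat.MonoidalCategory.tensor_ext fun x y => ?_
      rfl)
  μIso_hom_natural_left _ _ := rfl
  μIso_hom_natural_right _ _ := rfl
  associativity X Y Z := Action.Hom.ext <|
    ModuleCat.MonoidalCategory.tensor_ext₃' fun x y z => rfl
  left_unitality X := Action.Hom.ext <|
    ModuleCat.MonoidalCategory.tensor_ext fun x y => rfl
  right_unitality X := Action.Hom.ext <|
    ModuleCat.MonoidalCategory.tensor_ext fun x y => rfl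

instance : even.Monoidal := evenCore.toMonoidal

instance : even.Braided where
  braided V W := Action.Hom.ext <| ModuleCat.MonoidalCategory.tensor_ext fun x y => by
    change (y ⊗ₜ x : W ⊗[ℂ] V) = swap (even.obj V) (even.obj W) (x ⊗ₜ y)
    rw [swap_tmul]
    have h : ∀ t : W ⊗[ℂ] V, t = (1 / 2 : ℂ) • (t + t + t - t) := fun t => by module
    exact h _

end SuperVect

instance extendScalarsBraided {R S : Type} [CommRing R] [CommRing S] (f : R →+* S) :
    (ModuleCat.extendScalars f).Braided where
  braided V W := by
    have h : (ModuleCat.extendScalars f).map (β_ V W).hom ≫ δ (ModuleCat.extendScalars f) W V =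
        δ (ModuleCat.extendScalars f) V W ≫ (β_ _ _).hom :=
      ((ModuleCat.extendRestrictScalarsAdj f).homEquiv _ _).injective
        (ModuleCat.MonoidalCategory.tensor_ext fun _ _ => rfl)
    rw [← cancel_mono (δ (ModuleCat.extendScalars f) W V), Category.assoc, h]
    simp

/-- The extension from real vector spaces to complex supervector spaces, sending `V` to the purely
even supervector space `ℂ ⊗ V`. -/
def vectToSuperVect : ModuleCat.{0} ℝ ⥤ SuperVect :=
  ModuleCat.extendScalars (algebraMap ℝ ℂ) ⋙ SuperVect.even

instance : vectToSuperVect.Braided :=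
  inferInstanceAs (ModuleCat.extendScalars (algebraMap ℝ ℂ) ⋙ SuperVect.even).Braided

end Unit

section Tensor

open MonoidalCategory Functor.LaxMonoidal Functor.OplaxMonoidal MonoidalLeftAction
  Functor.LaxLeftLinear Functor.OplaxLeftLinear

variable {C : Type 1} [Category.{0} C] [MonoidalCategory C]
  {D : Type 1} [Category.{0} D] [MonoidalCategory D] (i : C ⥤ D) [i.Monoidal]

/-- A `C`-balanced functor of `v` in a `C`-module `V` and of `d` in `D`, with values in `U`, where
`C` acts on `D` by `d ↦ d ⊗ i c`. -/
structure BalFun (V : LinMod C) (U : LinCat) where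
  bi : V.carrier ⥤ D ⥤ U.carrier
  bal : ∀ (c : C) (v : V.carrier) (d : D),
    (bi.obj (c ⊙ₗ v)).obj d ≅ (bi.obj v).obj (d ⊗ i.obj c)
  natural_left : ∀ {c c' : C} (f : c ⟶ c') (v : V.carrier) (d : D),
    (bi.map (f ⊵ₗ v)).app d ≫ (bal c' v d).hom = (bal c v d).hom ≫ (bi.obj v).map (d ◁ i.map f)
  natural_mid : ∀ (c : C) {v v' : V.carrier} (f : v ⟶ v') (d : D),
    (bi.map (c ⊴ₗ f)).app d ≫ (bal c v' d).hom = (bal c v d).hom ≫ (bi.map f).app (d ⊗ i.obj c)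
  natural_right : ∀ (c : C) (v : V.carrier) {d d' : D} (f : d ⟶ d'),
    (bi.obj (c ⊙ₗ v)).map f ≫ (bal c v d').hom = (bal c v d).hom ≫ (bi.obj v).map (f ▷ i.obj c)
  unit : ∀ (v : V.carrier) (d : D),
    (bal (𝟙_ C) v d).hom ≫ (bi.obj v).map (d ◁ η i ≫ (ρ_ d).hom) =
      (bi.map (λₗ v).hom).app d
  mul : ∀ (c c' : C) (v : V.carrier) (d : D),
    (bal (c ⊗ c') v d).hom ≫ (bi.obj v).map (d ◁ δ i c c') =
      (bi.map (αₗ c c' v).hom).app d ≫ (bal c (c' ⊙ₗ v) d).hom ≫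
        (bal c' v (d ⊗ i.obj c)).hom ≫ (bi.obj v).map (α_ d (i.obj c) (i.obj c')).hom

namespace BalFun

variable {i} {V : LinMod C} {U U' : LinCat}

/-- Morphisms of balanced functors: natural transformations compatible with the balancings. -/
@[ext]
structure Hom (B B' : BalFun i V U) where
  trans : B.bi ⟶ B'.bi
  comm : ∀ (c : C) (v : V.carrier) (d : D),
    (trans.app (c ⊙ₗ v)).app d ≫ (B'.bal c v d).hom =
      (B.bal c v d).hom ≫ (trans.app v).app (d ⊗ i.obj c)

lemma Hom.comm_assoc {B B' : BalFun i V U} (a : Hom B B') (c : C) (v : V.carrier) (d : D)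
    {Z : U.carrier} (h : (B'.bi.obj v).obj (d ⊗ i.obj c) ⟶ Z) :
    (a.trans.app (c ⊙ₗ v)).app d ≫ (B'.bal c v d).hom ≫ h =
      (B.bal c v d).hom ≫ (a.trans.app v).app (d ⊗ i.obj c) ≫ h := by
  simpa only [Category.assoc] using congrArg (· ≫ h) (a.comm c v d)

instance : Category (BalFun i V U) where
  Hom := Hom
  id B := { trans := 𝟙 _, comm := by simp }
  comp a b := { trans := a.trans ≫ b.trans, comm := by simp [a.comm_assoc, b.comm] }

lemma hom_ext {B B' : BalFun i V U} {a b : B ⟶ B'} (h : a.trans = b.trans) : a = b := Hom.ext h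

/-- A balanced functor that is linear and cocontinuous in each variable. -/
structure IsAdmissible [Preadditive D] [Linear ℝ D] (B : BalFun i V U) : Prop where
  left : ∀ d : D, IsCocontLinear (B.bi.flip.obj d)
  right : ∀ v : V.carrier, IsCocontLinear (B.bi.obj v)

/-- The composition of a balanced functor with a functor. -/
@[simps bi]
def comp (B : BalFun i V U) (H : U.carrier ⥤ U'.carrier) : BalFun i V U' where
  bi := B.bi ⋙ (Functor.whiskeringRight _ _ _).obj H
  bal c v d := H.mapIso (B.bal c v d)
  natural_left f v d := by simp [← Functor.map_comp, B.natural_left]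
  natural_mid c _ _ f d := by simp [← Functor.map_comp, B.natural_mid]
  natural_right c v _ _ f := by simp [← Functor.map_comp, B.natural_right]
  unit v d := by
    simp [← B.unit]
  mul c c' v d := by simp [← Functor.map_comp, B.mul]

/-- Composition of a balanced functor with varying functors. -/
def postcomp (B : BalFun i V U) (U' : LinCat) :
    (U.carrier ⥤ U'.carrier) ⥤ BalFun i V U' where
  obj H := B.comp H
  map {H H'} a := Hom.mk (B := B.comp H) (B' := B.comp H')
    (Functor.whiskerLeft B.bi ((Functor.whiskeringRight _ _ _).map a))
    (fun c v d => (a.naturality (B.bal c v d).hom).symm)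
  map_id H := hom_ext (by ext; exact rfl)
  map_comp a b := hom_ext (by ext; exact rfl)

/-- A balanced functor exhibiting `T` as the relative tensor product of `V` and `D` over `C`:
composition with it is an equivalence from cocontinuous linear functors on `T` to balanced functors
that are linear and cocontinuous in each variable, for all locally presentable targets. -/
structure IsRelTensor [Preadditive D] [Linear ℝ D] {T : LinCat} (B : BalFun i V T) : Prop where
  admissible : B.IsAdmissible
  full : ∀ U : LinCat, IsLocallyPresentable.{0} U.carrier →
    (ObjectProperty.ι (fun H : T.carrier ⥤ U.carrier => IsCocontLinear H) ⋙ B.postcomp U).Full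
  faithful : ∀ U : LinCat, IsLocallyPresentable.{0} U.carrier →
    (ObjectProperty.ι (fun H : T.carrier ⥤ U.carrier => IsCocontLinear H) ⋙ B.postcomp U).Faithful
  lift : ∀ U : LinCat, IsLocallyPresentable.{0} U.carrier →
    ∀ B' : BalFun i V U, B'.IsAdmissible →
      ∃ H : T.carrier ⥤ U.carrier, IsCocontLinear H ∧ Nonempty ((B.postcomp U).obj H ≅ B')

end BalFun

section

variable {E : Type u} [Category.{v} E] [MonoidalCategory E] {G : Type 1} [Category.{v₁} G]
  [MonoidalCategory G] {J : G ⥤ E} [J.Monoidal] {i} {L : D ⥤ E} [L.Monoidal]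
  {κ : Commutation J (i ⋙ L)} {V : LinMod C} {W : LinMod E} (ι : V ⟶ fixObj κ W)

/-- The object of `W` underlying `ι(v)`, for a functor `ι` with values in fixed points of `W`. -/
def under (v : V.carrier) : W.carrier := FixedPt.pt (ι.functor.obj v)

/-- The morphism of `W` underlying `ι(f)`. -/
def underMap {v v' : V.carrier} (f : v ⟶ v') : under ι v ⟶ under ι v' :=
  FixedPt.val (ι.functor.map f)

lemma underMap_id (v : V.carrier) : underMap ι (𝟙 v) = 𝟙 _ :=
  congrArg FixedPt.val (ι.functor.map_id v)

lemma underMap_comp {v v' v'' : V.carrier} (f : v ⟶ v') (f' : v' ⟶ v'') :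
    underMap ι (f ≫ f') = underMap ι f ≫ underMap ι f' :=
  congrArg FixedPt.val (ι.functor.map_comp f f')

/-- The isomorphism `c • ι(v) ≅ ι(c • v)`. -/
def underIso (c : C) (v : V.carrier) : L.obj (i.obj c) ⊙ₗ under ι v ≅ under ι (c ⊙ₗ v) :=
  (FixedPt.forget J W).mapIso (Functor.LeftLinear.μₗIso ι.functor c v)

lemma underIso_natural_left {c c' : C} (f : c ⟶ c') (v : V.carrier) :
    L.map (i.map f) ⊵ₗ under ι v ≫ (underIso ι c' v).hom =
      (underIso ι c v).hom ≫ underMap ι (f ⊵ₗ v) :=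
  congrArg FixedPt.val (μₗ_naturality_left ι.functor f v)

lemma underIso_natural_right (c : C) {v v' : V.carrier} (f : v ⟶ v') :
    L.obj (i.obj c) ⊴ₗ underMap ι f ≫ (underIso ι c v').hom =
      (underIso ι c v).hom ≫ underMap ι (c ⊴ₗ f) :=
  congrArg FixedPt.val (μₗ_naturality_right ι.functor c f)

lemma underIso_mul (c c' : C) (v : V.carrier) :
    (underIso ι (c ⊗ c') v).hom ≫ underMap ι (αₗ c c' v).hom =
      ((L.map (δ i c c') ≫ δ L (i.obj c) (i.obj c')) ⊵ₗ under ι v ≫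
        (αₗ (L.obj (i.obj c)) (L.obj (i.obj c')) (under ι v)).hom) ≫
        L.obj (i.obj c) ⊴ₗ (underIso ι c' v).hom ≫ (underIso ι c (c' ⊙ₗ v)).hom :=
  congrArg FixedPt.val (μₗ_associativity ι.functor c c' v)

lemma underIso_unit (v : V.carrier) :
    (L.map (η i) ≫ η L) ⊵ₗ under ι v ≫ (λₗ (under ι v)).hom =
      (underIso ι (𝟙_ C) v).hom ≫ underMap ι (λₗ v).hom :=
  congrArg FixedPt.val (μₗ_unitality (C := C) ι.functor v)

/-- The isomorphism `d • ι(c • v) ≅ d • (c • ι(v)) ≅ (d ⊗ i c) • ι(v)`. -/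
def canonicalIso (c : C) (v : V.carrier) (d : D) :
    L.obj d ⊙ₗ under ι (c ⊙ₗ v) ≅ L.obj (d ⊗ i.obj c) ⊙ₗ under ι v :=
  rightIso (L.obj d) (underIso ι c v).symm ≪≫
    (αₗ (L.obj d) (L.obj (i.obj c)) (under ι v)).symm ≪≫
    leftIso (Functor.Monoidal.μIso L d (i.obj c)) (under ι v)

lemma canonicalIso_hom (c : C) (v : V.carrier) (d : D) : (canonicalIso ι c v d).hom =
    L.obj d ⊴ₗ (underIso ι c v).inv ≫ (αₗ (L.obj d) (L.obj (i.obj c)) (under ι v)).inv ≫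
      μ L d (i.obj c) ⊵ₗ under ι v := rfl

lemma canonicalIso_natural_left {c c' : C} (f : c ⟶ c') (v : V.carrier) (d : D) :
    L.obj d ⊴ₗ underMap ι (f ⊵ₗ v) ≫ (canonicalIso ι c' v d).hom =
      (canonicalIso ι c v d).hom ≫ L.map (d ◁ i.map f) ⊵ₗ under ι v := by
  have h : underMap ι (f ⊵ₗ v) ≫ (underIso ι c' v).inv =
      (underIso ι c v).inv ≫ L.map (i.map f) ⊵ₗ under ι v := by
    rw [Iso.comp_inv_eq, Category.assoc, underIso_natural_left, Iso.inv_hom_id_assoc]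
  have h' : L.obj d ⊴ₗ L.map (i.map f) ⊵ₗ under ι v ≫ (αₗ _ _ _).inv =
      (αₗ _ _ _).inv ≫ (L.obj d ◁ L.map (i.map f)) ⊵ₗ under ι v := by simp
  rw [canonicalIso_hom, canonicalIso_hom, ← actionHomRight_comp_assoc, h,
    actionHomRight_comp_assoc, reassoc_of% h', ← comp_actionHomLeft, μ_natural_right,
    comp_actionHomLeft]
  simp only [Category.assoc]

lemma canonicalIso_natural_mid (c : C) {v v' : V.carrier} (f : v ⟶ v') (d : D) :
    L.obj d ⊴ₗ underMap ι (c ⊴ₗ f) ≫ (canonicalIso ι c v' d).hom =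
      (canonicalIso ι c v d).hom ≫ L.obj (d ⊗ i.obj c) ⊴ₗ underMap ι f := by
  have h : underMap ι (c ⊴ₗ f) ≫ (underIso ι c v').inv =
      (underIso ι c v).inv ≫ L.obj (i.obj c) ⊴ₗ underMap ι f := by
    rw [Iso.comp_inv_eq, Category.assoc, underIso_natural_right, Iso.inv_hom_id_assoc]
  have h' : L.obj d ⊴ₗ L.obj (i.obj c) ⊴ₗ underMap ι f ≫ (αₗ _ _ _).inv =
      (αₗ _ _ _).inv ≫ (L.obj d ⊗ L.obj (i.obj c)) ⊴ₗ underMap ι f := by simp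
  rw [canonicalIso_hom, canonicalIso_hom, ← actionHomRight_comp_assoc, h,
    actionHomRight_comp_assoc, reassoc_of% h', action_exchange]
  simp only [Category.assoc]

lemma canonicalIso_natural_right (c : C) (v : V.carrier) {d d' : D} (f : d ⟶ d') :
    L.map f ⊵ₗ under ι (c ⊙ₗ v) ≫ (canonicalIso ι c v d').hom =
      (canonicalIso ι c v d).hom ≫ L.map (f ▷ i.obj c) ⊵ₗ under ι v := by
  have h : L.map f ⊵ₗ (L.obj (i.obj c) ⊙ₗ under ι v) ≫ (αₗ _ _ _).inv =
      (αₗ _ _ _).inv ≫ (L.map f ▷ L.obj (i.obj c)) ⊵ₗ under ι v := by simp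
  rw [canonicalIso_hom, canonicalIso_hom, ← action_exchange_assoc, reassoc_of% h,
    ← comp_actionHomLeft, μ_natural_left, comp_actionHomLeft]
  simp only [Category.assoc]

lemma canonicalIso_unit (v : V.carrier) (d : D) :
    (canonicalIso ι (𝟙_ C) v d).hom ≫ L.map (d ◁ η i ≫ (ρ_ d).hom) ⊵ₗ under ι v =
      L.obj d ⊴ₗ underMap ι (λₗ v).hom := by
  have h : underMap ι (λₗ v).hom =
      (underIso ι (𝟙_ C) v).inv ≫ (L.map (η i) ≫ η L) ⊵ₗ under ι v ≫ (λₗ (under ι v)).hom := by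
    rw [underIso_unit, Iso.inv_hom_id_assoc]
  have h₀ : μ L d (𝟙_ D) ≫ L.map (ρ_ d).hom = L.obj d ◁ η L ≫ (ρ_ (L.obj d)).hom := by
    rw [Functor.LaxMonoidal.right_unitality L, Functor.Monoidal.whiskerLeft_η_ε_assoc]
  have h₁ : μ L d (i.obj (𝟙_ C)) ≫ L.map (d ◁ η i ≫ (ρ_ d).hom) =
      L.obj d ◁ (L.map (η i) ≫ η L) ≫ (ρ_ (L.obj d)).hom := by
    rw [Functor.map_comp, ← μ_natural_right_assoc, MonoidalCategory.whiskerLeft_comp,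
      Category.assoc, h₀]
  have h₂ : ∀ {e : E} (f : e ⟶ 𝟙_ E), (αₗ (L.obj d) e (under ι v)).inv ≫
      (L.obj d ◁ f ≫ (ρ_ (L.obj d)).hom) ⊵ₗ under ι v =
      L.obj d ⊴ₗ (f ⊵ₗ under ι v ≫ (λₗ (under ι v)).hom) :=
    fun f => by simp [-Functor.LaxMonoidal.right_unitality]
  rw [canonicalIso_hom, h, Category.assoc, Category.assoc, ← comp_actionHomLeft, h₁, h₂,
    ← actionHomRight_comp]

lemma canonicalIso_mul (c c' : C) (v : V.carrier) (d : D) :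
    (canonicalIso ι (c ⊗ c') v d).hom ≫ L.map (d ◁ δ i c c') ⊵ₗ under ι v =
      L.obj d ⊴ₗ underMap ι (αₗ c c' v).hom ≫ (canonicalIso ι c (c' ⊙ₗ v) d).hom ≫
        (canonicalIso ι c' v (d ⊗ i.obj c)).hom ≫
        L.map (α_ d (i.obj c) (i.obj c')).hom ⊵ₗ under ι v := by
  have h : L.obj d ⊴ₗ underMap ι (αₗ c c' v).hom ≫
      L.obj d ⊴ₗ (underIso ι c (c' ⊙ₗ v)).inv =
      L.obj d ⊴ₗ (underIso ι (c ⊗ c') v).inv ≫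
        L.obj d ⊴ₗ ((L.map (δ i c c') ≫ δ L (i.obj c) (i.obj c')) ⊵ₗ under ι v) ≫
        L.obj d ⊴ₗ (αₗ (L.obj (i.obj c)) (L.obj (i.obj c')) (under ι v)).hom ≫
        L.obj d ⊴ₗ L.obj (i.obj c) ⊴ₗ (underIso ι c' v).hom := by
    simp only [← actionHomRight_comp]
    congr 1
    rw [Iso.comp_inv_eq, Category.assoc, Iso.eq_inv_comp, underIso_mul]
    simp only [Category.assoc]
  have h₁ : (αₗ (L.obj d) (L.obj (i.obj c)) (under ι (c' ⊙ₗ v))).inv ≫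
      μ L d (i.obj c) ⊵ₗ under ι (c' ⊙ₗ v) ≫ L.obj (d ⊗ i.obj c) ⊴ₗ (underIso ι c' v).inv =
      L.obj d ⊴ₗ L.obj (i.obj c) ⊴ₗ (underIso ι c' v).inv ≫
      (αₗ (L.obj d) (L.obj (i.obj c)) (L.obj (i.obj c') ⊙ₗ under ι v)).inv ≫
      μ L d (i.obj c) ⊵ₗ (L.obj (i.obj c') ⊙ₗ under ι v) := by
    rw [← action_exchange]
    simp
  have h₂ : L.obj d ⊴ₗ (αₗ (L.obj (i.obj c)) (L.obj (i.obj c')) (under ι v)).hom ≫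
      (αₗ (L.obj d) (L.obj (i.obj c)) (L.obj (i.obj c') ⊙ₗ under ι v)).inv ≫
      μ L d (i.obj c) ⊵ₗ (L.obj (i.obj c') ⊙ₗ under ι v) ≫
      (αₗ (L.obj (d ⊗ i.obj c)) (L.obj (i.obj c')) (under ι v)).inv =
      (αₗ (L.obj d) (L.obj (i.obj c) ⊗ L.obj (i.obj c')) (under ι v)).inv ≫
      ((α_ (L.obj d) (L.obj (i.obj c)) (L.obj (i.obj c'))).inv ≫
        μ L d (i.obj c) ▷ L.obj (i.obj c')) ⊵ₗ under ι v := by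
    have p : (αₗ (L.obj d) (L.obj (i.obj c) ⊗ L.obj (i.obj c')) (under ι v)).hom ≫
        L.obj d ⊴ₗ (αₗ (L.obj (i.obj c)) (L.obj (i.obj c')) (under ι v)).hom =
        (α_ (L.obj d) (L.obj (i.obj c)) (L.obj (i.obj c'))).inv ⊵ₗ under ι v ≫
        (αₗ (L.obj d ⊗ L.obj (i.obj c)) (L.obj (i.obj c')) (under ι v)).hom ≫
        (αₗ (L.obj d) (L.obj (i.obj c)) (L.obj (i.obj c') ⊙ₗ under ι v)).hom := by
      rw [← associator_actionHom, ← comp_actionHomLeft_assoc, Iso.inv_hom_id, id_actionHomLeft,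
        Category.id_comp]
    rw [← cancel_epi (αₗ (L.obj d) (L.obj (i.obj c) ⊗ L.obj (i.obj c')) (under ι v)).hom,
      reassoc_of% p]
    simp
  have h₃ : L.obj d ⊴ₗ ((L.map (δ i c c') ≫ δ L (i.obj c) (i.obj c')) ⊵ₗ under ι v) ≫
      (αₗ (L.obj d) (L.obj (i.obj c) ⊗ L.obj (i.obj c')) (under ι v)).inv =
      (αₗ (L.obj d) (L.obj (i.obj (c ⊗ c'))) (under ι v)).inv ≫
        (L.obj d ◁ (L.map (δ i c c') ≫ δ L (i.obj c) (i.obj c'))) ⊵ₗ under ι v := by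
    simp
  have h₄ : L.obj d ◁ (L.map (δ i c c') ≫ δ L (i.obj c) (i.obj c')) ≫
      ((α_ (L.obj d) (L.obj (i.obj c)) (L.obj (i.obj c'))).inv ≫
        μ L d (i.obj c) ▷ L.obj (i.obj c')) ≫
      μ L (d ⊗ i.obj c) (i.obj c') ≫ L.map (α_ d (i.obj c) (i.obj c')).hom =
      μ L d (i.obj (c ⊗ c')) ≫ L.map (d ◁ δ i c c') := by
    rw [← μ_natural_right, MonoidalCategory.whiskerLeft_comp, Category.assoc, Category.assoc,
      Functor.LaxMonoidal.associativity, Iso.inv_hom_id_assoc,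
      Functor.Monoidal.whiskerLeft_δ_μ_assoc]
  simp only [canonicalIso_hom, Category.assoc]
  rw [reassoc_of% h, ← comp_actionHomLeft, ← h₄, comp_actionHomLeft, comp_actionHomLeft,
    comp_actionHomLeft (μ L (d ⊗ i.obj c) (i.obj c'))]
  rw [← reassoc_of% h₃, ← reassoc_of% h₂, reassoc_of% h₁]
  simp only [← actionHomRight_comp_assoc]
  rw [← actionHomRight_comp (L.obj (i.obj c)), Iso.hom_inv_id, actionHomRight_id, Category.comp_id]

/-- The balanced functor `(v, d) ↦ d • ι(v)` defined by a `C`-module functor `ι` from `V` to the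
fixed points of `W`. -/
def canonicalBal : BalFun i V W.toLinCat where
  bi :=
    { obj := fun v =>
        { obj := fun d => L.obj d ⊙ₗ under ι v
          map := fun f => L.map f ⊵ₗ under ι v }
      map := fun f =>
        { app := fun d => L.obj d ⊴ₗ underMap ι f
          naturality := fun _ _ f' =>
            (action_exchange (L.map f') (underMap ι f)).symm }
      map_id := fun v => by ext d; simp [underMap_id]
      map_comp := fun f f' => by ext d; simp [underMap_comp] }
  bal c v d := canonicalIso ι c v d
  natural_left f v d := canonicalIso_natural_left ι f v d
  natural_mid c _ _ f d := canonicalIso_natural_mid ι c f d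
  natural_right c v _ _ f := canonicalIso_natural_right ι c v f
  unit v d := canonicalIso_unit ι v d
  mul c c' v d := canonicalIso_mul ι c c' v d

end

end Tensor

section Galois

open MonoidalCategory.MonoidalLeftAction Bicategory

lemma IsCocontLinear.id {X : Type u₁} [Category.{v₁} X] [Preadditive X] [Linear ℝ X] :
    IsCocontLinear (𝟭 X) :=
  ⟨inferInstance, inferInstance, inferInstance⟩

lemma IsCocontLinear.comp {X : Type u₁} [Category.{v₁} X] [Preadditive X] [Linear ℝ X]
    {Y : Type u₂} [Category.{v₂} Y] [Preadditive Y] [Linear ℝ Y]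
    {Z : Type u₃} [Category.{v₃} Z] [Preadditive Z] [Linear ℝ Z] {F : X ⥤ Y} {G : Y ⥤ Z}
    (hF : IsCocontLinear F) (hG : IsCocontLinear G) : IsCocontLinear (F ⋙ G) := by
  have := hF.additive
  have := hF.linear
  have := hF.cocontinuous
  have := hG.additive
  have := hG.linear
  have := hG.cocontinuous
  exact ⟨inferInstance, inferInstance, inferInstance⟩

/-- Real linear locally presentable categories. -/
def IsPres (V : LinCat) : Prop := IsLocallyPresentable.{0} V.carrier

/-- Finite-dimensional real linear locally presentable categories: there are finitely many objects
that generate the category under colimits, have finite-dimensional hom-spaces between them, and are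
compact projective, in the sense that `Hom(S k, -)`, with values in real vector spaces, preserves
small colimits. -/
def IsFinDim (V : LinCat) : Prop :=
  IsPres V ∧ ∃ (n : ℕ) (S : Fin n → V.carrier),
    (∀ k l, Module.Finite ℝ (S k ⟶ S l)) ∧
    (∀ k, PreservesColimitsOfSize.{0, 0} ((linearCoyoneda ℝ V.carrier).obj (op (S k)))) ∧
    ∀ P : ObjectProperty V.carrier,
      (∀ (J : Type) [Category.{0} J], P.IsClosedUnderColimitsOfShape J) →
      (∀ k, P (S k)) → ∀ X, P X

section

variable {A : Type u₁} [Category.{v₁} A] {E : Type u} [Category.{v} E] [MonoidalCategory E]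

/-- The functor `a ↦ k(a) • X`. -/
@[simps]
def orbit (k : A ⥤ E) (W : LinMod E) (X : W.carrier) : A ⥤ W.carrier where
  obj a := k.obj a ⊙ₗ X
  map f := k.map f ⊵ₗ X

/-- The functor `X ↦ e • X`. -/
@[simps]
def act (W : LinMod E) (e : E) : W.carrier ⥤ W.carrier where
  obj X := e ⊙ₗ X
  map f := e ⊴ₗ f

/-- The bicategory of `E`-modules whose underlying category satisfies `Q`, whose action is
cocontinuous and linear in the module variable and, along `k : A ⥤ E`, in the other variable. The
1-morphisms are the cocontinuous linear strong module functors. -/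
def cocontMod [Preadditive A] [Linear ℝ A] (k : A ⥤ E) (Q : LinCat → Prop) :
    SubBicategory (LinMod E) where
  obj W := Q W.toLinCat ∧ (∀ e : E, IsCocontLinear (act W e)) ∧
    ∀ X : W.carrier, IsCocontLinear (orbit k W X)
  hom F := IsCocontLinear F.functor
  id_mem _ := IsCocontLinear.id
  comp_mem _ _ hF hG := hF.comp hG

end

open scoped Pseudofunctor.StrongTrans

variable {C : Type 1} [Category.{0} C] [MonoidalCategory C] [BraidedCategory C] [Preadditive C]
  [Linear ℝ C] {D : Type 1} [Category.{0} D] [MonoidalCategory D] [BraidedCategory D]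
  [Preadditive D] [Linear ℝ D]

/-- The bicategory of `C`-modules whose underlying category satisfies `Q`. -/
abbrev MOD (C : Type 1) [Category.{0} C] [MonoidalCategory C] [Preadditive C] [Linear ℝ C]
    (Q : LinCat → Prop) := (cocontMod (𝟭 C) Q).Carrier

/-- The bicategory of `D`-modules with a compatible action of `Aut i`, whose underlying category
satisfies `Q`. -/
abbrev EquivariantMOD (i : C ⥤ D) [i.Braided] (Q : LinCat → Prop) :=
  (cocontMod (SemiProd.inclD i) Q).Carrier

/-- The extension `i` is Galois, with respect to modules whose underlying category satisfies `Q`: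
`Aut i`-fixed points of `D ⋊ Aut i`-modules define a pseudofunctor `Φ` to `C`-modules (the first two
conditions say that it is well-defined), which is an equivalence of bicategories with inverse `F`,
and `F` is base change along `i`: the unit `V ⟶ Φ (F V)` of the equivalence exhibits `F V` as
the relative tensor product of `V` and `D` over `C`. -/
def IsGalois (i : C ⥤ D) [i.Braided] (Q : LinCat → Prop) : Prop :=
  ∃ (hobj : ∀ W : LinMod (SemiProd i), (cocontMod (SemiProd.inclD i) Q).obj W →
      (cocontMod (𝟭 C) Q).obj (fixObj (SemiProd.commutation i) W))
    (hhom : ∀ {W W' : LinMod (SemiProd i)} (f : W ⟶ W'),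
      (cocontMod (SemiProd.inclD i) Q).obj W → (cocontMod (SemiProd.inclD i) Q).obj W' →
      (cocontMod (SemiProd.inclD i) Q).hom f →
      (cocontMod (𝟭 C) Q).hom (fixMap (SemiProd.commutation i) f)),
    let Φ : Pseudofunctor (EquivariantMOD i Q) (MOD C Q) :=
      restrictPseudofunctor (fixPseudofunctor (SemiProd.commutation i)) _ _ hobj hhom
    ∃ (F : Pseudofunctor (MOD C Q) (EquivariantMOD i Q))
      (unit : Pseudofunctor.id (MOD C Q) ≌ F.comp Φ),
      (∀ V : MOD C Q, (canonicalBal (L := SemiProd.inclD i) (unit.hom.app V).of).IsRelTensor) ∧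
      Nonempty (Φ.comp F ≌ Pseudofunctor.id (EquivariantMOD i Q))

end Galois

end CatGalois

end

open CategoryTheory Limits Opposite

noncomputable section

namespace CatGalois

universe v u v₁ u₁ v₂ u₂ v₃ u₃ w₁ w₂

section Whitehead

open Bicategory
open scoped Pseudofunctor.StrongTrans

variable {B : Type u₁} [Bicategory.{w₁, v₁} B] {C : Type u₂} [Bicategory.{w₂, v₂} C]

/-- A 1-morphism of a bicategory that has an inverse up to isomorphism. -/
def IsEquiv {a b : B} (f : a ⟶ b) : Prop :=
  ∃ g : b ⟶ a, Nonempty (𝟙 a ≅ f ≫ g) ∧ Nonempty (g ≫ f ≅ 𝟙 b)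

lemma IsEquiv.of_iso {a b : B} {f f' : a ⟶ b} (h : IsEquiv f) (e : f ≅ f') : IsEquiv f' := by
  obtain ⟨g, ⟨s⟩, ⟨t⟩⟩ := h
  exact ⟨g, ⟨s ≪≫ whiskerRightIso e g⟩, ⟨(whiskerLeftIso g e).symm ≪≫ t⟩⟩

lemma isEquivalence_precomp {a b : B} {f : a ⟶ b} (h : IsEquiv f) (c : B) :
    (precomp c f).IsEquivalence := by
  obtain ⟨g, ⟨s⟩, ⟨t⟩⟩ := h
  have h₁ {h h' : b ⟶ c} (x : h ⟶ h') : x ≫ (λ_ h').inv ≫ t.inv ▷ h' ≫ (α_ g f h').hom =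
      ((λ_ h).inv ≫ t.inv ▷ h ≫ (α_ g f h).hom) ≫ g ◁ f ◁ x := by
    have := whisker_exchange t.inv x
    simp only [id_whiskerLeft, comp_whiskerLeft, Category.assoc] at this
    rw [← cancel_epi (λ_ h).hom, ← cancel_mono (α_ g f h').inv]
    simpa using this
  have h₂ {h h' : a ⟶ c} (x : h ⟶ h') : f ◁ g ◁ x ≫ (α_ f g h').inv ≫ s.inv ▷ h' ≫ (λ_ h').hom =
      ((α_ f g h).inv ≫ s.inv ▷ h ≫ (λ_ h).hom) ≫ x := by
    have := whisker_exchange s.inv x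
    simp only [id_whiskerLeft, comp_whiskerLeft, Category.assoc] at this
    rw [← cancel_epi (α_ f g h).hom, ← cancel_mono (λ_ h').inv]
    simpa using this
  exact (CategoryTheory.Equivalence.mk (precomp c f) (precomp c g)
    (NatIso.ofComponents (fun h => (λ_ h).symm ≪≫ (whiskerRightIso t h).symm ≪≫ α_ g f h) h₁)
    (NatIso.ofComponents (fun h => (α_ f g h).symm ≪≫ (whiskerRightIso s h).symm ≪≫ λ_ h)
      h₂)).isEquivalence_functor

lemma isEquivalence_of_equivalence {a b : B} (e : a ≌ b) : IsEquiv e.hom :=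
  ⟨e.inv, ⟨e.unit⟩, ⟨e.counit⟩⟩

variable {F G : Pseudofunctor B C}

section

variable (η : F ⟶ G) (inv : ∀ a, G.obj a ⟶ F.obj a) (s : ∀ a, 𝟙 _ ≅ η.app a ≫ inv a)
  (hη : ∀ a, IsEquiv (η.app a))

/-- The naturality constraint of the pointwise inverse of `η`, precomposed with `η`. -/
def invNatAux {a b : B} (f : a ⟶ b) :
    η.app a ≫ G.map f ≫ inv b ≅ η.app a ≫ inv a ≫ F.map f :=
  (α_ _ _ _).symm ≪≫ whiskerRightIso (η.naturality f).symm (inv b) ≪≫ α_ _ _ _ ≪≫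
    whiskerLeftIso (F.map f) (s b).symm ≪≫ ρ_ _ ≪≫ (λ_ _).symm ≪≫
    whiskerRightIso (s a) (F.map f) ≪≫ α_ _ _ _

include hη in
lemma precomp_cancel (a : B) {c : C} {h k : G.obj a ⟶ c} {x y : h ⟶ k}
    (w : η.app a ◁ x = η.app a ◁ y) : x = y := by
  have := isEquivalence_precomp (hη a) c
  exact (precomp c (η.app a)).map_injective w

/-- The naturality constraint of the pointwise inverse of `η`. -/
def invNat {a b : B} (f : a ⟶ b) : G.map f ≫ inv b ≅ inv a ≫ F.map f :=
  have := isEquivalence_precomp (hη a) (F.obj b)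
  (precomp (F.obj b) (η.app a)).preimageIso (invNatAux η inv s f)

lemma whiskerLeft_invNat {a b : B} (f : a ⟶ b) :
    η.app a ◁ (invNat η inv s hη f).hom = (invNatAux η inv s f).hom :=
  have := isEquivalence_precomp (hη a) (F.obj b)
  (precomp (F.obj b) (η.app a)).map_preimage _

lemma invNatAux_hom {a b : B} (f : a ⟶ b) : (invNatAux η inv s f).hom =
    (α_ _ _ _).inv ≫ (η.naturality f).inv ▷ inv b ≫ (α_ _ _ _).hom ≫
    F.map f ◁ (s b).inv ≫ (ρ_ _).hom ≫ (λ_ _).inv ≫ (s a).hom ▷ F.map f ≫ (α_ _ _ _).hom := rfl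

/-- The pointwise inverse of a strong transformation. -/
def invTrans : G ⟶ F where
  app := inv
  naturality f := invNat η inv s hη f
  naturality_naturality {a b f g} x := by
    refine precomp_cancel η hη a ?_
    have h : η.app a ◁ G.map₂ x ≫ (η.naturality g).inv =
        (η.naturality f).inv ≫ F.map₂ x ▷ η.app b := by
      rw [Iso.comp_inv_eq, Category.assoc, η.naturality_naturality, Iso.inv_hom_id_assoc]
    have h₁ : η.app a ◁ G.map₂ x ▷ inv b ≫ (α_ _ _ _).inv ≫ (η.naturality g).inv ▷ inv b =
        (α_ _ _ _).inv ≫ (η.naturality f).inv ▷ inv b ≫ F.map₂ x ▷ η.app b ▷ inv b := by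
      rw [← comp_whiskerRight, ← h]
      simp
    have h₂ : F.map₂ x ▷ η.app b ▷ inv b ≫ (α_ _ _ _).hom ≫ F.map g ◁ (s b).inv ≫ (ρ_ _).hom =
        (α_ _ _ _).hom ≫ F.map f ◁ (s b).inv ≫ (ρ_ _).hom ≫ F.map₂ x := by
      have := whisker_exchange (F.map₂ x) (s b).inv
      rw [← cancel_epi (α_ _ _ _).inv, ← cancel_mono (ρ_ _).inv]
      simpa using this.symm
    have h₃ : F.map₂ x ≫ (λ_ _).inv ≫ (s a).hom ▷ F.map g ≫ (α_ _ _ _).hom = (λ_ _).inv ≫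
        (s a).hom ▷ F.map f ≫ (α_ _ _ _).hom ≫ η.app a ◁ inv a ◁ F.map₂ x := by
      have := whisker_exchange (s a).hom (F.map₂ x)
      rw [← cancel_epi (λ_ _).hom, ← cancel_mono (α_ _ _ _).inv]
      simpa using this
    rw [Bicategory.whiskerLeft_comp, Bicategory.whiskerLeft_comp, whiskerLeft_invNat,
      whiskerLeft_invNat]
    simp only [invNatAux_hom, Category.assoc]
    rw [reassoc_of% h₁, reassoc_of% h₂, h₃]
  naturality_id a := by
    refine precomp_cancel η hη a ?_
    have h₂ : (F.mapId a).inv ▷ η.app a ▷ inv a ≫ (α_ _ _ _).hom ≫ F.map (𝟙 a) ◁ (s a).inv ≫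
        (ρ_ _).hom = (α_ _ _ _).hom ≫ 𝟙 _ ◁ (s a).inv ≫ (ρ_ _).hom ≫ (F.mapId a).inv := by
      have := whisker_exchange (F.mapId a).inv (s a).inv
      rw [← cancel_epi (α_ _ _ _).inv, ← cancel_mono (ρ_ _).inv]
      simpa using this.symm
    have h₃ : (F.mapId a).inv ≫ (λ_ _).inv ≫ (s a).hom ▷ F.map (𝟙 a) ≫ (α_ _ _ _).hom =
        (λ_ _).inv ≫ (s a).hom ▷ 𝟙 _ ≫ (α_ _ _ _).hom ≫ η.app a ◁ inv a ◁ (F.mapId a).inv := by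
      have := whisker_exchange (s a).hom (F.mapId a).inv
      rw [← cancel_epi (λ_ _).hom, ← cancel_mono (α_ _ _ _).inv]
      simpa using this
    have h₄ : (η.naturality (𝟙 a)).inv = η.app a ◁ (G.mapId a).hom ≫ (ρ_ _).hom ≫ (λ_ _).inv ≫
        (F.mapId a).inv ▷ η.app a := Pseudofunctor.StrongTrans.naturality_id_inv η a
    rw [Bicategory.whiskerLeft_comp, Bicategory.whiskerLeft_comp, whiskerLeft_invNat]
    simp only [invNatAux_hom, Category.assoc]
    rw [h₄]
    simp only [comp_whiskerRight, Category.assoc]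
    rw [reassoc_of% h₂, reassoc_of% h₃]
    simp
  naturality_comp {a b c} f g := by
    refine precomp_cancel η hη a ?_
    have h₂ : (F.mapComp f g).inv ▷ η.app c ▷ inv c ≫ (α_ _ _ _).hom ≫ F.map (f ≫ g) ◁ (s c).inv ≫
        (ρ_ _).hom = (α_ _ _ _).hom ≫ (F.map f ≫ F.map g) ◁ (s c).inv ≫ (ρ_ _).hom ≫
          (F.mapComp f g).inv := by
      have := whisker_exchange (F.mapComp f g).inv (s c).inv
      rw [← cancel_epi (α_ _ _ _).inv, ← cancel_mono (ρ_ _).inv]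
      simpa using this.symm
    have h₃ : (F.mapComp f g).inv ≫ (λ_ _).inv ≫ (s a).hom ▷ F.map (f ≫ g) ≫ (α_ _ _ _).hom =
        (λ_ _).inv ≫ (s a).hom ▷ _ ≫ (α_ _ _ _).hom ≫ η.app a ◁ inv a ◁ (F.mapComp f g).inv := by
      have := whisker_exchange (s a).hom (F.mapComp f g).inv
      rw [← cancel_epi (λ_ _).hom, ← cancel_mono (α_ _ _ _).inv]
      simpa using this
    have h₄ : (η.naturality (f ≫ g)).inv = η.app a ◁ (G.mapComp f g).hom ≫ (α_ _ _ _).inv ≫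
        (η.naturality f).inv ▷ G.map g ≫ (α_ _ _ _).hom ≫ F.map f ◁ (η.naturality g).inv ≫
        (α_ _ _ _).inv ≫ (F.mapComp f g).inv ▷ η.app c :=
      Pseudofunctor.StrongTrans.naturality_comp_inv η f g
    have h₅ : η.app b ◁ (invNat η inv s hη g).hom = _ := whiskerLeft_invNat η inv s hη g
    have h₆ := whisker_exchange (η.naturality f).inv (invNat η inv s hη g).hom
    rw [Bicategory.whiskerLeft_comp, whiskerLeft_invNat]
    simp only [invNatAux_hom, Category.assoc]
    rw [h₄]
    simp only [comp_whiskerRight, Category.assoc]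
    rw [reassoc_of% h₂, reassoc_of% h₃]
    symm
    calc _ = η.app a ◁ (G.mapComp f g).hom ▷ inv c ⊗≫ ((η.app a ≫ G.map f) ◁ (invNat η inv s hη g).hom
          ≫ (η.naturality f).inv ▷ (inv b ≫ F.map g)) ⊗≫ F.map f ◁ (s b).inv ▷ F.map g ⊗≫
          (s a).hom ▷ (F.map f ≫ F.map g) ⊗≫ 𝟙 _ := by
            have h₈ : η.app a ◁ (invNat η inv s hη f).hom ▷ F.map g =
                (α_ _ _ _).inv ≫ (η.app a ◁ (invNat η inv s hη f).hom) ▷ F.map g ≫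
                  (α_ _ _ _).hom := by simp
            simp only [Bicategory.whiskerLeft_comp]
            rw [h₈, whiskerLeft_invNat, invNatAux_hom]
            bicategory
      _ = η.app a ◁ (G.mapComp f g).hom ▷ inv c ⊗≫ (η.naturality f).inv ▷ (G.map g ≫ inv c) ⊗≫
           F.map f ◁ (η.app b ◁ (invNat η inv s hη g).hom) ⊗≫ F.map f ◁ (s b).inv ▷ F.map g ⊗≫
          (s a).hom ▷ (F.map f ≫ F.map g) ⊗≫ 𝟙 _ := by
            rw [h₆]; bicategory
      _ = η.app a ◁ (G.mapComp f g).hom ▷ inv c ⊗≫ (η.naturality f).inv ▷ (G.map g ≫ inv c) ⊗≫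
           F.map f ◁ (η.naturality g).inv ▷ inv c ⊗≫ F.map f ◁ F.map g ◁ (s c).inv ⊗≫
           F.map f ◁ ((s b).hom ≫ (s b).inv) ▷ F.map g ⊗≫
          (s a).hom ▷ (F.map f ≫ F.map g) ⊗≫ 𝟙 _ := by
            rw [h₅, invNatAux_hom]; bicategory
      _ = _ := by
            have h₇ : η.app a ◁ inv a ◁ (F.mapComp f g).inv ≫ η.app a ◁ inv a ◁ (F.mapComp f g).hom
              = 𝟙 _ := by simp [← Bicategory.whiskerLeft_comp]
            rw [Iso.hom_inv_id, h₇]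
            bicategory
end
end Whitehead

section Whitehead

open Bicategory
open scoped Pseudofunctor.StrongTrans

variable {B : Type u₁} [Bicategory.{w₁, v₁} B] {C : Type u₂} [Bicategory.{w₂, v₂} C]

lemma IsEquiv.nonempty_equivalence {a b : B} {f : a ⟶ b} (h : IsEquiv f) :
    ∃ e : a ≌ b, e.hom = f := by
  obtain ⟨g, ⟨s⟩, ⟨t⟩⟩ := h
  exact ⟨Bicategory.Equivalence.mkOfAdjointifyCounit s t, rfl⟩

lemma isEquiv_of_sections {a b : B} {f : a ⟶ b} {g : b ⟶ a} {f' : a ⟶ b} (s : 𝟙 a ≅ f ≫ g)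
    (t : 𝟙 b ≅ g ≫ f') : IsEquiv f :=
  ⟨g, ⟨s⟩, ⟨whiskerLeftIso g ((ρ_ f).symm ≪≫ whiskerLeftIso f t ≪≫ (α_ f g f').symm ≪≫
    whiskerRightIso s.symm f' ≪≫ λ_ f') ≪≫ t.symm⟩⟩

lemma IsEquiv.of_inverse {a b : B} {f : a ⟶ b} {g : b ⟶ a} (s : 𝟙 a ≅ f ≫ g)
    (t : g ≫ f ≅ 𝟙 b) : IsEquiv g := ⟨f, ⟨t.symm⟩, ⟨s.symm⟩⟩

lemma IsEquiv.of_map {Φ : Pseudofunctor B C} (hΦ : ∀ a b, (Φ.mapFunctor a b).IsEquivalence)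
    {a b : B} {f : a ⟶ b} (h : IsEquiv (Φ.map f)) : IsEquiv f := by
  obtain ⟨g, ⟨s⟩, ⟨t⟩⟩ := h
  have := hΦ a a
  have := hΦ b b
  have := hΦ b a
  let g' := (Φ.mapFunctor b a).objPreimage g
  let e : Φ.map g' ≅ g := (Φ.mapFunctor b a).objObjPreimageIso g
  exact ⟨g', ⟨(Φ.mapFunctor a a).preimageIso
    (Φ.mapId a ≪≫ s ≪≫ whiskerLeftIso _ e.symm ≪≫ (Φ.mapComp f g').symm)⟩,
    ⟨(Φ.mapFunctor b b).preimageIso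
    (Φ.mapComp g' f ≪≫ whiskerRightIso e _ ≪≫ t ≪≫ (Φ.mapId b).symm)⟩⟩

variable {F G : Pseudofunctor B C}

lemma IsEquiv.app {η : F ⟶ G} (h : IsEquiv η) (a : B) : IsEquiv (η.app a) := by
  obtain ⟨θ, ⟨s⟩, ⟨t⟩⟩ := h
  refine ⟨θ.app a, ⟨⟨s.hom.as.app a, s.inv.as.app a, ?_, ?_⟩⟩,
    ⟨⟨t.hom.as.app a, t.inv.as.app a, ?_, ?_⟩⟩⟩
  · exact congrArg (fun m => m.as.app a) s.hom_inv_id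
  · exact congrArg (fun m => m.as.app a) s.inv_hom_id
  · exact congrArg (fun m => m.as.app a) t.hom_inv_id
  · exact congrArg (fun m => m.as.app a) t.inv_hom_id

lemma whiskerLeft_invNat_unit (η : F ⟶ G) (inv : ∀ a, G.obj a ⟶ F.obj a)
    (s : ∀ a, 𝟙 _ ≅ η.app a ≫ inv a) (hη : ∀ a, IsEquiv (η.app a)) {a b : B} (f : a ⟶ b) :
    F.map f ◁ (s b).hom ≫ (α_ _ _ _).inv ≫ (η.naturality f).hom ▷ inv b ≫ (α_ _ _ _).hom ≫
      η.app a ◁ (invNat η inv s hη f).hom ≫ (α_ _ _ _).inv =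
      ((ρ_ (F.map f)).hom ≫ (λ_ (F.map f)).inv) ≫ (s a).hom ▷ F.map f := by
  have h₁ : (η.naturality f).hom ▷ inv b ≫ (η.naturality f).inv ▷ inv b = 𝟙 _ := by
    rw [← comp_whiskerRight, Iso.hom_inv_id, id_whiskerRight]
  have h₂ : F.map f ◁ (s b).hom ≫ F.map f ◁ (s b).inv = 𝟙 _ := by
    rw [← Bicategory.whiskerLeft_comp, Iso.hom_inv_id, Bicategory.whiskerLeft_id]
  rw [whiskerLeft_invNat, invNatAux_hom]
  simp only [Category.assoc, Iso.hom_inv_id_assoc, reassoc_of% h₁, Iso.inv_hom_id_assoc,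
    reassoc_of% h₂, Iso.hom_inv_id, Category.comp_id]

/-- A strong transformation with its pointwise right inverse. -/
def compInvTrans (η : F ⟶ G) (inv : ∀ a, G.obj a ⟶ F.obj a)
    (s : ∀ a, 𝟙 _ ≅ η.app a ≫ inv a) (hη : ∀ a, IsEquiv (η.app a)) :
    𝟙 F ≅ η ≫ invTrans η inv s hη :=
  Pseudofunctor.StrongTrans.isoMk (η := 𝟙 F) (θ := η ≫ invTrans η inv s hη) s
    fun f => whiskerLeft_invNat_unit η inv s hη f

lemma isEquiv_of_app (η : F ⟶ G) (hη : ∀ a, IsEquiv (η.app a)) : IsEquiv η := by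
  choose inv s t using hη
  have hη : ∀ a, IsEquiv (η.app a) := fun a => ⟨inv a, s a, t a⟩
  let θ : G ⟶ F := invTrans η inv (fun a => (s a).some) hη
  have hθ : ∀ a, IsEquiv (θ.app a) := fun a => IsEquiv.of_inverse (s a).some (t a).some
  choose inv' s' t' using hθ
  have hθ : ∀ a, IsEquiv (θ.app a) := fun a => ⟨inv' a, s' a, t' a⟩
  exact isEquiv_of_sections (compInvTrans η inv (fun a => (s a).some) hη)
    (compInvTrans θ inv' (fun a => (s' a).some) hθ)

end Whitehead

section LocalEquivalence

open Bicategory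
open scoped Pseudofunctor.StrongTrans

variable {P : Type u₁} [Bicategory.{w₁, v₁} P] {M : Type u₂} [Bicategory.{w₂, v₂} M]
  (Φ : Pseudofunctor P M) (hΦ : ∀ a b, (Φ.mapFunctor a b).IsEquivalence)

include hΦ in
lemma isEquivalence_mapFunctor_precomp {a : M} {x : P} {f : a ⟶ Φ.obj x} (hf : IsEquiv f) (y : P) :
    (Φ.mapFunctor x y ⋙ precomp (Φ.obj y) f).IsEquivalence :=
  have := isEquivalence_precomp hf (Φ.obj y)
  have := hΦ x y
  inferInstance

lemma map₂_rightUnitor_inv' {a b : P} (f : a ⟶ b) : Φ.map₂ (ρ_ f).inv =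
    (ρ_ _).inv ≫ Φ.map f ◁ (Φ.mapId b).inv ≫ (Φ.mapComp f (𝟙 b)).inv := by
  have h : Φ.map₂ (ρ_ f).hom ≫ Φ.map₂ (ρ_ f).inv = 𝟙 _ := by
    rw [← Φ.map₂_comp, Iso.hom_inv_id, Φ.map₂_id]
  rw [Φ.map₂_right_unitor] at h
  simpa using (ρ_ _).inv ≫= Φ.map f ◁ (Φ.mapId b).inv ≫= (Φ.mapComp f (𝟙 b)).inv ≫= h

lemma map₂_associator_inv' {a b c d : P} (f : a ⟶ b) (g : b ⟶ c) (h : c ⟶ d) :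
    Φ.map₂ (α_ f g h).inv = (Φ.mapComp f (g ≫ h)).hom ≫ Φ.map f ◁ (Φ.mapComp g h).hom ≫
      (α_ _ _ _).inv ≫ (Φ.mapComp f g).inv ▷ Φ.map h ≫ (Φ.mapComp (f ≫ g) h).inv := by
  have h : Φ.map₂ (α_ f g h).hom ≫ Φ.map₂ (α_ f g h).inv = 𝟙 _ := by
    rw [← Φ.map₂_comp, Iso.hom_inv_id, Φ.map₂_id]
  rw [Φ.map₂_associator] at h
  simpa using (Φ.mapComp f (g ≫ _)).hom ≫= Φ.map f ◁ (Φ.mapComp g _).hom ≫= (α_ _ _ _).inv ≫=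
    (Φ.mapComp f g).inv ▷ Φ.map _ ≫= (Φ.mapComp (f ≫ g) _).inv ≫= h

variable (obj : M → P) (ι : ∀ a, a ⟶ Φ.obj (obj a)) (hι : ∀ a, IsEquiv (ι a))

namespace Inverse

include hΦ hι in
lemma faithful {a : M} {x : P} {f g : obj a ⟶ x} {s t : f ⟶ g}
    (h : ι a ◁ Φ.map₂ s = ι a ◁ Φ.map₂ t) : s = t :=
  have := isEquivalence_mapFunctor_precomp Φ hΦ (hι a) x
  (Φ.mapFunctor (obj a) x ⋙ precomp (Φ.obj x) (ι a)).map_injective h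

include hΦ hι in
lemma exists_map {a : M} {x : P} (f : a ⟶ Φ.obj x) :
    ∃ g : obj a ⟶ x, Nonempty (ι a ≫ Φ.map g ≅ f) :=
  have := isEquivalence_mapFunctor_precomp Φ hΦ (hι a) x
  ⟨_, ⟨(Φ.mapFunctor (obj a) x ⋙ precomp (Φ.obj x) (ι a)).objObjPreimageIso f⟩⟩

include hΦ hι in
lemma exists_map₂ {a : M} {x : P} {f g : obj a ⟶ x} (s : ι a ≫ Φ.map f ⟶ ι a ≫ Φ.map g) :
    ∃ t : f ⟶ g, ι a ◁ Φ.map₂ t = s :=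
  have := isEquivalence_mapFunctor_precomp Φ hΦ (hι a) x
  ⟨_, (Φ.mapFunctor (obj a) x ⋙ precomp (Φ.obj x) (ι a)).map_preimage s⟩

include hΦ hι in
lemma exists_iso {a : M} {x : P} {f g : obj a ⟶ x} (s : ι a ≫ Φ.map f ≅ ι a ≫ Φ.map g) :
    ∃ t : f ≅ g, ι a ◁ Φ.map₂ t.hom = s.hom ∧ ι a ◁ Φ.map₂ t.inv = s.inv :=
  have := isEquivalence_mapFunctor_precomp Φ hΦ (hι a) x
  ⟨(Φ.mapFunctor (obj a) x ⋙ precomp (Φ.obj x) (ι a)).preimageIso s,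
    (Φ.mapFunctor (obj a) x ⋙ precomp (Φ.obj x) (ι a)).map_preimage s.hom,
    (Φ.mapFunctor (obj a) x ⋙ precomp (Φ.obj x) (ι a)).map_preimage s.inv⟩

/-- The data of a pseudofunctor inverse to `Φ`. -/
structure Data where
  map : ∀ {a b : M}, (a ⟶ b) → (obj a ⟶ obj b)
  σ : ∀ {a b : M} (f : a ⟶ b), ι a ≫ Φ.map (map f) ≅ f ≫ ι b
  map₂ : ∀ {a b : M} {f g : a ⟶ b}, (f ⟶ g) → (map f ⟶ map g)
  map₂_eq : ∀ {a b : M} {f g : a ⟶ b} (x : f ⟶ g),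
    ι a ◁ Φ.map₂ (map₂ x) = (σ f).hom ≫ x ▷ ι b ≫ (σ g).inv
  mapId : ∀ a, map (𝟙 a) ≅ 𝟙 (obj a)
  mapId_eq : ∀ a, ι a ◁ Φ.map₂ (mapId a).hom =
    (σ (𝟙 a)).hom ≫ (λ_ _).hom ≫ (ρ_ _).inv ≫ ι a ◁ (Φ.mapId _).inv
  mapComp : ∀ {a b c : M} (f : a ⟶ b) (g : b ⟶ c), map (f ≫ g) ≅ map f ≫ map g
  mapComp_eq : ∀ {a b c : M} (f : a ⟶ b) (g : b ⟶ c), ι a ◁ Φ.map₂ (mapComp f g).hom =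
    (σ (f ≫ g)).hom ≫ (α_ _ _ _).hom ≫ f ◁ (σ g).inv ≫ (α_ _ _ _).inv ≫
      (σ f).inv ▷ Φ.map (map g) ≫ (α_ _ _ _).hom ≫ ι a ◁ (Φ.mapComp _ _).inv

include hΦ hι in
lemma nonempty_data : Nonempty (Data Φ obj ι) := by
  choose map σ using fun (a b : M) (f : a ⟶ b) => exists_map Φ hΦ obj ι hι (f ≫ ι b)
  let σ' := fun (a b : M) (f : a ⟶ b) => (σ a b f).some
  choose map₂ h₂ using fun (a b : M) (f g : a ⟶ b) (x : f ⟶ g) =>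
    exists_map₂ Φ hΦ obj ι hι ((σ' _ _ f).hom ≫ x ▷ ι b ≫ (σ' _ _ g).inv)
  choose mapId h₃ using fun (a : M) => exists_iso Φ hΦ obj ι hι
    (σ' _ _ (𝟙 a) ≪≫ λ_ _ ≪≫ (ρ_ _).symm ≪≫ whiskerLeftIso (ι a) (Φ.mapId _).symm)
  choose mapComp h₄ using fun (a b c : M) (f : a ⟶ b) (g : b ⟶ c) => exists_iso Φ hΦ obj ι hι
    (σ' _ _ (f ≫ g) ≪≫ α_ _ _ _ ≪≫ whiskerLeftIso f (σ' _ _ g).symm ≪≫ (α_ _ _ _).symm ≪≫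
      whiskerRightIso (σ' _ _ f).symm (Φ.map (map _ _ g)) ≪≫ α_ _ _ _ ≪≫
      whiskerLeftIso (ι a) (Φ.mapComp _ _).symm)
  exact ⟨{
    map := map _ _
    σ := σ' _ _
    map₂ := map₂ _ _ _ _
    map₂_eq := h₂ _ _ _ _
    mapId := mapId
    mapId_eq := fun a => (h₃ a).1
    mapComp := mapComp _ _ _
    mapComp_eq := fun f g => (h₄ _ _ _ f g).1 }⟩

variable {Φ obj ι} (d : Data Φ obj ι)

lemma whiskerLeft_map₂_whiskerRight {a : M} {x y : P} {h h' : obj a ⟶ x} (s : h ⟶ h') (k : x ⟶ y) :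
    ι a ◁ Φ.map₂ (s ▷ k) = ι a ◁ (Φ.mapComp _ _).hom ≫ (α_ _ _ _).inv ≫
      (ι a ◁ Φ.map₂ s) ▷ Φ.map k ≫ (α_ _ _ _).hom ≫ ι a ◁ (Φ.mapComp _ _).inv := by
  rw [Φ.map₂_whisker_right]
  simp

namespace Data

lemma whiskerLeft_map₂_whiskerLeft {a b : M} {x : P} (f : a ⟶ b) {h h' : obj b ⟶ x} (s : h ⟶ h') :
    ι a ◁ Φ.map₂ (d.map f ◁ s) = ι a ◁ (Φ.mapComp _ _).hom ≫ (α_ _ _ _).inv ≫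
      (d.σ f).hom ▷ Φ.map h ≫ (α_ _ _ _).hom ≫ f ◁ (ι b ◁ Φ.map₂ s) ≫ (α_ _ _ _).inv ≫
      (d.σ f).inv ▷ Φ.map h' ≫ (α_ _ _ _).hom ≫ ι a ◁ (Φ.mapComp _ _).inv := by
  have h₁ := whisker_exchange (d.σ f).hom (Φ.map₂ s)
  have h₂ : f ◁ (ι b ◁ Φ.map₂ s) = (α_ _ _ _).inv ≫ (f ≫ ι b) ◁ Φ.map₂ s ≫ (α_ _ _ _).hom := by
    simp
  rw [Φ.map₂_whisker_left, h₂]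
  simp only [Category.assoc, Iso.hom_inv_id_assoc, ← reassoc_of% h₁]
  simp

include hΦ hι

lemma map₂_comp {a b : M} {f g h : a ⟶ b} (x : f ⟶ g) (y : g ⟶ h) :
    d.map₂ (x ≫ y) = d.map₂ x ≫ d.map₂ y := by
  refine faithful Φ hΦ obj ι hι ?_
  rw [Φ.map₂_comp, Bicategory.whiskerLeft_comp, d.map₂_eq, d.map₂_eq, d.map₂_eq]; simp

lemma map₂_whisker_left {a b c : M} (f : a ⟶ b) {g h : b ⟶ c} (x : g ⟶ h) :
    d.map₂ (f ◁ x) ≫ (d.mapComp f h).hom = (d.mapComp f g).hom ≫ d.map f ◁ d.map₂ x := by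
  refine faithful Φ hΦ obj ι hι ?_
  rw [Φ.map₂_comp, Φ.map₂_comp, Bicategory.whiskerLeft_comp, Bicategory.whiskerLeft_comp,
    d.whiskerLeft_map₂_whiskerLeft, d.map₂_eq, d.mapComp_eq, d.mapComp_eq, d.map₂_eq]
  simp

lemma map₂_whisker_right {a b c : M} {f g : a ⟶ b} (x : f ⟶ g) (h : b ⟶ c) :
    d.map₂ (x ▷ h) ≫ (d.mapComp g h).hom = (d.mapComp f h).hom ≫ d.map₂ x ▷ d.map h := by
  refine faithful Φ hΦ obj ι hι ?_
  rw [Φ.map₂_comp, Φ.map₂_comp, Bicategory.whiskerLeft_comp, Bicategory.whiskerLeft_comp,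
    whiskerLeft_map₂_whiskerRight, d.map₂_eq, d.mapComp_eq, d.mapComp_eq, d.map₂_eq]
  have h₁ := whisker_exchange x (d.σ h).inv
  have h₂ : (α_ f h (ι c)).hom ≫ f ◁ (d.σ h).inv ≫ (α_ _ _ _).inv ≫ x ▷ ι b ▷ Φ.map (d.map h) =
      x ▷ h ▷ ι c ≫ (α_ _ _ _).hom ≫ g ◁ (d.σ h).inv ≫ (α_ _ _ _).inv := by
    rw [← cancel_mono (α_ _ _ _).hom, ← cancel_epi (α_ _ _ _).inv]
    simpa using h₁
  simp [reassoc_of% h₂]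

lemma map₂_associator {a b c e : M} (f : a ⟶ b) (g : b ⟶ c) (h : c ⟶ e) :
    d.map₂ (α_ f g h).hom ≫ (d.mapComp f (g ≫ h)).hom ≫ d.map f ◁ (d.mapComp g h).hom =
      (d.mapComp (f ≫ g) h).hom ≫ (d.mapComp f g).hom ▷ d.map h ≫ (α_ _ _ _).hom := by
  refine faithful Φ hΦ obj ι hι ?_
  simp only [Φ.map₂_comp, Bicategory.whiskerLeft_comp,
    d.whiskerLeft_map₂_whiskerLeft, whiskerLeft_map₂_whiskerRight, d.map₂_eq, d.mapComp_eq,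
    Φ.map₂_associator]
  have h₁ := whisker_exchange (d.σ f).inv (Φ.mapComp (d.map g) (d.map h)).inv
  have h₂ : f ◁ ι b ◁ (Φ.mapComp (d.map g) (d.map h)).inv ≫ (α_ _ _ _).inv ≫
      (d.σ f).inv ▷ Φ.map (d.map g ≫ d.map h) ≫ (α_ _ _ _).hom = (α_ _ _ _).inv ≫
      (d.σ f).inv ▷ (Φ.map (d.map g) ≫ Φ.map (d.map h)) ≫ (α_ _ _ _).hom ≫
      ι a ◁ Φ.map (d.map f) ◁ (Φ.mapComp (d.map g) (d.map h)).inv := by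
    rw [← cancel_mono (α_ _ _ _).inv, ← cancel_epi (α_ _ _ _).hom]
    simpa using h₁
  simp [reassoc_of% h₂]

lemma map₂_left_unitor {a b : M} (f : a ⟶ b) :
    d.map₂ (λ_ f).hom = (d.mapComp (𝟙 a) f).hom ≫ (d.mapId a).hom ▷ d.map f ≫ (λ_ _).hom := by
  refine faithful Φ hΦ obj ι hι ?_
  simp only [Φ.map₂_comp, Bicategory.whiskerLeft_comp,
    whiskerLeft_map₂_whiskerRight, d.map₂_eq, d.mapComp_eq, d.mapId_eq, Φ.map₂_left_unitor]
  simp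

lemma map₂_right_unitor {a b : M} (f : a ⟶ b) :
    d.map₂ (ρ_ f).hom = (d.mapComp f (𝟙 b)).hom ≫ d.map f ◁ (d.mapId b).hom ≫ (ρ_ _).hom := by
  refine faithful Φ hΦ obj ι hι ?_
  simp only [Φ.map₂_comp, Bicategory.whiskerLeft_comp,
    d.whiskerLeft_map₂_whiskerLeft, d.map₂_eq, d.mapComp_eq, d.mapId_eq, Φ.map₂_right_unitor]
  have h₁ := whisker_exchange (d.σ f).inv (Φ.mapId (obj b)).inv
  have h₂ : f ◁ ι b ◁ (Φ.mapId (obj b)).inv ≫ (α_ _ _ _).inv ≫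
      (d.σ f).inv ▷ Φ.map (𝟙 (obj b)) ≫ (α_ _ _ _).hom = (α_ _ _ _).inv ≫ (d.σ f).inv ▷ 𝟙 _ ≫
      (α_ _ _ _).hom ≫ ι a ◁ Φ.map (d.map f) ◁ (Φ.mapId (obj b)).inv := by
    rw [← cancel_mono (α_ _ _ _).inv, ← cancel_epi (α_ _ _ _).hom]
    simpa using h₁
  simp [reassoc_of% h₂]

omit hΦ hι

/-- The pseudofunctor inverse to `Φ`. -/
def pseudofunctor : Pseudofunctor M P where
  obj := obj
  map := d.map
  map₂ := d.map₂
  mapId := d.mapId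
  mapComp := d.mapComp
  map₂_id f := by
    refine faithful Φ hΦ obj ι hι ?_
    rw [d.map₂_eq]; simp
  map₂_comp x y := d.map₂_comp hΦ hι x y
  map₂_whisker_left f _ _ x := by
    rw [← cancel_mono (d.mapComp f _).hom, d.map₂_whisker_left hΦ hι]; simp
  map₂_whisker_right x h := by
    rw [← cancel_mono (d.mapComp _ h).hom, d.map₂_whisker_right hΦ hι]; simp
  map₂_associator f g h := by
    rw [← cancel_mono (d.mapComp f (g ≫ h)).hom, ← cancel_mono (d.map f ◁ (d.mapComp g h).hom),
      Category.assoc, d.map₂_associator hΦ hι]; simp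
  map₂_left_unitor f := d.map₂_left_unitor hΦ hι f
  map₂_right_unitor f := d.map₂_right_unitor hΦ hι f

/-- The unit of the equivalence of `Φ` and its inverse. -/
def unit : Pseudofunctor.id M ⟶ (d.pseudofunctor hΦ hι).comp Φ :=
  { app := ι
    naturality f := (d.σ f).symm
    naturality_naturality {a b f g} x :=
      show x ▷ ι b ≫ (d.σ g).inv = (d.σ f).inv ≫ ι a ◁ Φ.map₂ (d.map₂ x) by
        rw [d.map₂_eq, Iso.inv_hom_id_assoc]
    naturality_id a :=
      show (d.σ (𝟙 a)).inv ≫ ι a ◁ (Φ.map₂ (d.mapId a).hom ≫ (Φ.mapId _).hom) =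
        𝟙 _ ▷ ι a ≫ (λ_ _).hom ≫ (ρ_ _).inv by
        rw [Bicategory.whiskerLeft_comp, d.mapId_eq]
        simp
    naturality_comp {a b c} f g :=
      show (d.σ (f ≫ g)).inv ≫ ι a ◁ (Φ.map₂ (d.mapComp f g).hom ≫ (Φ.mapComp _ _).hom) =
        𝟙 _ ▷ ι c ≫ (α_ _ _ _).hom ≫ f ◁ (d.σ g).inv ≫ (α_ _ _ _).inv ≫
          (d.σ f).inv ▷ Φ.map (d.map g) ≫ (α_ _ _ _).hom by
        rw [Bicategory.whiskerLeft_comp, d.mapComp_eq]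
        simp }

/-- `Φ` maps this to the unit. -/
def counitNat (s : ∀ x, x ⟶ obj (Φ.obj x)) (τ : ∀ x, Φ.map (s x) ≅ ι (Φ.obj x)) {x y : P}
    (f : x ⟶ y) : Φ.map (f ≫ s y) ≅ Φ.map (s x ≫ d.map (Φ.map f)) :=
  Φ.mapComp _ _ ≪≫ whiskerLeftIso _ (τ y) ≪≫ (d.σ (Φ.map f)).symm ≪≫
    whiskerRightIso (τ x).symm _ ≪≫ (Φ.mapComp _ _).symm

lemma map₂_whiskerLeft_section {s : ∀ x, x ⟶ obj (Φ.obj x)} (τ : ∀ x, Φ.map (s x) ≅ ι (Φ.obj x))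
    (x : P) {y : P} {f g : obj (Φ.obj x) ⟶ y} (t : f ⟶ g) :
    Φ.map₂ (s x ◁ t) = (Φ.mapComp _ _).hom ≫ (τ x).hom ▷ Φ.map f ≫ ι _ ◁ Φ.map₂ t ≫
      (τ x).inv ▷ Φ.map g ≫ (Φ.mapComp _ _).inv := by
  rw [← whisker_exchange_assoc, Φ.map₂_whisker_left]
  simp

lemma counitNat_naturality {s : ∀ x, x ⟶ obj (Φ.obj x)} (τ : ∀ x, Φ.map (s x) ≅ ι (Φ.obj x))
    {x y : P} {f g : x ⟶ y} (t : f ⟶ g) :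
    Φ.map₂ (t ▷ s y) ≫ (d.counitNat s τ g).hom =
      (d.counitNat s τ f).hom ≫ Φ.map₂ (s x ◁ d.map₂ (Φ.map₂ t)) := by
  rw [map₂_whiskerLeft_section τ, d.map₂_eq, Φ.map₂_whisker_right]
  simp [counitNat, whisker_exchange_assoc]

lemma counitNat_id {s : ∀ x, x ⟶ obj (Φ.obj x)} (τ : ∀ x, Φ.map (s x) ≅ ι (Φ.obj x)) (x : P) :
    (d.counitNat s τ (𝟙 x)).hom ≫ Φ.map₂ (s x ◁ (d.map₂ (Φ.mapId x).hom ≫ (d.mapId _).hom)) =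
      Φ.map₂ ((λ_ (s x)).hom ≫ (ρ_ (s x)).inv) := by
  rw [map₂_whiskerLeft_section τ, Φ.map₂_comp, Bicategory.whiskerLeft_comp, d.map₂_eq, d.mapId_eq,
    Φ.map₂_comp, Φ.map₂_left_unitor, map₂_rightUnitor_inv']
  simp [counitNat, whisker_exchange_assoc]

lemma counitNat_comp {s : ∀ x, x ⟶ obj (Φ.obj x)} (τ : ∀ x, Φ.map (s x) ≅ ι (Φ.obj x))
    {x y z : P} (f : x ⟶ y) (g : y ⟶ z)
    (ν : ∀ {x y : P} (f : x ⟶ y), f ≫ s y ≅ s x ≫ d.map (Φ.map f))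
    (hν : ∀ {x y : P} (f : x ⟶ y), Φ.map₂ (ν f).hom = (d.counitNat s τ f).hom) :
    (d.counitNat s τ (f ≫ g)).hom ≫
        Φ.map₂ (s x ◁ (d.map₂ (Φ.mapComp f g).hom ≫ (d.mapComp _ _).hom)) =
      Φ.map₂ ((α_ _ _ _).hom ≫ f ◁ (ν g).hom ≫ (α_ _ _ _).inv ≫
          (ν f).hom ▷ d.map (Φ.map g) ≫ (α_ _ _ _).hom) := by
  rw [map₂_whiskerLeft_section τ, Φ.map₂_comp, Bicategory.whiskerLeft_comp, d.map₂_eq,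
    d.mapComp_eq]
  simp only [Φ.map₂_comp, Φ.map₂_associator, map₂_associator_inv', Φ.map₂_whisker_left,
    Φ.map₂_whisker_right, hν]
  simp [counitNat, whisker_exchange_assoc]

/-- The inverse of the counit of the equivalence of `Φ` and its inverse. -/
def counit (s : ∀ x, x ⟶ obj (Φ.obj x)) (τ : ∀ x, Φ.map (s x) ≅ ι (Φ.obj x))
    (ν : ∀ {x y : P} (f : x ⟶ y), f ≫ s y ≅ s x ≫ d.map (Φ.map f))
    (hν : ∀ {x y : P} (f : x ⟶ y), Φ.map₂ (ν f).hom = (d.counitNat s τ f).hom)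
    (hf : ∀ {x y : P} {f g : x ⟶ y} (p q : f ⟶ g), Φ.map₂ p = Φ.map₂ q → p = q) :
    Pseudofunctor.id P ⟶ Φ.comp (d.pseudofunctor hΦ hι) :=
  { app := s
    naturality f := ν f
    naturality_naturality {x y f g} t :=
      show t ▷ s y ≫ (ν g).hom = (ν f).hom ≫ s x ◁ d.map₂ (Φ.map₂ t) by
        apply hf
        rw [Φ.map₂_comp, Φ.map₂_comp, hν, hν, d.counitNat_naturality]
    naturality_id x :=
      show (ν (𝟙 x)).hom ≫ s x ◁ (d.map₂ (Φ.mapId x).hom ≫ (d.mapId _).hom) =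
        𝟙 _ ▷ s x ≫ (λ_ _).hom ≫ (ρ_ _).inv by
        rw [id_whiskerRight, Category.id_comp]
        apply hf
        rw [Φ.map₂_comp, hν, d.counitNat_id]
    naturality_comp {x y z} f g :=
      show (ν (f ≫ g)).hom ≫ s x ◁ (d.map₂ (Φ.mapComp f g).hom ≫ (d.mapComp _ _).hom) =
        𝟙 _ ▷ s z ≫ (α_ _ _ _).hom ≫ f ◁ (ν g).hom ≫ (α_ _ _ _).inv ≫
          (ν f).hom ▷ d.map (Φ.map g) ≫ (α_ _ _ _).hom by
        rw [id_whiskerRight, Category.id_comp]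
        apply hf
        rw [Φ.map₂_comp, hν, d.counitNat_comp τ f g ν hν] }

end Data

/-- A locally fully faithful and essentially surjective pseudofunctor is an equivalence. -/
theorem exists_inverse (Φ : Pseudofunctor P M) (hΦ : ∀ a b, (Φ.mapFunctor a b).IsEquivalence)
    (h : ∀ a : M, ∃ (b : P) (f : a ⟶ Φ.obj b), IsEquiv f) :
    ∃ (F : Pseudofunctor M P) (_ : Pseudofunctor.id M ≌ F.comp Φ),
      Nonempty (Φ.comp F ≌ Pseudofunctor.id P) := by
  choose obj ι hι using h
  obtain ⟨d⟩ := nonempty_data Φ hΦ obj ι hι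
  obtain ⟨e, -⟩ := (isEquiv_of_app (d.unit hΦ hι) hι).nonempty_equivalence
  have (x y : P) := hΦ x y
  let s (x : P) : x ⟶ obj (Φ.obj x) := (Φ.mapFunctor x _).objPreimage (ι (Φ.obj x))
  let τ (x : P) : Φ.map (s x) ≅ ι (Φ.obj x) := (Φ.mapFunctor x _).objObjPreimageIso (ι (Φ.obj x))
  have hs (x : P) : IsEquiv (s x) := IsEquiv.of_map hΦ ((hι _).of_iso (τ x).symm)
  let κ := d.counit hΦ hι s τ (fun f => (Φ.mapFunctor _ _).preimageIso (d.counitNat s τ f))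
    (fun f => (Φ.mapFunctor _ _).map_preimage _) (fun p q h => (Φ.mapFunctor _ _).map_injective h)
  obtain ⟨g, ⟨p⟩, ⟨q⟩⟩ := isEquiv_of_app κ hs
  obtain ⟨e', -⟩ := (IsEquiv.of_inverse p q).nonempty_equivalence
  exact ⟨d.pseudofunctor hΦ hι, e, ⟨e'⟩⟩

end Inverse

end LocalEquivalence

section Decomposition

variable {W : Type u} [Category.{v} W] [Preadditive W] {X₀ : Type u₁} [Category.{v₁} X₀]
  {X₁ : Type u₂} [Category.{v₂} X₁] {U : Type u₃} [Category.{v₃} U] [Preadditive U]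

/-- A functor that is naturally a direct summand of the sum of two functors preserving the colimits
of a given shape preserves them. -/
lemma preservesColimitsOfShape_of_sum {Y : Type u₁} [Category.{v₁} Y] {J : Type w₁}
    [Category.{w₂} J] {F G₀ G₁ : Y ⥤ U} [PreservesColimitsOfShape J G₀]
    [PreservesColimitsOfShape J G₁] (s₀ : F ⟶ G₀) (r₀ : G₀ ⟶ F) (s₁ : F ⟶ G₁) (r₁ : G₁ ⟶ F)
    (h' : ∀ y, s₀.app y ≫ r₀.app y + s₁.app y ≫ r₁.app y = 𝟙 (F.obj y)) :
    PreservesColimitsOfShape J F where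
  preservesColimit {K} := ⟨fun {c} hc => by
    have h₀ := isColimitOfPreserves G₀ hc
    have h₁ := isColimitOfPreserves G₁ hc
    let t₀ (t : Cocone (K ⋙ F)) : Cocone (K ⋙ G₀) :=
      (Cocone.precompose (Functor.whiskerLeft K r₀)).obj t
    let t₁ (t : Cocone (K ⋙ F)) : Cocone (K ⋙ G₁) :=
      (Cocone.precompose (Functor.whiskerLeft K r₁)).obj t
    let d₀ (t : Cocone (K ⋙ F)) : G₀.obj c.pt ⟶ t.pt := h₀.desc (t₀ t)
    let d₁ (t : Cocone (K ⋙ F)) : G₁.obj c.pt ⟶ t.pt := h₁.desc (t₁ t)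
    have f₀ (t : Cocone (K ⋙ F)) (j : J) :
        G₀.map (c.ι.app j) ≫ d₀ t = r₀.app _ ≫ t.ι.app j := h₀.fac (t₀ t) j
    have f₁ (t : Cocone (K ⋙ F)) (j : J) :
        G₁.map (c.ι.app j) ≫ d₁ t = r₁.app _ ≫ t.ι.app j := h₁.fac (t₁ t) j
    refine ⟨{ desc := fun t => (s₀.app c.pt ≫ d₀ t + s₁.app c.pt ≫ d₁ t : F.obj c.pt ⟶ t.pt)
              fac := fun t j => ?_
              uniq := fun t m hm => ?_ }⟩
    · have n₀ : F.map (c.ι.app j) ≫ s₀.app c.pt = s₀.app (K.obj j) ≫ G₀.map (c.ι.app j) :=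
        s₀.naturality (c.ι.app j)
      have n₁ : F.map (c.ι.app j) ≫ s₁.app c.pt = s₁.app (K.obj j) ≫ G₁.map (c.ι.app j) :=
        s₁.naturality (c.ι.app j)
      change F.map (c.ι.app j) ≫ (s₀.app c.pt ≫ d₀ t + s₁.app c.pt ≫ d₁ t) = _
      rw [Preadditive.comp_add, ← Category.assoc, ← Category.assoc, n₀, n₁,
        Category.assoc, Category.assoc, f₀, f₁, ← Category.assoc, ← Category.assoc,
        ← Preadditive.add_comp, h', Category.id_comp]
    · change F.obj c.pt ⟶ t.pt at m
      have hm' (j : J) : F.map (c.ι.app j) ≫ m = t.ι.app j := hm j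
      have n₀ (j : J) : G₀.map (c.ι.app j) ≫ r₀.app c.pt = r₀.app (K.obj j) ≫ F.map (c.ι.app j) :=
        r₀.naturality (c.ι.app j)
      have n₁ (j : J) : G₁.map (c.ι.app j) ≫ r₁.app c.pt = r₁.app (K.obj j) ≫ F.map (c.ι.app j) :=
        r₁.naturality (c.ι.app j)
      have e₀ : d₀ t = r₀.app _ ≫ m := (h₀.uniq (t₀ t) (r₀.app c.pt ≫ m) fun j => by
        change G₀.map (c.ι.app j) ≫ r₀.app c.pt ≫ m = r₀.app _ ≫ t.ι.app j
        rw [← hm', reassoc_of% n₀]).symm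
      have e₁ : d₁ t = r₁.app _ ≫ m := (h₁.uniq (t₁ t) (r₁.app c.pt ≫ m) fun j => by
        change G₁.map (c.ι.app j) ≫ r₁.app c.pt ≫ m = r₁.app _ ≫ t.ι.app j
        rw [← hm', reassoc_of% n₁]).symm
      rw [e₀, e₁, ← Category.assoc, ← Category.assoc, ← Preadditive.add_comp, h',
        Category.id_comp]⟩

/-- A decomposition of the objects of `W` into an object in the image of `N₀` and one in the image
of `N₁`, up to direct summands, where the two images are orthogonal. -/
structure Decomp (N₀ : X₀ ⥤ W) (N₁ : X₁ ⥤ W) where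
  R₀ : W ⥤ X₀
  R₁ : W ⥤ X₁
  s₀ : ∀ w, w ⟶ N₀.obj (R₀.obj w)
  r₀ : ∀ w, N₀.obj (R₀.obj w) ⟶ w
  s₁ : ∀ w, w ⟶ N₁.obj (R₁.obj w)
  r₁ : ∀ w, N₁.obj (R₁.obj w) ⟶ w
  s₀_natural : ∀ {w w'} (f : w ⟶ w'), f ≫ s₀ w' = s₀ w ≫ N₀.map (R₀.map f)
  r₀_natural : ∀ {w w'} (f : w ⟶ w'), N₀.map (R₀.map f) ≫ r₀ w' = r₀ w ≫ f
  s₁_natural : ∀ {w w'} (f : w ⟶ w'), f ≫ s₁ w' = s₁ w ≫ N₁.map (R₁.map f)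
  r₁_natural : ∀ {w w'} (f : w ⟶ w'), N₁.map (R₁.map f) ≫ r₁ w' = r₁ w ≫ f
  total : ∀ w, s₀ w ≫ r₀ w + s₁ w ≫ r₁ w = 𝟙 w
  zero₀₁ : ∀ {x : X₀} {y : X₁} (m : N₀.obj x ⟶ N₁.obj y), m = 0
  zero₁₀ : ∀ {x : X₁} {y : X₀} (m : N₁.obj x ⟶ N₀.obj y), m = 0

namespace Decomp

variable {N₀ : X₀ ⥤ W} {N₁ : X₁ ⥤ W} (d : Decomp N₀ N₁)

include d

lemma natTrans_ext {H H' : W ⥤ U} [H.Additive] {α β : H ⟶ H'}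
    (h₀ : ∀ x, α.app (N₀.obj x) = β.app (N₀.obj x))
    (h₁ : ∀ x, α.app (N₁.obj x) = β.app (N₁.obj x)) : α = β := by
  ext w
  have e (γ : H ⟶ H') : γ.app w = H.map (d.s₀ w) ≫ γ.app (N₀.obj (d.R₀.obj w)) ≫
      H'.map (d.r₀ w) + H.map (d.s₁ w) ≫ γ.app (N₁.obj (d.R₁.obj w)) ≫ H'.map (d.r₁ w) := by
    rw [← γ.naturality, ← γ.naturality, ← H.map_comp_assoc, ← H.map_comp_assoc,
      ← Preadditive.add_comp, ← H.map_add, d.total, H.map_id, Category.id_comp]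
  rw [e α, e β, h₀, h₁]

lemma total₀ (x : X₀) : d.s₀ (N₀.obj x) ≫ d.r₀ (N₀.obj x) = 𝟙 _ := by
  have h := d.total (N₀.obj x)
  rwa [d.zero₀₁ (d.s₁ (N₀.obj x)), zero_comp, add_zero] at h

lemma total₁ (x : X₁) : d.s₁ (N₁.obj x) ≫ d.r₁ (N₁.obj x) = 𝟙 _ := by
  have h := d.total (N₁.obj x)
  rwa [d.zero₁₀ (d.s₀ (N₁.obj x)), zero_comp, zero_add] at h

lemma exists_natTrans [N₀.Full] [N₁.Full] {H H' : W ⥤ U} [H.Additive]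
    (τ₀ : N₀ ⋙ H ⟶ N₀ ⋙ H') (τ₁ : N₁ ⋙ H ⟶ N₁ ⋙ H') :
    ∃ α : H ⟶ H', (∀ x, α.app (N₀.obj x) = τ₀.app x) ∧ ∀ x, α.app (N₁.obj x) = τ₁.app x := by
  have n₀ {x y : X₀} (m : N₀.obj x ⟶ N₀.obj y) :
      H.map m ≫ τ₀.app y = τ₀.app x ≫ H'.map m := by
    obtain ⟨m, rfl⟩ := N₀.map_surjective m
    exact τ₀.naturality m
  have n₁ {x y : X₁} (m : N₁.obj x ⟶ N₁.obj y) :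
      H.map m ≫ τ₁.app y = τ₁.app x ≫ H'.map m := by
    obtain ⟨m, rfl⟩ := N₁.map_surjective m
    exact τ₁.naturality m
  let t₀ (x : X₀) : H.obj (N₀.obj x) ⟶ H'.obj (N₀.obj x) := τ₀.app x
  let t₁ (x : X₁) : H.obj (N₁.obj x) ⟶ H'.obj (N₁.obj x) := τ₁.app x
  have n₀ {x y : X₀} (m : N₀.obj x ⟶ N₀.obj y) : H.map m ≫ t₀ y = t₀ x ≫ H'.map m := n₀ m
  have n₁ {x y : X₁} (m : N₁.obj x ⟶ N₁.obj y) : H.map m ≫ t₁ y = t₁ x ≫ H'.map m := n₁ m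
  let α : H ⟶ H' :=
    { app := fun w => H.map (d.s₀ w) ≫ t₀ (d.R₀.obj w) ≫ H'.map (d.r₀ w) +
        H.map (d.s₁ w) ≫ t₁ (d.R₁.obj w) ≫ H'.map (d.r₁ w)
      naturality := fun w w' f => by
        rw [Preadditive.comp_add, Preadditive.add_comp, ← H.map_comp_assoc, ← H.map_comp_assoc,
          d.s₀_natural, d.s₁_natural, H.map_comp_assoc, H.map_comp_assoc, reassoc_of% n₀,
          reassoc_of% n₁, ← H'.map_comp, ← H'.map_comp, d.r₀_natural, d.r₁_natural]
        simp only [Category.assoc, H'.map_comp] }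
  refine ⟨α, fun x => ?_, fun x => ?_⟩
  · change H.map (d.s₀ _) ≫ t₀ _ ≫ H'.map (d.r₀ _) +
      H.map (d.s₁ _) ≫ t₁ _ ≫ H'.map (d.r₁ _) = t₀ x
    rw [d.zero₀₁ (d.s₁ (N₀.obj x)), H.map_zero, zero_comp, add_zero, reassoc_of% n₀,
      ← H'.map_comp, d.total₀, H'.map_id, Category.comp_id]
  · change H.map (d.s₀ _) ≫ t₀ _ ≫ H'.map (d.r₀ _) +
      H.map (d.s₁ _) ≫ t₁ _ ≫ H'.map (d.r₁ _) = t₁ x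
    rw [d.zero₁₀ (d.s₀ (N₁.obj x)), H.map_zero, zero_comp, zero_add, reassoc_of% n₁,
      ← H'.map_comp, d.total₁, H'.map_id, Category.comp_id]

lemma idem₀ (w : W) : (d.r₀ w ≫ d.s₀ w) ≫ d.r₀ w ≫ d.s₀ w = d.r₀ w ≫ d.s₀ w := by
  have h : d.s₀ w ≫ d.r₀ w = 𝟙 w - d.s₁ w ≫ d.r₁ w := eq_sub_of_add_eq (d.total w)
  rw [Category.assoc, reassoc_of% h, Preadditive.sub_comp, Category.assoc,
    d.zero₁₀ (d.r₁ w ≫ d.s₀ w), comp_zero, Category.id_comp, sub_zero]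

lemma idem₁ (w : W) : (d.r₁ w ≫ d.s₁ w) ≫ d.r₁ w ≫ d.s₁ w = d.r₁ w ≫ d.s₁ w := by
  have h : d.s₁ w ≫ d.r₁ w = 𝟙 w - d.s₀ w ≫ d.r₀ w := eq_sub_of_add_eq' (d.total w)
  rw [Category.assoc, reassoc_of% h, Preadditive.sub_comp, Category.assoc,
    d.zero₀₁ (d.r₀ w ≫ d.s₁ w), comp_zero, Category.id_comp, sub_zero]

omit d
end Decomp

section

variable {N : X₀ ⥤ W} [N.Full] [N.Faithful] {R : W ⥤ X₀} (s : ∀ w, w ⟶ N.obj (R.obj w))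
  (r : ∀ w, N.obj (R.obj w) ⟶ w)

omit [Preadditive W] [Preadditive U] in
/-- The summand of `R ⋙ H` cut out by the natural idempotent that `r ≫ s` induces. -/
lemma exists_split [IsIdempotentComplete U]
    (hs : ∀ {w w'} (f : w ⟶ w'), f ≫ s w' = s w ≫ N.map (R.map f))
    (hr : ∀ {w w'} (f : w ⟶ w'), N.map (R.map f) ≫ r w' = r w ≫ f)
    (h : ∀ w, (r w ≫ s w) ≫ r w ≫ s w = r w ≫ s w) (H : X₀ ⥤ U) :
    ∃ (F : W ⥤ U) (i : F ⟶ R ⋙ H) (p : R ⋙ H ⟶ F), (∀ w, i.app w ≫ p.app w = 𝟙 _) ∧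
      ∀ w, p.app w ≫ i.app w = H.map (N.preimage (r w ≫ s w)) := by
  let e : R ⟶ R :=
    { app := fun w => N.preimage (r w ≫ s w)
      naturality := fun w w' f => N.map_injective (by
        rw [N.map_comp, N.map_comp, N.map_preimage, N.map_preimage, reassoc_of% hr, hs,
          Category.assoc]) }
  have he : Functor.whiskerRight e H ≫ Functor.whiskerRight e H = Functor.whiskerRight e H := by
    rw [← Functor.whiskerRight_comp]
    congr 1
    ext w
    refine N.map_injective ?_
    rw [NatTrans.comp_app, N.map_comp, N.map_preimage]
    exact h w
  obtain ⟨F, i, p, h₁, h₂⟩ := IsIdempotentComplete.idempotents_split _ _ he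
  exact ⟨F, i, p, fun w => congrArg (fun t : F ⟶ F => t.app w) h₁,
    fun w => congrArg (fun t : R ⋙ H ⟶ R ⋙ H => t.app w) h₂⟩

omit [Preadditive W] [Preadditive U] in
/-- On the image of `N` the summand is everything. -/
lemma splitIso (hr : ∀ {w w'} (f : w ⟶ w'), N.map (R.map f) ≫ r w' = r w ≫ f) {H : X₀ ⥤ U} {F : W ⥤ U}
    {i : F ⟶ R ⋙ H} {p : R ⋙ H ⟶ F} (h₁ : ∀ w, i.app w ≫ p.app w = 𝟙 _)
    (h₂ : ∀ w, p.app w ≫ i.app w = H.map (N.preimage (r w ≫ s w)))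
    (h : ∀ x, s (N.obj x) ≫ r (N.obj x) = 𝟙 _) : Nonempty (N ⋙ F ≅ H) := by
  have e₁ (w : W) : i.app w ≫ H.map (N.preimage (r w ≫ s w)) = i.app w := by
    rw [← h₂, reassoc_of% h₁]
  have hN (x : X₀) : N.preimage (s (N.obj x)) ≫ N.preimage (r (N.obj x)) = 𝟙 _ :=
    N.map_injective (by simp [h])
  have hN' (x : X₀) : N.preimage (r (N.obj x)) ≫ N.preimage (s (N.obj x)) =
    N.preimage (r (N.obj x) ≫ s (N.obj x)) := N.map_injective (by simp)
  refine ⟨NatIso.ofComponents (fun x =>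
    { hom := (i.app (N.obj x) : F.obj _ ⟶ H.obj _) ≫ H.map (N.preimage (r (N.obj x)))
      inv := H.map (N.preimage (s (N.obj x))) ≫ (p.app (N.obj x) : H.obj _ ⟶ F.obj _)
      hom_inv_id := ?_
      inv_hom_id := ?_ }) fun {x y} f => ?_⟩
  · rw [Category.assoc, ← H.map_comp_assoc, hN', ← Category.assoc]
    exact (congrArg (· ≫ _) (e₁ _)).trans (h₁ _)
  · have : (p.app (N.obj x) : H.obj _ ⟶ F.obj _) ≫ (i.app (N.obj x) : F.obj _ ⟶ H.obj _) =
      H.map (N.preimage (r (N.obj x) ≫ s (N.obj x))) := h₂ (N.obj x)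
    rw [Category.assoc, reassoc_of% this, ← H.map_comp, ← H.map_comp, ← hN', Category.assoc, hN,
      Category.comp_id, hN, H.map_id]
  · have n₁ : F.map (N.map f) ≫ (i.app (N.obj y) : F.obj _ ⟶ H.obj _) =
      (i.app (N.obj x) : F.obj _ ⟶ H.obj _) ≫ H.map (R.map (N.map f)) := i.naturality (N.map f)
    have n₂ : R.map (N.map f) ≫ N.preimage (r (N.obj y)) = N.preimage (r (N.obj x)) ≫ f :=
      N.map_injective (by simp [hr])
    change F.map (N.map f) ≫ (i.app (N.obj y) : F.obj _ ⟶ H.obj _) ≫ _ = _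
    rw [reassoc_of% n₁, ← H.map_comp, n₂, H.map_comp, Category.assoc]

end

lemma Decomp.exists_lift [IsIdempotentComplete U] [HasBinaryBiproducts U] {N₀ : X₀ ⥤ W}
    {N₁ : X₁ ⥤ W} (d : Decomp N₀ N₁) [N₀.Full] [N₀.Faithful] [N₁.Full] [N₁.Faithful]
    (H₀ : X₀ ⥤ U) (H₁ : X₁ ⥤ U) (h₀ : ∀ x y (f : x ⟶ y), N₀.map f = 0 → H₀.map f = 0)
    (h₁ : ∀ x y (f : x ⟶ y), N₁.map f = 0 → H₁.map f = 0) :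
    ∃ H : W ⥤ U, Nonempty (N₀ ⋙ H ≅ H₀) ∧ Nonempty (N₁ ⋙ H ≅ H₁) ∧
      ∃ (s₀ : H ⟶ d.R₀ ⋙ H₀) (r₀ : d.R₀ ⋙ H₀ ⟶ H) (s₁ : H ⟶ d.R₁ ⋙ H₁) (r₁ : d.R₁ ⋙ H₁ ⟶ H),
        ∀ w, s₀.app w ≫ r₀.app w + s₁.app w ≫ r₁.app w = 𝟙 (H.obj w) := by
  obtain ⟨F₀, i₀, p₀, a₀, b₀⟩ := exists_split d.s₀ d.r₀ d.s₀_natural d.r₀_natural d.idem₀ H₀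
  obtain ⟨F₁, i₁, p₁, a₁, b₁⟩ := exists_split d.s₁ d.r₁ d.s₁_natural d.r₁_natural d.idem₁ H₁
  obtain ⟨e₀⟩ := splitIso d.s₀ d.r₀ d.r₀_natural a₀ b₀ d.total₀
  obtain ⟨e₁⟩ := splitIso d.s₁ d.r₁ d.r₁_natural a₁ b₁ d.total₁
  have z₁ (x : X₀) : 𝟙 (F₁.obj (N₀.obj x)) = 0 := by
    have hb : p₁.app (N₀.obj x) ≫ i₁.app (N₀.obj x) = 0 := by
      rw [b₁]
      refine h₁ _ _ _ ?_
      rw [N₁.map_preimage, d.zero₀₁ (d.s₁ (N₀.obj x)), comp_zero]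
    have : i₁.app (N₀.obj x) ≫ (p₁.app (N₀.obj x) ≫ i₁.app (N₀.obj x)) ≫ p₁.app (N₀.obj x) =
        𝟙 _ := by
      rw [Category.assoc, a₁, Category.comp_id, a₁]
    rw [← this, hb, zero_comp, comp_zero]
  have z₀ (x : X₁) : 𝟙 (F₀.obj (N₁.obj x)) = 0 := by
    have hb : p₀.app (N₁.obj x) ≫ i₀.app (N₁.obj x) = 0 := by
      rw [b₀]
      refine h₀ _ _ _ ?_
      rw [N₀.map_preimage, d.zero₁₀ (d.s₀ (N₁.obj x)), comp_zero]
    have : i₀.app (N₁.obj x) ≫ (p₀.app (N₁.obj x) ≫ i₀.app (N₁.obj x)) ≫ p₀.app (N₁.obj x) =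
        𝟙 _ := by
      rw [Category.assoc, a₀, Category.comp_id, a₀]
    rw [← this, hb, zero_comp, comp_zero]
  let H : W ⥤ U :=
    { obj := fun w => F₀.obj w ⊞ F₁.obj w
      map := fun f => biprod.map (F₀.map f) (F₁.map f) }
  refine ⟨H, ⟨NatIso.ofComponents (F := N₀ ⋙ H) (G := N₀ ⋙ F₀) (fun x =>
      { hom := (biprod.fst : F₀.obj (N₀.obj x) ⊞ F₁.obj (N₀.obj x) ⟶ _)
        inv := (biprod.inl : _ ⟶ F₀.obj (N₀.obj x) ⊞ F₁.obj (N₀.obj x))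
        hom_inv_id := ?_
        inv_hom_id := ?_ }) (fun {x y} f => biprod.map_fst _ _) ≪≫ e₀⟩,
    ⟨NatIso.ofComponents (F := N₁ ⋙ H) (G := N₁ ⋙ F₁) (fun x =>
      { hom := (biprod.snd : F₀.obj (N₁.obj x) ⊞ F₁.obj (N₁.obj x) ⟶ _)
        inv := (biprod.inr : _ ⟶ F₀.obj (N₁.obj x) ⊞ F₁.obj (N₁.obj x))
        hom_inv_id := ?_
        inv_hom_id := ?_ }) (fun {x y} f => biprod.map_snd _ _) ≪≫ e₁⟩,
    { app := fun w => (biprod.fst : F₀.obj w ⊞ F₁.obj w ⟶ _)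
      naturality := fun _ _ f => biprod.map_fst _ _ } ≫ i₀,
    p₀ ≫ { app := fun w => (biprod.inl : _ ⟶ F₀.obj w ⊞ F₁.obj w)
           naturality := fun _ _ f => (biprod.inl_map _ _).symm },
    { app := fun w => (biprod.snd : F₀.obj w ⊞ F₁.obj w ⟶ _)
      naturality := fun _ _ f => biprod.map_snd _ _ } ≫ i₁,
    p₁ ≫ { app := fun w => (biprod.inr : _ ⟶ F₀.obj w ⊞ F₁.obj w)
           naturality := fun _ _ f => (biprod.inr_map _ _).symm }, fun w => ?_⟩
  · have : (biprod.snd : F₀.obj (N₀.obj x) ⊞ F₁.obj (N₀.obj x) ⟶ _) = 0 := by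
      rw [← Category.comp_id biprod.snd, z₁, comp_zero]
    refine Eq.trans ?_ biprod.total
    rw [this, zero_comp, add_zero]
  · exact biprod.inl_fst
  · have : (biprod.fst : F₀.obj (N₁.obj x) ⊞ F₁.obj (N₁.obj x) ⟶ _) = 0 := by
      rw [← Category.comp_id biprod.fst, z₀, comp_zero]
    refine Eq.trans ?_ biprod.total
    rw [this, zero_comp, zero_add]
  · exact biprod.inr_snd
  · change ((biprod.fst : F₀.obj w ⊞ F₁.obj w ⟶ _) ≫ i₀.app w) ≫ p₀.app w ≫ biprod.inl +
      (biprod.snd ≫ i₁.app w) ≫ p₁.app w ≫ biprod.inr = _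
    rw [Category.assoc, Category.assoc, reassoc_of% a₀, reassoc_of% a₁]
    exact biprod.total

end Decomposition

section Copower

variable {K : Type} [Field K]

/-- The linear map `K ⟶ m` that corresponds to an element of `m`. -/
def elemHom {m : ModuleCat.{0} K} (z : m) : ModuleCat.of K K ⟶ m :=
  ModuleCat.ofHom (LinearMap.toSpanSingleton K m z)

lemma elemHom_comp {m m' : ModuleCat.{0} K} (z : m) (f : m ⟶ m') :
    elemHom z ≫ f = elemHom (f z) := by
  ext
  simp [elemHom]

lemma elemHom_add {m : ModuleCat.{0} K} (z w : m) : elemHom (z + w) = elemHom z + elemHom w := by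
  ext
  simp [elemHom]

lemma elemHom_smul {m : ModuleCat.{0} K} (r : K) (z : m) :
    elemHom (r • z) = elemHom (m := ModuleCat.of K K) r ≫ elemHom z := by
  ext
  simp [elemHom]

lemma elemHom_zero {m : ModuleCat.{0} K} : elemHom (0 : m) = 0 := by
  ext
  simp [elemHom]

lemma elemHom_one : elemHom (m := ModuleCat.of K K) 1 = 𝟙 _ := by
  ext
  simp [elemHom]

/-- A vector space is the coproduct of copies of the base field, indexed by a basis. -/
def basisCofanIsColimit {m : ModuleCat.{0} K} {ι : Type} (b : Module.Basis ι K m) :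
    IsColimit (Cofan.mk m fun i => elemHom (b i)) :=
  Cofan.IsColimit.mk _ (fun s => ModuleCat.ofHom (b.constr K fun i => s.inj i (1 : K)))
    (fun s i => by
      ext
      simp [elemHom])
    (fun s f h => by
      refine ModuleCat.hom_ext (b.ext fun i => ?_)
      have := ConcreteCategory.congr_hom (h i) (1 : K)
      simpa [elemHom] using this)

variable {U : Type u} [Category.{v} U]

lemma copower_hom_ext (X : ModuleCat.{0} K ⥤ U) [PreservesColimitsOfSize.{0, 0} X]
    {m : ModuleCat.{0} K} {x : U} {f g : X.obj m ⟶ x}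
    (h : ∀ z : m, X.map (elemHom z) ≫ f = X.map (elemHom z) ≫ g) : f = g :=
  (isColimitOfPreserves X (basisCofanIsColimit (Module.Basis.ofVectorSpace K m))).hom_ext
    fun i => h _

variable [Preadditive U]

lemma copower_exists_desc (X : ModuleCat.{0} K ⥤ U) [PreservesColimitsOfSize.{0, 0} X]
    [X.Additive] {m : ModuleCat.{0} K} {x : U} (φ : m → (X.obj (ModuleCat.of K K) ⟶ x))
    (h₁ : ∀ z w, φ (z + w) = φ z + φ w)
    (h₂ : ∀ (r : K) (z : m), φ (r • z) = X.map (elemHom (m := ModuleCat.of K K) r) ≫ φ z) :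
    ∃ f : X.obj m ⟶ x, ∀ z, X.map (elemHom z) ≫ f = φ z := by
  let b := Module.Basis.ofVectorSpace K m
  have hc := isColimitOfPreserves X (basisCofanIsColimit b)
  let c : Cocone (Discrete.functor (fun _ => ModuleCat.of K K) ⋙ X) :=
    { pt := x
      ι := Discrete.natTrans fun i => φ (b i.as) }
  let f : X.obj m ⟶ x := hc.desc c
  have hf : ∀ i, X.map (elemHom (b i)) ≫ f = φ (b i) := fun i => hc.fac c ⟨i⟩
  refine ⟨f, fun z => ?_⟩
  induction b.mem_span z using Submodule.span_induction with
  | mem z hz =>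
    obtain ⟨i, rfl⟩ := hz
    exact hf i
  | zero =>
    have h := h₂ 0 0
    rw [elemHom_zero, X.map_zero, zero_comp, zero_smul] at h
    rw [elemHom_zero, X.map_zero, zero_comp, h]
  | add z w _ _ h h' => rw [elemHom_add, X.map_add, Preadditive.add_comp, h, h', h₁]
  | smul r z _ h => rw [elemHom_smul, X.map_comp, Category.assoc, h, h₂]

omit [Preadditive U] in
lemma copower_natTrans_ext {X Y : ModuleCat.{0} K ⥤ U} [PreservesColimitsOfSize.{0, 0} X]
    {α β : X ⟶ Y} (h : α.app (ModuleCat.of K K) = β.app (ModuleCat.of K K)) : α = β := by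
  ext m
  refine copower_hom_ext X fun z => ?_
  rw [α.naturality, β.naturality, h]

lemma copower_exists_natTrans {X Y : ModuleCat.{0} K ⥤ U} [PreservesColimitsOfSize.{0, 0} X]
    [X.Additive] [Y.Additive] (t : X.obj (ModuleCat.of K K) ⟶ Y.obj (ModuleCat.of K K))
    (h : ∀ r : K, X.map (elemHom (m := ModuleCat.of K K) r) ≫ t =
      t ≫ Y.map (elemHom (m := ModuleCat.of K K) r)) :
    ∃ α : X ⟶ Y, α.app (ModuleCat.of K K) = t := by
  choose f hf using fun m : ModuleCat.{0} K =>
    copower_exists_desc X (fun z : m => t ≫ Y.map (elemHom z))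
      (fun z w => by rw [elemHom_add, Y.map_add, Preadditive.comp_add])
      (fun r z => by rw [elemHom_smul, Y.map_comp, ← Category.assoc, ← h, Category.assoc])
  refine ⟨{ app := f, naturality := fun m m' g => copower_hom_ext X fun z => ?_ }, ?_⟩
  · rw [← X.map_comp_assoc, elemHom_comp, hf, ← elemHom_comp, Y.map_comp, reassoc_of% hf]
  · have := hf (ModuleCat.of K K) (1 : K)
    rwa [elemHom_one, X.map_id, Category.id_comp, Y.map_id, Category.comp_id] at this

lemma copower_exists_natIso {X Y : ModuleCat.{0} K ⥤ U} [PreservesColimitsOfSize.{0, 0} X]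
    [PreservesColimitsOfSize.{0, 0} Y] [X.Additive] [Y.Additive]
    (t : X.obj (ModuleCat.of K K) ≅ Y.obj (ModuleCat.of K K))
    (h : ∀ r : K, X.map (elemHom (m := ModuleCat.of K K) r) ≫ t.hom =
      t.hom ≫ Y.map (elemHom (m := ModuleCat.of K K) r)) :
    ∃ α : X ≅ Y, α.hom.app (ModuleCat.of K K) = t.hom := by
  obtain ⟨α, hα⟩ := copower_exists_natTrans t.hom h
  obtain ⟨β, hβ⟩ := copower_exists_natTrans (X := Y) (Y := X) t.inv fun r => by
    rw [← cancel_epi t.hom, ← reassoc_of% h, t.hom_inv_id_assoc, t.hom_inv_id, Category.comp_id]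
  exact ⟨⟨α, β, copower_natTrans_ext (by simp [hα, hβ]), copower_natTrans_ext (by simp [hα, hβ])⟩,
    hα⟩

end Copower

section RealCopower

variable {U : Type u} [Category.{v} U] [Preadditive U] [Linear ℝ U]

lemma elemHom_real (r : ℝ) : elemHom (m := ModuleCat.of ℝ ℝ) r = r • 𝟙 _ := by
  ext
  simp [elemHom]

lemma map_elemHom_real (X : ModuleCat.{0} ℝ ⥤ U) [X.Additive] [X.Linear ℝ] (r : ℝ) :
    X.map (elemHom (m := ModuleCat.of ℝ ℝ) r) = r • 𝟙 _ := by
  rw [elemHom_real, Functor.map_smul, X.map_id]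

lemma realCopower_exists_natIso {X Y : ModuleCat.{0} ℝ ⥤ U} (hX : IsCocontLinear X)
    (hY : IsCocontLinear Y) (t : X.obj (ModuleCat.of ℝ ℝ) ≅ Y.obj (ModuleCat.of ℝ ℝ)) :
    ∃ α : X ≅ Y, α.hom.app (ModuleCat.of ℝ ℝ) = t.hom := by
  have := hX.additive
  have := hX.linear
  have := hX.cocontinuous
  have := hY.additive
  have := hY.linear
  have := hY.cocontinuous
  exact copower_exists_natIso t fun r => by simp [map_elemHom_real]

lemma realCopower_natTrans_ext {X Y : ModuleCat.{0} ℝ ⥤ U} (hX : IsCocontLinear X)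
    {α β : X ⟶ Y} (h : α.app (ModuleCat.of ℝ ℝ) = β.app (ModuleCat.of ℝ ℝ)) : α = β :=
  have := hX.cocontinuous
  copower_natTrans_ext h

end RealCopower

section LeftLinear

open MonoidalCategory MonoidalLeftAction Functor.LaxLeftLinear Functor.OplaxLeftLinear

variable {E : Type u} [Category.{v} E] [MonoidalCategory E] {V : Type u₁} [Category.{v₁} V]
  [MonoidalLeftAction E V] {W : Type u₂} [Category.{v₂} W] [MonoidalLeftAction E W]

/-- A strong module functor from an invertible lineator. -/
@[reducible]
def leftLinearMk (F : V ⥤ W) (m : ∀ (e : E) (x : V), e ⊙ₗ F.obj x ≅ F.obj (e ⊙ₗ x))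
    (natural_left : ∀ {e e' : E} (f : e ⟶ e') (x : V),
      f ⊵ₗ F.obj x ≫ (m e' x).hom = (m e x).hom ≫ F.map (f ⊵ₗ x))
    (natural_right : ∀ (e : E) {x x' : V} (f : x ⟶ x'),
      e ⊴ₗ F.map f ≫ (m e x').hom = (m e x).hom ≫ F.map (e ⊴ₗ f))
    (assoc : ∀ (e e' : E) (x : V), (m (e ⊗ e') x).hom ≫ F.map (αₗ e e' x).hom =
      (αₗ e e' (F.obj x)).hom ≫ e ⊴ₗ (m e' x).hom ≫ (m e (e' ⊙ₗ x)).hom)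
    (unit : ∀ x : V, (λₗ (F.obj x)).hom = (m (𝟙_ E) x).hom ≫ F.map (λₗ x).hom) :
    F.LeftLinear E where
  μₗ e x := (m e x).hom
  δₗ e x := (m e x).inv
  μₗ_naturality_left := natural_left
  μₗ_naturality_right := natural_right
  μₗ_associativity := assoc
  μₗ_unitality := unit
  δₗ_naturality_left f x := by
    rw [Iso.comp_inv_eq, Category.assoc, natural_left, Iso.inv_hom_id_assoc]
  δₗ_naturality_right e _ _ f := by
    rw [Iso.comp_inv_eq, Category.assoc, natural_right, Iso.inv_hom_id_assoc]
  δₗ_associativity e e' x := by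
    have h : e ⊴ₗ (m e' x).hom ≫ e ⊴ₗ (m e' x).inv = 𝟙 _ := by
      rw [← actionHomRight_comp, Iso.hom_inv_id, actionHomRight_id]
    rw [Iso.inv_comp_eq, reassoc_of% (assoc e e' x), Iso.hom_inv_id_assoc, h, Category.comp_id]
  δₗ_unitality_inv x := by
    rw [← cancel_epi (λₗ[E] (F.obj x)).hom, Iso.hom_inv_id, unit, Category.assoc, ← F.map_comp_assoc,
      Iso.hom_inv_id, F.map_id, Category.id_comp, Iso.hom_inv_id]
  μₗ_comp_δₗ := by simp
  δₗ_comp_μₗ := by simp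

end LeftLinear

section VectModules

open MonoidalCategory MonoidalLeftAction Functor.LaxLeftLinear Functor.OplaxLeftLinear

/-- A module over the category of real vector spaces whose action is cocontinuous and linear in the
vector space. -/
def IsVectMod (V : LinMod (ModuleCat.{0} ℝ)) : Prop :=
  ∀ x : V.carrier, IsCocontLinear (orbit (𝟭 (ModuleCat.{0} ℝ)) V x)

variable {V W : LinMod (ModuleCat.{0} ℝ)}

lemma IsVectMod.comp_map (hV : IsVectMod V) {F : V.carrier ⥤ W.carrier} (hF : IsCocontLinear F)
    (x : V.carrier) : IsCocontLinear (orbit (𝟭 (ModuleCat.{0} ℝ)) V x ⋙ F) := (hV x).comp hF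

/-- Transformations of cocontinuous functors are automatically compatible with the action of
real vector spaces. -/
lemma vectMod_comm (hW : IsVectMod W) {F G : V ⟶ W} (a : F.functor ⟶ G.functor)
    (c : ModuleCat.{0} ℝ) (x : V.carrier) :
    μₗ F.functor c x ≫ a.app (c ⊙ₗ x) = c ⊴ₗ a.app x ≫ μₗ G.functor c x := by
  let α : orbit (𝟭 (ModuleCat.{0} ℝ)) W (F.functor.obj x) ⟶
      orbit (𝟭 (ModuleCat.{0} ℝ)) V x ⋙ G.functor :=
    { app := fun c => μₗ F.functor c x ≫ a.app (c ⊙ₗ x)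
      naturality := fun c c' f => by
        change f ⊵ₗ F.functor.obj x ≫ μₗ F.functor c' x ≫ a.app (c' ⊙ₗ x) =
          (μₗ F.functor c x ≫ a.app (c ⊙ₗ x)) ≫ G.functor.map (f ⊵ₗ x)
        simp }
  let β : orbit (𝟭 (ModuleCat.{0} ℝ)) W (F.functor.obj x) ⟶
      orbit (𝟭 (ModuleCat.{0} ℝ)) V x ⋙ G.functor :=
    { app := fun c => c ⊴ₗ a.app x ≫ μₗ G.functor c x
      naturality := fun c c' f => by
        change f ⊵ₗ F.functor.obj x ≫ c' ⊴ₗ a.app x ≫ μₗ G.functor c' x =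
          (c ⊴ₗ a.app x ≫ μₗ G.functor c x) ≫ G.functor.map (f ⊵ₗ x)
        rw [← action_exchange_assoc, μₗ_naturality_left, Category.assoc] }
  have h : α = β := by
    refine realCopower_natTrans_ext (hW _) ?_
    change μₗ F.functor (𝟙_ (ModuleCat.{0} ℝ)) x ≫ a.app (𝟙_ (ModuleCat.{0} ℝ) ⊙ₗ x) =
      𝟙_ (ModuleCat.{0} ℝ) ⊴ₗ a.app x ≫ μₗ G.functor (𝟙_ (ModuleCat.{0} ℝ)) x
    rw [← cancel_mono (G.functor.map (λₗ x).hom)]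
    simp
  exact congrArg (fun t => t.app c) h

/-- Cocontinuous functors automatically commute with the action of real vector spaces. -/
lemma exists_vectModHom (hV : IsVectMod V) (hW : IsVectMod W) (F : V.carrier ⥤ W.carrier)
    (hF : IsCocontLinear F) : ∃ G : V ⟶ W, G.functor = F := by
  choose m hm using fun x : V.carrier => realCopower_exists_natIso (hW (F.obj x))
    (hV.comp_map hF x) (λₗ (F.obj x) ≪≫ F.mapIso (λₗ x).symm)
  let μ (c : ModuleCat.{0} ℝ) (x : V.carrier) : c ⊙ₗ F.obj x ≅ F.obj (c ⊙ₗ x) := (m x).app c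
  have hμ (x : V.carrier) : (μ (𝟙_ (ModuleCat.{0} ℝ)) x).hom =
      (λₗ (F.obj x)).hom ≫ F.map (λₗ x).inv := hm x
  have nl {c c' : ModuleCat.{0} ℝ} (f : c ⟶ c') (x : V.carrier) :
      f ⊵ₗ F.obj x ≫ (μ c' x).hom = (μ c x).hom ≫ F.map (f ⊵ₗ x) := (m x).hom.naturality f
  have nr (c : ModuleCat.{0} ℝ) {x x' : V.carrier} (f : x ⟶ x') :
      c ⊴ₗ F.map f ≫ (μ c x').hom = (μ c x).hom ≫ F.map (c ⊴ₗ f) := by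
    let α : orbit (𝟭 (ModuleCat.{0} ℝ)) W (F.obj x) ⟶ orbit (𝟭 (ModuleCat.{0} ℝ)) V x' ⋙ F :=
      { app := fun c => c ⊴ₗ F.map f ≫ (μ c x').hom
        naturality := fun c c' g => by
          change g ⊵ₗ F.obj x ≫ c' ⊴ₗ F.map f ≫ (μ c' x').hom =
            (c ⊴ₗ F.map f ≫ (μ c x').hom) ≫ F.map (g ⊵ₗ x')
          rw [← action_exchange_assoc, nl, Category.assoc] }
    let β : orbit (𝟭 (ModuleCat.{0} ℝ)) W (F.obj x) ⟶ orbit (𝟭 (ModuleCat.{0} ℝ)) V x' ⋙ F :=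
      { app := fun c => (μ c x).hom ≫ F.map (c ⊴ₗ f)
        naturality := fun c c' g => by
          change g ⊵ₗ F.obj x ≫ (μ c' x).hom ≫ F.map (c' ⊴ₗ f) =
            ((μ c x).hom ≫ F.map (c ⊴ₗ f)) ≫ F.map (g ⊵ₗ x')
          rw [reassoc_of% nl, Category.assoc, ← F.map_comp, ← F.map_comp, action_exchange] }
    have h : α = β := by
      refine realCopower_natTrans_ext (hW _) ?_
      change 𝟙_ (ModuleCat.{0} ℝ) ⊴ₗ F.map f ≫ (μ (𝟙_ (ModuleCat.{0} ℝ)) x').hom =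
        (μ (𝟙_ (ModuleCat.{0} ℝ)) x).hom ≫ F.map (𝟙_ (ModuleCat.{0} ℝ) ⊴ₗ f)
      rw [hμ, hμ, Category.assoc, ← F.map_comp]
      have h₁ : 𝟙_ (ModuleCat.{0} ℝ) ⊴ₗ F.map f ≫ (λₗ (F.obj x')).hom =
        (λₗ (F.obj x)).hom ≫ F.map f := by simp
      have h₂ : (λₗ x).inv ≫ 𝟙_ (ModuleCat.{0} ℝ) ⊴ₗ f = f ≫ (λₗ x').inv := by simp
      rw [reassoc_of% h₁, h₂, F.map_comp]
    exact congrArg (fun t => t.app c) h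
  have as (c c' : ModuleCat.{0} ℝ) (x : V.carrier) :
      (αₗ c c' (F.obj x)).inv ≫ (μ (c ⊗ c') x).hom ≫ F.map (αₗ c c' x).hom =
        c ⊴ₗ (μ c' x).hom ≫ (μ c (c' ⊙ₗ x)).hom := by
    let α : orbit (𝟭 (ModuleCat.{0} ℝ)) W (c' ⊙ₗ F.obj x) ⟶
        orbit (𝟭 (ModuleCat.{0} ℝ)) V (c' ⊙ₗ x) ⋙ F :=
      { app := fun c => (αₗ c c' (F.obj x)).inv ≫ (μ (c ⊗ c') x).hom ≫ F.map (αₗ c c' x).hom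
        naturality := fun c d g => by
          change g ⊵ₗ (c' ⊙ₗ F.obj x) ≫ (αₗ d c' (F.obj x)).inv ≫ (μ (d ⊗ c') x).hom ≫
            F.map (αₗ d c' x).hom = ((αₗ c c' (F.obj x)).inv ≫ (μ (c ⊗ c') x).hom ≫
            F.map (αₗ c c' x).hom) ≫ F.map (g ⊵ₗ (c' ⊙ₗ x))
          have h₁ : g ⊵ₗ (c' ⊙ₗ F.obj x) ≫ (αₗ d c' (F.obj x)).inv =
            (αₗ c c' (F.obj x)).inv ≫ (g ▷ c') ⊵ₗ F.obj x := by simp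
          have h₂ : (αₗ c c' x).hom ≫ g ⊵ₗ (c' ⊙ₗ x) = (g ▷ c') ⊵ₗ x ≫ (αₗ d c' x).hom := by simp
          rw [reassoc_of% h₁, reassoc_of% nl, Category.assoc, Category.assoc, ← F.map_comp,
            ← F.map_comp, h₂] }
    let β : orbit (𝟭 (ModuleCat.{0} ℝ)) W (c' ⊙ₗ F.obj x) ⟶
        orbit (𝟭 (ModuleCat.{0} ℝ)) V (c' ⊙ₗ x) ⋙ F :=
      { app := fun c => c ⊴ₗ (μ c' x).hom ≫ (μ c (c' ⊙ₗ x)).hom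
        naturality := fun c d g => by
          change g ⊵ₗ (c' ⊙ₗ F.obj x) ≫ d ⊴ₗ (μ c' x).hom ≫ (μ d (c' ⊙ₗ x)).hom =
            (c ⊴ₗ (μ c' x).hom ≫ (μ c (c' ⊙ₗ x)).hom) ≫ F.map (g ⊵ₗ (c' ⊙ₗ x))
          rw [← action_exchange_assoc, nl, Category.assoc] }
    have h : α = β := by
      refine realCopower_natTrans_ext (hW _) ?_
      change (αₗ (𝟙_ (ModuleCat.{0} ℝ)) c' (F.obj x)).inv ≫
        (μ (𝟙_ (ModuleCat.{0} ℝ) ⊗ c') x).hom ≫ F.map (αₗ (𝟙_ (ModuleCat.{0} ℝ)) c' x).hom =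
        𝟙_ (ModuleCat.{0} ℝ) ⊴ₗ (μ c' x).hom ≫ (μ (𝟙_ (ModuleCat.{0} ℝ)) (c' ⊙ₗ x)).hom
      have h₁ : (αₗ (𝟙_ (ModuleCat.{0} ℝ)) c' x).hom =
        (λ_ c').hom ⊵ₗ x ≫ (λₗ (c' ⊙ₗ x)).inv := by simp
      have h₂ : (αₗ (𝟙_ (ModuleCat.{0} ℝ)) c' (F.obj x)).inv ≫ (λ_ c').hom ⊵ₗ F.obj x =
        (λₗ (c' ⊙ₗ F.obj x)).hom := by simp
      have h₃ : 𝟙_ (ModuleCat.{0} ℝ) ⊴ₗ (μ c' x).hom ≫ (λₗ (F.obj (c' ⊙ₗ x))).hom =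
        (λₗ (c' ⊙ₗ F.obj x)).hom ≫ (μ c' x).hom := by simp
      rw [h₁, F.map_comp, ← reassoc_of% nl, reassoc_of% h₂, hμ, reassoc_of% h₃]
    exact congrArg (fun t => t.app c) h
  exact ⟨{ functor := F
           leftLinear := leftLinearMk F μ nl nr
            (fun c c' x => by rw [← as, Iso.hom_inv_id_assoc])
            (fun x => by
              rw [hμ, Category.assoc, ← F.map_comp, Iso.inv_hom_id, F.map_id, Category.comp_id]) },
    rfl⟩

/-- Isomorphisms of cocontinuous functors, as isomorphisms of module functors. -/
def vectModIso (hW : IsVectMod W) {F G : V ⟶ W} (a : F.functor ≅ G.functor) : F ≅ G :=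
  LinMod.isoMk a (vectMod_comm hW a.hom)

end VectModules

namespace SuperVect

open MonoidalCategory TensorProduct

/-- A linear map that commutes with the parities. -/
def mkHom {X Y : SuperVect} (f : X.V →ₗ[ℂ] Y.V) (h : ∀ x, f (parity X x) = parity Y (f x)) :
    X ⟶ Y :=
  Action.Hom.mk (M := X) (N := Y) (ModuleCat.ofHom f) fun g => by
    have h₁ : g = 1 ∨ g = Multiplicative.ofAdd 1 := by
      revert g
      decide
    rcases h₁ with rfl | rfl
    · rw [map_one, map_one]
      rfl
    · ext x
      exact h x

/-- The linear map underlying a morphism. -/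
def lin {X Y : SuperVect} (f : X ⟶ Y) : X.V →ₗ[ℂ] Y.V := f.hom.hom

lemma lin_injective {X Y : SuperVect} {f g : X ⟶ Y} (h : ∀ x, lin f x = lin g x) : f = g :=
  Action.Hom.ext (ModuleCat.hom_ext (LinearMap.ext h))

lemma lin_comp {X Y Z : SuperVect} (f : X ⟶ Y) (g : Y ⟶ Z) (x : X.V) :
    lin (f ≫ g) x = lin g (lin f x) := rfl

lemma lin_parity {X Y : SuperVect} (f : X ⟶ Y) (x : X.V) :
    lin f (parity X x) = parity Y (lin f x) := parity_comm f x

/-- The supervector space with a given parity automorphism. -/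
def ofParity (V : ModuleCat.{0} ℂ) (p : V →ₗ[ℂ] V) (hp : ∀ x, p (p x) = x) : SuperVect :=
  Action.mk V
    { toFun := fun g => if g = 1 then End.of (𝟙 V) else End.of (ModuleCat.ofHom p)
      map_one' := if_pos rfl
      map_mul' := fun g h => by
        have hp' : End.of (ModuleCat.ofHom p) * End.of (ModuleCat.ofHom p) = 1 :=
          ModuleCat.hom_ext (LinearMap.ext hp)
        have h₁ (g : Multiplicative (ZMod 2)) : g = 1 ∨ g = Multiplicative.ofAdd 1 := by
          revert g
          decide
        have h₂ : Multiplicative.ofAdd (1 : ZMod 2) ≠ 1 := by decide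
        have h₃ : Multiplicative.ofAdd (1 : ZMod 2) * Multiplicative.ofAdd 1 = 1 := by decide
        have h₄ : End.of (𝟙 V) = 1 := rfl
        rcases h₁ g with rfl | rfl <;> rcases h₁ h with rfl | rfl
        · rw [one_mul, if_pos rfl, h₄, one_mul]
        · rw [one_mul, if_pos rfl, h₄, one_mul]
        · rw [mul_one, if_pos rfl, h₄, mul_one]
        · rw [h₃, if_pos rfl, if_neg h₂, hp', h₄] }

lemma parity_ofParity (V : ModuleCat.{0} ℂ) (p : V →ₗ[ℂ] V) (hp : ∀ x, p (p x) = x) :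
    parity (ofParity V p hp) = p := by
  have h₂ : Multiplicative.ofAdd (1 : ZMod 2) ≠ 1 := by decide
  have h : (ofParity V p hp).ρ (Multiplicative.ofAdd 1) = ModuleCat.ofHom p :=
    if_neg (c := Multiplicative.ofAdd (1 : ZMod 2) = 1) (α := End V) (t := End.of (𝟙 V)) h₂
  unfold parity
  rw [h]
  rfl

/-- The purely odd supervector space on a complex vector space. -/
def odd : ModuleCat.{0} ℂ ⥤ SuperVect where
  obj V := ofParity V (-LinearMap.id) (by simp)
  map {V W} f := mkHom (X := ofParity V _ _) (Y := ofParity W _ _) f.hom (fun x => by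
    rw [parity_ofParity, parity_ofParity]
    exact map_neg f.hom x)

lemma parity_even (V : ModuleCat.{0} ℂ) (x : V) : parity (even.obj V) x = x := rfl

lemma parity_odd (V : ModuleCat.{0} ℂ) (x : V) : parity (odd.obj V) x = -x := by
  have := parity_ofParity V (-LinearMap.id) (by simp)
  exact congrArg (fun f : V →ₗ[ℂ] V => f x) this

instance : even.Full := ⟨fun f => ⟨f.hom, rfl⟩⟩
instance : odd.Full := ⟨fun f => ⟨f.hom, rfl⟩⟩
instance : even.Additive := ⟨rfl⟩
instance : odd.Additive := ⟨rfl⟩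

/-- The underlying vector space. -/
def space : SuperVect ⥤ ModuleCat.{0} ℂ := Action.forget _ _

instance : ReflectsColimitsOfSize.{0, 0} space :=
  inferInstanceAs (ReflectsColimitsOfSize.{0, 0} (Action.forget _ _))

instance : PreservesColimitsOfSize.{0, 0} even :=
  have : PreservesColimitsOfSize.{0, 0} (even ⋙ space) :=
    inferInstanceAs (PreservesColimitsOfSize.{0, 0} (𝟭 (ModuleCat.{0} ℂ)))
  preservesColimits_of_reflects_of_preserves even space

instance : PreservesColimitsOfSize.{0, 0} odd :=
  have : PreservesColimitsOfSize.{0, 0} (odd ⋙ space) :=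
    inferInstanceAs (PreservesColimitsOfSize.{0, 0} (𝟭 (ModuleCat.{0} ℂ)))
  preservesColimits_of_reflects_of_preserves odd space

lemma eq_zero_of_eq_neg {M : Type} [AddCommGroup M] [Module ℂ M] {x : M} (h : x = -x) : x = 0 := by
  have h₁ : x = (1 / 2 : ℂ) • (x - -x) := by module
  rw [h₁, ← h, sub_self, smul_zero]

/-- Supervector spaces are sums of even and odd ones. -/
def decomp : Decomp even odd where
  R₀ := space
  R₁ := space
  s₀ X := mkHom (X := X) (Y := even.obj X.V) ((1 / 2 : ℂ) • (LinearMap.id + parity X))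
    fun (x : X.V) => by
      refine Eq.trans ?_ (parity_even X.V _).symm
      change (1 / 2 : ℂ) • (parity X x + parity X (parity X x)) = (1 / 2 : ℂ) • (x + parity X x)
      rw [parity_parity, add_comm]
  r₀ X := mkHom (X := even.obj X.V) (Y := X) ((1 / 2 : ℂ) • (LinearMap.id + parity X))
    fun (x : X.V) => by
      change (1 / 2 : ℂ) • (x + parity X x) = parity X ((1 / 2 : ℂ) • (x + parity X x))
      rw [map_smul, map_add, parity_parity, add_comm]
  s₁ X := mkHom (X := X) (Y := odd.obj X.V) ((1 / 2 : ℂ) • (LinearMap.id - parity X))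
    fun (x : X.V) => by
      refine Eq.trans ?_ (parity_odd X.V _).symm
      change (1 / 2 : ℂ) • (parity X x - parity X (parity X x)) = -((1 / 2 : ℂ) • (x - parity X x))
      rw [parity_parity]
      module
  r₁ X := mkHom (X := odd.obj X.V) (Y := X) ((1 / 2 : ℂ) • (LinearMap.id - parity X))
    fun (x : X.V) => by
      refine (congrArg _ (parity_odd X.V x)).trans ?_
      change (1 / 2 : ℂ) • (-x - parity X (-x)) = parity X ((1 / 2 : ℂ) • (x - parity X x))
      rw [map_smul, map_sub, parity_parity, map_neg]
      module
  s₀_natural {X Y} f := lin_injective fun (x : X.V) => by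
    change (1 / 2 : ℂ) • (lin f x + parity Y (lin f x)) = lin f ((1 / 2 : ℂ) • (x + parity X x))
    rw [map_smul, map_add, lin_parity]
  r₀_natural {X Y} f := lin_injective fun (x : X.V) => by
    change (1 / 2 : ℂ) • (lin f x + parity Y (lin f x)) = lin f ((1 / 2 : ℂ) • (x + parity X x))
    rw [map_smul, map_add, lin_parity]
  s₁_natural {X Y} f := lin_injective fun (x : X.V) => by
    change (1 / 2 : ℂ) • (lin f x - parity Y (lin f x)) = lin f ((1 / 2 : ℂ) • (x - parity X x))
    rw [map_smul, map_sub, lin_parity]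
  r₁_natural {X Y} f := lin_injective fun (x : X.V) => by
    change (1 / 2 : ℂ) • (lin f x - parity Y (lin f x)) = lin f ((1 / 2 : ℂ) • (x - parity X x))
    rw [map_smul, map_sub, lin_parity]
  total X := lin_injective fun (x : X.V) => by
    have h (y z : X.V) (hy : y = (1 / 2 : ℂ) • (x + parity X x))
        (hz : z = (1 / 2 : ℂ) • (x - parity X x)) :
        (1 / 2 : ℂ) • (y + parity X y) + (1 / 2 : ℂ) • (z - parity X z) = x := by
      rw [hy, hz]
      simp only [map_smul, map_add, map_sub, parity_parity]
      module
    exact h _ _ rfl rfl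
  zero₀₁ {V W} m := lin_injective fun (x : V) => by
    have h : (lin m x : W) = -lin m x := (lin_parity m x).trans (parity_odd W _)
    exact eq_zero_of_eq_neg h
  zero₁₀ {V W} m := lin_injective fun (x : V) => by
    have h : lin m x = (-lin m x : W) := ((lin_parity m x).symm.trans
      (congrArg _ (parity_odd V x))).trans (map_neg (lin m) x)
    exact eq_zero_of_eq_neg h

/-- The odd line. -/
def oddLine : SuperVect := odd.obj (ModuleCat.of ℂ ℂ)

/-- Multiplication by the imaginary unit. -/
def imag (X : SuperVect) : X ⟶ X := Complex.I • 𝟙 X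

lemma imag_natural {X Y : SuperVect} (f : X ⟶ Y) : f ≫ imag Y = imag X ≫ f :=
  lin_injective fun x => (map_smul (lin f) Complex.I x).symm

lemma imag_imag (X : SuperVect) : imag X ≫ imag X = -𝟙 X :=
  lin_injective fun x => by
    change Complex.I • Complex.I • x = -x
    rw [smul_smul, Complex.I_mul_I, neg_one_smul]

lemma even_map_elemHom (z : ℂ) : even.map (elemHom (m := ModuleCat.of ℂ ℂ) z) =
    z.re • 𝟙 (𝟙_ SuperVect) + z.im • imag (𝟙_ SuperVect) := lin_injective fun (x : ℂ) => by
  change x * z = (z.re : ℂ) * x + (z.im : ℂ) * (Complex.I * x)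
  conv_lhs => rw [← Complex.re_add_im z]
  ring

lemma odd_map_elemHom (z : ℂ) : odd.map (elemHom (m := ModuleCat.of ℂ ℂ) z) =
    z.re • 𝟙 oddLine + z.im • imag oddLine := lin_injective fun (x : ℂ) => by
  change x * z = (z.re : ℂ) * x + (z.im : ℂ) * (Complex.I * x)
  conv_lhs => rw [← Complex.re_add_im z]
  ring

section

variable {U : Type u} [Category.{v} U] [Preadditive U] [Linear ℝ U]

lemma natTrans_ext {H H' : SuperVect ⥤ U} (hH : IsCocontLinear H) {α β : H ⟶ H'}
    (h₁ : α.app (𝟙_ SuperVect) = β.app (𝟙_ SuperVect)) (h₂ : α.app oddLine = β.app oddLine) :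
    α = β := by
  have := hH.additive
  have := hH.cocontinuous
  refine decomp.natTrans_ext (fun V => ?_) fun V => ?_
  · have : Functor.whiskerLeft even α = Functor.whiskerLeft even β := copower_natTrans_ext h₁
    exact congrArg (fun t => t.app V) this
  · have : Functor.whiskerLeft odd α = Functor.whiskerLeft odd β := copower_natTrans_ext h₂
    exact congrArg (fun t => t.app V) this

lemma exists_natTrans {H H' : SuperVect ⥤ U} (hH : IsCocontLinear H) (hH' : IsCocontLinear H')
    (t₀ : H.obj (𝟙_ SuperVect) ⟶ H'.obj (𝟙_ SuperVect)) (t₁ : H.obj oddLine ⟶ H'.obj oddLine)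
    (h₀ : H.map (imag (𝟙_ SuperVect)) ≫ t₀ = t₀ ≫ H'.map (imag (𝟙_ SuperVect)))
    (h₁ : H.map (imag oddLine) ≫ t₁ = t₁ ≫ H'.map (imag oddLine)) :
    ∃ α : H ⟶ H', α.app (𝟙_ SuperVect) = t₀ ∧ α.app oddLine = t₁ := by
  have := hH.additive
  have := hH.linear
  have := hH.cocontinuous
  have := hH'.additive
  have := hH'.linear
  obtain ⟨α₀, hα₀⟩ := copower_exists_natTrans (X := even ⋙ H) (Y := even ⋙ H') t₀ fun z => by
    have e (K : SuperVect ⥤ U) [K.Additive] [K.Linear ℝ] :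
        K.map (even.map (elemHom (m := ModuleCat.of ℂ ℂ) z)) =
          z.re • 𝟙 (K.obj (𝟙_ SuperVect)) + z.im • K.map (imag (𝟙_ SuperVect)) :=
      (congrArg (fun t : 𝟙_ SuperVect ⟶ 𝟙_ SuperVect => K.map t) (even_map_elemHom z)).trans
        (by simp only [Functor.map_add, Functor.map_smul, CategoryTheory.Functor.map_id])
    change H.map (even.map _) ≫ t₀ = t₀ ≫ H'.map (even.map _)
    have h : (z.re • 𝟙 (H.obj (𝟙_ SuperVect)) + z.im • H.map (imag (𝟙_ SuperVect))) ≫ t₀ =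
        t₀ ≫ (z.re • 𝟙 (H'.obj (𝟙_ SuperVect)) + z.im • H'.map (imag (𝟙_ SuperVect))) := by
      simp only [Preadditive.add_comp, Preadditive.comp_add, Linear.smul_comp, Linear.comp_smul,
        h₀, Category.id_comp, Category.comp_id]
    exact (congrArg (· ≫ t₀) (e H)).trans (h.trans (congrArg (t₀ ≫ ·) (e H')).symm)
  obtain ⟨α₁, hα₁⟩ := copower_exists_natTrans (X := odd ⋙ H) (Y := odd ⋙ H') t₁ fun z => by
    have e (K : SuperVect ⥤ U) [K.Additive] [K.Linear ℝ] :
        K.map (odd.map (elemHom (m := ModuleCat.of ℂ ℂ) z)) =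
          z.re • 𝟙 (K.obj (oddLine)) + z.im • K.map (imag (oddLine)) :=
      (congrArg (fun t : oddLine ⟶ oddLine => K.map t) (odd_map_elemHom z)).trans
        (by simp only [Functor.map_add, Functor.map_smul, CategoryTheory.Functor.map_id])
    change H.map (odd.map _) ≫ t₁ = t₁ ≫ H'.map (odd.map _)
    have h : (z.re • 𝟙 (H.obj (oddLine)) + z.im • H.map (imag (oddLine))) ≫ t₁ =
        t₁ ≫ (z.re • 𝟙 (H'.obj (oddLine)) + z.im • H'.map (imag (oddLine))) := by
      simp only [Preadditive.add_comp, Preadditive.comp_add, Linear.smul_comp, Linear.comp_smul,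
        h₁, Category.id_comp, Category.comp_id]
    exact (congrArg (· ≫ t₁) (e H)).trans (h.trans (congrArg (t₁ ≫ ·) (e H')).symm)
  obtain ⟨α, h, h'⟩ := decomp.exists_natTrans α₀ α₁
  exact ⟨α, (h _).trans hα₀, (h' _).trans hα₁⟩

lemma exists_natIso {H H' : SuperVect ⥤ U} (hH : IsCocontLinear H) (hH' : IsCocontLinear H')
    (t₀ : H.obj (𝟙_ SuperVect) ≅ H'.obj (𝟙_ SuperVect)) (t₁ : H.obj oddLine ≅ H'.obj oddLine)
    (h₀ : H.map (imag (𝟙_ SuperVect)) ≫ t₀.hom = t₀.hom ≫ H'.map (imag (𝟙_ SuperVect)))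
    (h₁ : H.map (imag oddLine) ≫ t₁.hom = t₁.hom ≫ H'.map (imag oddLine)) :
    ∃ α : H ≅ H', α.hom.app (𝟙_ SuperVect) = t₀.hom ∧ α.hom.app oddLine = t₁.hom := by
  obtain ⟨α, a₀, a₁⟩ := exists_natTrans hH hH' t₀.hom t₁.hom h₀ h₁
  obtain ⟨β, b₀, b₁⟩ := exists_natTrans hH' hH t₀.inv t₁.inv
    (by rw [← cancel_epi t₀.hom, ← reassoc_of% h₀, t₀.hom_inv_id_assoc, t₀.hom_inv_id,
      Category.comp_id])
    (by rw [← cancel_epi t₁.hom, ← reassoc_of% h₁, t₁.hom_inv_id_assoc, t₁.hom_inv_id,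
      Category.comp_id])
  exact ⟨⟨α, β, natTrans_ext hH (by simp [a₀, b₀]) (by simp [a₁, b₁]),
    natTrans_ext hH' (by simp [a₀, b₀]) (by simp [a₁, b₁])⟩, a₀, a₁⟩

end

end SuperVect

namespace SuperVect

open MonoidalCategory TensorProduct

/-- Homogeneous tensors, as elements of the tensor product of supervector spaces. -/
def tm {X Y : SuperVect} (x : X.V) (y : Y.V) : (X ⊗ Y : SuperVect).V := (x ⊗ₜ[ℂ] y : X.V ⊗[ℂ] Y.V)

lemma complex_tmul_smul {M N : Type} [AddCommGroup M] [Module ℂ M] [AddCommGroup N] [Module ℂ N]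
    (z : ℂ) (x : M) (y : N) : x ⊗ₜ[ℂ] (z • y) = z • (x ⊗ₜ[ℂ] y) := by simp

lemma complex_smul_tmul {M N : Type} [AddCommGroup M] [Module ℂ M] [AddCommGroup N] [Module ℂ N]
    (z : ℂ) (x : M) (y : N) : (z • x) ⊗ₜ[ℂ] y = z • (x ⊗ₜ[ℂ] y) := (TensorProduct.smul_tmul' _ _ _).symm

lemma tm_smul {X Y : SuperVect} (z : ℂ) (x : X.V) (y : Y.V) : tm x (z • y) = z • tm x y :=
  complex_tmul_smul z x y

lemma smul_tm {X Y : SuperVect} (z : ℂ) (x : X.V) (y : Y.V) : tm (z • x) y = z • tm x y :=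
  complex_smul_tmul z x y

lemma tensor_ext {X Y Z : SuperVect} {f g : X ⊗ Y ⟶ Z}
    (h : ∀ x y, lin f (tm x y) = lin g (tm x y)) : f = g :=
  Action.Hom.ext (ModuleCat.MonoidalCategory.tensor_ext h)

lemma tensor_ext₃ {X Y Z W : SuperVect} {f g : (X ⊗ Y) ⊗ Z ⟶ W}
    (h : ∀ x y z, lin f (tm (tm x y) z) = lin g (tm (tm x y) z)) : f = g :=
  Action.Hom.ext (ModuleCat.MonoidalCategory.tensor_ext₃' h)

lemma parity_tm {X Y : SuperVect} (x : X.V) (y : Y.V) :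
    parity (X ⊗ Y) (tm x y) = tm (parity X x) (parity Y y) := rfl

lemma lin_whiskerLeft {X Y Z : SuperVect} (f : Y ⟶ Z) (x : X.V) (y : Y.V) :
    lin (X ◁ f) (tm x y) = tm x (lin f y) := rfl

lemma lin_whiskerRight {X Y Z : SuperVect} (f : X ⟶ Z) (x : X.V) (y : Y.V) :
    lin (f ▷ Y) (tm x y) = tm (lin f x) y := rfl

lemma lin_assoc {X Y Z : SuperVect} (x : X.V) (y : Y.V) (z : Z.V) :
    lin (α_ X Y Z).hom (tm (tm x y) z) = tm x (tm y z) := rfl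

lemma lin_braiding {X Y : SuperVect} (x : X.V) (y : Y.V) : lin (β_ X Y).hom (tm x y) =
    (1 / 2 : ℂ) • (tm y x + tm y (parity X x) + tm (parity Y y) x - tm (parity Y y) (parity X x)) :=
  swap_tmul X Y x y

instance : MonoidalPreadditive SuperVect :=
  inferInstanceAs (MonoidalPreadditive (Action (ModuleCat.{0} ℂ) (Multiplicative (ZMod 2))))

instance : PreservesColimitsOfSize.{0, 0} space :=
  inferInstanceAs (PreservesColimitsOfSize.{0, 0} (Action.forget (ModuleCat.{0} ℂ)
    (Multiplicative (ZMod 2))))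

instance : HasColimitsOfSize.{0, 0} SuperVect :=
  inferInstanceAs (HasColimitsOfSize.{0, 0} (Action (ModuleCat.{0} ℂ) (Multiplicative (ZMod 2))))

lemma isCocontLinear_tensorLeft (X : SuperVect) : IsCocontLinear (tensorLeft X) where
  additive := ⟨MonoidalPreadditive.whiskerLeft_add _ _⟩
  linear := ⟨fun f r => tensor_ext fun x y => tm_smul (r : ℂ) x (lin f y)⟩
  cocontinuous :=
    have : PreservesColimitsOfSize.{0, 0} (tensorLeft X ⋙ space) :=
      preservesColimits_of_natIso (F := space ⋙ tensorLeft (X.V : ModuleCat ℂ))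
        (NatIso.ofComponents (fun _ => Iso.refl _) fun _ => rfl)
    preservesColimits_of_reflects_of_preserves _ space

lemma isCocontLinear_tensorRight (X : SuperVect) : IsCocontLinear (tensorRight X) where
  additive := ⟨MonoidalPreadditive.add_whiskerRight _ _⟩
  linear := ⟨fun f r => tensor_ext fun x y => smul_tm (r : ℂ) (lin f x) y⟩
  cocontinuous :=
    have : PreservesColimitsOfSize.{0, 0} (tensorRight X ⋙ space) :=
      preservesColimits_of_natIso (F := space ⋙ tensorRight (X.V : ModuleCat ℂ))
        (NatIso.ofComponents (fun _ => Iso.refl _) fun _ => rfl)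
    preservesColimits_of_reflects_of_preserves _ space

/-- The parity automorphism, as an endomorphism. -/
def parityHom (X : SuperVect) : X ⟶ X := mkHom (parity X) fun _ => rfl

lemma parityHom_natural {X Y : SuperVect} (f : X ⟶ Y) : f ≫ parityHom Y = parityHom X ≫ f :=
  lin_injective fun x => (lin_parity f x).symm

lemma parityHom_parityHom (X : SuperVect) : parityHom X ≫ parityHom X = 𝟙 X :=
  lin_injective fun x => parity_parity X x

lemma parityHom_even (V : ModuleCat.{0} ℂ) : parityHom (even.obj V) = 𝟙 _ := rfl

lemma parityHom_odd (V : ModuleCat.{0} ℂ) : parityHom (odd.obj V) = -𝟙 _ :=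
  lin_injective fun x => parity_odd V x

lemma parityHom_tensor (X Y : SuperVect) : parityHom (X ⊗ Y) = parityHom X ⊗ₘ parityHom Y :=
  tensor_ext fun _ _ => rfl

/-- The product of odd lines is the even line. -/
def oddLineTensor : oddLine ⊗ oddLine ≅ 𝟙_ SuperVect :=
  Action.mkIso (M := oddLine ⊗ oddLine) (N := 𝟙_ SuperVect)
    (LinearEquiv.toModuleIso (TensorProduct.lid ℂ ℂ)) fun g => by
      have h₁ : g = 1 ∨ g = Multiplicative.ofAdd 1 := by
        revert g
        decide
      rcases h₁ with rfl | rfl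
      · rw [map_one, map_one]
        rfl
      · refine ModuleCat.MonoidalCategory.tensor_ext fun (x : ℂ) (y : ℂ) => ?_
        have h₂ := parity_tm (X := oddLine) (Y := oddLine) x y
        rw [show parity oddLine x = (-x : ℂ) from parity_odd (ModuleCat.of ℂ ℂ) x,
          show parity oddLine y = (-y : ℂ) from parity_odd (ModuleCat.of ℂ ℂ) y] at h₂
        refine (congrArg (TensorProduct.lid ℂ ℂ) h₂).trans ?_
        change -x * -y = x * y
        ring

/-- A linear equivalence that commutes with the parities. -/
def mkIso {X Y : SuperVect} (e : X.V ≃ₗ[ℂ] Y.V) (h : ∀ x, e (parity X x) = parity Y (e x)) :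
    X ≅ Y where
  hom := mkHom e.toLinearMap h
  inv := mkHom e.symm.toLinearMap fun y => e.injective (by
    have h₁ := h (e.symm y)
    rw [e.apply_symm_apply] at h₁
    exact (e.apply_symm_apply _).trans h₁.symm)
  hom_inv_id := lin_injective e.symm_apply_apply
  inv_hom_id := lin_injective e.apply_symm_apply

/-- Complex conjugation of supervector spaces. -/
def conjFunctor : SuperVect ⥤ SuperVect :=
  (ModuleCat.restrictScalars (starRingEnd ℂ)).mapAction (Multiplicative (ZMod 2))

/-- The antilinear identification of a supervector space with its complex conjugate. -/
def toConj (X : SuperVect) : X.V ≃ₛₗ[starRingEnd ℂ] (conjFunctor.obj X).V where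
  toFun x := x
  invFun x := x
  map_add' _ _ := rfl
  map_smul' z x := by
    change z • (x : X.V) = starRingEnd ℂ (starRingEnd ℂ z) • (x : X.V)
    rw [starRingEnd_self_apply]
  left_inv _ := rfl
  right_inv _ := rfl

lemma parity_toConj {X : SuperVect} (x : X.V) :
    parity (conjFunctor.obj X) (toConj X x) = toConj X (parity X x) := rfl

lemma lin_conj {X Y : SuperVect} (f : X ⟶ Y) (x : X.V) :
    lin (conjFunctor.map f) (toConj X x) = toConj Y (lin f x) := rfl

/-- Conjugation commutes with tensor products. -/
def conjTensor (X Y : SuperVect) :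
    conjFunctor.obj X ⊗ conjFunctor.obj Y ≅ conjFunctor.obj (X ⊗ Y) :=
  mkIso (X := conjFunctor.obj X ⊗ conjFunctor.obj Y)
    ((TensorProduct.congr (toConj X).symm (toConj Y).symm).trans (toConj (X ⊗ Y))) fun t => by
    have h := TensorProduct.ext' (g := (((TensorProduct.congr (toConj X).symm
        (toConj Y).symm).trans (toConj (X ⊗ Y))).toLinearMap ∘ₗ TensorProduct.map
          (parity (conjFunctor.obj X)) (parity (conjFunctor.obj Y))))
      (h := parity (conjFunctor.obj (X ⊗ Y)) ∘ₗ ((TensorProduct.congr (toConj X).symm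
        (toConj Y).symm).trans (toConj (X ⊗ Y))).toLinearMap) fun x y => rfl
    exact congrArg (fun f => f t) h

lemma lin_conjTensor {X Y : SuperVect} (x : X.V) (y : Y.V) :
    lin (conjTensor X Y).hom (tm (toConj X x) (toConj Y y)) = toConj (X ⊗ Y) (tm x y) := rfl

lemma conj_ext {X Y : SuperVect} {f g : conjFunctor.obj X ⟶ Y}
    (h : ∀ x : X.V, lin f (toConj X x) = lin g (toConj X x)) : f = g := lin_injective h

lemma conj_tensor_ext {X Y Z : SuperVect} {f g : conjFunctor.obj X ⊗ conjFunctor.obj Y ⟶ Z}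
    (h : ∀ (x : X.V) (y : Y.V), lin f (tm (toConj X x) (toConj Y y)) =
      lin g (tm (toConj X x) (toConj Y y))) : f = g := tensor_ext h

/-- Conjugation of scalars. -/
def conjUnit : 𝟙_ SuperVect ≅ conjFunctor.obj (𝟙_ SuperVect) :=
  mkIso (X := 𝟙_ SuperVect)
    ((starLinearEquiv ℂ (A := ℂ)).trans (toConj (𝟙_ SuperVect))) fun _ => rfl

/-- The monoidal structure of conjugation. -/
def conjCore : conjFunctor.CoreMonoidal where
  εIso := conjUnit
  μIso := conjTensor
  μIso_hom_natural_left f Z := conj_tensor_ext fun x z => rfl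
  μIso_hom_natural_right Z f := conj_tensor_ext fun x z => rfl
  associativity X Y Z := tensor_ext₃ fun (x : X.V) (y : Y.V) (z : Z.V) => by
    change lin (((conjTensor X Y).hom ▷ conjFunctor.obj Z) ≫ (conjTensor (X ⊗ Y) Z).hom ≫
      conjFunctor.map (α_ X Y Z).hom) (tm (tm (toConj X x) (toConj Y y)) (toConj Z z)) =
      lin ((α_ _ _ _).hom ≫ conjFunctor.obj X ◁ (conjTensor Y Z).hom ≫ (conjTensor X (Y ⊗ Z)).hom)
        (tm (tm (toConj X x) (toConj Y y)) (toConj Z z))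
    rw [lin_comp, lin_comp, lin_comp, lin_comp, lin_whiskerRight, lin_conjTensor, lin_conjTensor,
      lin_conj, lin_assoc, lin_assoc, lin_whiskerLeft, lin_conjTensor, lin_conjTensor]
  left_unitality X := tensor_ext fun (z : ℂ) (x : X.V) => by
    have h := (toConj X).map_smulₛₗ (starRingEnd ℂ z) x
    rw [starRingEnd_self_apply] at h
    exact h.symm
  right_unitality X := tensor_ext fun (x : X.V) (z : ℂ) => by
    have h := (toConj X).map_smulₛₗ (starRingEnd ℂ z) x
    rw [starRingEnd_self_apply] at h
    exact h.symm

instance : conjFunctor.Monoidal := conjCore.toMonoidal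

lemma lin_conj_μ {X Y : SuperVect} (x : X.V) (y : Y.V) :
    lin (Functor.LaxMonoidal.μ conjFunctor X Y) (tm (toConj X x) (toConj Y y)) =
      toConj (X ⊗ Y) (tm x y) := rfl

instance : conjFunctor.Braided where
  braided X Y := by
    refine conj_tensor_ext fun x y => ?_
    rw [lin_comp, lin_comp, lin_braiding, lin_conj_μ, lin_conj, lin_braiding]
    rw [map_smulₛₗ, map_sub, map_add, map_add, map_smul, map_sub, map_add, map_add]
    have h : starRingEnd ℂ (1 / 2) = 1 / 2 := by
      have := Complex.conj_ofReal (1 / 2)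
      push_cast at this
      exact this
    simp only [parity_toConj, lin_conj_μ, h]

/-- Conjugating twice. -/
def conjConj : conjFunctor ⋙ conjFunctor ≅ 𝟭 SuperVect :=
  NatIso.ofComponents (F := conjFunctor ⋙ conjFunctor) (G := 𝟭 SuperVect) (fun X =>
    mkIso (X := conjFunctor.obj (conjFunctor.obj X)) (Y := X)
      ((toConj (conjFunctor.obj X)).symm.trans (toConj X).symm) fun _ => rfl) fun _ => rfl

instance : conjFunctor.IsEquivalence :=
  (CategoryTheory.Equivalence.mk conjFunctor conjFunctor conjConj.symm conjConj).isEquivalence_functor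

instance : conjFunctor.Additive := ⟨rfl⟩

instance : conjFunctor.Linear ℝ where
  map_smul {X Y} f r := conj_ext fun x => by
    have h := (toConj Y).map_smulₛₗ (r : ℂ) (lin f x)
    rw [Complex.conj_ofReal] at h
    exact h

lemma conj_imag (X : SuperVect) : conjFunctor.map (imag X) = -imag (conjFunctor.obj X) :=
  conj_ext fun x => by
    have h := (toConj X).map_smulₛₗ Complex.I x
    rw [Complex.conj_I, neg_smul] at h
    exact h

lemma isCocontLinear_of_isEquivalence {F : SuperVect ⥤ SuperVect} [F.IsEquivalence] [F.Additive]
    [F.Linear ℝ] : IsCocontLinear F := ⟨inferInstance, inferInstance, inferInstance⟩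

end SuperVect

open SuperVect

instance : (ModuleCat.extendScalars.{0, 0, 0} (algebraMap ℝ ℂ)).IsLeftAdjoint :=
  (ModuleCat.extendRestrictScalarsAdj (algebraMap ℝ ℂ)).isLeftAdjoint

instance : (ModuleCat.extendScalars.{0, 0, 0} (algebraMap ℝ ℂ)).Additive :=
  (ModuleCat.extendRestrictScalarsAdj (algebraMap ℝ ℂ)).left_adjoint_additive

instance : vectToSuperVect.Additive :=
  inferInstanceAs (ModuleCat.extendScalars (algebraMap ℝ ℂ) ⋙ SuperVect.even).Additive

instance : vectToSuperVect.Linear ℝ where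
  map_smul f r := Action.Hom.ext (ModuleCat.ExtendScalars.hom_ext fun m =>
    TensorProduct.tmul_smul r (1 : ℂ) (f.hom m))

lemma isCocontLinear_vectToSuperVect : IsCocontLinear vectToSuperVect where
  additive := inferInstance
  linear := inferInstance
  cocontinuous := inferInstanceAs (PreservesColimitsOfSize.{0, 0}
    (ModuleCat.extendScalars (algebraMap ℝ ℂ) ⋙ SuperVect.even))

section Monoidal

open MonoidalCategory Functor.LaxMonoidal Functor.OplaxMonoidal

variable {A : Type u} [Category.{v} A] [MonoidalCategory A] {B : Type u₁} [Category.{v₁} B]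
  [MonoidalCategory B] {F G : A ⥤ B} [F.Monoidal] [G.Monoidal] (α : F ⟶ G)

lemma tensor_of_unit_left (h : ε F ≫ α.app (𝟙_ A) = ε G) (Y : A) :
    μ F (𝟙_ A) Y ≫ α.app (𝟙_ A ⊗ Y) = (α.app (𝟙_ A) ⊗ₘ α.app Y) ≫ μ G (𝟙_ A) Y := by
  rw [← cancel_epi (ε F ▷ F.obj Y), ← cancel_mono (G.map (λ_ Y).hom)]
  have h₁ : ε F ▷ F.obj Y ≫ μ F (𝟙_ A) Y ≫ F.map (λ_ Y).hom = (λ_ (F.obj Y)).hom :=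
    (Functor.LaxMonoidal.left_unitality F Y).symm
  have h₂ : ε G ▷ G.obj Y ≫ μ G (𝟙_ A) Y ≫ G.map (λ_ Y).hom = (λ_ (G.obj Y)).hom :=
    (Functor.LaxMonoidal.left_unitality G Y).symm
  have h₃ : ε F ▷ F.obj Y ≫ (α.app (𝟙_ A) ⊗ₘ α.app Y) = 𝟙_ B ◁ α.app Y ≫ ε G ▷ G.obj Y := by
    rw [MonoidalCategory.tensorHom_def, ← comp_whiskerRight_assoc, h, whisker_exchange]
  simp only [Category.assoc]
  rw [← α.naturality, reassoc_of% h₁, reassoc_of% h₃, h₂, leftUnitor_naturality]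

lemma tensor_of_unit_right (h : ε F ≫ α.app (𝟙_ A) = ε G) (X : A) :
    μ F X (𝟙_ A) ≫ α.app (X ⊗ 𝟙_ A) = (α.app X ⊗ₘ α.app (𝟙_ A)) ≫ μ G X (𝟙_ A) := by
  rw [← cancel_epi (F.obj X ◁ ε F), ← cancel_mono (G.map (ρ_ X).hom)]
  have h₁ : F.obj X ◁ ε F ≫ μ F X (𝟙_ A) ≫ F.map (ρ_ X).hom = (ρ_ (F.obj X)).hom :=
    (Functor.LaxMonoidal.right_unitality F X).symm
  have h₂ : G.obj X ◁ ε G ≫ μ G X (𝟙_ A) ≫ G.map (ρ_ X).hom = (ρ_ (G.obj X)).hom :=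
    (Functor.LaxMonoidal.right_unitality G X).symm
  have h₃ : F.obj X ◁ ε F ≫ (α.app X ⊗ₘ α.app (𝟙_ A)) = α.app X ▷ 𝟙_ B ≫ G.obj X ◁ ε G := by
    rw [MonoidalCategory.tensorHom_def', ← MonoidalCategory.whiskerLeft_comp_assoc, h,
      whisker_exchange]
  simp only [Category.assoc]
  rw [← α.naturality, reassoc_of% h₁, reassoc_of% h₃, h₂, rightUnitor_naturality]

lemma monoidal_app_unit (α : F ⟶ G) [NatTrans.IsMonoidal α] : α.app (𝟙_ A) = η F ≫ ε G := by
  rw [← NatTrans.IsMonoidal.unit (τ := α), Functor.Monoidal.η_ε_assoc]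

end Monoidal

open MonoidalCategory Functor.LaxMonoidal Functor.OplaxMonoidal SuperVect

section RealMonoidal

variable {F G : ModuleCat.{0} ℝ ⥤ SuperVect} [F.Monoidal] [G.Monoidal]

lemma isMonoidal_of_unit (hF : IsCocontLinear F) (α : F ⟶ G)
    (h : ε F ≫ α.app (𝟙_ (ModuleCat.{0} ℝ)) = ε G) : NatTrans.IsMonoidal α where
  unit := h
  tensor X Y := by
    let a : F ⋙ tensorRight (F.obj Y) ⟶ tensorRight Y ⋙ G :=
      { app := fun X => μ F X Y ≫ α.app (X ⊗ Y)
        naturality := fun X X' f => by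
          change F.map f ▷ F.obj Y ≫ μ F X' Y ≫ α.app (X' ⊗ Y) =
            (μ F X Y ≫ α.app (X ⊗ Y)) ≫ G.map (f ▷ Y)
          simp }
    let b : F ⋙ tensorRight (F.obj Y) ⟶ tensorRight Y ⋙ G :=
      { app := fun X => (α.app X ⊗ₘ α.app Y) ≫ μ G X Y
        naturality := fun X X' f => by
          change F.map f ▷ F.obj Y ≫ (α.app X' ⊗ₘ α.app Y) ≫ μ G X' Y =
            ((α.app X ⊗ₘ α.app Y) ≫ μ G X Y) ≫ G.map (f ▷ Y)
          rw [Category.assoc, ← μ_natural_left]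
          simp only [← tensorHom_id, tensorHom_comp_tensorHom_assoc, α.naturality,
            Category.id_comp, Category.comp_id] }
    have hab : a = b := realCopower_natTrans_ext (hF.comp (isCocontLinear_tensorRight _))
      (tensor_of_unit_left α h Y)
    exact congrArg (fun t => t.app X) hab

lemma monoidal_natTrans_ext (hF : IsCocontLinear F) (α β : F ⟶ G) [NatTrans.IsMonoidal α]
    [NatTrans.IsMonoidal β] : α = β :=
  realCopower_natTrans_ext hF ((monoidal_app_unit α).trans (monoidal_app_unit β).symm)

end RealMonoidal

namespace SuperVect

lemma isMonoidal_of_odd {F G : SuperVect ⥤ SuperVect} [F.Monoidal] [G.Monoidal]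
    (hF : IsCocontLinear F) (α : F ⟶ G) (h : ε F ≫ α.app (𝟙_ SuperVect) = ε G)
    (h' : μ F oddLine oddLine ≫ α.app (oddLine ⊗ oddLine) =
      (α.app oddLine ⊗ₘ α.app oddLine) ≫ μ G oddLine oddLine) : NatTrans.IsMonoidal α where
  unit := h
  tensor X Y := by
    have left (X : SuperVect) (hX : μ F X oddLine ≫ α.app (X ⊗ oddLine) =
        (α.app X ⊗ₘ α.app oddLine) ≫ μ G X oddLine) (Y : SuperVect) :
        μ F X Y ≫ α.app (X ⊗ Y) = (α.app X ⊗ₘ α.app Y) ≫ μ G X Y := by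
      let a : F ⋙ tensorLeft (F.obj X) ⟶ tensorLeft X ⋙ G :=
        { app := fun Y => μ F X Y ≫ α.app (X ⊗ Y)
          naturality := fun Y Y' f => by
            change F.obj X ◁ F.map f ≫ μ F X Y' ≫ α.app (X ⊗ Y') =
              (μ F X Y ≫ α.app (X ⊗ Y)) ≫ G.map (X ◁ f)
            simp }
      let b : F ⋙ tensorLeft (F.obj X) ⟶ tensorLeft X ⋙ G :=
        { app := fun Y => (α.app X ⊗ₘ α.app Y) ≫ μ G X Y
          naturality := fun Y Y' f => by
            change F.obj X ◁ F.map f ≫ (α.app X ⊗ₘ α.app Y') ≫ μ G X Y' =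
              ((α.app X ⊗ₘ α.app Y) ≫ μ G X Y) ≫ G.map (X ◁ f)
            rw [Category.assoc, ← μ_natural_right]
            simp only [← id_tensorHom, tensorHom_comp_tensorHom_assoc, α.naturality,
              Category.id_comp, Category.comp_id] }
      have hab : a = b := natTrans_ext (hF.comp (isCocontLinear_tensorLeft _))
        (tensor_of_unit_right α h X) hX
      exact congrArg (fun t => t.app Y) hab
    let a : F ⋙ tensorRight (F.obj Y) ⟶ tensorRight Y ⋙ G :=
      { app := fun X => μ F X Y ≫ α.app (X ⊗ Y)
        naturality := fun X X' f => by
          change F.map f ▷ F.obj Y ≫ μ F X' Y ≫ α.app (X' ⊗ Y) =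
            (μ F X Y ≫ α.app (X ⊗ Y)) ≫ G.map (f ▷ Y)
          simp }
    let b : F ⋙ tensorRight (F.obj Y) ⟶ tensorRight Y ⋙ G :=
      { app := fun X => (α.app X ⊗ₘ α.app Y) ≫ μ G X Y
        naturality := fun X X' f => by
          change F.map f ▷ F.obj Y ≫ (α.app X' ⊗ₘ α.app Y) ≫ μ G X' Y =
            ((α.app X ⊗ₘ α.app Y) ≫ μ G X Y) ≫ G.map (f ▷ Y)
          rw [Category.assoc, ← μ_natural_left]
          simp only [← tensorHom_id, tensorHom_comp_tensorHom_assoc, α.naturality,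
            Category.id_comp, Category.comp_id] }
    have hab : a = b := natTrans_ext (hF.comp (isCocontLinear_tensorRight _))
      (tensor_of_unit_left α h Y) (left oddLine h' Y)
    exact congrArg (fun t => t.app X) hab

/-- Supervector spaces of dimension one. -/
def IsLine (X : SuperVect) : Prop := Nonempty (X ≅ 𝟙_ SuperVect) ∨ Nonempty (X ≅ oddLine)

lemma IsLine.of_iso {X Y : SuperVect} (h : IsLine Y) (e : X ≅ Y) : IsLine X :=
  h.imp (fun ⟨e'⟩ => ⟨e ≪≫ e'⟩) fun ⟨e'⟩ => ⟨e ≪≫ e'⟩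

lemma isLine_unit : IsLine (𝟙_ SuperVect) := Or.inl ⟨Iso.refl _⟩

lemma isLine_oddLine : IsLine oddLine := Or.inr ⟨Iso.refl _⟩

lemma smul_comp' {X Y Z : SuperVect} (z : ℂ) (f : X ⟶ Y) (g : Y ⟶ Z) :
    (z • f) ≫ g = z • f ≫ g := lin_injective fun x => (lin g).map_smul z (lin f x)

lemma comp_smul' {X Y Z : SuperVect} (z : ℂ) (f : X ⟶ Y) (g : Y ⟶ Z) :
    f ≫ (z • g) = z • f ≫ g := rfl

lemma smul_smul' {X Y : SuperVect} (z w : ℂ) (f : X ⟶ Y) : z • w • f = (z * w) • f :=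
  smul_smul z w f

lemma IsLine.exists_smul {X : SuperVect} (h : IsLine X) (f : X ⟶ X) : ∃ z : ℂ, f = z • 𝟙 X := by
  have key {Y : SuperVect} (e : X ≅ Y) (hY : ∀ f : Y ⟶ Y, ∃ z : ℂ, f = z • 𝟙 Y) :
      ∃ z : ℂ, f = z • 𝟙 X := by
    obtain ⟨z, hz⟩ := hY (e.inv ≫ f ≫ e.hom)
    refine ⟨z, ?_⟩
    rw [← cancel_epi e.inv, ← cancel_mono e.hom, Category.assoc, hz, comp_smul', smul_comp',
      Category.comp_id, e.inv_hom_id]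
  rcases h with ⟨⟨e⟩⟩ | ⟨⟨e⟩⟩
  · refine key e fun f => ⟨(lin f (1 : ℂ) : ℂ), lin_injective fun (x : ℂ) => ?_⟩
    have h := (lin f).map_smul x (1 : ℂ)
    exact ((congrArg (lin f) (mul_one x).symm).trans h).trans (mul_comm x (lin f (1 : ℂ) : ℂ))
  · refine key e fun f => ⟨(lin f (1 : ℂ) : ℂ), lin_injective fun (x : ℂ) => ?_⟩
    have h := (lin f).map_smul x (1 : ℂ)
    exact ((congrArg (lin f) (mul_one x).symm).trans h).trans (mul_comm x (lin f (1 : ℂ) : ℂ))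

lemma IsLine.smul_id {X : SuperVect} (h : IsLine X) {z : ℂ} (hz : z • 𝟙 X = 0) : z = 0 := by
  have key {Y : SuperVect} (e : X ≅ Y) (hY : z • 𝟙 Y = 0 → z = 0) : z = 0 := hY (by
    rw [← e.inv_hom_id, ← Category.id_comp e.hom, ← comp_smul', ← smul_comp', hz, zero_comp,
      comp_zero])
  rcases h with ⟨⟨e⟩⟩ | ⟨⟨e⟩⟩
  · refine key e fun h => ?_
    have := congrArg (fun f => (lin f (1 : ℂ) : ℂ)) h
    exact (mul_one z).symm.trans this
  · refine key e fun h => ?_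
    have := congrArg (fun f => (lin f (1 : ℂ) : ℂ)) h
    exact (mul_one z).symm.trans this

lemma imag_whiskerRight (X Y : SuperVect) : imag X ▷ Y = imag (X ⊗ Y) :=
  tensor_ext fun x y => smul_tm Complex.I x y

lemma imag_whiskerLeft (X Y : SuperVect) : X ◁ imag Y = imag (X ⊗ Y) :=
  tensor_ext fun x y => tm_smul Complex.I x y

section Functors

variable {F : SuperVect ⥤ SuperVect} [F.Monoidal] [F.Additive] [F.Linear ℝ]

variable (F) in
lemma exists_sign : ∃ s : ℝ, (s = 1 ∨ s = -1) ∧ ∀ X, F.map (imag X) = s • imag (F.obj X) := by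
  obtain ⟨z, hz⟩ := isLine_unit.exists_smul (ε F ≫ F.map (imag _) ≫ η F)
  have hz₂ : (z * z + 1) • 𝟙 (𝟙_ SuperVect) = 0 := by
    have h₁ : (ε F ≫ F.map (imag _) ≫ η F) ≫ ε F ≫ F.map (imag _) ≫ η F = -𝟙 _ := by
      simp only [Category.assoc, Functor.Monoidal.η_ε_assoc]
      rw [← F.map_comp_assoc, imag_imag, F.map_neg, F.map_id]
      simp
    rw [hz, comp_smul', smul_comp', Category.comp_id, smul_smul'] at h₁
    rw [add_smul, h₁, one_smul, neg_add_cancel]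
  have hz₃ : (z - Complex.I) * (z + Complex.I) = 0 := by
    have := isLine_unit.smul_id hz₂
    linear_combination this - Complex.I_mul_I
  have hs : ∃ s : ℝ, (s = 1 ∨ s = -1) ∧ z = s * Complex.I := by
    rcases mul_eq_zero.1 hz₃ with h | h
    · exact ⟨1, Or.inl rfl, by push_cast; linear_combination h⟩
    · exact ⟨-1, Or.inr rfl, by push_cast; linear_combination h⟩
  obtain ⟨s, hs, rfl⟩ := hs
  have h₁ : F.map (imag (𝟙_ SuperVect)) = s • imag _ := by
    have h₂ : ε F ≫ F.map (imag _) ≫ η F = s • imag (𝟙_ SuperVect) :=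
      hz.trans (smul_smul' _ _ _).symm
    rw [← cancel_epi (ε F), ← cancel_mono (η F), Category.assoc, h₂, Linear.comp_smul,
      Linear.smul_comp, imag_natural, Category.assoc, Functor.Monoidal.ε_η, Category.comp_id]
  refine ⟨s, hs, fun X => ?_⟩
  have h₂ : imag X = (λ_ X).inv ≫ imag (𝟙_ SuperVect) ▷ X ≫ (λ_ X).hom := by
    rw [imag_whiskerRight, ← imag_natural, Iso.inv_hom_id_assoc]
  have h₃ : F.map (imag (𝟙_ SuperVect) ▷ X) = s • imag _ := by
    rw [Functor.Monoidal.map_whiskerRight, h₁]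
    have : (s • imag (F.obj (𝟙_ SuperVect))) ▷ F.obj X = s • imag _ := by
      have := (isCocontLinear_tensorRight (F.obj X)).linear
      exact ((tensorRight (F.obj X)).map_smul s _).trans (congrArg (s • ·) (imag_whiskerRight _ _))
    rw [this, Linear.smul_comp, Linear.comp_smul, ← imag_natural, Functor.Monoidal.δ_μ_assoc]
  rw [h₂, F.map_comp, F.map_comp, h₃, Linear.smul_comp, Linear.comp_smul, ← imag_natural,
    ← F.map_comp_assoc, Iso.inv_hom_id, F.map_id, Category.id_comp]

/-- The morphism from the even line given by an even element. -/
def evenElem {X : SuperVect} (x : X.V) (h : parity X x = x) : 𝟙_ SuperVect ⟶ X :=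
  mkHom (X := 𝟙_ SuperVect) (LinearMap.toSpanSingleton ℂ X.V x) fun (z : ℂ) => by
    change z • x = parity X (z • x)
    rw [map_smul, h]

/-- The morphism from the odd line given by an odd element. -/
def oddElem {X : SuperVect} (x : X.V) (h : parity X x = -x) : oddLine ⟶ X :=
  mkHom (X := oddLine) (LinearMap.toSpanSingleton ℂ X.V x) fun (z : ℂ) => by
    refine (congrArg _ (parity_odd (ModuleCat.of ℂ ℂ) z)).trans ?_
    change (-z) • x = parity X (z • x)
    rw [map_smul, h, smul_neg, neg_smul]

omit [F.Linear ℝ] in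
variable (F) in
lemma exists_oddLineIso [F.IsEquivalence] : Nonempty (F.obj oddLine ≅ oddLine) := by
  have h₁ (x : (F.obj oddLine).V) (hx : parity _ x = x) : x = 0 := by
    obtain ⟨m, hm⟩ := F.map_surjective (η F ≫ evenElem x hx)
    have hm' : m = 0 := decomp.zero₀₁ (x := ModuleCat.of ℂ ℂ) (y := ModuleCat.of ℂ ℂ) m
    rw [hm', F.map_zero] at hm
    have h₂ : evenElem x hx = 0 := by rw [← cancel_epi (η F), ← hm, comp_zero]
    exact (one_smul ℂ x).symm.trans (congrArg (fun f => lin f (1 : ℂ)) h₂)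
  have h₂ (x : (F.obj oddLine).V) : parity _ x = -x := by
    have := h₁ (x + parity _ x) (by rw [map_add, parity_parity, add_comm])
    exact (neg_eq_of_add_eq_zero_right this).symm
  have h₃ : ∃ x : (F.obj oddLine).V, x ≠ 0 := by
    by_contra! h
    have h' : F.map (𝟙 oddLine) = F.map 0 := lin_injective fun x => (h _).trans (h _).symm
    have h'' := isLine_oddLine.smul_id (z := 1) (by rw [one_smul, F.map_injective h'])
    exact one_ne_zero h''
  obtain ⟨x, hx⟩ := h₃
  obtain ⟨φ, hφ⟩ : ∃ φ : Module.Dual ℂ (F.obj oddLine).V, φ x ≠ 0 := by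
    by_contra! h
    exact hx ((Module.forall_dual_apply_eq_zero_iff ℂ x).1 h)
  let a : oddLine ⟶ F.obj oddLine := oddElem x (h₂ x)
  let b : F.obj oddLine ⟶ oddLine := mkHom (Y := oddLine) ((φ x)⁻¹ • φ) fun y => by
    refine Eq.trans ?_ (parity_odd (ModuleCat.of ℂ ℂ) _).symm
    rw [h₂]
    exact map_neg ((φ x)⁻¹ • φ) y
  have hab : a ≫ b = 𝟙 oddLine := lin_injective fun (z : ℂ) => by
    change (φ x)⁻¹ * φ (z • x) = z
    rw [map_smul, smul_eq_mul]
    field_simp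
  obtain ⟨m, hm⟩ := F.map_surjective (b ≫ a)
  obtain ⟨z, rfl⟩ := isLine_oddLine.exists_smul m
  have hz : (z * z - z) • 𝟙 oddLine = 0 := by
    have h₄ : F.map (z • 𝟙 oddLine) ≫ F.map (z • 𝟙 oddLine) = F.map (z • 𝟙 oddLine) := by
      rw [hm, Category.assoc, reassoc_of% hab]
    rw [← F.map_comp] at h₄
    have h₅ := F.map_injective h₄
    rw [comp_smul', smul_comp', Category.comp_id, smul_smul'] at h₅
    rw [sub_smul, h₅, sub_self]
  have hz' : z * (z - 1) = 0 := by linear_combination isLine_oddLine.smul_id hz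
  refine ⟨⟨b, a, ?_, hab⟩⟩
  rcases mul_eq_zero.1 hz' with h | h
  · exfalso
    rw [h, zero_smul, F.map_zero] at hm
    have h₄ : 𝟙 oddLine = 0 := by
      rw [← Category.comp_id (𝟙 oddLine), ← hab, Category.assoc, ← reassoc_of% hm, zero_comp,
        comp_zero]
    exact one_ne_zero (isLine_oddLine.smul_id (z := 1) (by rw [one_smul, h₄]))
  · rw [← hm, sub_eq_zero.1 h, one_smul, F.map_id]

end Functors

section Classification

variable {F G : SuperVect ⥤ SuperVect} [F.Monoidal] [F.Additive] [F.Linear ℝ] [G.Monoidal]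
  [G.Additive] [G.Linear ℝ]

variable (F) in
lemma isLine_obj_unit : IsLine (F.obj (𝟙_ SuperVect)) :=
  Or.inl ⟨(Functor.Monoidal.εIso F).symm⟩

variable (F) in
lemma isLine_obj_oddLine [F.IsEquivalence] : IsLine (F.obj oddLine) :=
  Or.inr (exists_oddLineIso F)

lemma smul_tensorHom (z w : ℂ) {X Y X' Y' : SuperVect} (f : X ⟶ X') (g : Y ⟶ Y') :
    (z • f) ⊗ₘ (w • g) = (z * w) • (f ⊗ₘ g) := tensor_ext fun x y => by
  change tm (z • lin f x) (w • lin g y) = (z * w) • tm (lin f x) (lin g y)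
  rw [smul_tm, tm_smul, smul_smul]

lemma exists_monoidalIso [F.IsEquivalence] [G.IsEquivalence] {s : ℝ}
    (hF : ∀ X, F.map (imag X) = s • imag (F.obj X))
    (hG : ∀ X, G.map (imag X) = s • imag (G.obj X)) :
    ∃ α : F ≅ G, NatTrans.IsMonoidal α.hom := by
  have cF : IsCocontLinear F := isCocontLinear_of_isEquivalence
  have cG : IsCocontLinear G := isCocontLinear_of_isEquivalence
  obtain ⟨e⟩ := exists_oddLineIso F
  obtain ⟨e'⟩ := exists_oddLineIso G
  have key (t : F.obj oddLine ≅ G.obj oddLine) : ∃ α : F ≅ G,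
      α.hom.app (𝟙_ SuperVect) = η F ≫ ε G ∧ α.hom.app oddLine = t.hom :=
    exists_natIso cF cG ((Functor.Monoidal.εIso F).symm ≪≫ Functor.Monoidal.εIso G) t
      (by rw [hF, hG, Linear.smul_comp, Linear.comp_smul, imag_natural])
      (by rw [hF, hG, Linear.smul_comp, Linear.comp_smul, imag_natural])
  let t : F.obj oddLine ≅ G.obj oddLine := e ≪≫ e'.symm
  obtain ⟨α, hα₀, hα₁⟩ := key t
  let q : F.obj oddLine ⊗ F.obj oddLine ≅ G.obj (oddLine ⊗ oddLine) :=
    (t ⊗ᵢ t) ≪≫ Functor.Monoidal.μIso G oddLine oddLine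
  let p : F.obj oddLine ⊗ F.obj oddLine ≅ G.obj (oddLine ⊗ oddLine) :=
    Functor.Monoidal.μIso F oddLine oddLine ≪≫ α.app _
  have hl : IsLine (G.obj (oddLine ⊗ oddLine)) :=
    (isLine_obj_unit G).of_iso (G.mapIso oddLineTensor)
  obtain ⟨z, hz⟩ := hl.exists_smul (q.inv ≫ p.hom)
  have hz' : z ≠ 0 := by
    rintro rfl
    rw [zero_smul] at hz
    refine one_ne_zero (hl.smul_id (z := 1) ?_)
    rw [one_smul, ← (q.symm ≪≫ p).inv_hom_id]
    exact (congrArg (_ ≫ ·) hz).trans comp_zero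
  have hp : p.hom = z • q.hom := by
    rw [← cancel_epi q.inv, hz, comp_smul', q.inv_hom_id]
  obtain ⟨w, rfl⟩ := IsAlgClosed.exists_eq_mul_self z
  have hw : w ≠ 0 := fun h => hz' (by rw [h, zero_mul])
  let t' : F.obj oddLine ≅ G.obj oddLine :=
    { hom := w • t.hom
      inv := w⁻¹ • t.inv
      hom_inv_id := by
        rw [smul_comp', comp_smul', smul_smul', mul_inv_cancel₀ hw, one_smul, t.hom_inv_id]
      inv_hom_id := by
        rw [smul_comp', comp_smul', smul_smul', inv_mul_cancel₀ hw, one_smul, t.inv_hom_id] }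
  obtain ⟨β, hβ₀, hβ₁⟩ := key t'
  have hβ : β.hom.app (oddLine ⊗ oddLine) = α.hom.app (oddLine ⊗ oddLine) := by
    rw [← cancel_mono (G.map oddLineTensor.hom), ← β.hom.naturality, ← α.hom.naturality, hα₀, hβ₀]
  refine ⟨β, isMonoidal_of_odd cF β.hom (by rw [hβ₀, Functor.Monoidal.ε_η_assoc]) ?_⟩
  rw [hβ₁, hβ]
  refine hp.trans ?_
  change (w * w) • (t.hom ⊗ₘ t.hom) ≫ μ G oddLine oddLine =
    ((w • t.hom) ⊗ₘ (w • t.hom)) ≫ μ G oddLine oddLine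
  rw [smul_tensorHom, smul_comp']

lemma monoidal_eq_or [F.IsEquivalence] [G.IsEquivalence] (α β : F ≅ G)
    [NatTrans.IsMonoidal α.hom] [NatTrans.IsMonoidal β.hom] :
    β.hom = α.hom ∨ ∀ X, β.hom.app X = α.hom.app X ≫ parityHom (G.obj X) := by
  have cF : IsCocontLinear F := isCocontLinear_of_isEquivalence
  have h₀ : β.hom.app (𝟙_ SuperVect) = α.hom.app (𝟙_ SuperVect) :=
    (monoidal_app_unit β.hom).trans (monoidal_app_unit α.hom).symm
  have h₂ : β.hom.app (oddLine ⊗ oddLine) = α.hom.app (oddLine ⊗ oddLine) := by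
    rw [← cancel_mono (G.map oddLineTensor.hom), ← β.hom.naturality, ← α.hom.naturality, h₀]
  obtain ⟨z, hz⟩ := (isLine_obj_oddLine G).exists_smul (α.inv.app oddLine ≫ β.hom.app oddLine)
  have hz₁ : β.hom.app oddLine = z • α.hom.app oddLine := by
    rw [← cancel_epi (α.inv.app oddLine), hz, comp_smul', Iso.inv_hom_id_app]
  have hz₂ : (z * z - 1) • 𝟙 (G.obj (oddLine ⊗ oddLine)) = 0 := by
    have h₃ : (z * z) • (α.hom.app oddLine ⊗ₘ α.hom.app oddLine) ≫ μ G oddLine oddLine =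
        (α.hom.app oddLine ⊗ₘ α.hom.app oddLine) ≫ μ G oddLine oddLine := by
      have a := NatTrans.IsMonoidal.tensor (τ := α.hom) oddLine oddLine
      have b := NatTrans.IsMonoidal.tensor (τ := β.hom) oddLine oddLine
      rw [hz₁, smul_tensorHom, smul_comp', h₂, a] at b
      exact b.symm
    rw [← cancel_epi ((α.hom.app oddLine ⊗ₘ α.hom.app oddLine) ≫ μ G oddLine oddLine), comp_smul',
      comp_zero, Category.comp_id, sub_smul, h₃, one_smul, sub_self]
  have hl : IsLine (G.obj (oddLine ⊗ oddLine)) :=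
    (isLine_obj_unit G).of_iso (G.mapIso oddLineTensor)
  have hz₃ : (z - 1) * (z + 1) = 0 := by linear_combination hl.smul_id hz₂
  rcases mul_eq_zero.1 hz₃ with h | h
  · refine Or.inl (natTrans_ext cF h₀ ?_)
    rw [hz₁, sub_eq_zero.1 h, one_smul]
  · right
    let γ : F ⟶ G :=
      { app := fun X => α.hom.app X ≫ parityHom (G.obj X)
        naturality := fun X Y f => by
          rw [Category.assoc, ← parityHom_natural, reassoc_of% α.hom.naturality] }
    have hγ : β.hom = γ := by
      refine natTrans_ext cF ?_ ?_
      · change _ = α.hom.app _ ≫ parityHom _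
        rw [h₀, ← cancel_mono (η G), Category.assoc, ← parityHom_natural]
        rw [show parityHom (𝟙_ SuperVect) = 𝟙 _ from rfl, Category.comp_id]
      · change _ = α.hom.app _ ≫ parityHom _
        obtain ⟨e⟩ := exists_oddLineIso G
        have h₃ : parityHom (G.obj oddLine) = -𝟙 _ := by
          rw [← cancel_mono e.hom, ← parityHom_natural,
            show parityHom oddLine = -𝟙 _ from parityHom_odd _]
          simp
        rw [hz₁, h₃, eq_neg_of_add_eq_zero_left h, neg_smul, one_smul]
        simp
    exact fun X => congrArg (fun t => t.app X) hγ

end Classification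

end SuperVect


/-- The automorphism group of supervector spaces over the reals. -/
abbrev SuperAut : Type 1 := Aut vectToSuperVect

/-- The category of homogeneous operators on modules. -/
abbrev SuperSemi : Type 1 := SemiProd vectToSuperVect

lemma isCocontLinear_comp_aut (g : SuperAut) : IsCocontLinear (vectToSuperVect ⋙ g.functor) :=
  isCocontLinear_vectToSuperVect.comp isCocontLinear_of_isEquivalence

namespace SuperAut

lemma comm_of_isMonoidal {g h : SuperAut} (α : g.functor ⟶ h.functor) [NatTrans.IsMonoidal α]
    (c : ModuleCat.{0} ℝ) : α.app (vectToSuperVect.obj c) ≫ h.triangle.hom.app c =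
      g.triangle.hom.app c := by
  have : NatTrans.IsMonoidal (Functor.whiskerLeft vectToSuperVect α ≫ h.triangle.hom) :=
    inferInstance
  have h' := monoidal_natTrans_ext (isCocontLinear_comp_aut g)
    (Functor.whiskerLeft vectToSuperVect α ≫ h.triangle.hom) g.triangle.hom
  exact congrArg (fun t => t.app c) h'

/-- Complex conjugation, as an automorphism. -/
def conj : SuperAut where
  functor := conjFunctor
  triangle := (realCopower_exists_natIso
    (isCocontLinear_vectToSuperVect.comp isCocontLinear_of_isEquivalence)
    isCocontLinear_vectToSuperVect
    ((Functor.Monoidal.εIso (vectToSuperVect ⋙ conjFunctor)).symm ≪≫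
      Functor.Monoidal.εIso vectToSuperVect)).choose
  triangle_isMonoidal := isMonoidal_of_unit
    (isCocontLinear_vectToSuperVect.comp isCocontLinear_of_isEquivalence) _ (by
      have h := (realCopower_exists_natIso
        (isCocontLinear_vectToSuperVect.comp isCocontLinear_of_isEquivalence)
        isCocontLinear_vectToSuperVect
        ((Functor.Monoidal.εIso (vectToSuperVect ⋙ conjFunctor)).symm ≪≫
          Functor.Monoidal.εIso vectToSuperVect)).choose_spec
      refine (congrArg (ε (vectToSuperVect ⋙ conjFunctor) ≫ ·) h).trans ?_
      exact (Functor.Monoidal.ε_η_assoc _ _))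

instance : NatTrans.IsMonoidal conjConj.hom where
  unit := lin_injective fun (z : ℂ) => starRingEnd_self_apply z
  tensor _ _ := conj_tensor_ext fun _ _ => rfl

/-- Complex conjugation is an involution. -/
def conjSq : conj ⊗ conj ≅ 𝟙_ SuperAut :=
  Aut.isoMk (g := conj ⊗ conj) (h := 𝟙_ SuperAut) conjConj
    (inferInstanceAs (NatTrans.IsMonoidal conjConj.hom))
    (@comm_of_isMonoidal (conj ⊗ conj) (𝟙_ SuperAut) conjConj.hom
      (inferInstanceAs (NatTrans.IsMonoidal conjConj.hom)))

lemma conjSq_whisker : conjSq.hom ▷ conj ≫ (λ_ conj).hom =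
    (α_ conj conj conj).hom ≫ conj ◁ conjSq.hom ≫ (ρ_ conj).hom :=
  Aut.hom_ext' fun _ => rfl

/-- The parity of supervector spaces, as an automorphism of the identity. -/
def parityAut : 𝟙_ SuperAut ≅ 𝟙_ SuperAut :=
  let e : 𝟭 SuperVect ≅ 𝟭 SuperVect := NatIso.ofComponents (F := 𝟭 SuperVect) (G := 𝟭 SuperVect)
    (fun X => ⟨parityHom X, parityHom X, parityHom_parityHom X, parityHom_parityHom X⟩)
    (fun f => parityHom_natural f)
  have he : NatTrans.IsMonoidal e.hom :=
    { unit := rfl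
      tensor := fun X Y => (Category.id_comp _).trans
        ((parityHom_tensor X Y).trans (Category.comp_id _).symm) }
  Aut.isoMk (g := 𝟙_ SuperAut) (h := 𝟙_ SuperAut) e he
    (@comm_of_isMonoidal (𝟙_ SuperAut) (𝟙_ SuperAut) e.hom he)

/-- The parity, as an automorphism of an automorphism. -/
def twist (g : SuperAut) : g ⟶ g := (λ_ g).inv ≫ parityAut.hom ▷ g ≫ (λ_ g).hom

lemma twist_app (g : SuperAut) (X : SuperVect) :
    (twist g).trans.app X = parityHom (g.functor.obj X) := by
  change 𝟙 _ ≫ parityHom (g.functor.obj X) ≫ 𝟙 _ = _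
  simp

lemma hom_eq_or {g h : SuperAut} (a b : g ⟶ h) : b = a ∨ b = a ≫ twist h := by
  have : NatTrans.IsMonoidal (asIso a.trans).hom := a.isMonoidal
  have : NatTrans.IsMonoidal (asIso b.trans).hom := b.isMonoidal
  rcases monoidal_eq_or (asIso a.trans) (asIso b.trans) with h' | h'
  · exact Or.inl (Aut.hom_ext h')
  · refine Or.inr (Aut.hom_ext' fun X => (h' X).trans ?_)
    rw [← twist_app]
    rfl

lemma nonempty_iso (g : SuperAut) : Nonempty (𝟙_ SuperAut ≅ g) ∨ Nonempty (conj ≅ g) := by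
  obtain ⟨s, hs, hg⟩ := exists_sign g.functor
  have key {h : SuperAut} (hh : ∀ X, h.functor.map (imag X) = s • imag (h.functor.obj X)) :
      Nonempty (h ≅ g) := by
    obtain ⟨α, hα⟩ := exists_monoidalIso hh hg
    exact ⟨Aut.isoMk α hα (comm_of_isMonoidal α.hom)⟩
  rcases hs with rfl | rfl
  · exact Or.inl (key fun X => (one_smul ℝ (imag X)).symm)
  · exact Or.inr (key fun X => (conj_imag X).trans (by rw [neg_one_smul]; rfl))

end SuperAut

section UnitEnd

open MonoidalCategory MonoidalLeftAction Functor.LaxLeftLinear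

variable {E : Type u} [Category.{v} E] [MonoidalCategory E] {V : Type u₁} [Category.{v₁} V]
  [MonoidalLeftAction E V]

/-- The natural endomorphism of the identity induced by an endomorphism of the unit. -/
def unitEnd (s : 𝟙_ E ⟶ 𝟙_ E) (w : V) : w ⟶ w := (λₗ[E] w).inv ≫ s ⊵ₗ w ≫ (λₗ[E] w).hom

lemma unitEnd_natural (s : 𝟙_ E ⟶ 𝟙_ E) {w w' : V} (f : w ⟶ w') :
    f ≫ unitEnd s w' = unitEnd s w ≫ f := by
  simp only [unitEnd, Category.assoc]
  have h := actionUnitIso_hom_naturality (C := E) f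
  rw [← cancel_epi (λₗ[E] w).hom, reassoc_of% h, Iso.hom_inv_id_assoc, Iso.hom_inv_id_assoc, h,
    action_exchange_assoc]

lemma unitEnd_id (w : V) : unitEnd (𝟙 (𝟙_ E)) w = 𝟙 w := by simp [unitEnd]

lemma unitEnd_comp (s t : 𝟙_ E ⟶ 𝟙_ E) (w : V) :
    unitEnd (s ≫ t) w = unitEnd s w ≫ unitEnd t w := by
  simp [unitEnd, comp_actionHomLeft]

lemma leftUnitor_inv_actionHomLeft (e : E) (w : V) :
    (λ_ e).inv ⊵ₗ w ≫ (αₗ (𝟙_ E) e w).hom = (λₗ[E] (e ⊙ₗ w)).inv := by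
  rw [← cancel_mono (λₗ[E] (e ⊙ₗ w)).hom, Category.assoc, ← leftUnitor_actionHom,
    ← comp_actionHomLeft]
  simp

lemma rightUnitor_inv_actionHomLeft (e : E) (w : V) :
    (ρ_ e).inv ⊵ₗ w ≫ (αₗ e (𝟙_ E) w).hom = e ⊴ₗ (λₗ[E] w).inv := by
  rw [← cancel_mono (e ⊴ₗ (λₗ[E] w).hom), Category.assoc, ← rightUnitor_actionHom,
    ← comp_actionHomLeft, ← actionHomRight_comp]
  simp

lemma unitEnd_action (s : 𝟙_ E ⟶ 𝟙_ E) (e : E) (w : V) :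
    unitEnd s (e ⊙ₗ w) = ((λ_ e).inv ≫ s ▷ e ≫ (λ_ e).hom) ⊵ₗ w := by
  simp only [unitEnd, comp_actionHomLeft, whiskerRight_actionHomLeft, leftUnitor_actionHom,
    Category.assoc, Iso.inv_hom_id_assoc]
  rw [reassoc_of% leftUnitor_inv_actionHomLeft]

lemma action_unitEnd (s : 𝟙_ E ⟶ 𝟙_ E) (e : E) (w : V) :
    e ⊴ₗ unitEnd s w = ((ρ_ e).inv ≫ e ◁ s ≫ (ρ_ e).hom) ⊵ₗ w := by
  simp only [unitEnd, comp_actionHomLeft, whiskerLeft_actionHomLeft, rightUnitor_actionHom,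
    actionHomRight_comp, Category.assoc, Iso.inv_hom_id_assoc]
  rw [reassoc_of% rightUnitor_inv_actionHomLeft]

/-- The isomorphism `c • (c • w) ≅ w` induced by `c ⊗ c ≅ 1`. -/
def actInv {c : E} (q : c ⊗ c ≅ 𝟙_ E) (w : V) : c ⊙ₗ c ⊙ₗ w ≅ w :=
  (αₗ c c w).symm ≪≫ leftIso q w ≪≫ λₗ[E] w

lemma actInv_hom {c : E} (q : c ⊗ c ≅ 𝟙_ E) (w : V) :
    (actInv q w).hom = (αₗ c c w).inv ≫ q.hom ⊵ₗ w ≫ (λₗ[E] w).hom := rfl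

lemma actInv_natural {c : E} (q : c ⊗ c ≅ 𝟙_ E) {w w' : V} (f : w ⟶ w') :
    c ⊴ₗ c ⊴ₗ f ≫ (actInv q w').hom = (actInv q w).hom ≫ f := by
  rw [actInv_hom, actInv_hom, Category.assoc, Category.assoc,
    actionUnitIso_hom_naturality (C := E) f, ← action_exchange_assoc]
  simp

lemma actInv_action {c : E} (q : c ⊗ c ≅ 𝟙_ E)
    (hq : q.hom ▷ c ≫ (λ_ c).hom = (α_ c c c).hom ≫ c ◁ q.hom ≫ (ρ_ c).hom) (w : V) :
    (actInv q (c ⊙ₗ w)).hom = c ⊴ₗ (actInv q w).hom := by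
  have h := congrArg (· ⊵ₗ w) hq
  simp only [comp_actionHomLeft, whiskerRight_actionHomLeft, whiskerLeft_actionHomLeft,
    leftUnitor_actionHom, rightUnitor_actionHom, Category.assoc, Iso.inv_hom_id_assoc] at h
  have h' := associator_actionHom c c c w
  rw [actInv_hom, actInv_hom, ← cancel_epi (αₗ c c (c ⊙ₗ w)).hom,
    ← cancel_epi (αₗ (c ⊗ c) c w).hom, Iso.hom_inv_id_assoc, h, ← reassoc_of% h',
    actionHomRight_comp, actionHomRight_comp, ← actionHomRight_comp_assoc]
  simp

end UnitEnd

section SuperMod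

open MonoidalCategory MonoidalLeftAction SemiProd SuperVect SuperAut Functor.LaxMonoidal
  Functor.OplaxMonoidal

/-- The inclusion of supervector spaces into the homogeneous operators. -/
abbrev inclL : SuperVect ⥤ SuperSemi := inclD vectToSuperVect

/-- The inclusion of automorphisms into the homogeneous operators. -/
abbrev inclJ : SuperAut ⥤ SuperSemi := inclG vectToSuperVect

/-- The imaginary unit, as an endomorphism of the unit. -/
def imagEnd : 𝟙_ SuperSemi ⟶ 𝟙_ SuperSemi := inclL.map (imag (𝟙_ SuperVect))

/-- The parity, as an endomorphism of the unit. -/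
def parityEnd : 𝟙_ SuperSemi ⟶ 𝟙_ SuperSemi := inclJ.map parityAut.hom

lemma parityEnd_comp : parityEnd ≫ parityEnd = 𝟙 _ := by
  refine hom_ext (Category.comp_id _) (Aut.hom_ext' fun X => parityHom_parityHom X)

lemma whisker_imagEnd_inclL (d : SuperVect) :
    (ρ_ (inclL.obj d)).inv ≫ inclL.obj d ◁ imagEnd ≫ (ρ_ (inclL.obj d)).hom =
      inclL.map (imag d) := by
  rw [Iso.inv_comp_eq]
  exact hom_ext
    (show d ◁ imag (𝟙_ SuperVect) ≫ d ◁ 𝟙 (𝟙_ SuperVect) ≫ (ρ_ d).hom =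
        (d ◁ 𝟙 (𝟙_ SuperVect) ≫ (ρ_ d).hom) ≫ imag d by
      rw [whiskerLeft_id, Category.id_comp, imag_whiskerLeft, imag_natural])
    (Aut.hom_ext' fun X => rfl)

lemma whisker_imagEnd_conj :
    (ρ_ (inclJ.obj conj)).inv ≫ inclJ.obj conj ◁ imagEnd ≫ (ρ_ (inclJ.obj conj)).hom =
    (λ_ (inclJ.obj conj)).inv ≫ (inclL.map (-imag (𝟙_ SuperVect)) : 𝟙_ SuperSemi ⟶ 𝟙_ SuperSemi) ▷
      inclJ.obj conj ≫ (λ_ (inclJ.obj conj)).hom := by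
  have h : (λ_ (inclJ.obj conj)).inv ≫ (inclL.map (-imag (𝟙_ SuperVect)) :
      𝟙_ SuperSemi ⟶ 𝟙_ SuperSemi) ▷ inclJ.obj conj ≫ (λ_ (inclJ.obj conj)).hom =
      Hom.mk (x := inclJ.obj conj) (y := inclJ.obj conj) (-imag (𝟙_ SuperVect)) (𝟙 conj) := by
    rw [Iso.inv_comp_eq]
    exact hom_ext
      (show ((-imag (𝟙_ SuperVect)) ⊗ₘ 𝟙 (𝟙_ SuperVect)) ≫ (λ_ (𝟙_ SuperVect)).hom =
          (λ_ (𝟙_ SuperVect)).hom ≫ (-imag (𝟙_ SuperVect)) by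
        rw [tensorHom_id, show (-imag (𝟙_ SuperVect)) ▷ 𝟙_ SuperVect = -(imag (𝟙_ SuperVect) ▷ 𝟙_ SuperVect) from
            (tensorRight (𝟙_ SuperVect)).map_neg, imag_whiskerRight,
          Preadditive.neg_comp, Preadditive.comp_neg, imag_natural])
      (Aut.hom_ext' fun X => rfl)
  rw [h, Iso.inv_comp_eq]
  exact hom_ext
    (show 𝟙_ SuperVect ◁ conjFunctor.map (imag (𝟙_ SuperVect)) ≫ 𝟙_ SuperVect ◁ η conjFunctor ≫
          (ρ_ (𝟙_ SuperVect)).hom =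
        (𝟙_ SuperVect ◁ η conjFunctor ≫ (ρ_ (𝟙_ SuperVect)).hom) ≫ (-imag (𝟙_ SuperVect)) by
      rw [conj_imag, show 𝟙_ SuperVect ◁ (-imag (conjFunctor.obj (𝟙_ SuperVect))) =
          -(𝟙_ SuperVect ◁ imag _) from (tensorLeft (𝟙_ SuperVect)).map_neg, imag_whiskerLeft,
        Preadditive.neg_comp, Preadditive.comp_neg, imag_natural])
    (Aut.hom_ext' fun X => rfl)

lemma parityEnd_whisker_inclL (d : SuperVect) :
    (λ_ (inclL.obj d)).inv ≫ parityEnd ▷ inclL.obj d ≫ (λ_ (inclL.obj d)).hom =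
      inclL.map (parityHom d) ≫
      (ρ_ (inclL.obj d)).inv ≫ inclL.obj d ◁ parityEnd ≫ (ρ_ (inclL.obj d)).hom := by
  have h : (ρ_ (inclL.obj d)).inv ≫ inclL.obj d ◁ parityEnd ≫ (ρ_ (inclL.obj d)).hom =
      Hom.mk (x := inclL.obj d) (y := inclL.obj d) (𝟙 d) parityAut.hom := by
    rw [Iso.inv_comp_eq]
    exact hom_ext
      (show d ◁ 𝟙 (𝟙_ SuperVect) ≫ d ◁ 𝟙 (𝟙_ SuperVect) ≫ (ρ_ d).hom =
          (d ◁ 𝟙 (𝟙_ SuperVect) ≫ (ρ_ d).hom) ≫ 𝟙 d by simp)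
      (Aut.hom_ext' fun X => rfl)
  rw [h, Iso.inv_comp_eq]
  exact hom_ext
    (show (𝟙 (𝟙_ SuperVect) ⊗ₘ parityHom d) ≫ (λ_ d).hom =
        (λ_ d).hom ≫ parityHom d ≫ 𝟙 d by
      rw [id_tensorHom, leftUnitor_naturality, Category.comp_id])
    (Aut.hom_ext' fun X => show parityHom X ≫ 𝟙 X = 𝟙 X ≫ 𝟙 X ≫ parityHom X by simp)

lemma parityEnd_whisker_inclJ (g : SuperAut) :
    (λ_ (inclJ.obj g)).inv ≫ parityEnd ▷ inclJ.obj g ≫ (λ_ (inclJ.obj g)).hom =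
      inclJ.map (twist g) := by
  rw [Iso.inv_comp_eq]
  exact hom_ext
    (show (𝟙 (𝟙_ SuperVect) ⊗ₘ parityHom (𝟙_ SuperVect)) ≫ (λ_ (𝟙_ SuperVect)).hom =
        (λ_ (𝟙_ SuperVect)).hom ≫ 𝟙 _ by
      rw [show parityHom (𝟙_ SuperVect) = 𝟙 _ from rfl]
      simp)
    (Aut.hom_ext' fun X => show parityHom _ ≫ 𝟙 _ = 𝟙 _ ≫ (twist g).trans.app X by
      rw [twist_app, Category.comp_id, Category.id_comp])

lemma parityEnd_whisker_conj :
    (λ_ (inclJ.obj conj)).inv ≫ parityEnd ▷ inclJ.obj conj ≫ (λ_ (inclJ.obj conj)).hom =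
      (ρ_ (inclJ.obj conj)).inv ≫ inclJ.obj conj ◁ parityEnd ≫ (ρ_ (inclJ.obj conj)).hom := by
  have h : (ρ_ (inclJ.obj conj)).inv ≫ inclJ.obj conj ◁ parityEnd ≫ (ρ_ (inclJ.obj conj)).hom =
      Hom.mk (x := inclJ.obj conj) (y := inclJ.obj conj) (𝟙 _) (twist conj) := by
    rw [Iso.inv_comp_eq]
    refine hom_ext
      (show 𝟙_ SuperVect ◁ conjFunctor.map (𝟙 (𝟙_ SuperVect)) ≫ 𝟙_ SuperVect ◁ η conjFunctor ≫
          (ρ_ (𝟙_ SuperVect)).hom =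
        (𝟙_ SuperVect ◁ η conjFunctor ≫ (ρ_ (𝟙_ SuperVect)).hom) ≫ 𝟙 _ by simp)
      (Aut.hom_ext' fun X =>
        show conjFunctor.map (parityHom X) ≫ 𝟙 _ = 𝟙 _ ≫ (twist conj).trans.app X from ?_)
    rw [twist_app, Category.comp_id, Category.id_comp]
    exact conj_ext fun x => rfl
  exact (parityEnd_whisker_inclJ conj).trans h.symm

/-- Complex conjugation is an involution. -/
def conjSqSemi : inclJ.obj conj ⊗ inclJ.obj conj ≅ 𝟙_ SuperSemi :=
  Functor.Monoidal.μIso inclJ conj conj ≪≫ inclJ.mapIso conjSq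

lemma conjSqSemi_whisker : conjSqSemi.hom ▷ inclJ.obj conj ≫ (λ_ (inclJ.obj conj)).hom =
    (α_ _ _ _).hom ≫ inclJ.obj conj ◁ conjSqSemi.hom ≫ (ρ_ (inclJ.obj conj)).hom := by
  have hl : (λ_ (inclJ.obj conj)).hom = μ inclJ (𝟙_ _) conj ≫ inclJ.map (λ_ conj).hom := by
    have h := Functor.LaxMonoidal.left_unitality inclJ conj
    have h' : ε inclJ ▷ inclJ.obj conj = 𝟙 (𝟙_ SuperSemi ⊗ inclJ.obj conj) :=
      id_whiskerRight (𝟙_ SuperSemi) (inclJ.obj conj)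
    exact h.trans ((congrArg (· ≫ _) h').trans (Category.id_comp _))
  have hr : (ρ_ (inclJ.obj conj)).hom = μ inclJ conj (𝟙_ _) ≫ inclJ.map (ρ_ conj).hom := by
    have h := Functor.LaxMonoidal.right_unitality inclJ conj
    have h' : inclJ.obj conj ◁ ε inclJ = 𝟙 (inclJ.obj conj ⊗ 𝟙_ SuperSemi) :=
      whiskerLeft_id (inclJ.obj conj) (𝟙_ SuperSemi)
    exact h.trans ((congrArg (· ≫ _) h').trans (Category.id_comp _))
  have h := congrArg (μ inclJ conj conj ▷ inclJ.obj conj ≫ μ inclJ (conj ⊗ conj) conj ≫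
    inclJ.map ·) conjSq_whisker
  simp only [Functor.map_comp] at h
  rw [Functor.LaxMonoidal.associativity_assoc, ← μ_natural_left_assoc,
    ← μ_natural_right_assoc] at h
  have h₁ : conjSqSemi.hom ▷ inclJ.obj conj =
      μ inclJ conj conj ▷ inclJ.obj conj ≫ inclJ.map conjSq.hom ▷ inclJ.obj conj :=
    comp_whiskerRight _ _ _
  have h₂ : inclJ.obj conj ◁ conjSqSemi.hom =
      inclJ.obj conj ◁ μ inclJ conj conj ≫ inclJ.obj conj ◁ inclJ.map conjSq.hom :=
    MonoidalCategory.whiskerLeft_comp _ _ _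
  rw [hl, hr, h₁, h₂]
  refine (Category.assoc _ _ _).trans (h.trans ?_)
  exact congrArg (_ ≫ ·) (Category.assoc _ _ _).symm

/-- Every operator is a product of a supervector space and an automorphism. -/
def semiIso (e : SuperSemi) : inclL.obj e.fst ⊗ inclJ.obj e.snd ≅ e :=
  SemiProd.isoMk (x := inclL.obj e.fst ⊗ inclJ.obj e.snd) (y := e) (ρ_ e.fst) (λ_ e.snd)

/-- The tensor square of the odd line. -/
def oddSqSemi : inclL.obj oddLine ⊗ inclL.obj oddLine ≅ 𝟙_ SuperSemi :=
  Functor.Monoidal.μIso inclL oddLine oddLine ≪≫ inclL.mapIso oddLineTensor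

variable {W : LinMod SuperSemi}

/-- The action of `SuperSemi` on `W` is linear and cocontinuous in each variable. -/
structure IsSuperMod (W : LinMod SuperSemi) : Prop where
  act : ∀ e : SuperSemi, IsCocontLinear (act W e)
  orbit : ∀ X : W.carrier, IsCocontLinear (orbit inclL W X)

/-- Multiplication by the imaginary unit. -/
def imagEndo (w : W.carrier) : w ⟶ w := unitEnd imagEnd w

/-- The parity automorphism. -/
def parityEndo (w : W.carrier) : w ⟶ w := unitEnd parityEnd w

lemma imagEndo_natural {w w' : W.carrier} (f : w ⟶ w') : f ≫ imagEndo w' = imagEndo w ≫ f :=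
  unitEnd_natural _ f

lemma parityEndo_natural {w w' : W.carrier} (f : w ⟶ w') :
    f ≫ parityEndo w' = parityEndo w ≫ f :=
  unitEnd_natural _ f

lemma parityEndo_parityEndo (w : W.carrier) : parityEndo w ≫ parityEndo w = 𝟙 w := by
  rw [parityEndo, ← unitEnd_comp, parityEnd_comp, unitEnd_id]

lemma inclL_imagEndo (d : SuperVect) (w : W.carrier) :
    inclL.obj d ⊴ₗ imagEndo w = inclL.map (imag d) ⊵ₗ w := by
  rw [imagEndo, action_unitEnd, whisker_imagEnd_inclL]

lemma parityEndo_inclL (d : SuperVect) (w : W.carrier) :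
    parityEndo (inclL.obj d ⊙ₗ w) = inclL.map (parityHom d) ⊵ₗ w ≫ inclL.obj d ⊴ₗ parityEndo w := by
  rw [parityEndo, parityEndo, action_unitEnd, unitEnd_action, parityEnd_whisker_inclL,
    comp_actionHomLeft]

lemma parityEndo_conj (w : W.carrier) :
    parityEndo (inclJ.obj conj ⊙ₗ w) = inclJ.obj conj ⊴ₗ parityEndo w := by
  rw [parityEndo, parityEndo, action_unitEnd, unitEnd_action, parityEnd_whisker_conj]

/-- Complex conjugation is an involution. -/
def conjInv (w : W.carrier) : inclJ.obj conj ⊙ₗ inclJ.obj conj ⊙ₗ w ≅ w := actInv conjSqSemi w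

lemma conjInv_natural {w w' : W.carrier} (f : w ⟶ w') :
    inclJ.obj conj ⊴ₗ inclJ.obj conj ⊴ₗ f ≫ (conjInv w').hom = (conjInv w).hom ≫ f :=
  actInv_natural _ f

lemma conjInv_conj (w : W.carrier) :
    (conjInv (inclJ.obj conj ⊙ₗ w)).hom = inclJ.obj conj ⊴ₗ (conjInv w).hom :=
  actInv_action _ conjSqSemi_whisker w

/-- The odd line is its own inverse. -/
def oddInv (w : W.carrier) : inclL.obj oddLine ⊙ₗ inclL.obj oddLine ⊙ₗ w ≅ w := actInv oddSqSemi w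

lemma oddInv_natural {w w' : W.carrier} (f : w ⟶ w') :
    inclL.obj oddLine ⊴ₗ inclL.obj oddLine ⊴ₗ f ≫ (oddInv w').hom = (oddInv w).hom ≫ f :=
  actInv_natural _ f

lemma unitEnd_inclL_neg (hW : IsSuperMod W) (f : 𝟙_ SuperVect ⟶ 𝟙_ SuperVect) (w : W.carrier) :
    unitEnd (inclL.map (-f) : 𝟙_ SuperSemi ⟶ 𝟙_ SuperSemi) w =
      -unitEnd (inclL.map f : 𝟙_ SuperSemi ⟶ 𝟙_ SuperSemi) w := by
  have := (hW.orbit w).additive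
  have key (s s' : 𝟙_ SuperSemi ⟶ 𝟙_ SuperSemi) (h : s' ⊵ₗ w = -(s ⊵ₗ w)) :
      unitEnd s' w = -unitEnd s w := by
    simp [unitEnd, h]
  exact key _ _ ((orbit inclL W w).map_neg (f := f))

lemma conj_imagEndo (hW : IsSuperMod W) (w : W.carrier) :
    inclJ.obj conj ⊴ₗ imagEndo w = -imagEndo (inclJ.obj conj ⊙ₗ w) := by
  rw [imagEndo, action_unitEnd, whisker_imagEnd_conj]
  exact (unitEnd_action (inclL.map (-imag (𝟙_ SuperVect)) : 𝟙_ SuperSemi ⟶ 𝟙_ SuperSemi) _ _).symm.trans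
    (unitEnd_inclL_neg hW _ _)

lemma imagEndo_imagEndo (hW : IsSuperMod W) (w : W.carrier) :
    imagEndo w ≫ imagEndo w = -𝟙 w := by
  rw [imagEndo, ← unitEnd_comp, ← unitEnd_id (E := SuperSemi) w]
  refine Eq.trans ?_ (unitEnd_inclL_neg hW (𝟙 _) w)
  refine congrArg (unitEnd · w) ((inclL.map_comp _ _).symm.trans (congrArg inclL.map ?_))
  rw [imag_imag]

lemma oddLine_parityEndo (hW : IsSuperMod W) (w : W.carrier) :
    parityEndo (inclL.obj oddLine ⊙ₗ w) = -inclL.obj oddLine ⊴ₗ parityEndo w := by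
  have := (hW.orbit w).additive
  have h : inclL.map (parityHom oddLine) ⊵ₗ w = -𝟙 (inclL.obj oddLine ⊙ₗ w) := by
    rw [show parityHom oddLine = -𝟙 _ from parityHom_odd _]
    refine ((orbit inclL W w).map_neg (f := 𝟙 oddLine)).trans ?_
    rw [CategoryTheory.Functor.map_id]
    rfl
  rw [parityEndo_inclL, h]
  simp

end SuperMod

section FixedPoints

open MonoidalCategory MonoidalLeftAction SemiProd SuperVect SuperAut Functor.LaxMonoidal
  Functor.OplaxMonoidal

variable {W : LinMod SuperSemi}

lemma SuperAut.isEmpty_unit_conj : IsEmpty (𝟙_ SuperAut ⟶ conj) := by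
  refine ⟨fun γ => ?_⟩
  have h₁ : imag (𝟙_ SuperVect) ≫ γ.trans.app (𝟙_ SuperVect) =
    -(γ.trans.app (𝟙_ SuperVect) ≫ imag (conj.functor.obj (𝟙_ SuperVect))) :=
    (γ.trans.naturality (imag (𝟙_ SuperVect))).trans ((congrArg (γ.trans.app (𝟙_ SuperVect) ≫ ·)
      (conj_imag (𝟙_ SuperVect))).trans (Preadditive.comp_neg _ _))
  rw [imag_natural] at h₁
  have := γ.isIso
  have h₂ : imag (𝟙_ SuperVect) = 0 := by
    rw [← cancel_mono (γ.trans.app (𝟙_ SuperVect)), zero_comp]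
    exact eq_zero_of_eq_neg h₁
  refine one_ne_zero (isLine_unit.smul_id (z := 1) ?_)
  have h₃ := imag_imag (𝟙_ SuperVect)
  rw [h₂, zero_comp] at h₃
  rw [one_smul]
  exact neg_eq_zero.1 h₃.symm

lemma SuperAut.isIso_of_hom {g h : SuperAut} (γ : g ⟶ h) : IsIso γ := by
  have : IsIso γ.trans := γ.isIso
  have e : γ = (Aut.isoMk (asIso γ.trans) γ.isMonoidal γ.comm).hom := rfl
  rw [e]
  infer_instance

section

variable {E : Type u} [Category.{v} E] [MonoidalCategory E] {G : Type u₁} [Category.{v₁} G]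
  [MonoidalCategory G] (J : G ⥤ E) [J.Monoidal] {V : Type u₂} [Category.{v₂} V]
  [MonoidalLeftAction E V]

lemma map_leftUnitor_actionHomLeft (g : G) {w : V} (f : J.obj g ⊙ₗ w ⟶ w) :
    J.map (λ_ g).hom ⊵ₗ w ≫ f = δ J (𝟙_ G) g ⊵ₗ w ≫ (αₗ (J.obj (𝟙_ G)) (J.obj g) w).hom ≫
      J.obj (𝟙_ G) ⊴ₗ f ≫ η J ⊵ₗ w ≫ (λₗ[E] w).hom := by
  rw [action_exchange_assoc, ← actionUnitIso_hom_naturality, ← Functor.OplaxMonoidal.left_unitality_hom J g]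
  simp only [comp_actionHomLeft, whiskerRight_actionHomLeft, leftUnitor_actionHom, Category.assoc,
    Iso.inv_hom_id_assoc]

lemma map_rightUnitor_actionHomLeft (g : G) {w : V} (f : J.obj g ⊙ₗ w ⟶ w) :
    J.map (ρ_ g).hom ⊵ₗ w ≫ f = δ J g (𝟙_ G) ⊵ₗ w ≫ (αₗ (J.obj g) (J.obj (𝟙_ G)) w).hom ≫
      J.obj g ⊴ₗ (η J ⊵ₗ w ≫ (λₗ[E] w).hom) ≫ f := by
  rw [← Functor.OplaxMonoidal.right_unitality_hom J g]
  simp only [comp_actionHomLeft, whiskerLeft_actionHomLeft, rightUnitor_actionHom, Category.assoc,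
    Iso.inv_hom_id_assoc, actionHomRight_comp]

end

/-- Descent along complex conjugation: an object with trivial parity and an isomorphism to its
conjugate. -/
structure IsDescent (w : W.carrier) (φ : inclJ.obj conj ⊙ₗ w ⟶ w) : Prop where
  parity : parityEndo w = 𝟙 w
  sq : inclJ.obj conj ⊴ₗ φ ≫ φ = (conjInv w).hom

namespace IsDescent

variable {w : W.carrier} {φ : inclJ.obj conj ⊙ₗ w ⟶ w} (h : IsDescent w φ)

/-- The isomorphism to the conjugate. -/
def iso : inclJ.obj conj ⊙ₗ w ≅ w where
  hom := φ
  inv := (conjInv w).inv ≫ inclJ.obj conj ⊴ₗ φ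
  hom_inv_id := by
    rw [← cancel_epi (conjInv (inclJ.obj conj ⊙ₗ w)).hom, ← reassoc_of% conjInv_natural φ,
      Iso.hom_inv_id_assoc, ← actionHomRight_comp, h.sq, conjInv_conj, Category.comp_id]
  inv_hom_id := by rw [Category.assoc, h.sq, Iso.inv_hom_id]

include h

lemma parity_action (g : SuperAut) : inclJ.map (twist g) ⊵ₗ w = 𝟙 _ := by
  have h₁ (g : SuperAut) : inclJ.map (twist g) ⊵ₗ w = parityEndo (inclJ.obj g ⊙ₗ w) := by
    rw [parityEndo, unitEnd_action, parityEnd_whisker_inclJ]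
  rw [h₁]
  have key {g₀ : SuperAut} (e : g₀ ≅ g) (h₀ : parityEndo (inclJ.obj g₀ ⊙ₗ w) = 𝟙 _) :
      parityEndo (inclJ.obj g ⊙ₗ w) = 𝟙 _ := by
    rw [← cancel_epi (leftIso (inclJ.mapIso e) w).hom, parityEndo_natural]
    erw [h₀]
    simp
  rcases nonempty_iso g with ⟨⟨e⟩⟩ | ⟨⟨e⟩⟩
  · refine key e ?_
    have h₂ : parityEndo (𝟙_ SuperSemi ⊙ₗ w) = 𝟙 _ := by
      rw [← cancel_mono (λₗ[SuperSemi] w).hom, ← parityEndo_natural, h.parity, Category.comp_id,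
        Category.id_comp]
    exact h₂
  · refine key e ?_
    rw [parityEndo_conj, h.parity, actionHomRight_id]

open Classical in
/-- The action of the automorphism `g`. -/
def std (g : SuperAut) : inclJ.obj g ⊙ₗ w ≅ w :=
  if p : Nonempty (𝟙_ SuperAut ≅ g) then
    (leftIso (inclJ.mapIso p.some) w).symm ≪≫ λₗ[SuperSemi] w
  else
    (leftIso (inclJ.mapIso ((nonempty_iso g).resolve_left p).some) w).symm ≪≫ h.iso

lemma map_eq {g g' : SuperAut} (a b : g ⟶ g') : inclJ.map a ⊵ₗ w = inclJ.map b ⊵ₗ w := by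
  rcases hom_eq_or a b with rfl | rfl
  · rfl
  · rw [Functor.map_comp, comp_actionHomLeft, h.parity_action, Category.comp_id]

lemma std_unit {g : SuperAut} (γ : 𝟙_ SuperAut ⟶ g) :
    inclJ.map γ ⊵ₗ w ≫ (h.std g).hom = (λₗ[SuperSemi] w).hom := by
  have := isIso_of_hom γ
  have p : Nonempty (𝟙_ SuperAut ≅ g) := ⟨asIso γ⟩
  rw [std, dif_pos p, h.map_eq γ p.some.hom]
  exact (leftIso (inclJ.mapIso p.some) w).hom_inv_id_assoc _

lemma std_conj {g : SuperAut} (γ : conj ⟶ g) : inclJ.map γ ⊵ₗ w ≫ (h.std g).hom = φ := by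
  have := isIso_of_hom γ
  have p : ¬ Nonempty (𝟙_ SuperAut ≅ g) := fun ⟨e⟩ => isEmpty_unit_conj.false (e.hom ≫ inv γ)
  rw [std, dif_neg p, h.map_eq γ ((nonempty_iso g).resolve_left p).some.hom]
  exact (leftIso (inclJ.mapIso ((nonempty_iso g).resolve_left p).some) w).hom_inv_id_assoc _

lemma std_conj_self : (h.std conj).hom = φ := by
  have h₁ := h.std_conj (𝟙 conj)
  rwa [inclJ.map_id, id_actionHomLeft, Category.id_comp] at h₁

lemma std_natural {g g' : SuperAut} (γ : g ⟶ g') :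
    inclJ.map γ ⊵ₗ w ≫ (h.std g').hom = (h.std g).hom := by
  rcases nonempty_iso g with ⟨⟨e⟩⟩ | ⟨⟨e⟩⟩
  · rw [← cancel_epi (leftIso (inclJ.mapIso e) w).hom]
    change inclJ.map e.hom ⊵ₗ w ≫ _ = inclJ.map e.hom ⊵ₗ w ≫ _
    rw [← comp_actionHomLeft_assoc, ← Functor.map_comp, h.std_unit, h.std_unit]
  · rw [← cancel_epi (leftIso (inclJ.mapIso e) w).hom]
    change inclJ.map e.hom ⊵ₗ w ≫ _ = inclJ.map e.hom ⊵ₗ w ≫ _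
    rw [← comp_actionHomLeft_assoc, ← Functor.map_comp, h.std_conj, h.std_conj]

lemma std_one : (h.std (𝟙_ _)).hom = η inclJ ⊵ₗ w ≫ (λₗ[SuperSemi] w).hom := by
  have h₁ := h.std_unit (𝟙 (𝟙_ _))
  rw [inclJ.map_id, id_actionHomLeft, Category.id_comp] at h₁
  have h₂ : η inclJ ⊵ₗ w = 𝟙 (𝟙_ SuperSemi ⊙ₗ w) := id_actionHomLeft _ _
  rw [h₁]
  exact ((congrArg (· ≫ _) h₂).trans (Category.id_comp _)).symm

lemma std_mul (g g' : SuperAut) : (h.std (g ⊗ g')).hom = δ inclJ g g' ⊵ₗ w ≫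
    (αₗ (inclJ.obj g) (inclJ.obj g') w).hom ≫ inclJ.obj g ⊴ₗ (h.std g').hom ≫ (h.std g).hom := by
  have key {g₀ g₀'} (a : g₀ ≅ g) (b : g₀' ≅ g')
      (h₀ : (h.std (g₀ ⊗ g₀')).hom = δ inclJ g₀ g₀' ⊵ₗ w ≫
        (αₗ (inclJ.obj g₀) (inclJ.obj g₀') w).hom ≫ inclJ.obj g₀ ⊴ₗ (h.std g₀').hom ≫
          (h.std g₀).hom) :
      (h.std (g ⊗ g')).hom = δ inclJ g g' ⊵ₗ w ≫
        (αₗ (inclJ.obj g) (inclJ.obj g') w).hom ≫ inclJ.obj g ⊴ₗ (h.std g').hom ≫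
          (h.std g).hom := by
    rw [← cancel_epi (leftIso (inclJ.mapIso (a ⊗ᵢ b)) w).hom]
    refine (h.std_natural (a.hom ⊗ₘ b.hom)).trans (h₀.trans ?_)
    change _ = inclJ.map (a.hom ⊗ₘ b.hom) ⊵ₗ w ≫ _
    rw [← comp_actionHomLeft_assoc, ← δ_natural, comp_actionHomLeft_assoc,
      MonoidalCategory.tensorHom_def', comp_actionHomLeft_assoc]
    simp only [whiskerRight_actionHomLeft, whiskerLeft_actionHomLeft, Category.assoc,
      Iso.inv_hom_id_assoc]
    rw [← h.std_natural a.hom, ← h.std_natural b.hom, actionHomRight_comp_assoc]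
    rw [action_exchange_assoc]
  have hc₀ : ∀ g', (h.std (𝟙_ _ ⊗ g')).hom = δ inclJ (𝟙_ _) g' ⊵ₗ w ≫
      (αₗ (inclJ.obj (𝟙_ _)) (inclJ.obj g') w).hom ≫ inclJ.obj (𝟙_ _) ⊴ₗ (h.std g').hom ≫
        (h.std (𝟙_ _)).hom := fun g' => by
    rw [h.std_one, ← map_leftUnitor_actionHomLeft, h.std_natural]
  have hc₁ : ∀ g, (h.std (g ⊗ 𝟙_ _)).hom = δ inclJ g (𝟙_ _) ⊵ₗ w ≫
      (αₗ (inclJ.obj g) (inclJ.obj (𝟙_ _)) w).hom ≫ inclJ.obj g ⊴ₗ (h.std (𝟙_ _)).hom ≫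
        (h.std g).hom := fun g => by
    rw [h.std_one, ← map_rightUnitor_actionHomLeft, h.std_natural]
  have hc₂ : (h.std (conj ⊗ conj)).hom = δ inclJ conj conj ⊵ₗ w ≫
      (αₗ (inclJ.obj conj) (inclJ.obj conj) w).hom ≫ inclJ.obj conj ⊴ₗ (h.std conj).hom ≫
        (h.std conj).hom := by
    have h₃ : δ inclJ conj conj ≫ conjSqSemi.hom = inclJ.map conjSq.hom :=
      Functor.Monoidal.δ_μ_assoc inclJ conj conj (inclJ.map conjSq.hom)
    rw [h.std_conj_self, h.sq, conjInv, actInv_hom, Iso.hom_inv_id_assoc, ← comp_actionHomLeft_assoc,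
      h₃, ← h.std_natural conjSq.hom, h.std_one]
    have h₂ : η inclJ ⊵ₗ w = 𝟙 (𝟙_ SuperSemi ⊙ₗ w) := id_actionHomLeft _ _
    exact congrArg (_ ≫ ·) ((congrArg (· ≫ _) h₂).trans (Category.id_comp _))
  rcases nonempty_iso g with ⟨⟨a⟩⟩ | ⟨⟨a⟩⟩
  · exact key a (Iso.refl _) (hc₀ _)
  · rcases nonempty_iso g' with ⟨⟨b⟩⟩ | ⟨⟨b⟩⟩
    · exact key a b (hc₁ _)
    · exact key a b hc₂

/-- The fixed point given by a descent datum. -/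
def fixedPt : FixedPt inclJ W where
  pt := w
  iso g := h.std g
  naturality γ := h.std_natural γ
  unit := h.std_one
  mul g g' := h.std_mul g g'

end IsDescent

namespace FixedPt

/-- The isomorphism of a fixed point to its conjugate. -/
def conjHom (x : FixedPt inclJ W) : inclJ.obj conj ⊙ₗ x.pt ⟶ x.pt := (x.iso conj).hom

instance (x : FixedPt inclJ W) : IsIso x.conjHom := inferInstanceAs (IsIso (x.iso conj).hom)

lemma iso_one (x : FixedPt inclJ W) : (x.iso (𝟙_ _)).hom = (λₗ[SuperSemi] x.pt).hom := by
  have h₂ : η inclJ ⊵ₗ x.pt = 𝟙 (𝟙_ SuperSemi ⊙ₗ x.pt) := id_actionHomLeft _ _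
  exact x.unit.trans ((congrArg (· ≫ _) h₂).trans (Category.id_comp _))

lemma isDescent (x : FixedPt inclJ W) : IsDescent x.pt x.conjHom where
  parity := by
    have h := x.naturality parityAut.hom
    rw [iso_one] at h
    rw [parityEndo, unitEnd, Iso.inv_comp_eq, Category.comp_id]
    exact h
  sq := by
    have h₃ : inclJ.map conjSq.hom = δ inclJ conj conj ≫ conjSqSemi.hom :=
      (Functor.Monoidal.δ_μ_assoc inclJ conj conj (inclJ.map conjSq.hom)).symm
    have h := (x.naturality conjSq.hom).trans (x.mul conj conj)
    rw [iso_one, h₃] at h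
    have h₄ : (δ inclJ conj conj ≫ conjSqSemi.hom) ⊵ₗ x.pt ≫ (λₗ[SuperSemi] x.pt).hom =
      δ inclJ conj conj ⊵ₗ x.pt ≫ conjSqSemi.hom ⊵ₗ x.pt ≫ (λₗ[SuperSemi] x.pt).hom := by simp
    have h₅ := h₄.symm.trans h
    rw [cancel_epi (δ inclJ conj conj ⊵ₗ x.pt)] at h₅
    rw [conjInv, actInv_hom, h₅, Iso.inv_hom_id_assoc]
    rfl

lemma conjHom_comm {x y : FixedPt inclJ W} (f : x ⟶ y) :
    inclJ.obj conj ⊴ₗ val f ≫ y.conjHom = x.conjHom ≫ val f := val_comm f conj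

/-- Morphisms of fixed points are morphisms compatible with conjugation. -/
def homOfConj {x y : FixedPt inclJ W} (f : x.pt ⟶ y.pt)
    (h : inclJ.obj conj ⊴ₗ f ≫ y.conjHom = x.conjHom ≫ f) : x ⟶ y :=
  homMk f fun g => by
    rcases nonempty_iso g with ⟨⟨e⟩⟩ | ⟨⟨e⟩⟩
    · rw [← cancel_epi (leftIso (inclJ.mapIso e) x.pt).hom]
      change inclJ.map e.hom ⊵ₗ x.pt ≫ _ = inclJ.map e.hom ⊵ₗ x.pt ≫ _
      rw [← action_exchange_assoc, y.naturality, reassoc_of% x.naturality, iso_one, iso_one]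
      exact (actionUnitIso_hom_naturality (C := SuperSemi) f).symm
    · rw [← cancel_epi (leftIso (inclJ.mapIso e) x.pt).hom]
      change inclJ.map e.hom ⊵ₗ x.pt ≫ _ = inclJ.map e.hom ⊵ₗ x.pt ≫ _
      rw [← action_exchange_assoc, y.naturality, reassoc_of% x.naturality]
      exact h

@[simp] lemma val_homOfConj {x y : FixedPt inclJ W} (f : x.pt ⟶ y.pt)
    (h : inclJ.obj conj ⊴ₗ f ≫ y.conjHom = x.conjHom ≫ f) : val (homOfConj f h) = f := rfl

end FixedPt

namespace IsDescent

variable {w : W.carrier} {φ : inclJ.obj conj ⊙ₗ w ⟶ w} (h : IsDescent w φ)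

lemma fixedPt_conjHom : h.fixedPt.conjHom = φ := h.std_conj_self

/-- Morphisms to the fixed point given by a descent datum. -/
def homTo {x : FixedPt inclJ W} (f : x.pt ⟶ w)
    (hf : inclJ.obj conj ⊴ₗ f ≫ φ = x.conjHom ≫ f) : x ⟶ h.fixedPt :=
  FixedPt.homOfConj (y := h.fixedPt) f ((congrArg (inclJ.obj conj ⊴ₗ f ≫ ·) h.fixedPt_conjHom).trans hf)

/-- Morphisms from the fixed point given by a descent datum. -/
def homFrom {x : FixedPt inclJ W} (f : w ⟶ x.pt)
    (hf : inclJ.obj conj ⊴ₗ f ≫ x.conjHom = φ ≫ f) : h.fixedPt ⟶ x :=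
  FixedPt.homOfConj (x := h.fixedPt) f (hf.trans (congrArg (· ≫ f) h.fixedPt_conjHom).symm)

end IsDescent

end FixedPoints

section FixedPoints

open MonoidalCategory MonoidalLeftAction SemiProd SuperVect SuperAut

variable {W : LinMod SuperSemi}

namespace FixedPt

instance : (forget inclJ W).Faithful := ⟨fun h => hom_ext h⟩
instance : (forget inclJ W).Additive := ⟨rfl⟩
instance : (forget inclJ W).Linear ℝ := ⟨fun _ _ => rfl⟩

instance : (forget inclJ W).ReflectsIsomorphisms where
  reflects {x y} f hf := by
    have : IsIso (val f) := hf
    exact (isoMk (asIso (val f)) (val_comm f)).isIso_hom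

lemma exists_colimit (hW : IsSuperMod W) [HasColimitsOfSize.{0, 0} W.carrier] {K : Type}
    [Category.{0} K] (F : K ⥤ FixedPt inclJ W) :
    ∃ t : Cocone F, Nonempty (IsColimit t) ∧ Nonempty (IsColimit ((forget inclJ W).mapCocone t)) := by
  let c := colimit.cocone (F ⋙ forget inclJ W)
  let hc : IsColimit c := colimit.isColimit _
  have := (hW.act (inclJ.obj conj)).cocontinuous
  let hc₁ := isColimitOfPreserves (act W (inclJ.obj conj)) hc
  let hc₂ := isColimitOfPreserves (act W (inclJ.obj conj)) hc₁
  let P : W.carrier := c.pt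
  let a (k : K) : (F.obj k).pt ⟶ P := c.ι.app k
  have ha {k l : K} (f : k ⟶ l) : val (F.map f) ≫ a l = a k := c.w f
  have hext {z : W.carrier} {m m' : P ⟶ z} (h : ∀ k, a k ≫ m = a k ≫ m') : m = m' :=
    hc.hom_ext h
  have hext₁ {z : W.carrier} {m m' : inclJ.obj conj ⊙ₗ P ⟶ z}
    (h : ∀ k, inclJ.obj conj ⊴ₗ a k ≫ m = inclJ.obj conj ⊴ₗ a k ≫ m') : m = m' := hc₁.hom_ext h
  have hext₂ {z : W.carrier} {m m' : inclJ.obj conj ⊙ₗ inclJ.obj conj ⊙ₗ P ⟶ z}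
    (h : ∀ k, inclJ.obj conj ⊴ₗ inclJ.obj conj ⊴ₗ a k ≫ m =
      inclJ.obj conj ⊴ₗ inclJ.obj conj ⊴ₗ a k ≫ m') : m = m' := hc₂.hom_ext h
  have hn {k l : K} (f : k ⟶ l) : inclJ.obj conj ⊴ₗ val (F.map f) ≫ (F.obj l).conjHom ≫ a l =
      (F.obj k).conjHom ≫ a k := by
    rw [reassoc_of% conjHom_comm (F.map f), ha]
  let d : Cocone ((F ⋙ forget inclJ W) ⋙ act W (inclJ.obj conj)) :=
    { pt := P
      ι :=
        { app := fun k => (F.obj k).conjHom ≫ a k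
          naturality := fun k l f => (hn f).trans (Category.comp_id _).symm } }
  let φ : inclJ.obj conj ⊙ₗ P ⟶ P := hc₁.desc d
  have hφ (k : K) : inclJ.obj conj ⊴ₗ a k ≫ φ = (F.obj k).conjHom ≫ a k := hc₁.fac d k
  have hd : IsDescent P φ :=
    { parity := hext fun k => by
        rw [parityEndo_natural, (F.obj k).isDescent.parity, Category.id_comp, Category.comp_id]
      sq := hext₂ fun k => by
        rw [← actionHomRight_comp_assoc, hφ, conjInv_natural, actionHomRight_comp_assoc, hφ,
          reassoc_of% (F.obj k).isDescent.sq] }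
  let t : Cocone F :=
    { pt := hd.fixedPt
      ι :=
        { app := fun k => hd.homTo (a k) (hφ k)
          naturality := fun k l f => hom_ext (c.ι.naturality f) } }
  have hdesc (s : Cocone F) : ∃ m : P ⟶ s.pt.pt, ∀ k, a k ≫ m = val (s.ι.app k) :=
    ⟨hc.desc ((forget inclJ W).mapCocone s), hc.fac ((forget inclJ W).mapCocone s)⟩
  choose m hm using hdesc
  refine ⟨t, ⟨{ desc := fun s => hd.homFrom (m s) ?_
                fac := fun s k => hom_ext (hm s k)
                uniq := fun s m' hm' => hom_ext (hext fun k =>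
                  (congrArg val (hm' k)).trans (hm s k).symm) }⟩, ⟨?_⟩⟩
  · refine hext₁ fun k => ?_
    have h := conjHom_comm (s.ι.app k)
    rw [reassoc_of% hφ, hm, ← actionHomRight_comp_assoc, hm]
    exact h
  · exact IsColimit.ofIsoColimit hc (Cocone.ext (Iso.refl _) fun k => Category.comp_id _)

lemma hasColimits (hW : IsSuperMod W) [HasColimitsOfSize.{0, 0} W.carrier] :
    HasColimitsOfSize.{0, 0} (FixedPt inclJ W) :=
  ⟨fun _ _ => ⟨fun F => by
    obtain ⟨t, ⟨ht⟩, -⟩ := exists_colimit hW F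
    exact ⟨⟨t, ht⟩⟩⟩⟩

lemma isCocontLinear_forget (hW : IsSuperMod W) [HasColimitsOfSize.{0, 0} W.carrier] :
    IsCocontLinear (forget inclJ W) where
  additive := inferInstance
  linear := inferInstance
  cocontinuous := ⟨fun {K _} => ⟨fun {F} => by
    obtain ⟨t, ⟨ht⟩, ⟨ht'⟩⟩ := exists_colimit hW F
    exact preservesColimit_of_preserves_colimit_cocone ht ht'⟩⟩

lemma isCocontLinear_of_forget (hW : IsSuperMod W) [HasColimitsOfSize.{0, 0} W.carrier]
    {A : Type u} [Category.{v} A] [Preadditive A] [Linear ℝ A] {F : A ⥤ FixedPt inclJ W}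
    (hF : IsCocontLinear (F ⋙ forget inclJ W)) : IsCocontLinear F where
  additive := ⟨fun {_ _ f g} => hom_ext (hF.additive.map_add (f := f) (g := g))⟩
  linear := ⟨fun f r => hom_ext (hF.linear.map_smul f r)⟩
  cocontinuous := by
    have := hasColimits hW
    have := (isCocontLinear_forget hW).cocontinuous
    have := hF.cocontinuous
    have : ReflectsColimitsOfSize.{0, 0} (forget inclJ W) :=
      reflectsColimits_of_reflectsIsomorphisms
    exact preservesColimits_of_reflects_of_preserves F (forget inclJ W)

end FixedPt

lemma exists_free (hW : IsSuperMod W) [HasBinaryBiproducts W.carrier] [IsIdempotentComplete W.carrier]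
    (w : W.carrier) : ∃ (y : FixedPt inclJ W) (s : w ⟶ y.pt) (r : y.pt ⟶ w)
      (r' : y.pt ⟶ inclJ.obj conj ⊙ₗ w),
      s ≫ r = (1 / 2 : ℝ) • (𝟙 w + parityEndo w) ∧
      (inclJ.obj conj ⊴ₗ s ≫ y.conjHom) ≫ r = 0 ∧
      r ≫ s + r' ≫ inclJ.obj conj ⊴ₗ s ≫ y.conjHom = 𝟙 _ ∧
      ∀ (x : FixedPt inclJ W) (f : w ⟶ x.pt), ∃ g : y ⟶ x, s ≫ FixedPt.val g = f := by
  have := (hW.act (inclJ.obj conj)).additive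
  have hadd {a b : W.carrier} (f g : a ⟶ b) :
    inclJ.obj conj ⊴ₗ (f + g) = inclJ.obj conj ⊴ₗ f + inclJ.obj conj ⊴ₗ g := W.action_add _ f g
  have hsmul {a b : W.carrier} (r : ℝ) (f : a ⟶ b) :
    inclJ.obj conj ⊴ₗ (r • f) = r • inclJ.obj conj ⊴ₗ f := W.action_smul _ r f
  have hzero (a b : W.carrier) : inclJ.obj conj ⊴ₗ (0 : a ⟶ b) = 0 :=
    (act W (inclJ.obj conj)).map_zero a b
  let T := w ⊞ inclJ.obj conj ⊙ₗ w
  let Φ : inclJ.obj conj ⊙ₗ T ⟶ T := inclJ.obj conj ⊴ₗ biprod.fst ≫ biprod.inr +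
    inclJ.obj conj ⊴ₗ biprod.snd ≫ (conjInv w).hom ≫ biprod.inl
  have hΦ₁ : biprod.fst ≫ biprod.inl + biprod.snd ≫ biprod.inr = 𝟙 T := biprod.total
  have hΦl : inclJ.obj conj ⊴ₗ biprod.inl ≫ Φ = biprod.inr := by
    rw [Preadditive.comp_add, ← actionHomRight_comp_assoc, ← actionHomRight_comp_assoc,
      biprod.inl_fst, biprod.inl_snd, hzero, zero_comp, add_zero, actionHomRight_id,
      Category.id_comp]
  have hΦr : inclJ.obj conj ⊴ₗ biprod.inr ≫ Φ = (conjInv w).hom ≫ biprod.inl := by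
    rw [Preadditive.comp_add, ← actionHomRight_comp_assoc, ← actionHomRight_comp_assoc,
      biprod.inr_fst, biprod.inr_snd, hzero, zero_comp, zero_add, actionHomRight_id,
      Category.id_comp]
  have hΦ : inclJ.obj conj ⊴ₗ Φ ≫ Φ = (conjInv T).hom := by
    rw [hadd, Preadditive.add_comp, actionHomRight_comp_assoc, actionHomRight_comp_assoc,
      actionHomRight_comp_assoc, hΦl, hΦr, ← conjInv_conj, reassoc_of% conjInv_natural,
      reassoc_of% conjInv_natural, ← Preadditive.comp_add, hΦ₁, Category.comp_id]
  let e : T ⟶ T := (1 / 2 : ℝ) • (𝟙 T + parityEndo T)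
  have hep : e ≫ parityEndo T = e := by
    rw [Linear.smul_comp, Preadditive.add_comp, parityEndo_parityEndo, Category.id_comp, add_comm]
  have he : e ≫ e = e := by
    rw [Linear.comp_smul, Preadditive.comp_add, hep, Category.comp_id]
    module
  have heΦ : inclJ.obj conj ⊴ₗ e ≫ Φ = Φ ≫ e := by
    have h : Φ ≫ parityEndo T = parityEndo _ ≫ Φ := parityEndo_natural Φ
    rw [hsmul, hadd, ← parityEndo_conj, Linear.smul_comp, Linear.comp_smul,
      Preadditive.comp_add _ _ _ Φ, h, Preadditive.add_comp, actionHomRight_id, Category.id_comp Φ,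
      Category.comp_id Φ]
  have hef {x : W.carrier} (hx : parityEndo x = 𝟙 x) (f : T ⟶ x) : e ≫ f = f := by
    rw [Linear.smul_comp, Preadditive.add_comp, ← parityEndo_natural, hx, Category.id_comp,
      Category.comp_id]
    module
  obtain ⟨y, i, p, hi, hp⟩ := IsIdempotentComplete.idempotents_split T e he
  let φ : inclJ.obj conj ⊙ₗ y ⟶ y := inclJ.obj conj ⊴ₗ i ≫ Φ ≫ p
  have hφ : φ ≫ i = inclJ.obj conj ⊴ₗ i ≫ Φ := by
    have h : e ≫ e = e := he
    simp only [φ, Category.assoc, hp]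
    rw [← heΦ, ← actionHomRight_comp_assoc, ← hp, reassoc_of% hi]
  have hφ' : inclJ.obj conj ⊴ₗ p ≫ φ = Φ ≫ p := by
    rw [← actionHomRight_comp_assoc, hp, reassoc_of% heΦ, ← hp, Category.assoc, hi,
      Category.comp_id]
  have hy : IsDescent y φ :=
    { parity := by
        have h : i ≫ e = i := by rw [← hp, reassoc_of% hi]
        have h' : parityEndo y ≫ i = i := by
          rw [← parityEndo_natural, ← h, Category.assoc, hep]
        rw [← Category.comp_id (parityEndo y), ← hi, reassoc_of% h']
      sq := by
        have : inclJ.obj conj ⊴ₗ φ ≫ φ = inclJ.obj conj ⊴ₗ (φ ≫ i) ≫ Φ ≫ p := by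
          rw [actionHomRight_comp _ φ i, Category.assoc]
        rw [this, hφ, actionHomRight_comp_assoc, reassoc_of% hΦ, reassoc_of% conjInv_natural, hi,
          Category.comp_id] }
  have hs : inclJ.obj conj ⊴ₗ (biprod.inl ≫ p) ≫ φ = biprod.inr ≫ p := by
    rw [actionHomRight_comp_assoc, hφ', reassoc_of% hΦl]
  have h₁ : (biprod.inl ≫ p) ≫ i ≫ biprod.fst = (1 / 2 : ℝ) • (𝟙 w + parityEndo w) := by
    rw [Category.assoc, reassoc_of% hp, Linear.smul_comp, Linear.comp_smul, Preadditive.add_comp,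
      Preadditive.comp_add, Category.id_comp, biprod.inl_fst, ← parityEndo_natural,
      biprod.inl_fst_assoc]
  have h₂ : ∀ ψ, ψ = φ → (inclJ.obj conj ⊴ₗ (biprod.inl ≫ p) ≫ ψ) ≫ i ≫ biprod.fst = 0 := by
    rintro _ rfl
    rw [hs, Category.assoc, reassoc_of% hp, Linear.smul_comp, Linear.comp_smul,
      Preadditive.add_comp, Preadditive.comp_add, Category.id_comp, biprod.inr_fst,
      ← parityEndo_natural, biprod.inr_fst_assoc, zero_comp, add_zero, smul_zero]
  have h₃ : ∀ ψ, ψ = φ → (i ≫ biprod.fst) ≫ biprod.inl ≫ p +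
      (i ≫ biprod.snd) ≫ inclJ.obj conj ⊴ₗ (biprod.inl ≫ p) ≫ ψ = 𝟙 y := by
    rintro _ rfl
    have : i ≫ (biprod.fst ≫ biprod.inl + biprod.snd ≫ biprod.inr) ≫ p = 𝟙 y := by
      rw [hΦ₁, Category.id_comp, hi]
    rw [hs]
    simpa using this
  refine ⟨hy.fixedPt, biprod.inl ≫ p, i ≫ biprod.fst, i ≫ biprod.snd, h₁,
    h₂ _ hy.fixedPt_conjHom, h₃ _ hy.fixedPt_conjHom, fun x f => ?_⟩
  · let m : T ⟶ x.pt := biprod.fst ≫ f + biprod.snd ≫ inclJ.obj conj ⊴ₗ f ≫ x.conjHom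
    have hm : inclJ.obj conj ⊴ₗ m ≫ x.conjHom = Φ ≫ m := by
      rw [hadd, actionHomRight_comp, actionHomRight_comp, actionHomRight_comp,
        Preadditive.add_comp, Category.assoc, Category.assoc, Category.assoc,
        x.isDescent.sq, conjInv_natural, Preadditive.add_comp, Category.assoc,
        Category.assoc, Category.assoc]
      simp [m]
    refine ⟨hy.homFrom (i ≫ m) ?_, ?_⟩
    · rw [reassoc_of% hφ, actionHomRight_comp_assoc, hm]
    · change (biprod.inl ≫ p) ≫ i ≫ m = f
      rw [Category.assoc, reassoc_of% hp, hef x.isDescent.parity]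
      simp [m]

end FixedPoints

section Presentable

lemma isIdempotentComplete_of_hasCoequalizers {X : Type u₁} [Category.{v₁} X] [HasCoequalizers X] :
    IsIdempotentComplete X where
  idempotents_split x p hp := by
    have h : coequalizer.π (𝟙 x) p ≫ coequalizer.desc p (by rw [hp, Category.id_comp]) = p :=
      coequalizer.π_desc _ _
    refine ⟨coequalizer (𝟙 x) p, coequalizer.desc p (by rw [hp, Category.id_comp]),
      coequalizer.π _ _, ?_, h⟩
    rw [← cancel_epi (coequalizer.π (𝟙 x) p), reassoc_of% h, ← coequalizer.condition,
      Category.id_comp, Category.comp_id]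

lemma IsPres.hasColimits {V : LinCat} (h : IsPres V) : HasColimitsOfSize.{0, 0} V.carrier := by
  obtain ⟨κ, _, _⟩ := h.exists_cardinal
  infer_instance

lemma IsPres.hasBinaryBiproducts {V : LinCat} (h : IsPres V) : HasBinaryBiproducts V.carrier := by
  have := h.hasColimits
  exact HasBinaryBiproducts.of_hasBinaryCoproducts

lemma IsPres.isIdempotentComplete {V : LinCat} (h : IsPres V) : IsIdempotentComplete V.carrier := by
  have := h.hasColimits
  exact isIdempotentComplete_of_hasCoequalizers

variable {X : Type u₁} [Category.{0} X] {Y : Type u₂} [Category.{0} Y] {F : X ⥤ Y} {G : Y ⥤ X}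

lemma isLocallyPresentable_of_adjunction (adj : F ⊣ G) [IsLocallyPresentable.{0} X]
    [HasColimitsOfSize.{0, 0} Y] [PreservesColimitsOfSize.{0, 0} G] [G.Faithful]
    [G.ReflectsIsomorphisms] : IsLocallyPresentable.{0} Y := by
  obtain ⟨κ, _, hκ⟩ := IsLocallyPresentable.exists_cardinal.{0} X
  refine ⟨κ, inferInstance, ?_⟩
  obtain ⟨P, _, hP, hP'⟩ :=
    (IsCardinalLocallyPresentable.iff_exists_isStrongGenerator X κ).1 inferInstance
  rw [ObjectProperty.isStrongGenerator_iff] at hP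
  refine (IsCardinalLocallyPresentable.iff_exists_isStrongGenerator Y κ).2
    ⟨P.strictMap F, inferInstance, ?_, ?_⟩
  · rw [ObjectProperty.isStrongGenerator_iff]
    refine ⟨fun A B f g h => G.map_injective (hP.1 _ _ fun s hs t => ?_), fun A B i _ h => ?_⟩
    · have := h (F.obj s) (P.strictMap_obj F hs) ((adj.homEquiv _ _).symm t)
      have h' := congrArg (adj.homEquiv _ _) this
      rwa [adj.homEquiv_naturality_right, adj.homEquiv_naturality_right,
        Equiv.apply_symm_apply] at h'
    · have := adj.isRightAdjoint
      have : IsIso (G.map i) := hP.2 _ fun s hs t => by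
        obtain ⟨t', ht'⟩ := h (F.obj s) (P.strictMap_obj F hs) ((adj.homEquiv _ _).symm t)
        refine ⟨adj.homEquiv _ _ t', ?_⟩
        change t' ≫ i = _ at ht'
        change adj.homEquiv _ _ t' ≫ G.map i = t
        rw [← adj.homEquiv_naturality_right, ht', Equiv.apply_symm_apply]
      exact isIso_of_reflects_iso i G
  · rintro _ ⟨s, hs⟩
    have hs' := hP' s hs
    rw [isCardinalPresentable_iff] at hs' ⊢
    exact adj.isCardinalPresentable_leftAdjoint_obj κ s

/-- Every object is a coequalizer of free objects. -/
lemma prop_of_adjunction (adj : F ⊣ G) [HasColimitsOfSize.{0, 0} Y]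
    [PreservesColimitsOfSize.{0, 0} G] [G.ReflectsIsomorphisms] (P : ObjectProperty Y)
    [P.IsClosedUnderColimitsOfShape WalkingParallelPair] (h : ∀ x, P (F.obj x)) (y : Y) : P y := by
  have : ReflectsColimitsOfSize.{0, 0} G := reflectsColimits_of_reflectsIsomorphisms
  let f : F.obj (G.obj (F.obj (G.obj y))) ⟶ F.obj (G.obj y) := F.map (G.map (adj.counit.app y))
  let g : F.obj (G.obj (F.obj (G.obj y))) ⟶ F.obj (G.obj y) := adj.counit.app (F.obj (G.obj y))
  have w : f ≫ adj.counit.app y = g ≫ adj.counit.app y := by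
    simp [f, g]
  let s : IsSplitCoequalizer (G.map f) (G.map g) (G.map (adj.counit.app y)) :=
    { rightSection := adj.unit.app (G.obj y)
      leftSection := adj.unit.app (G.obj (F.obj (G.obj y)))
      condition := by rw [← G.map_comp, w, G.map_comp]
      rightSection_π := by simp
      leftSection_bottom := by simp [g]
      leftSection_top := by simp [f] }
  have hc : IsColimit (Cofork.ofπ (adj.counit.app y) w) :=
    isColimitOfIsColimitCoforkMap G w s.isCoequalizer
  refine P.prop_of_isColimit hc ?_
  rintro (_ | _)
  · exact h _
  · exact h _

end Presentable

section FinDim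

/-- The objects `s` such that `Hom(s, -)` is cocontinuous. -/
def IsTiny {V : Type u₁} [Category.{0} V] [Preadditive V] [Linear ℝ V] (s : V) : Prop :=
  PreservesColimitsOfSize.{0, 0} ((linearCoyoneda ℝ V).obj (op s))

variable {V : Type u₁} [Category.{0} V] [Preadditive V] [Linear ℝ V]

lemma IsTiny.exists_sum {n : ℕ} {S : Fin n → V}
    (hS : ∀ P : ObjectProperty V, (∀ (J : Type) [Category.{0} J], P.IsClosedUnderColimitsOfShape J) →
      (∀ k, P (S k)) → ∀ X, P X) {s : V} (hs : IsTiny s) :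
    ∃ (m : ℕ) (j : Fin m → Fin n) (a : ∀ i, s ⟶ S (j i)) (b : ∀ i, S (j i) ⟶ s),
      ∑ i, a i ≫ b i = 𝟙 s := by
  let T (y : V) : Set (s ⟶ y) := {f | ∃ (k : Fin n) (a : s ⟶ S k) (b : S k ⟶ y), a ≫ b = f}
  have key : ∀ y, Submodule.span ℝ (T y) = ⊤ := by
    refine hS (fun y => Submodule.span ℝ (T y) = ⊤) (fun J _ => ⟨?_⟩) fun k => ?_
    · rintro y ⟨p⟩
      have : PreservesColimitsOfSize.{0, 0} ((linearCoyoneda ℝ V).obj (op s)) := hs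
      let hc := isColimitOfPreserves ((linearCoyoneda ℝ V).obj (op s)) p.isColimit
      have hq : ModuleCat.ofHom (Submodule.span ℝ (T y)).mkQ =
          (0 : ModuleCat.of ℝ (s ⟶ y) ⟶ ModuleCat.of ℝ ((s ⟶ y) ⧸ Submodule.span ℝ (T y))) := by
        refine hc.hom_ext fun j => ModuleCat.hom_ext (LinearMap.ext fun (f : s ⟶ p.diag.obj j) => ?_)
        change Submodule.Quotient.mk (f ≫ p.ι.app j) = 0
        rw [Submodule.Quotient.mk_eq_zero]
        have hf : f ∈ Submodule.span ℝ (T (p.diag.obj j)) := by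
          rw [p.prop_diag_obj j]
          trivial
        induction hf using Submodule.span_induction with
        | mem f hf =>
          obtain ⟨k, a, b, rfl⟩ := hf
          exact Submodule.subset_span ⟨k, a, b ≫ p.ι.app j, by simp⟩
        | zero => rw [zero_comp]; exact Submodule.zero_mem _
        | add f g _ _ hf hg => rw [Preadditive.add_comp]; exact Submodule.add_mem _ hf hg
        | smul r f _ hf => rw [Linear.smul_comp]; exact Submodule.smul_mem _ r hf
      refine eq_top_iff.2 fun f _ => ?_
      rw [← Submodule.Quotient.mk_eq_zero]
      exact congrArg (fun q => ModuleCat.Hom.hom q f) hq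
    · exact eq_top_iff.2 fun f _ => Submodule.subset_span ⟨k, f, 𝟙 _, Category.comp_id _⟩
  have h : 𝟙 s ∈ Submodule.span ℝ (T s) := by
    rw [key]
    trivial
  obtain ⟨m, r, g, hg⟩ := Submodule.mem_span_set'.1 h
  choose j a b hab using fun i => (g i).2
  refine ⟨m, j, fun i => r i • a i, b, ?_⟩
  rw [← hg]
  exact Finset.sum_congr rfl fun i _ => by rw [Linear.smul_comp, hab]

lemma IsTiny.finite_hom {n : ℕ} {S : Fin n → V} (hf : ∀ k l, Module.Finite ℝ (S k ⟶ S l))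
    (hS : ∀ P : ObjectProperty V, (∀ (J : Type) [Category.{0} J], P.IsClosedUnderColimitsOfShape J) →
      (∀ k, P (S k)) → ∀ X, P X) {s t : V} (hs : IsTiny s) (ht : IsTiny t) :
    Module.Finite ℝ (s ⟶ t) := by
  obtain ⟨m, j, a, b, h⟩ := hs.exists_sum hS
  obtain ⟨m', j', a', b', h'⟩ := ht.exists_sum hS
  let φ : (s ⟶ t) →ₗ[ℝ] (∀ (i : Fin m) (i' : Fin m'), S (j i) ⟶ S (j' i')) :=
    { toFun := fun f i i' => b i ≫ f ≫ a' i'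
      map_add' := fun f g => by ext; simp
      map_smul' := fun r f => by ext; simp }
  refine Module.Finite.of_injective φ fun f g hfg => ?_
  have e (f : s ⟶ t) : f = ∑ i, ∑ i', a i ≫ φ f i i' ≫ b' i' := by
    have : f = (∑ i, a i ≫ b i) ≫ f ≫ ∑ i', a' i' ≫ b' i' := by rw [h, h']; simp
    conv_lhs => rw [this]
    simp only [Preadditive.sum_comp, Preadditive.comp_sum, φ, Category.assoc, LinearMap.coe_mk,
      AddHom.coe_mk]
    exact Finset.sum_comm
  rw [e f, e g, hfg]

lemma isFinDim_of_adjunction {X Y : LinCat} {F : X.carrier ⥤ Y.carrier} {G : Y.carrier ⥤ X.carrier}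
    (adj : F ⊣ G) [HasColimitsOfSize.{0, 0} Y.carrier] (hG : IsCocontLinear G) [G.Faithful]
    [G.ReflectsIsomorphisms] (hX : IsFinDim X)
    (hF : (∀ s t : X.carrier, IsTiny s → IsTiny t → Module.Finite ℝ (s ⟶ t)) →
      ∀ s t : X.carrier, IsTiny s → IsTiny t → Module.Finite ℝ (s ⟶ G.obj (F.obj t))) :
    IsFinDim Y := by
  obtain ⟨hX, n, S, hf, hS, hP⟩ := hX
  have : IsLocallyPresentable.{0} X.carrier := hX
  have := hG.additive
  have := hG.linear
  have := hG.cocontinuous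
  refine ⟨isLocallyPresentable_of_adjunction adj, n, fun k => F.obj (S k), fun k l => ?_, fun k => ?_,
    fun P hP₀ hP₁ y => ?_⟩
  · have := hF (fun s t hs ht => hs.finite_hom hf hP ht) (S k) (S l) (hS k) (hS l)
    let φ : (F.obj (S k) ⟶ F.obj (S l)) →ₗ[ℝ] (S k ⟶ G.obj (F.obj (S l))) :=
      { toFun := adj.homEquiv _ _
        map_add' := fun f g => by simp [Adjunction.homEquiv_unit]
        map_smul' := fun r f => by simp [Adjunction.homEquiv_unit, Functor.map_smul] }
    exact Module.Finite.of_injective φ (adj.homEquiv _ _).injective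
  · have := hS k
    let e : G ⋙ (linearCoyoneda ℝ X.carrier).obj (op (S k)) ≅
        (linearCoyoneda ℝ Y.carrier).obj (op (F.obj (S k))) :=
      NatIso.ofComponents (fun y => LinearEquiv.toModuleIso
        { (adj.homEquiv (S k) y).symm with
          map_add' := fun f g => (adj.homEquiv (S k) y).injective <| by
            simp [Adjunction.homEquiv_unit, Adjunction.homEquiv_counit]
          map_smul' := fun r f => (adj.homEquiv (S k) y).injective <| by
            simp [Adjunction.homEquiv_unit, Adjunction.homEquiv_counit, Functor.map_smul] })
        fun f => ModuleCat.hom_ext (LinearMap.ext fun g =>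
          adj.homEquiv_naturality_right_symm g f)
    exact preservesColimits_of_natIso e
  · have := hP₀ WalkingParallelPair
    refine prop_of_adjunction adj P (fun x => ?_) y
    have : F.IsLeftAdjoint := adj.isLeftAdjoint
    exact hP (P.inverseImage F) (fun J _ => by infer_instance) hP₁ x

end FinDim

section Fix

open MonoidalCategory MonoidalLeftAction SemiProd SuperVect SuperAut

variable {W : LinMod SuperSemi} (hW : IsSuperMod W) [HasBinaryBiproducts W.carrier]
  [IsIdempotentComplete W.carrier]

/-- The free fixed point on an object. -/
def freePt (w : W.carrier) : FixedPt inclJ W := (exists_free hW w).choose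

/-- The unit of the free fixed point. -/
def freeUnit (w : W.carrier) : w ⟶ (freePt hW w).pt := (exists_free hW w).choose_spec.choose

/-- The retraction of the free fixed point. -/
def freeRet (w : W.carrier) : (freePt hW w).pt ⟶ w :=
  (exists_free hW w).choose_spec.choose_spec.choose

/-- The retraction of the free fixed point to the conjugate. -/
def freeRetConj (w : W.carrier) : (freePt hW w).pt ⟶ inclJ.obj conj ⊙ₗ w :=
  (exists_free hW w).choose_spec.choose_spec.choose_spec.choose

lemma freeUnit_freeRet (w : W.carrier) : freeUnit hW w ≫ freeRet hW w =
    (1 / 2 : ℝ) • (𝟙 w + parityEndo w) :=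
  (exists_free hW w).choose_spec.choose_spec.choose_spec.choose_spec.1

lemma conj_freeUnit_freeRet (w : W.carrier) :
    inclJ.obj conj ⊴ₗ freeUnit hW w ≫ (freePt hW w).conjHom ≫ freeRet hW w = 0 := by
  rw [← Category.assoc]
  exact (exists_free hW w).choose_spec.choose_spec.choose_spec.choose_spec.2.1

lemma freePt_total (w : W.carrier) : freeRet hW w ≫ freeUnit hW w +
    freeRetConj hW w ≫ inclJ.obj conj ⊴ₗ freeUnit hW w ≫ (freePt hW w).conjHom = 𝟙 _ :=
  (exists_free hW w).choose_spec.choose_spec.choose_spec.choose_spec.2.2.1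

lemma exists_free_desc (w : W.carrier) (x : FixedPt inclJ W) (f : w ⟶ x.pt) :
    ∃ g : freePt hW w ⟶ x, freeUnit hW w ≫ FixedPt.val g = f :=
  (exists_free hW w).choose_spec.choose_spec.choose_spec.choose_spec.2.2.2 x f

lemma freePt_hom_ext {w z : W.carrier} {m m' : (freePt hW w).pt ⟶ z}
    (h : freeUnit hW w ≫ m = freeUnit hW w ≫ m')
    (h' : inclJ.obj conj ⊴ₗ freeUnit hW w ≫ (freePt hW w).conjHom ≫ m =
      inclJ.obj conj ⊴ₗ freeUnit hW w ≫ (freePt hW w).conjHom ≫ m') : m = m' := by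
  rw [← Category.id_comp m, ← Category.id_comp m', ← freePt_total]
  simp only [Preadditive.add_comp, Category.assoc, h, h']

/-- The universal property of the free fixed point. -/
def freeEquiv (w : W.carrier) (x : FixedPt inclJ W) : (freePt hW w ⟶ x) ≃ (w ⟶ x.pt) :=
  Equiv.ofBijective (fun g => freeUnit hW w ≫ FixedPt.val g)
    ⟨fun g g' (h : freeUnit hW w ≫ FixedPt.val g = freeUnit hW w ≫ FixedPt.val g') =>
      FixedPt.hom_ext (freePt_hom_ext hW h (by
        rw [← FixedPt.conjHom_comm, ← FixedPt.conjHom_comm, ← actionHomRight_comp_assoc, h,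
          actionHomRight_comp_assoc])), exists_free_desc hW w x⟩

/-- Functoriality of the free fixed point. -/
def freeMap {w w' : W.carrier} (f : w ⟶ w') : freePt hW w ⟶ freePt hW w' :=
  (freeEquiv hW w (freePt hW w')).symm (f ≫ freeUnit hW w')

lemma freeUnit_natural {w w' : W.carrier} (f : w ⟶ w') :
    f ≫ freeUnit hW w' = freeUnit hW w ≫ FixedPt.val (freeMap hW f) :=
  (Equiv.apply_symm_apply (freeEquiv hW w (freePt hW w')) _).symm

/-- The free fixed point functor. -/
def freeFix : W.carrier ⥤ FixedPt inclJ W where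
  obj := freePt hW
  map := freeMap hW
  map_id w := (freeEquiv hW w (freePt hW w)).injective
    (show freeUnit hW w ≫ FixedPt.val _ = freeUnit hW w ≫ 𝟙 _ by
      rw [← freeUnit_natural, Category.id_comp, Category.comp_id])
  map_comp {w w' w''} f g := (freeEquiv hW w (freePt hW w'')).injective
    (show freeUnit hW w ≫ FixedPt.val _ = freeUnit hW w ≫ FixedPt.val _ ≫ FixedPt.val _ by
      rw [← freeUnit_natural, ← Category.assoc (freeUnit hW w), ← freeUnit_natural, Category.assoc,
        Category.assoc, freeUnit_natural])

/-- Free fixed points are left adjoint to the forgetful functor. -/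
def freeAdj : freeFix hW ⊣ FixedPt.forget inclJ W :=
  Adjunction.mkOfHomEquiv
    { homEquiv := freeEquiv hW
      homEquiv_naturality_left_symm := fun {w' w x} f g =>
        (freeEquiv hW w' x).injective (by
          refine ((freeEquiv hW w' x).apply_symm_apply _).trans ?_
          have h : freeUnit hW w ≫ FixedPt.val ((freeEquiv hW w x).symm g) = g :=
            (freeEquiv hW w x).apply_symm_apply g
          change f ≫ g = freeUnit hW w' ≫ FixedPt.val (freeMap hW f) ≫ FixedPt.val _
          rw [← Category.assoc, ← freeUnit_natural, Category.assoc]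
          exact (congrArg (f ≫ ·) h).symm)
      homEquiv_naturality_right := fun {w x x'} f g =>
        (Category.assoc (freeUnit hW w) (FixedPt.val f) (FixedPt.val g)).symm }

lemma freeRet_natural {w w' : W.carrier} (f : w ⟶ w') :
    FixedPt.val (freeMap hW f) ≫ freeRet hW w' = freeRet hW w ≫ f := by
  have h := FixedPt.conjHom_comm (freeMap hW f)
  refine freePt_hom_ext hW ?_ ?_
  · rw [← Category.assoc, ← freeUnit_natural, Category.assoc, freeUnit_freeRet,
      ← Category.assoc, freeUnit_freeRet, Linear.comp_smul, Linear.smul_comp, Preadditive.comp_add,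
      Preadditive.add_comp, parityEndo_natural, Category.comp_id, Category.id_comp]
  · have h₀ : inclJ.obj conj ⊴ₗ freeUnit hW w ≫ (freePt hW w).conjHom ≫ freeRet hW w ≫ f = 0 := by
      have := conj_freeUnit_freeRet hW w =≫ f
      simpa only [Category.assoc, zero_comp] using this
    rw [h₀, ← reassoc_of% h, ← actionHomRight_comp_assoc, ← freeUnit_natural,
      actionHomRight_comp_assoc, conj_freeUnit_freeRet, comp_zero]

end Fix

section Objects

open MonoidalCategory MonoidalLeftAction SemiProd SuperVect SuperAut

lemma isSuperMod_of_mem {Q : LinCat → Prop} {W : LinMod SuperSemi}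
    (h : (cocontMod (SemiProd.inclD vectToSuperVect) Q).obj W) : IsSuperMod W := ⟨h.2.1, h.2.2⟩

lemma isPres_fixObj {W : LinMod SuperSemi} (hW : IsSuperMod W) (h : IsPres W.toLinCat) :
    IsPres (fixObj (commutation vectToSuperVect) W).toLinCat := by
  have := h.hasColimits
  have := h.hasBinaryBiproducts
  have := h.isIdempotentComplete
  have : IsLocallyPresentable.{0} W.carrier := h
  have : PreservesColimitsOfSize.{0, 0} (FixedPt.forget inclJ W) :=
    (FixedPt.isCocontLinear_forget hW).cocontinuous
  have : HasColimitsOfSize.{0, 0} (FixedPt inclJ W) := FixedPt.hasColimits hW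
  have h' : IsLocallyPresentable.{0} (FixedPt inclJ W) :=
    isLocallyPresentable_of_adjunction (freeAdj hW)
  exact h'

lemma isTiny_conj {W : LinMod SuperSemi} (hW : IsSuperMod W) {s : W.carrier} (hs : IsTiny s) :
    IsTiny (inclJ.obj conj ⊙ₗ s) := by
  have hadd {a b : W.carrier} (f g : a ⟶ b) :
    inclJ.obj conj ⊴ₗ (f + g) = inclJ.obj conj ⊴ₗ f + inclJ.obj conj ⊴ₗ g := W.action_add _ f g
  have hsmul {a b : W.carrier} (r : ℝ) (f : a ⟶ b) :
    inclJ.obj conj ⊴ₗ (r • f) = r • inclJ.obj conj ⊴ₗ f := W.action_smul _ r f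
  let l (y : W.carrier) : (s ⟶ inclJ.obj conj ⊙ₗ y) ≃ₗ[ℝ] (inclJ.obj conj ⊙ₗ s ⟶ y) :=
    { toFun := fun g => inclJ.obj conj ⊴ₗ g ≫ (conjInv y).hom
      invFun := fun f => (conjInv s).inv ≫ inclJ.obj conj ⊴ₗ f
      map_add' := fun f g => by rw [hadd, Preadditive.add_comp]
      map_smul' := fun r f => by rw [hsmul, Linear.smul_comp]; rfl
      left_inv := fun g => by
        dsimp only
        rw [actionHomRight_comp, ← conjInv_conj, conjInv_natural, Iso.inv_hom_id_assoc]
      right_inv := fun f => by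
        dsimp only
        rw [actionHomRight_comp_assoc, conjInv_natural, conjInv_conj, ← actionHomRight_comp_assoc,
          Iso.inv_hom_id, actionHomRight_id, Category.id_comp] }
  let e : act W (inclJ.obj conj) ⋙ (linearCoyoneda ℝ W.carrier).obj (op s) ≅
      (linearCoyoneda ℝ W.carrier).obj (op (inclJ.obj conj ⊙ₗ s)) :=
    NatIso.ofComponents (fun y => (l y).toModuleIso) fun {y y'} f =>
      ModuleCat.hom_ext (LinearMap.ext fun (g : s ⟶ inclJ.obj conj ⊙ₗ y) => by
        change inclJ.obj conj ⊴ₗ (g ≫ inclJ.obj conj ⊴ₗ f) ≫ (conjInv y').hom =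
          (inclJ.obj conj ⊴ₗ g ≫ (conjInv y).hom) ≫ f
        rw [actionHomRight_comp_assoc, conjInv_natural, Category.assoc])
  have : PreservesColimitsOfSize.{0, 0} ((linearCoyoneda ℝ W.carrier).obj (op s)) := hs
  have := (hW.act (inclJ.obj conj)).cocontinuous
  exact preservesColimits_of_natIso e

lemma isFinDim_fixObj {W : LinMod SuperSemi} (hW : IsSuperMod W) (h : IsFinDim W.toLinCat) :
    IsFinDim (fixObj (commutation vectToSuperVect) W).toLinCat := by
  have := IsPres.hasColimits h.1
  have := IsPres.hasBinaryBiproducts h.1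
  have := IsPres.isIdempotentComplete h.1
  let Y : LinCat := { carrier := FixedPt inclJ W }
  have : HasColimitsOfSize.{0, 0} Y.carrier := FixedPt.hasColimits hW
  have : Functor.Faithful (C := Y.carrier) (FixedPt.forget inclJ W) :=
    inferInstanceAs (FixedPt.forget inclJ W).Faithful
  have : Functor.ReflectsIsomorphisms (C := Y.carrier) (FixedPt.forget inclJ W) :=
    inferInstanceAs (FixedPt.forget inclJ W).ReflectsIsomorphisms
  refine isFinDim_of_adjunction (X := W.toLinCat) (Y := Y) (freeAdj hW)
    (FixedPt.isCocontLinear_forget hW) h fun H s t hs ht => ?_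
  have := H s t hs ht
  have := H s _ hs (isTiny_conj hW ht)
  let φ : (s ⟶ (freePt hW t).pt) →ₗ[ℝ] (s ⟶ t) × (s ⟶ inclJ.obj conj ⊙ₗ t) :=
    LinearMap.prod
      { toFun := fun f => f ≫ freeRet hW t
        map_add' := fun f g => Preadditive.add_comp _ _ _ _ _ _
        map_smul' := fun r f => Linear.smul_comp _ _ _ _ _ _ }
      { toFun := fun f => f ≫ freeRetConj hW t
        map_add' := fun f g => Preadditive.add_comp _ _ _ _ _ _
        map_smul' := fun r f => Linear.smul_comp _ _ _ _ _ _ }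
  refine Module.Finite.of_injective φ fun (f g : s ⟶ (freePt hW t).pt) hfg => ?_
  have h₁ : f ≫ freeRet hW t = g ≫ freeRet hW t := congrArg Prod.fst hfg
  have h₂ : f ≫ freeRetConj hW t = g ≫ freeRetConj hW t := congrArg Prod.snd hfg
  rw [← Category.comp_id f, ← Category.comp_id g, ← freePt_total, Preadditive.comp_add,
    Preadditive.comp_add, reassoc_of% h₁, reassoc_of% h₂]

lemma act_fixObj {W : LinMod SuperSemi} (hW : IsSuperMod W) [HasColimitsOfSize.{0, 0} W.carrier]
    (c : ModuleCat.{0} ℝ) : IsCocontLinear (act (fixObj (commutation vectToSuperVect) W) c) :=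
  FixedPt.isCocontLinear_of_forget hW
    ((FixedPt.isCocontLinear_forget hW).comp (hW.act (inclL.obj (vectToSuperVect.obj c))))

lemma orbit_fixObj {W : LinMod SuperSemi} (hW : IsSuperMod W) [HasColimitsOfSize.{0, 0} W.carrier]
    (x : FixedPt inclJ W) :
    IsCocontLinear (orbit (𝟭 _) (fixObj (commutation vectToSuperVect) W) x) :=
  FixedPt.isCocontLinear_of_forget hW (isCocontLinear_vectToSuperVect.comp (hW.orbit x.pt))

lemma fixMap_isCocontLinear {W W' : LinMod SuperSemi} (hW : IsSuperMod W) (hW' : IsSuperMod W')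
    [HasColimitsOfSize.{0, 0} W.carrier] [HasColimitsOfSize.{0, 0} W'.carrier] (F : W ⟶ W')
    (hF : IsCocontLinear F.functor) :
    IsCocontLinear (fixMap (commutation vectToSuperVect) F).functor :=
  FixedPt.isCocontLinear_of_forget hW' ((FixedPt.isCocontLinear_forget hW).comp hF)

end Objects

/-- The complexification of a linear category, with the same objects. -/
structure Cplx (V : Type u) where
  /-- The underlying object. -/
  of : V

namespace Cplx

variable {V : Type u} [Category.{v} V] [Preadditive V] {U : Type u₁} [Category.{v₁} U]
  [Preadditive U]

/-- The real and imaginary parts of a morphism of the complexification. -/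
structure Hom (x y : Cplx V) where
  /-- The real part. -/
  re : x.of ⟶ y.of
  /-- The imaginary part. -/
  im : x.of ⟶ y.of

omit [Preadditive V] in
lemma Hom.ext' {x y : Cplx V} {f g : Hom x y} (h : f.re = g.re) (h' : f.im = g.im) : f = g := by
  cases f; cases g; cases h; cases h'; rfl

instance : Category (Cplx V) where
  Hom := Hom
  id x := ⟨𝟙 x.of, 0⟩
  comp f g := ⟨f.re ≫ g.re - f.im ≫ g.im, f.re ≫ g.im + f.im ≫ g.re⟩
  id_comp f := Hom.ext' (by simp) (by simp)
  comp_id f := Hom.ext' (by simp) (by simp)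
  assoc f g h := Hom.ext' (by simp; abel) (by simp; abel)

/-- The canonical functor to the complexification. -/
def incl : V ⥤ Cplx V where
  obj v := ⟨v⟩
  map f := ⟨f, 0⟩
  map_id v := rfl
  map_comp f g := Hom.ext' (by change f ≫ g = f ≫ g - 0 ≫ 0; simp)
    (by change 0 = f ≫ 0 + 0 ≫ g; simp)

/-- A functor with a complex structure extends to the complexification. -/
def lift (G : V ⥤ U) [G.Additive] (I : ∀ v, G.obj v ⟶ G.obj v)
    (hI : ∀ (v v') (f : v ⟶ v'), G.map f ≫ I v' = I v ≫ G.map f)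
    (hI' : ∀ v, I v ≫ I v = -𝟙 _) : Cplx V ⥤ U where
  obj x := G.obj x.of
  map {x y} f := G.map (Hom.re f) + G.map (Hom.im f) ≫ I y.of
  map_id x := by
    change G.map (𝟙 x.of) + G.map 0 ≫ I x.of = 𝟙 _
    simp
  map_comp {x y z} f g := by
    change G.map (Hom.re f ≫ Hom.re g - Hom.im f ≫ Hom.im g) +
      G.map (Hom.re f ≫ Hom.im g + Hom.im f ≫ Hom.re g) ≫ I z.of = _
    have h := hI _ _ (Hom.im g)
    have h' := hI _ _ (Hom.re g)
    simp only [G.map_sub, G.map_add, G.map_comp, Preadditive.add_comp, Preadditive.comp_add,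
      Category.assoc, ← h']
    rw [h, reassoc_of% hI' y.of]
    simp
    abel

end Cplx

section Real

open MonoidalCategory MonoidalLeftAction SemiProd SuperVect SuperAut

lemma faithful_act {W : LinMod SuperSemi} {e : SuperSemi} (q : e ⊗ e ≅ 𝟙_ SuperSemi) :
    (act W e).Faithful :=
  ⟨fun {x y f g} (h : e ⊴ₗ f = e ⊴ₗ g) => by
    rw [← cancel_epi (actInv q x).hom, ← actInv_natural, ← actInv_natural, h]⟩

lemma full_act {W : LinMod SuperSemi} {e : SuperSemi} (q : e ⊗ e ≅ 𝟙_ SuperSemi) :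
    (act W e).Full :=
  ⟨fun {x y} (f : e ⊙ₗ x ⟶ e ⊙ₗ y) => ⟨(actInv q x).inv ≫ e ⊴ₗ f ≫ (actInv q y).hom, by
    have := faithful_act (W := W) q
    refine (act W e).map_injective ?_
    change e ⊴ₗ e ⊴ₗ _ = e ⊴ₗ f
    rw [← cancel_mono (actInv q y).hom, actInv_natural, Iso.hom_inv_id_assoc]⟩⟩

variable {W : LinMod SuperSemi} (hW : IsSuperMod W)

/-- The tensor square of the unit. -/
def unitSqSemi : inclL.obj (𝟙_ SuperVect) ⊗ inclL.obj (𝟙_ SuperVect) ≅ 𝟙_ SuperSemi :=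
  Functor.Monoidal.μIso inclL (𝟙_ SuperVect) (𝟙_ SuperVect) ≪≫ inclL.mapIso (λ_ _)

include hW in
lemma exists_re_im {x y : FixedPt inclJ W} (m : x.pt ⟶ y.pt) :
    ∃ f g : x ⟶ y, m = FixedPt.val f + FixedPt.val g ≫ imagEndo y.pt := by
  have : (act W (inclJ.obj conj)).Additive := (hW.act _).additive
  have : (act W (inclJ.obj conj)).Linear ℝ := (hW.act _).linear
  let b : x.pt ⟶ y.pt := inv x.conjHom ≫ inclJ.obj conj ⊴ₗ m ≫ y.conjHom
  have hb : inclJ.obj conj ⊴ₗ m ≫ y.conjHom = x.conjHom ≫ b := by simp [b]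
  have hb' : inclJ.obj conj ⊴ₗ b ≫ y.conjHom = x.conjHom ≫ m := by
    have hx := x.isDescent.sq
    have hy := y.isDescent.sq
    rw [← cancel_epi (inclJ.obj conj ⊴ₗ x.conjHom), ← actionHomRight_comp_assoc, ← hb,
      actionHomRight_comp_assoc, hy, conjInv_natural, ← reassoc_of% hx]
  have hadd (p q : x.pt ⟶ y.pt) : inclJ.obj conj ⊴ₗ (p + q) =
    inclJ.obj conj ⊴ₗ p + inclJ.obj conj ⊴ₗ q := (act W (inclJ.obj conj)).map_add
  have hsub (p q : x.pt ⟶ y.pt) : inclJ.obj conj ⊴ₗ (p - q) =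
    inclJ.obj conj ⊴ₗ p - inclJ.obj conj ⊴ₗ q := (act W (inclJ.obj conj)).map_sub
  have hsmul (r : ℝ) (p : x.pt ⟶ y.pt) : inclJ.obj conj ⊴ₗ (r • p) =
    r • inclJ.obj conj ⊴ₗ p := (act W (inclJ.obj conj)).map_smul r p
  have hI : inclJ.obj conj ⊴ₗ imagEndo y.pt ≫ y.conjHom = -(y.conjHom ≫ imagEndo y.pt) := by
    rw [conj_imagEndo hW, Preadditive.neg_comp, imagEndo_natural]
  refine ⟨FixedPt.homOfConj ((1 / 2 : ℝ) • (m + b)) ?_,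
    FixedPt.homOfConj ((1 / 2 : ℝ) • ((b - m) ≫ imagEndo y.pt)) ?_, ?_⟩
  · rw [hsmul, hadd, Linear.smul_comp, Preadditive.add_comp, hb, hb', Linear.comp_smul,
      Preadditive.comp_add, add_comm]
  · rw [hsmul, actionHomRight_comp, hsub, Linear.smul_comp, Category.assoc, hI,
      Preadditive.comp_neg, Preadditive.sub_comp, reassoc_of% hb, reassoc_of% hb',
      Linear.comp_smul, Preadditive.sub_comp, Preadditive.comp_sub, neg_sub]
  · rw [FixedPt.val_homOfConj, FixedPt.val_homOfConj, Linear.smul_comp, Category.assoc,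
      imagEndo_imagEndo hW, Preadditive.comp_neg, Category.comp_id, ← smul_add, neg_sub]
    rw [show m + b + (m - b) = (2 : ℝ) • m by rw [two_smul]; abel, smul_smul]
    norm_num

include hW in
lemma re_im_injective {x y : FixedPt inclJ W} {f g f' g' : x ⟶ y}
    (h : FixedPt.val f + FixedPt.val g ≫ imagEndo y.pt =
      FixedPt.val f' + FixedPt.val g' ≫ imagEndo y.pt) : f = f' ∧ g = g' := by
  have : (act W (inclJ.obj conj)).Additive := (hW.act _).additive
  have hadd {a b : W.carrier} (p q : a ⟶ b) : inclJ.obj conj ⊴ₗ (p + q) =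
    inclJ.obj conj ⊴ₗ p + inclJ.obj conj ⊴ₗ q := (act W (inclJ.obj conj)).map_add
  have hI : inclJ.obj conj ⊴ₗ imagEndo y.pt ≫ y.conjHom = -(y.conjHom ≫ imagEndo y.pt) := by
    rw [conj_imagEndo hW, Preadditive.neg_comp, imagEndo_natural]
  have hc (f g : x ⟶ y) : inclJ.obj conj ⊴ₗ (FixedPt.val f + FixedPt.val g ≫ imagEndo y.pt) ≫
      y.conjHom = x.conjHom ≫ (FixedPt.val f - FixedPt.val g ≫ imagEndo y.pt) := by
    rw [hadd, actionHomRight_comp, Preadditive.add_comp, Category.assoc, hI, FixedPt.conjHom_comm,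
      Preadditive.comp_neg, ← Category.assoc (inclJ.obj conj ⊴ₗ FixedPt.val g),
      FixedPt.conjHom_comm, Preadditive.comp_sub, Category.assoc, sub_eq_add_neg]
  have h₂ : FixedPt.val f - FixedPt.val g ≫ imagEndo y.pt =
      FixedPt.val f' - FixedPt.val g' ≫ imagEndo y.pt := by
    rw [← cancel_epi x.conjHom, ← hc, ← hc, h]
  have h₃ : FixedPt.val f = FixedPt.val f' := by
    have := congrArg₂ (· + ·) h h₂
    simp only [add_add_sub_cancel, ← two_smul ℝ] at this
    exact smul_right_injective _ (two_ne_zero) this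
  have h₄ : FixedPt.val g ≫ imagEndo y.pt = FixedPt.val g' ≫ imagEndo y.pt := by
    rw [h₃] at h
    exact add_left_cancel h
  refine ⟨FixedPt.hom_ext h₃, FixedPt.hom_ext ?_⟩
  have := congrArg (· ≫ imagEndo y.pt) h₄
  simpa [imagEndo_imagEndo hW] using this

variable {V : Type u₁} [Category.{v₁} V] [Preadditive V] (G : V ⥤ FixedPt inclJ W) [G.Additive]

/-- Objects with a real structure, and all morphisms between them. -/
def realPart : Cplx V ⥤ W.carrier :=
  Cplx.lift (G ⋙ FixedPt.forget inclJ W) (fun v => imagEndo (G.obj v).pt)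
    (fun _ _ _ => imagEndo_natural _) fun _ => imagEndo_imagEndo hW _

instance [G.Full] : (realPart hW G).Full :=
  ⟨fun {x y} (m : (G.obj x.of).pt ⟶ (G.obj y.of).pt) => by
    obtain ⟨f, g, h⟩ := exists_re_im hW m
    obtain ⟨f, rfl⟩ := G.map_surjective f
    obtain ⟨g, rfl⟩ := G.map_surjective g
    exact ⟨⟨f, g⟩, h.symm⟩⟩

instance [G.Faithful] : (realPart hW G).Faithful :=
  ⟨fun {x y f g} h => by
    obtain ⟨h, h'⟩ := re_im_injective hW h
    exact Cplx.Hom.ext' (G.map_injective h) (G.map_injective h')⟩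

/-- Twists of objects with a real structure. -/
abbrev twistPart (d : SuperVect) : Cplx V ⥤ W.carrier := realPart hW G ⋙ act W (inclL.obj d)

lemma twistPart_map (d : SuperVect) {x y : Cplx V} (f : x ⟶ y) : (twistPart hW G d).map f =
    inclL.obj d ⊴ₗ FixedPt.val (G.map f.re) + inclL.obj d ⊴ₗ FixedPt.val (G.map f.im) ≫
      inclL.map (imag d) ⊵ₗ (G.obj y.of).pt := by
  have : (act W (inclL.obj d)).Additive := (hW.act _).additive
  refine ((act W (inclL.obj d)).map_add (f := FixedPt.val (G.map f.re))
    (g := FixedPt.val (G.map f.im) ≫ imagEndo (G.obj y.of).pt)).trans (congrArg _ ?_)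
  exact (actionHomRight_comp _ _ _).trans (congrArg _ (inclL_imagEndo _ _))

instance [G.Full] : (twistPart hW G (𝟙_ SuperVect)).Full :=
  have := full_act (W := W) unitSqSemi
  inferInstance
instance [G.Faithful] : (twistPart hW G (𝟙_ SuperVect)).Faithful :=
  have := faithful_act (W := W) unitSqSemi
  inferInstance
instance [G.Full] : (twistPart hW G oddLine).Full :=
  have := full_act (W := W) oddSqSemi
  inferInstance
instance [G.Faithful] : (twistPart hW G oddLine).Faithful :=
  have := faithful_act (W := W) oddSqSemi
  inferInstance

lemma parityEndo_even (x : FixedPt inclJ W) :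
    parityEndo (inclL.obj (𝟙_ SuperVect) ⊙ₗ x.pt) = 𝟙 _ := by
  rw [parityEndo_inclL, x.isDescent.parity,
    show parityHom (𝟙_ SuperVect) = 𝟙 _ from parityHom_even _]
  simp

include hW in
lemma parityEndo_odd (x : FixedPt inclJ W) :
    parityEndo (inclL.obj oddLine ⊙ₗ x.pt) = -𝟙 _ := by
  rw [oddLine_parityEndo hW, x.isDescent.parity, actionHomRight_id]

include hW in
lemma even_odd_eq_zero {x y : FixedPt inclJ W}
    (m : inclL.obj (𝟙_ SuperVect) ⊙ₗ x.pt ⟶ inclL.obj oddLine ⊙ₗ y.pt) : m = 0 := by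
  have h := parityEndo_natural m
  rw [parityEndo_odd hW, parityEndo_even, Preadditive.comp_neg, Category.comp_id,
    Category.id_comp] at h
  have : (2 : ℝ) • m = 0 := by rw [two_smul]; nth_rw 1 [← h]; simp
  simpa using this

include hW in
lemma odd_even_eq_zero {x y : FixedPt inclJ W}
    (m : inclL.obj oddLine ⊙ₗ x.pt ⟶ inclL.obj (𝟙_ SuperVect) ⊙ₗ y.pt) : m = 0 := by
  have h := parityEndo_natural m
  rw [parityEndo_odd hW, parityEndo_even, Preadditive.neg_comp, Category.comp_id,
    Category.id_comp] at h
  have : (2 : ℝ) • m = 0 := by rw [two_smul]; nth_rw 1 [h]; simp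
  simpa using this

section

omit [Preadditive V] [G.Additive]
variable [HasBinaryBiproducts W.carrier] [IsIdempotentComplete W.carrier] [G.IsEquivalence]

/-- The free object with a real structure. -/
def freeOf : W.carrier ⥤ V := freeFix hW ⋙ G.inv

/-- The free object with a real structure, as a fixed point. -/
def freeOfIso (w : W.carrier) : G.obj ((freeOf hW G).obj w) ≅ freePt hW w :=
  G.asEquivalence.counitIso.app (freePt hW w)

lemma freeOfIso_natural {w w' : W.carrier} (f : w ⟶ w') :
    G.map ((freeOf hW G).map f) ≫ (freeOfIso hW G w').hom =
      (freeOfIso hW G w).hom ≫ freeMap hW f :=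
  G.asEquivalence.counitIso.hom.naturality (freeMap hW f)

/-- The unit, to the free object with a real structure. -/
def freeIn (w : W.carrier) : w ⟶ (G.obj ((freeOf hW G).obj w)).pt :=
  freeUnit hW w ≫ FixedPt.val (freeOfIso hW G w).inv

/-- The retraction, from the free object with a real structure. -/
def freeOut (w : W.carrier) : (G.obj ((freeOf hW G).obj w)).pt ⟶ w :=
  FixedPt.val (freeOfIso hW G w).hom ≫ freeRet hW w

lemma freeIn_freeOut (w : W.carrier) :
    freeIn hW G w ≫ freeOut hW G w = (1 / 2 : ℝ) • (𝟙 w + parityEndo w) := by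
  have h : FixedPt.val (freeOfIso hW G w).inv ≫ FixedPt.val (freeOfIso hW G w).hom = 𝟙 _ :=
    congrArg FixedPt.val (freeOfIso hW G w).inv_hom_id
  rw [freeIn, freeOut, Category.assoc, reassoc_of% h, freeUnit_freeRet]

lemma freeIn_natural {w w' : W.carrier} (f : w ⟶ w') :
    f ≫ freeIn hW G w' = freeIn hW G w ≫ FixedPt.val (G.map ((freeOf hW G).map f)) := by
  have h : FixedPt.val (freeMap hW f) ≫ FixedPt.val (freeOfIso hW G w').inv =
      FixedPt.val (freeOfIso hW G w).inv ≫ FixedPt.val (G.map ((freeOf hW G).map f)) :=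
    congrArg FixedPt.val (show freeMap hW f ≫ (freeOfIso hW G w').inv =
      (freeOfIso hW G w).inv ≫ G.map ((freeOf hW G).map f) by
        rw [Iso.comp_inv_eq, Category.assoc, freeOfIso_natural, Iso.inv_hom_id_assoc])
  rw [freeIn, freeIn, ← Category.assoc, freeUnit_natural, Category.assoc, Category.assoc, h]

lemma freeOut_natural {w w' : W.carrier} (f : w ⟶ w') :
    FixedPt.val (G.map ((freeOf hW G).map f)) ≫ freeOut hW G w' = freeOut hW G w ≫ f := by
  have h : FixedPt.val (G.map ((freeOf hW G).map f)) ≫ FixedPt.val (freeOfIso hW G w').hom =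
      FixedPt.val (freeOfIso hW G w).hom ≫ FixedPt.val (freeMap hW f) :=
    congrArg FixedPt.val (freeOfIso_natural hW G f)
  rw [freeOut, freeOut, Category.assoc, ← freeRet_natural, reassoc_of% h]

end

end Real

lemma Preadditive.add_comp_intertwine {U : Type u} [Category.{v} U] [Preadditive U]
    {X Y X' Y' : U} {a b : X ⟶ Y} {c : Y ⟶ Y} {a' b' : X' ⟶ Y'} {c' : Y' ⟶ Y'} {t : X ⟶ X'}
    {t' : Y ⟶ Y'} (ha : a ≫ t' = t ≫ a') (hb : b ≫ t' = t ≫ b') (hc : c ≫ t' = t' ≫ c') :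
    (a + b ≫ c) ≫ t' = t ≫ (a' + b' ≫ c') := by
  rw [Preadditive.add_comp, Preadditive.comp_add, ha, Category.assoc, hc, reassoc_of% hb]

lemma Functor.map_add_comp {W : Type u₁} [Category.{v₁} W] [Preadditive W] {U : Type u}
    [Category.{v} U] [Preadditive U] (K : W ⥤ U) [K.Additive] {X Y : W} (a b : X ⟶ Y)
    (c : Y ⟶ Y) : K.map (a + b ≫ c) = K.map a + K.map b ≫ K.map c := by
  rw [K.map_add, K.map_comp]

section Split

open MonoidalCategory MonoidalLeftAction SemiProd SuperVect SuperAut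

variable {W : LinMod SuperSemi} (hW : IsSuperMod W)
  {V : Type u₁} [Category.{v₁} V] [Preadditive V] (G : V ⥤ FixedPt inclJ W) [G.Additive]

lemma twistPart_map_incl (d : SuperVect) {x y : V} (f : x ⟶ y) :
    (twistPart hW G d).map (Cplx.incl.map f) = inclL.obj d ⊴ₗ FixedPt.val (G.map f) := by
  have : (act W (inclL.obj d)).Additive := (hW.act _).additive
  rw [twistPart_map]
  have h : inclL.obj d ⊴ₗ FixedPt.val (G.map (0 : x ⟶ y)) = 0 := by
    rw [G.map_zero]
    exact (act W (inclL.obj d)).map_zero _ _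
  refine Eq.trans (congrArg (_ + ·) ((congrArg (· ≫ _) h).trans zero_comp)) (add_zero _)

section

variable [HasBinaryBiproducts W.carrier] [IsIdempotentComplete W.carrier] [G.IsEquivalence]

/-- The even part of an object, as a subobject. -/
def evenIn (w : W.carrier) : w ⟶ 𝟙_ SuperSemi ⊙ₗ (G.obj ((freeOf hW G).obj w)).pt :=
  freeIn hW G w ≫ (λₗ[SuperSemi] (G.obj ((freeOf hW G).obj w)).pt).inv

/-- The even part of an object, as a quotient. -/
def evenOut (w : W.carrier) : 𝟙_ SuperSemi ⊙ₗ (G.obj ((freeOf hW G).obj w)).pt ⟶ w :=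
  (λₗ[SuperSemi] (G.obj ((freeOf hW G).obj w)).pt).hom ≫ freeOut hW G w

/-- The odd part of an object, as a subobject. -/
def oddIn (w : W.carrier) : w ⟶ inclL.obj oddLine ⊙ₗ
    (G.obj ((freeOf hW G).obj (inclL.obj oddLine ⊙ₗ w))).pt :=
  (oddInv w).inv ≫ inclL.obj oddLine ⊴ₗ freeIn hW G (inclL.obj oddLine ⊙ₗ w)

/-- The odd part of an object, as a quotient. -/
def oddOut (w : W.carrier) : inclL.obj oddLine ⊙ₗ
    (G.obj ((freeOf hW G).obj (inclL.obj oddLine ⊙ₗ w))).pt ⟶ w :=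
  inclL.obj oddLine ⊴ₗ freeOut hW G (inclL.obj oddLine ⊙ₗ w) ≫ (oddInv w).hom

omit [Preadditive V] [G.Additive] in
lemma evenIn_natural {w w' : W.carrier} (f : w ⟶ w') : f ≫ evenIn hW G w' =
    evenIn hW G w ≫ 𝟙_ SuperSemi ⊴ₗ FixedPt.val (G.map ((freeOf hW G).map f)) := by
  rw [evenIn, evenIn, ← Category.assoc, freeIn_natural, Category.assoc, Category.assoc]
  refine congrArg _ ?_
  rw [Iso.comp_inv_eq, Category.assoc, Iso.eq_inv_comp]
  exact actionUnitIso_hom_naturality (C := SuperSemi) _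

omit [Preadditive V] [G.Additive] in
lemma evenOut_natural {w w' : W.carrier} (f : w ⟶ w') :
    𝟙_ SuperSemi ⊴ₗ FixedPt.val (G.map ((freeOf hW G).map f)) ≫ evenOut hW G w' =
      evenOut hW G w ≫ f := by
  rw [evenOut, evenOut, Category.assoc, ← freeOut_natural, ← Category.assoc, ← Category.assoc]
  exact congrArg (· ≫ _) (actionUnitIso_hom_naturality (C := SuperSemi) _).symm

omit [Preadditive V] [G.Additive] in
lemma oddIn_natural {w w' : W.carrier} (f : w ⟶ w') : f ≫ oddIn hW G w' =
    oddIn hW G w ≫ inclL.obj oddLine ⊴ₗ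
      FixedPt.val (G.map ((freeOf hW G).map (inclL.obj oddLine ⊴ₗ f))) := by
  have h : f ≫ (oddInv w').inv =
      (oddInv w).inv ≫ inclL.obj oddLine ⊴ₗ inclL.obj oddLine ⊴ₗ f := by
    rw [Iso.comp_inv_eq, Category.assoc, oddInv_natural, Iso.inv_hom_id_assoc]
  rw [oddIn, oddIn, reassoc_of% h, ← actionHomRight_comp, freeIn_natural, actionHomRight_comp,
    Category.assoc]

omit [Preadditive V] [G.Additive] in
lemma oddOut_natural {w w' : W.carrier} (f : w ⟶ w') : inclL.obj oddLine ⊴ₗ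
    FixedPt.val (G.map ((freeOf hW G).map (inclL.obj oddLine ⊴ₗ f))) ≫ oddOut hW G w' =
      oddOut hW G w ≫ f := by
  rw [oddOut, oddOut, Category.assoc, ← oddInv_natural, ← actionHomRight_comp_assoc,
    freeOut_natural, actionHomRight_comp_assoc]

omit [Preadditive V] [G.Additive] in
lemma evenIn_evenOut_add (w : W.carrier) :
    evenIn hW G w ≫ evenOut hW G w + oddIn hW G w ≫ oddOut hW G w = 𝟙 w := by
  have : (act W (inclL.obj oddLine)).Additive := (hW.act _).additive
  have : (act W (inclL.obj oddLine)).Linear ℝ := (hW.act _).linear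
  have h₀ : inclL.obj oddLine ⊴ₗ freeIn hW G (inclL.obj oddLine ⊙ₗ w) ≫
      inclL.obj oddLine ⊴ₗ freeOut hW G (inclL.obj oddLine ⊙ₗ w) =
      (1 / 2 : ℝ) • (𝟙 _ - inclL.obj oddLine ⊴ₗ inclL.obj oddLine ⊴ₗ parityEndo w) := by
    rw [← actionHomRight_comp, freeIn_freeOut, oddLine_parityEndo hW, ← sub_eq_add_neg]
    refine ((act W (inclL.obj oddLine)).map_smul _ _).trans (congrArg _ ?_)
    exact (act W (inclL.obj oddLine)).map_sub.trans
      (congrArg (· - _) ((act W (inclL.obj oddLine)).map_id _))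
  rw [evenIn, evenOut, oddIn, oddOut, Category.assoc, Iso.inv_hom_id_assoc, freeIn_freeOut,
    Category.assoc, reassoc_of% h₀, Linear.smul_comp, Preadditive.sub_comp, oddInv_natural,
    Linear.comp_smul, Preadditive.comp_sub, Category.id_comp, Iso.inv_hom_id,
    Iso.inv_hom_id_assoc, ← smul_add]
  rw [show 𝟙 w + parityEndo w + (𝟙 w - parityEndo w) = (2 : ℝ) • 𝟙 w by rw [two_smul]; abel,
    smul_smul]
  norm_num

/-- Every object is a retract of even and odd twists of objects with a real structure. -/
def twistDecomp : Decomp (twistPart hW G (𝟙_ SuperVect)) (twistPart hW G oddLine) where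
  R₀ := freeOf hW G ⋙ Cplx.incl
  R₁ := act W (inclL.obj oddLine) ⋙ freeOf hW G ⋙ Cplx.incl
  s₀ := evenIn hW G
  r₀ := evenOut hW G
  s₁ := oddIn hW G
  r₁ := oddOut hW G
  s₀_natural f := (evenIn_natural hW G f).trans
    (congrArg (_ ≫ ·) (twistPart_map_incl hW G _ _).symm)
  r₀_natural f := (congrArg (· ≫ _) (twistPart_map_incl hW G _ _)).trans (evenOut_natural hW G f)
  s₁_natural f := (oddIn_natural hW G f).trans
    (congrArg (_ ≫ ·) (twistPart_map_incl hW G _ _).symm)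
  r₁_natural f := (congrArg (· ≫ _) (twistPart_map_incl hW G _ _)).trans (oddOut_natural hW G f)
  total := evenIn_evenOut_add hW G
  zero₀₁ m := even_odd_eq_zero hW m
  zero₁₀ m := odd_even_eq_zero hW m

variable {U : Type u₂} [Category.{v₂} U] [Preadditive U] [Linear ℝ U]

include hW in
omit [Linear ℝ U] in
lemma superMod_natTrans_ext {H H' : W.carrier ⥤ U} [H.Additive] {α β : H ⟶ H'}
    (h₀ : ∀ v, α.app (inclL.obj (𝟙_ SuperVect) ⊙ₗ (G.obj v).pt) =
      β.app (inclL.obj (𝟙_ SuperVect) ⊙ₗ (G.obj v).pt))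
    (h₁ : ∀ v, α.app (inclL.obj oddLine ⊙ₗ (G.obj v).pt) =
      β.app (inclL.obj oddLine ⊙ₗ (G.obj v).pt)) : α = β :=
  (twistDecomp hW G).natTrans_ext (fun x => h₀ x.of) fun x => h₁ x.of

/-- Natural transformations on twists of objects with a real structure. -/
def twistNatTrans (d : SuperVect) {H H' : W.carrier ⥤ U} [H.Additive] [H'.Additive]
    (τ : ∀ v, H.obj (inclL.obj d ⊙ₗ (G.obj v).pt) ⟶ H'.obj (inclL.obj d ⊙ₗ (G.obj v).pt))
    (hτ : ∀ {v v'} (f : v ⟶ v'), H.map (inclL.obj d ⊴ₗ FixedPt.val (G.map f)) ≫ τ v' =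
      τ v ≫ H'.map (inclL.obj d ⊴ₗ FixedPt.val (G.map f)))
    (hτ' : ∀ v, H.map (inclL.map (imag d) ⊵ₗ (G.obj v).pt) ≫ τ v =
      τ v ≫ H'.map (inclL.map (imag d) ⊵ₗ (G.obj v).pt)) :
    twistPart hW G d ⋙ H ⟶ twistPart hW G d ⋙ H' where
  app x := τ x.of
  naturality x y f := by
    have e (K : W.carrier ⥤ U) [K.Additive] : (twistPart hW G d ⋙ K).map f =
        K.map (inclL.obj d ⊴ₗ FixedPt.val (G.map f.re)) +
          K.map (inclL.obj d ⊴ₗ FixedPt.val (G.map f.im)) ≫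
            K.map (inclL.map (imag d) ⊵ₗ (G.obj y.of).pt) :=
      (congrArg K.map (twistPart_map hW G d f)).trans (Functor.map_add_comp K _ _ _)
    exact (congrArg (· ≫ _) (e H)).trans ((Preadditive.add_comp_intertwine (hτ _) (hτ _)
      (hτ' _)).trans (congrArg (_ ≫ ·) (e H').symm))

include hW in
/-- A natural transformation is determined by its values on twists of objects with a real
structure. -/
lemma superMod_exists_natTrans {H H' : W.carrier ⥤ U} (hH : IsCocontLinear H)
    (hH' : IsCocontLinear H')
    (τ : ∀ d v, H.obj (inclL.obj d ⊙ₗ (G.obj v).pt) ⟶ H'.obj (inclL.obj d ⊙ₗ (G.obj v).pt))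
    (hτ : ∀ d {v v'} (f : v ⟶ v'), H.map (inclL.obj d ⊴ₗ FixedPt.val (G.map f)) ≫ τ d v' =
      τ d v ≫ H'.map (inclL.obj d ⊴ₗ FixedPt.val (G.map f)))
    (hτ' : ∀ {d d'} (f : d ⟶ d') v, H.map (inclL.map f ⊵ₗ (G.obj v).pt) ≫ τ d' v =
      τ d v ≫ H'.map (inclL.map f ⊵ₗ (G.obj v).pt)) :
    ∃ α : H ⟶ H', ∀ d v, α.app (inclL.obj d ⊙ₗ (G.obj v).pt) = τ d v := by
  have := hH.additive
  have := hH'.additive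
  obtain ⟨α, h₀, h₁⟩ := (twistDecomp hW G).exists_natTrans
    (twistNatTrans hW G (𝟙_ SuperVect) (τ _) (hτ _) (hτ' _))
    (twistNatTrans hW G oddLine (τ _) (hτ _) (hτ' _))
  refine ⟨α, fun d v => ?_⟩
  let β : orbit inclL W (G.obj v).pt ⋙ H ⟶ orbit inclL W (G.obj v).pt ⋙ H' :=
    { app := fun d => τ d v
      naturality := fun d d' f => hτ' f v }
  have h : Functor.whiskerLeft (orbit inclL W (G.obj v).pt) α = β :=
    SuperVect.natTrans_ext ((hW.orbit _).comp hH) (h₀ ⟨v⟩) (h₁ ⟨v⟩)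
  exact congrArg (fun t => t.app d) h

include hW in
lemma superMod_exists_natIso {H H' : W.carrier ⥤ U} (hH : IsCocontLinear H)
    (hH' : IsCocontLinear H')
    (τ : ∀ d v, H.obj (inclL.obj d ⊙ₗ (G.obj v).pt) ≅ H'.obj (inclL.obj d ⊙ₗ (G.obj v).pt))
    (hτ : ∀ d {v v'} (f : v ⟶ v'), H.map (inclL.obj d ⊴ₗ FixedPt.val (G.map f)) ≫ (τ d v').hom =
      (τ d v).hom ≫ H'.map (inclL.obj d ⊴ₗ FixedPt.val (G.map f)))
    (hτ' : ∀ {d d'} (f : d ⟶ d') v, H.map (inclL.map f ⊵ₗ (G.obj v).pt) ≫ (τ d' v).hom =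
      (τ d v).hom ≫ H'.map (inclL.map f ⊵ₗ (G.obj v).pt)) :
    ∃ α : H ≅ H', ∀ d v, α.hom.app (inclL.obj d ⊙ₗ (G.obj v).pt) = (τ d v).hom := by
  have := hH.additive
  have := hH'.additive
  obtain ⟨α, hα⟩ := superMod_exists_natTrans hW G hH hH' (fun d v => (τ d v).hom) hτ hτ'
  obtain ⟨β, hβ⟩ := superMod_exists_natTrans hW G hH' hH (fun d v => (τ d v).inv)
    (fun d v v' f => by rw [Iso.comp_inv_eq, Category.assoc, hτ, Iso.inv_hom_id_assoc])
    (fun f v => by rw [Iso.comp_inv_eq, Category.assoc, hτ', Iso.inv_hom_id_assoc])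
  exact ⟨⟨α, β, superMod_natTrans_ext hW G (fun v => by simp [hα, hβ]) fun v => by simp [hα, hβ],
    superMod_natTrans_ext hW G (fun v => by simp [hα, hβ]) fun v => by simp [hα, hβ]⟩, hα⟩

end

end Split

namespace IsCocontLinear

variable {X : Type u₁} [Category.{v₁} X] [Preadditive X] [Linear ℝ X]
  {Y : Type u₂} [Category.{v₂} Y] [Preadditive Y] [Linear ℝ Y]

lemma of_iso {F F' : X ⥤ Y} (e : F ≅ F') (h : IsCocontLinear F) : IsCocontLinear F' := by
  have := h.additive
  have := h.linear
  have := h.cocontinuous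
  have : F'.Additive := Functor.additive_of_iso e
  exact ⟨this, ⟨fun f r => by
    rw [← cancel_epi (e.hom.app _), ← e.hom.naturality, F.map_smul, Linear.smul_comp,
      e.hom.naturality, Linear.comp_smul]⟩, preservesColimits_of_natIso e⟩

lemma of_sum {F K₀ K₁ : X ⥤ Y} (h₀ : IsCocontLinear K₀) (h₁ : IsCocontLinear K₁) (s₀ : F ⟶ K₀)
    (r₀ : K₀ ⟶ F) (s₁ : F ⟶ K₁) (r₁ : K₁ ⟶ F)
    (h : ∀ x, s₀.app x ≫ r₀.app x + s₁.app x ≫ r₁.app x = 𝟙 (F.obj x)) : IsCocontLinear F := by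
  have := h₀.additive
  have := h₀.linear
  have := h₀.cocontinuous
  have := h₁.additive
  have := h₁.linear
  have := h₁.cocontinuous
  have e {x y : X} (f : x ⟶ y) : F.map f =
      s₀.app x ≫ K₀.map f ≫ r₀.app y + s₁.app x ≫ K₁.map f ≫ r₁.app y := by
    rw [← Category.comp_id (F.map f), ← h, Preadditive.comp_add, s₀.naturality_assoc,
      s₁.naturality_assoc]
  exact ⟨⟨fun {x y f g} => by
      rw [e, e f, e g, K₀.map_add, K₁.map_add]
      simp only [Preadditive.add_comp, Preadditive.comp_add]
      abel⟩, ⟨fun f r => by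
      rw [e, e f, K₀.map_smul, K₁.map_smul, smul_add]
      simp only [Linear.smul_comp, Linear.comp_smul]⟩,
    ⟨preservesColimitsOfShape_of_sum s₀ r₀ s₁ r₁ h⟩⟩

lemma inv {F : X ⥤ Y} (h : IsCocontLinear F) [F.IsEquivalence] : IsCocontLinear F.inv := by
  have := h.additive
  have := h.linear
  have : F.asEquivalence.functor.Additive := h.additive
  have : F.asEquivalence.functor.Linear ℝ := h.linear
  exact ⟨inferInstanceAs F.asEquivalence.inverse.Additive,
    inferInstanceAs (F.asEquivalence.inverse.Linear ℝ), inferInstance⟩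

end IsCocontLinear

section Lift

open MonoidalCategory MonoidalLeftAction SemiProd SuperVect SuperAut

namespace Cplx

variable {V : Type u} [Category.{v} V] [Preadditive V] {U : Type u₁} [Category.{v₁} U]
    [Preadditive U] (G : V ⥤ U) [G.Additive] (I : ∀ v, G.obj v ⟶ G.obj v)
    (hI : ∀ (v v') (f : v ⟶ v'), G.map f ≫ I v' = I v ≫ G.map f)
    (hI' : ∀ v, I v ≫ I v = -𝟙 _)

/-- Multiplication by `i`. -/
def imag (v : V) : incl.obj v ⟶ incl.obj v := ⟨0, 𝟙 v⟩

/-- The zero morphism. -/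
def zero (x y : Cplx V) : x ⟶ y := ⟨0, 0⟩

lemma lift_map_incl {v v' : V} (f : v ⟶ v') :
    (lift G I hI hI').map (incl.map f) = G.map f := by
  have h : G.map f + G.map 0 ≫ I v' = G.map f := by rw [G.map_zero, zero_comp, add_zero]
  exact h

lemma lift_map_imag (v : V) : (lift G I hI hI').map (imag v) = I v := by
  have h : G.map 0 + G.map (𝟙 v) ≫ I v = I v := by
    rw [G.map_zero, G.map_id, Category.id_comp, zero_add]
  exact h

lemma lift_map_zero (x y : Cplx V) : (lift G I hI hI').map (zero x y) = 0 := by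
  have h : G.map (0 : x.of ⟶ y.of) + G.map (0 : x.of ⟶ y.of) ≫ I y.of = 0 := by
    rw [G.map_zero, zero_comp, add_zero]
  exact h

/-- A functor with a complex structure is the restriction of its extension to the
complexification. -/
def inclLift : G ≅ incl ⋙ lift G I hI hI' :=
  NatIso.ofComponents (G := incl ⋙ lift G I hI hI') (fun v => Iso.refl _) fun {v v'} f =>
    (Category.comp_id (G.map f)).trans ((lift_map_incl G I hI hI' f).symm.trans
      (Category.id_comp ((lift G I hI hI').map (incl.map f))).symm)

end Cplx

variable {W : LinMod SuperSemi} (hW : IsSuperMod W)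
  {V : Type u₁} [Category.{v₁} V] [Preadditive V] [Linear ℝ V] {G : V ⥤ FixedPt inclJ W}
  (hG : IsCocontLinear G) [HasBinaryBiproducts W.carrier] [IsIdempotentComplete W.carrier]

lemma isCocontLinear_freeFix : IsCocontLinear (freeFix hW) := by
  refine ⟨(freeAdj hW).left_adjoint_additive, ⟨fun {w w'} f r => ?_⟩,
    (freeAdj hW).leftAdjoint_preservesColimits⟩
  refine (freeEquiv hW w (freePt hW w')).injective ?_
  change freeUnit hW w ≫ FixedPt.val (freeMap hW (r • f)) =
    freeUnit hW w ≫ (r • FixedPt.val (freeMap hW f))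
  rw [← freeUnit_natural, Linear.comp_smul, ← freeUnit_natural, Linear.smul_comp]

include hG in
lemma isCocontLinear_freeOf [G.IsEquivalence] : IsCocontLinear (freeOf hW G) :=
  (isCocontLinear_freeFix hW).comp hG.inv

variable {U : Type u₂} [Category.{v₂} U] [Preadditive U] [Linear ℝ U]

section

variable (B : V ⥤ SuperVect ⥤ U) (hl : ∀ d, IsCocontLinear (B.flip.obj d))
    (hr : ∀ v, IsCocontLinear (B.obj v)) (d : SuperVect)

omit [Preadditive V] [Linear ℝ V] [Preadditive U] [Linear ℝ U] in
lemma flip_map_imag (v v' : V) (f : v ⟶ v') : (B.flip.obj d).map f ≫ (B.obj v').map (imag d) =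
    (B.obj v).map (imag d) ≫ (B.flip.obj d).map f :=
  ((B.map f).naturality _).symm

omit [Preadditive V] [Linear ℝ V] in
include hr in
lemma map_imag_imag (v : V) : (B.obj v).map (imag d) ≫ (B.obj v).map (imag d) = -𝟙 _ := by
  have := (hr v).additive
  rw [← (B.obj v).map_comp, imag_imag, (B.obj v).map_neg, (B.obj v).map_id]

/-- The functor on objects with a real structure and all morphisms, given by a functor that is
linear in the twist. -/
def twistLift : Cplx V ⥤ U :=
  have := (hl d).additive
  Cplx.lift (B.flip.obj d) (fun v => (B.obj v).map (imag d)) (flip_map_imag B d)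
    (map_imag_imag B hr d)

lemma twistLift_map_zero (x y : Cplx V) : (twistLift B hl hr d).map (Cplx.zero x y) = 0 :=
  have := (hl d).additive
  Cplx.lift_map_zero (B.flip.obj d) (fun v => (B.obj v).map (imag d)) (flip_map_imag B d)
    (map_imag_imag B hr d) x y

lemma twistLift_map_imag (v : V) :
    (twistLift B hl hr d).map (Cplx.imag v) = (B.obj v).map (imag d) :=
  have := (hl d).additive
  Cplx.lift_map_imag (B.flip.obj d) (fun v => (B.obj v).map (imag d)) (flip_map_imag B d)
    (map_imag_imag B hr d) v

lemma twistLift_map_incl {v v' : V} (f : v ⟶ v') :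
    (twistLift B hl hr d).map (Cplx.incl.map f) = (B.map f).app d :=
  have := (hl d).additive
  Cplx.lift_map_incl (B.flip.obj d) (fun v => (B.obj v).map (imag d)) (flip_map_imag B d)
    (map_imag_imag B hr d) f

/-- The restriction of `twistLift`. -/
def inclTwistLift : B.flip.obj d ≅ Cplx.incl ⋙ twistLift B hl hr d :=
  have := (hl d).additive
  Cplx.inclLift (B.flip.obj d) (fun v => (B.obj v).map (imag d)) (flip_map_imag B d)
    (map_imag_imag B hr d)

omit [HasBinaryBiproducts W.carrier] [IsIdempotentComplete W.carrier] [Linear ℝ V] in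
lemma realPart_map_zero [G.Additive] (x y : Cplx V) : (realPart hW G).map (Cplx.zero x y) = 0 :=
  Cplx.lift_map_zero (G ⋙ FixedPt.forget inclJ W) (fun v => imagEndo (G.obj v).pt) _ _ x y

end

include hW hG in
lemma exists_lift_of_biadditive [IsIdempotentComplete U] [HasBinaryBiproducts U]
    [G.IsEquivalence] (B : V ⥤ SuperVect ⥤ U) (hl : ∀ d, IsCocontLinear (B.flip.obj d))
    (hr : ∀ v, IsCocontLinear (B.obj v)) :
    ∃ H : W.carrier ⥤ U, IsCocontLinear H ∧
      ∃ τ : ∀ d v, H.obj (inclL.obj d ⊙ₗ (G.obj v).pt) ≅ (B.obj v).obj d,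
        (∀ d {v v'} (f : v ⟶ v'), H.map (inclL.obj d ⊴ₗ FixedPt.val (G.map f)) ≫ (τ d v').hom =
          (τ d v).hom ≫ (B.map f).app d) ∧
        ∀ {d d'} (f : d ⟶ d') v, H.map (inclL.map f ⊵ₗ (G.obj v).pt) ≫ (τ d' v).hom =
          (τ d v).hom ≫ (B.obj v).map f := by
  have := hG.additive
  have hz (d : SuperVect) [(twistPart hW G d).Faithful] (x y : Cplx V) (f : x ⟶ y)
      (hf : (twistPart hW G d).map f = 0) : (twistLift B hl hr d).map f = 0 := by
    have := (hW.act (inclL.obj d)).additive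
    have h₀ : f = Cplx.zero x y := (twistPart hW G d).map_injective (hf.trans
      ((congrArg (act W (inclL.obj d)).map (realPart_map_zero hW x y)).trans
        ((act W (inclL.obj d)).map_zero _ _)).symm)
    rw [h₀]
    exact twistLift_map_zero B hl hr d x y
  obtain ⟨H, ⟨e₀⟩, ⟨e₁⟩, s₀, r₀, s₁, r₁, h⟩ := (twistDecomp hW G).exists_lift
    (twistLift B hl hr (𝟙_ SuperVect)) (twistLift B hl hr oddLine) (hz _) (hz _)
  have hc (d : SuperVect) : IsCocontLinear ((freeOf hW G ⋙ Cplx.incl) ⋙ twistLift B hl hr d) := by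
    exact ((isCocontLinear_freeOf hW hG).comp (hl d)).of_iso
      (Functor.isoWhiskerLeft (freeOf hW G) (inclTwistLift B hl hr d))
  have hH : IsCocontLinear H := .of_sum (hc _) ((hW.act (inclL.obj oddLine)).comp (hc oddLine))
    s₀ r₀ s₁ r₁ h
  have hi (d : SuperVect) (e : twistPart hW G d ⋙ H ≅ twistLift B hl hr d) (v : V) :
      H.map (inclL.map (imag d) ⊵ₗ (G.obj v).pt) ≫ e.hom.app (Cplx.incl.obj v) =
        e.hom.app (Cplx.incl.obj v) ≫ (B.obj v).map (imag d) := by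
    have h₀ : (realPart hW G).map (Cplx.imag v) = imagEndo (G.obj v).pt :=
      Cplx.lift_map_imag _ _ _ _ v
    have h₁ : (twistPart hW G d).map (Cplx.imag v) = inclL.map (imag d) ⊵ₗ (G.obj v).pt :=
      (congrArg (act W (inclL.obj d)).map h₀).trans
        (inclL_imagEndo _ _)
    rw [← h₁, ← twistLift_map_imag B hl hr]
    exact e.hom.naturality (Cplx.imag v)
  have hv (d : SuperVect) (e : twistPart hW G d ⋙ H ≅ twistLift B hl hr d) {v v' : V}
      (f : v ⟶ v') : H.map (inclL.obj d ⊴ₗ FixedPt.val (G.map f)) ≫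
        e.hom.app (Cplx.incl.obj v') = e.hom.app (Cplx.incl.obj v) ≫ (B.map f).app d := by
    rw [← twistPart_map_incl hW, ← twistLift_map_incl B hl hr]
    exact e.hom.naturality (Cplx.incl.map f)
  choose β hβ using fun v => SuperVect.exists_natIso ((hW.orbit (G.obj v).pt).comp hH) (hr v)
    (e₀.app (Cplx.incl.obj v)) (e₁.app (Cplx.incl.obj v)) (hi _ e₀ v) (hi _ e₁ v)
  refine ⟨H, hH, fun d v => (β v).app d, fun d {v v'} f => ?_, fun f v => (β v).hom.naturality f⟩
  let γ : orbit inclL W (G.obj v).pt ⋙ H ⟶ orbit inclL W (G.obj v').pt ⋙ H :=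
    { app := fun d => H.map (inclL.obj d ⊴ₗ FixedPt.val (G.map f))
      naturality := fun d d' g => by
        refine (H.map_comp _ _).symm.trans (Eq.trans (congrArg H.map ?_) (H.map_comp _ _))
        exact (action_exchange _ _).symm }
  have hγ : γ ≫ (β v').hom = (β v).hom ≫ B.map f := by
    refine SuperVect.natTrans_ext ((hW.orbit _).comp hH) ?_ ?_
    · rw [NatTrans.comp_app, NatTrans.comp_app, (hβ v').1, (hβ v).1]
      exact hv _ e₀ f
    · rw [NatTrans.comp_app, NatTrans.comp_app, (hβ v').2, (hβ v).2]
      exact hv _ e₁ f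
  exact congrArg (fun t => t.app d) hγ

end Lift

section RelTensor

open MonoidalCategory MonoidalLeftAction SemiProd SuperVect SuperAut
open Functor.LaxMonoidal Functor.OplaxMonoidal

/-- Transformations of balanced functors are automatically compatible with the balancings. -/
lemma BalFun.comm_of_trans {V : LinMod (ModuleCat.{0} ℝ)} (hV : IsVectMod V) {U : LinCat}
    {B B' : BalFun vectToSuperVect V U} (hB : B.IsAdmissible) (t : B.bi ⟶ B'.bi)
    (c : ModuleCat.{0} ℝ) (v : V.carrier) (d : SuperVect) :
    (t.app (c ⊙ₗ v)).app d ≫ (B'.bal c v d).hom =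
      (B.bal c v d).hom ≫ (t.app v).app (d ⊗ vectToSuperVect.obj c) := by
  let X : ModuleCat.{0} ℝ ⥤ U.carrier := orbit (𝟭 (ModuleCat.{0} ℝ)) V v ⋙ B.bi.flip.obj d
  have hX : IsCocontLinear X := (hV v).comp (hB.left d)
  let Y : ModuleCat.{0} ℝ ⥤ U.carrier :=
    (vectToSuperVect ⋙ MonoidalCategory.tensorLeft d) ⋙ B'.bi.obj v
  let α : X ⟶ Y :=
    { app := fun c => (t.app (c ⊙ₗ v)).app d ≫ (B'.bal c v d).hom
      naturality := fun c c' f => by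
        have h : (B.bi.map (f ⊵ₗ v)).app d ≫ (t.app (c' ⊙ₗ v)).app d =
            (t.app (c ⊙ₗ v)).app d ≫ (B'.bi.map (f ⊵ₗ v)).app d :=
          congrArg (fun s => s.app d) (t.naturality (f ⊵ₗ v))
        refine (Category.assoc _ _ _).symm.trans ((congrArg (· ≫ _) h).trans ?_)
        exact (Category.assoc _ _ _).trans ((congrArg (_ ≫ ·) (B'.natural_left f v d)).trans
          (Category.assoc _ _ _).symm) }
  let β : X ⟶ Y :=
    { app := fun c => (B.bal c v d).hom ≫ (t.app v).app (d ⊗ vectToSuperVect.obj c)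
      naturality := fun c c' f => by
        refine (Category.assoc _ _ _).symm.trans
          ((congrArg (· ≫ _) (B.natural_left f v d)).trans ?_)
        exact (Category.assoc _ _ _).trans ((congrArg (_ ≫ ·) ((t.app v).naturality _)).trans
          (Category.assoc _ _ _).symm) }
  have h : α = β := by
    refine realCopower_natTrans_ext hX ?_
    change (t.app (𝟙_ (ModuleCat.{0} ℝ) ⊙ₗ v)).app d ≫ (B'.bal (𝟙_ (ModuleCat.{0} ℝ)) v d).hom =
      (B.bal (𝟙_ (ModuleCat.{0} ℝ)) v d).hom ≫
        (t.app v).app (d ⊗ vectToSuperVect.obj (𝟙_ (ModuleCat.{0} ℝ)))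
    have hi : IsIso (η vectToSuperVect) := inferInstance
    rw [← cancel_mono ((B'.bi.obj v).map (d ◁ η vectToSuperVect ≫ (ρ_ d).hom)), Category.assoc,
      B'.unit, Category.assoc, ← (t.app v).naturality, ← Category.assoc (B.bal _ v d).hom, B.unit]
    exact (congrArg (fun s => s.app d) (t.naturality (λₗ[ModuleCat.{0} ℝ] v).hom)).symm
  exact congrArg (fun s => s.app c) h

variable {V : LinMod (ModuleCat.{0} ℝ)} (hV : IsVectMod V) {W : LinMod SuperSemi}
  (hW : IsSuperMod W) [HasColimitsOfSize.{0, 0} W.carrier] [HasBinaryBiproducts W.carrier]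
  [IsIdempotentComplete W.carrier] (ι : V ⟶ fixObj (commutation vectToSuperVect) W)
  (hι : IsCocontLinear ι.functor)

omit [HasBinaryBiproducts W.carrier] [IsIdempotentComplete W.carrier] in
include hW hι in
lemma isAdmissible_canonicalBal :
    (canonicalBal (i := vectToSuperVect) (L := SemiProd.inclD vectToSuperVect) ι).IsAdmissible where
  left d := (hι.comp (FixedPt.isCocontLinear_forget hW)).comp (hW.act _)
  right v := hW.orbit _

include hV hW hι in
/-- A module is the relative tensor product of its fixed points with the category of super vector
spaces. -/
lemma isRelTensor_canonicalBal [ι.functor.IsEquivalence] :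
    (canonicalBal (i := vectToSuperVect) (L := SemiProd.inclD vectToSuperVect) ι).IsRelTensor := by
  have hB := isAdmissible_canonicalBal hW ι hι
  let G : V.carrier ⥤ FixedPt inclJ W := ι.functor
  have : G.IsEquivalence := inferInstanceAs ι.functor.IsEquivalence
  have hG : IsCocontLinear G := hι
  have := hG.additive
  refine ⟨hB, fun U hU => ⟨fun {H H'} b => ?_⟩, fun U hU => ⟨fun {H H' a a'} h => ?_⟩,
    fun U hU B' hB' => ?_⟩
  · obtain ⟨α, hα⟩ := superMod_exists_natTrans hW G H.property H'.property
      (fun d v => (b.trans.app v).app d)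
      (fun d {v v'} f => congrArg (fun s => s.app d) (b.trans.naturality f))
      (fun {d d'} f v => (b.trans.app v).naturality f)
    exact ⟨ObjectProperty.homMk α, BalFun.hom_ext (NatTrans.ext (funext fun v =>
      NatTrans.ext (funext fun d => hα d v)))⟩
  · have := H.property.additive
    have e (d : SuperVect) (v : V.carrier) := congrArg (fun t => (t.trans.app v).app d) h
    exact ObjectProperty.hom_ext _ (superMod_natTrans_ext hW G (e _) (e _))
  · have hU : IsPres U := hU
    have := hU.isIdempotentComplete
    have := hU.hasBinaryBiproducts
    obtain ⟨H, hH, τ, hτ, hτ'⟩ := exists_lift_of_biadditive hW hG B'.bi hB'.left hB'.right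
    refine ⟨H, hH, ⟨?_⟩⟩
    let B := (canonicalBal (i := vectToSuperVect) (L := SemiProd.inclD vectToSuperVect) ι).comp H
    have hB : B.IsAdmissible := ⟨fun d => (hB.left d).comp hH, fun v => (hB.right v).comp hH⟩
    let t : B.bi ≅ B'.bi := NatIso.ofComponents (F := B.bi) (G := B'.bi)
      (fun v => NatIso.ofComponents (F := B.bi.obj v) (G := B'.bi.obj v) (fun d => τ d v)
        fun f => hτ' f v)
      (fun f => NatTrans.ext (funext fun d => hτ d f))
    exact
      { hom := BalFun.Hom.mk (B := B) (B' := B') t.hom (BalFun.comm_of_trans hV hB t.hom)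
        inv := BalFun.Hom.mk (B := B') (B' := B) t.inv (BalFun.comm_of_trans hV hB' t.inv)
        hom_inv_id := BalFun.hom_ext t.hom_inv_id
        inv_hom_id := BalFun.hom_ext t.inv_hom_id }

end RelTensor

section IsLinAt

open MonoidalCategory MonoidalLeftAction Functor.LaxLeftLinear Functor.OplaxLeftLinear

variable {E : Type u} [Category.{v} E] [MonoidalCategory E] {W : Type u₁} [Category.{v₁} W]
  [MonoidalLeftAction E W] {W' : Type u₂} [Category.{v₂} W'] [MonoidalLeftAction E W']
  {F F' : W ⥤ W'} [F.LeftLinear E] [F'.LeftLinear E]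

/-- Compatibility of a natural transformation with the action of `e` on `w`. -/
def IsLinAt (α : F ⟶ F') (e : E) (w : W) : Prop :=
  μₗ F e w ≫ α.app (e ⊙ₗ w) = e ⊴ₗ α.app w ≫ μₗ F' e w

variable {α : F ⟶ F'}

lemma IsLinAt.of_iso_right {e : E} {w w' : W} (h : IsLinAt α e w) (ψ : w ≅ w') :
    IsLinAt α e w' := by
  have : IsIso (e ⊴ₗ F.map ψ.hom) := (rightIso e (F.mapIso ψ)).isIso_hom
  unfold IsLinAt at *
  rw [← cancel_epi (e ⊴ₗ F.map ψ.hom), μₗ_naturality_right_assoc, α.naturality, reassoc_of% h,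
    ← actionHomRight_comp_assoc, α.naturality, actionHomRight_comp_assoc, μₗ_naturality_right]

lemma IsLinAt.of_iso_left {e e' : E} {w : W} (h : IsLinAt α e w) (q : e ≅ e') :
    IsLinAt α e' w := by
  have : IsIso (q.hom ⊵ₗ F.obj w) := (leftIso q (F.obj w)).isIso_hom
  unfold IsLinAt at *
  rw [← cancel_epi (q.hom ⊵ₗ F.obj w), μₗ_naturality_left_assoc, α.naturality, reassoc_of% h,
    ← action_exchange_assoc, μₗ_naturality_left]

lemma isLinAt_tensor_iff {e e' : E} {w : W} (h : IsLinAt α e' w) :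
    IsLinAt α (e ⊗ e') w ↔ IsLinAt α e (e' ⊙ₗ w) := by
  have : IsIso (e ⊴ₗ μₗ F e' w) := (rightIso e (Functor.LeftLinear.μₗIso F e' w)).isIso_hom
  unfold IsLinAt at *
  rw [← cancel_mono (F'.map (αₗ e e' w).hom), Category.assoc, Category.assoc, ← α.naturality,
    μₗ_associativity_assoc, μₗ_associativity]
  simp only [tensor_actionHomRight, Category.assoc, Iso.inv_hom_id_assoc]
  rw [cancel_epi, ← cancel_epi (e ⊴ₗ μₗ F e' w)]
  rw [← actionHomRight_comp_assoc e (μₗ F e' w), h, actionHomRight_comp_assoc]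

end IsLinAt

section FixLocal

open MonoidalCategory MonoidalLeftAction SemiProd SuperVect SuperAut Functor.LaxLeftLinear
  Functor.OplaxLeftLinear

variable {W W' : LinMod SuperSemi} (hW : IsSuperMod W) (hW' : IsSuperMod W')
  [HasBinaryBiproducts W.carrier] [IsIdempotentComplete W.carrier]

include hW hW' in
lemma isLinAt_of_fixedPt {F F' : W ⟶ W'} (hF : IsCocontLinear F.functor)
    (α : F.functor ⟶ F'.functor) (hl : ∀ d (x : FixedPt inclJ W), IsLinAt α (inclL.obj d) x.pt)
    (hj : ∀ g (x : FixedPt inclJ W), IsLinAt α (inclJ.obj g) x.pt) (e : SuperSemi)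
    (w : W.carrier) : IsLinAt α e w := by
  have h₁ (e : SuperSemi) (x : FixedPt inclJ W) : IsLinAt α e x.pt :=
    ((isLinAt_tensor_iff (hj e.snd x)).2 ((hl e.fst x).of_iso_right
      (x.iso e.snd).symm)).of_iso_left (semiIso e)
  have h₂ (d : SuperVect) (x : FixedPt inclJ W) : IsLinAt α e (inclL.obj d ⊙ₗ x.pt) :=
    (isLinAt_tensor_iff (hl d x)).1 (h₁ _ x)
  let A : F.functor ⋙ act W' e ⟶ act W e ⋙ F'.functor :=
    { app := fun w => μₗ F.functor e w ≫ α.app (e ⊙ₗ w)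
      naturality := fun w w' f => by
        refine (μₗ_naturality_right_assoc F.functor e f _).trans ?_
        exact (congrArg (_ ≫ ·) (α.naturality (e ⊴ₗ f))).trans (Category.assoc _ _ _).symm }
  let B : F.functor ⋙ act W' e ⟶ act W e ⋙ F'.functor :=
    { app := fun w => e ⊴ₗ α.app w ≫ μₗ F'.functor e w
      naturality := fun w w' f => by
        refine (actionHomRight_comp_assoc _ _ _ _).symm.trans
          ((congrArg (e ⊴ₗ · ≫ _) (α.naturality f)).trans ?_)
        refine (actionHomRight_comp_assoc _ _ _ _).trans (Eq.trans ?_ (Category.assoc _ _ _).symm)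
        exact congrArg (_ ≫ ·) (μₗ_naturality_right F'.functor e f) }
  have := (hF.comp (hW'.act e)).additive
  have h : A = B := superMod_natTrans_ext hW (𝟭 (FixedPt inclJ W)) (h₂ _) (h₂ _)
  exact congrArg (fun t => t.app w) h

include hW in
lemma fixMap₂_injective {F F' : W ⟶ W'} (hF : IsCocontLinear F.functor) {α β : F ⟶ F'}
    (h : fixMap₂ (commutation vectToSuperVect) α = fixMap₂ (commutation vectToSuperVect) β) :
    α = β := by
  have h₁ (x : FixedPt inclJ W) : α.trans.app x.pt = β.trans.app x.pt :=
    congrArg (fun t : fixMap (commutation vectToSuperVect) F ⟶ fixMap (commutation vectToSuperVect) F' =>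
      FixedPt.val (t.trans.app x)) h
  have h₂ (d : SuperVect) (x : FixedPt inclJ W) :
      α.trans.app (inclL.obj d ⊙ₗ x.pt) = β.trans.app (inclL.obj d ⊙ₗ x.pt) := by
    rw [← cancel_epi (Functor.LeftLinear.μₗIso F.functor (inclL.obj d) x.pt).hom]
    exact (α.comm _ _).trans ((congrArg (inclL.obj d ⊴ₗ · ≫ _) (h₁ x)).trans (β.comm _ _).symm)
  have := hF.additive
  exact LinMod.Hom₂.ext (superMod_natTrans_ext hW (𝟭 (FixedPt inclJ W)) (h₂ _) (h₂ _))

include hW hW' in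
lemma fixMap₂_surjective {F F' : W ⟶ W'} (hF : IsCocontLinear F.functor)
    (hF' : IsCocontLinear F'.functor) (b : fixMap (commutation vectToSuperVect) F ⟶
      fixMap (commutation vectToSuperVect) F') :
    ∃ α : F ⟶ F', fixMap₂ (commutation vectToSuperVect) α = b := by
  let β (x : FixedPt inclJ W) : F.functor.obj x.pt ⟶ F'.functor.obj x.pt :=
    FixedPt.val (b.trans.app x)
  have hβ {x y : FixedPt inclJ W} (f : x ⟶ y) :
      F.functor.map (FixedPt.val f) ≫ β y = β x ≫ F'.functor.map (FixedPt.val f) :=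
    congrArg FixedPt.val (b.trans.naturality f)
  have hβ' (x : FixedPt inclJ W) (g : SuperAut) :
      inclJ.obj g ⊴ₗ β x ≫ μₗ F'.functor (inclJ.obj g) x.pt ≫ F'.functor.map (x.iso g).hom =
        μₗ F.functor (inclJ.obj g) x.pt ≫ F.functor.map (x.iso g).hom ≫ β x :=
    (FixedPt.val_comm (b.trans.app x) g).trans (Category.assoc _ _ _)
  obtain ⟨α, hα⟩ := superMod_exists_natTrans hW (𝟭 (FixedPt inclJ W)) hF hF'
    (fun d x => δₗ F.functor (inclL.obj d) x.pt ≫ inclL.obj d ⊴ₗ β x ≫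
      μₗ F'.functor (inclL.obj d) x.pt)
    (fun d {x y} f => by
      change F.functor.map (inclL.obj d ⊴ₗ FixedPt.val f) ≫ δₗ F.functor (inclL.obj d) y.pt ≫
        inclL.obj d ⊴ₗ β y ≫ μₗ F'.functor (inclL.obj d) y.pt =
        (δₗ F.functor (inclL.obj d) x.pt ≫ inclL.obj d ⊴ₗ β x ≫
          μₗ F'.functor (inclL.obj d) x.pt) ≫ F'.functor.map (inclL.obj d ⊴ₗ FixedPt.val f)
      rw [δₗ_naturality_right_assoc, ← actionHomRight_comp_assoc, hβ, actionHomRight_comp_assoc,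
        Category.assoc, Category.assoc, μₗ_naturality_right])
    (fun {d d'} f x => by
      change F.functor.map (inclL.map f ⊵ₗ x.pt) ≫ δₗ F.functor (inclL.obj d') x.pt ≫
        inclL.obj d' ⊴ₗ β x ≫ μₗ F'.functor (inclL.obj d') x.pt =
        (δₗ F.functor (inclL.obj d) x.pt ≫ inclL.obj d ⊴ₗ β x ≫
          μₗ F'.functor (inclL.obj d) x.pt) ≫ F'.functor.map (inclL.map f ⊵ₗ x.pt)
      rw [δₗ_naturality_left_assoc, ← action_exchange_assoc, Category.assoc, Category.assoc,
        μₗ_naturality_left])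
  replace hα (d : SuperVect) (x : FixedPt inclJ W) : μₗ F.functor (inclL.obj d) x.pt ≫
      α.app (inclL.obj d ⊙ₗ x.pt) = inclL.obj d ⊴ₗ β x ≫ μₗ F'.functor (inclL.obj d) x.pt := by
    have h : α.app (inclL.obj d ⊙ₗ x.pt) = δₗ F.functor (inclL.obj d) x.pt ≫
      inclL.obj d ⊴ₗ β x ≫ μₗ F'.functor (inclL.obj d) x.pt := hα d x
    rw [h, Functor.LeftLinear.μₗ_comp_δₗ_assoc]
  have hx (x : FixedPt inclJ W) : α.app x.pt = β x := by
    have h : μₗ F.functor (𝟙_ SuperSemi) x.pt ≫ α.app (𝟙_ SuperSemi ⊙ₗ x.pt) =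
      𝟙_ SuperSemi ⊴ₗ β x ≫ μₗ F'.functor (𝟙_ SuperSemi) x.pt := hα (𝟙_ SuperVect) x
    have h' := h =≫ F'.functor.map (λₗ[SuperSemi] x.pt).hom
    rw [Category.assoc, Category.assoc, ← α.naturality, ← μₗ_unitality (C := SuperSemi) F'.functor,
      ← μₗ_unitality_assoc (C := SuperSemi) F.functor] at h'
    rw [← cancel_epi (λₗ[SuperSemi] (F.functor.obj x.pt)).hom, h',
      actionUnitIso_hom_naturality (C := SuperSemi)]
  have hl (d : SuperVect) (x : FixedPt inclJ W) : IsLinAt α (inclL.obj d) x.pt := by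
    rw [IsLinAt, hα, hx]
  have hj (g : SuperAut) (x : FixedPt inclJ W) : IsLinAt α (inclJ.obj g) x.pt := by
    rw [IsLinAt, hx, ← cancel_mono (F'.functor.map (x.iso g).hom), Category.assoc, Category.assoc,
      hβ', ← α.naturality, hx]
  exact ⟨LinMod.Hom₂.mk α (isLinAt_of_fixedPt hW hW' hF α hl hj),
    LinMod.hom₂_ext fun x => FixedPt.hom_ext (hx x)⟩

end FixLocal

section Coherence

open MonoidalCategory MonoidalLeftAction SemiProd SuperVect SuperAut Functor.LaxMonoidal
  Functor.OplaxMonoidal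

lemma semiIso_tensor (e : SuperSemi) (g : SuperAut) :
    (α_ (inclL.obj e.fst) (inclJ.obj e.snd) (inclJ.obj g)).inv ≫ (semiIso e).hom ▷ inclJ.obj g =
      inclL.obj e.fst ◁ μ inclJ e.snd g ≫
        inclL.map ((ρ_ e.fst).inv ≫ e.fst ◁ ε e.snd.functor) ▷ inclJ.obj (e.snd ⊗ g) ≫
          (semiIso (e ⊗ inclJ.obj g)).hom := by
  rw [Iso.inv_comp_eq]
  refine hom_ext ?_ ?_
  · change ((ρ_ e.fst).hom ⊗ₘ 𝟙 (e.snd.functor.obj (𝟙_ SuperVect))) =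
      ((α_ e.fst (𝟙_ SuperVect) (e.snd.functor.obj (𝟙_ SuperVect))).hom ≫ e.fst ◁ 𝟙 _) ≫
        e.fst ◁ ((λ_ (e.snd.functor.obj (𝟙_ SuperVect))).hom ≫ η e.snd.functor) ≫
        (((ρ_ e.fst).inv ≫ e.fst ◁ ε e.snd.functor) ⊗ₘ 𝟙 (𝟙_ SuperVect)) ≫
        (ρ_ (e.fst ⊗ e.snd.functor.obj (𝟙_ SuperVect))).hom
    simp [-Functor.LaxMonoidal.left_unitality]
  · change (λ_ e.snd).hom ▷ g = (α_ (𝟙_ SuperAut) e.snd g).hom ≫ 𝟙_ SuperAut ◁ 𝟙 (e.snd ⊗ g) ≫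
      𝟙 (𝟙_ SuperAut) ▷ (e.snd ⊗ g) ≫ (λ_ (e.snd ⊗ g)).hom
    simp

lemma reduce_tensor {E : Type u} [Category.{v} E] [MonoidalCategory E] {V : Type u₁}
    [Category.{v₁} V] [MonoidalLeftAction E V] {l l' k g kg e : E} (s : l ⊗ k ≅ e)
    (s' : l' ⊗ kg ≅ e ⊗ g) (m : k ⊗ g ⟶ kg) (r : l ⟶ l')
    (h : (α_ l k g).inv ≫ s.hom ▷ g = l ◁ m ≫ r ▷ kg ≫ s'.hom) {x : V} {a : k ⊙ₗ x ⟶ x}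
    {b : g ⊙ₗ x ⟶ x} {c : kg ⊙ₗ x ⟶ x} (hc : m ⊵ₗ x ≫ c = (αₗ k g x).hom ≫ k ⊴ₗ b ≫ a) :
    s'.inv ⊵ₗ x ≫ (αₗ l' kg x).hom ≫ l' ⊴ₗ c =
      (αₗ e g x).hom ≫ e ⊴ₗ b ≫ (s.inv ⊵ₗ x ≫ (αₗ l k x).hom ≫ l ⊴ₗ a) ≫ r ⊵ₗ x := by
  have h' : s'.inv = s.inv ▷ g ≫ (α_ l k g).hom ≫ l ◁ m ≫ r ▷ kg := by
    rw [← cancel_mono s'.hom, Iso.inv_hom_id]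
    simp only [Category.assoc]
    rw [← h, Iso.hom_inv_id_assoc, ← comp_whiskerRight, Iso.inv_hom_id, id_whiskerRight]
  rw [h']
  simp only [comp_actionHomLeft, whiskerLeft_actionHomLeft, whiskerRight_actionHomLeft,
    Category.assoc, Iso.inv_hom_id_assoc]
  rw [← action_exchange, ← actionHomRight_comp_assoc, hc]
  have p : (α_ l k g).hom ⊵ₗ x ≫ (αₗ l (k ⊗ g) x).hom ≫ l ⊴ₗ (αₗ k g x).hom =
      (αₗ (l ⊗ k) g x).hom ≫ (αₗ l k (g ⊙ₗ x)).hom := associator_actionHom l k g x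
  have q : (αₗ l k (g ⊙ₗ x)).hom ≫ l ⊴ₗ k ⊴ₗ b = (l ⊗ k) ⊴ₗ b ≫ (αₗ l k x).hom := by simp
  rw [action_exchange_assoc, ← reassoc_of% q, actionHomRight_comp_assoc, actionHomRight_comp_assoc,
    reassoc_of% p, Iso.inv_hom_id_assoc]

variable {W : LinMod SuperSemi}

lemma semiIso_natural {e e' : SuperSemi} (f : e ⟶ e') :
    (semiIso e).hom ≫ f = (inclL.map f.fst ⊗ₘ inclJ.map f.snd) ≫ (semiIso e').hom := by
  refine hom_ext ?_ ?_
  · change (ρ_ e.fst).hom ≫ f.fst = (f.fst ⊗ₘ (𝟙 _ ≫ 𝟙 (𝟙_ SuperVect))) ≫ (ρ_ e'.fst).hom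
    simp
  · change (λ_ e.snd).hom ≫ f.snd = (𝟙 _ ⊗ₘ f.snd) ≫ (λ_ e'.snd).hom
    simp

/-- The isomorphism `(d, g) • x ≅ d • x` for a fixed point `x`. -/
def reduceIso (e : SuperSemi) (x : FixedPt inclJ W) : e ⊙ₗ x.pt ≅ inclL.obj e.fst ⊙ₗ x.pt :=
  leftIso (semiIso e).symm x.pt ≪≫ αₗ _ _ _ ≪≫ rightIso _ (x.iso e.snd)

lemma reduceIso_hom (e : SuperSemi) (x : FixedPt inclJ W) : (reduceIso e x).hom =
    (semiIso e).inv ⊵ₗ x.pt ≫ (αₗ (inclL.obj e.fst) (inclJ.obj e.snd) x.pt).hom ≫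
      inclL.obj e.fst ⊴ₗ (x.iso e.snd).hom := rfl

lemma reduceIso_natural_left {e e' : SuperSemi} (f : e ⟶ e') (x : FixedPt inclJ W) :
    f ⊵ₗ x.pt ≫ (reduceIso e' x).hom = (reduceIso e x).hom ≫ inclL.map f.fst ⊵ₗ x.pt := by
  have h : f ≫ (semiIso e').inv = (semiIso e).inv ≫ (inclL.map f.fst ⊗ₘ inclJ.map f.snd) := by
    rw [Iso.comp_inv_eq, Category.assoc, ← semiIso_natural, Iso.inv_hom_id_assoc]
  rw [reduceIso_hom, reduceIso_hom, ← comp_actionHomLeft_assoc, h, MonoidalCategory.tensorHom_def']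
  simp only [comp_actionHomLeft, whiskerLeft_actionHomLeft, whiskerRight_actionHomLeft,
    Category.assoc, Iso.inv_hom_id_assoc]
  rw [← action_exchange, ← actionHomRight_comp_assoc, x.naturality]

lemma reduceIso_natural_right (e : SuperSemi) {x y : FixedPt inclJ W} (f : x ⟶ y) :
    e ⊴ₗ FixedPt.val f ≫ (reduceIso e y).hom =
      (reduceIso e x).hom ≫ inclL.obj e.fst ⊴ₗ FixedPt.val f := by
  rw [reduceIso_hom, reduceIso_hom, action_exchange_assoc]
  simp only [Category.assoc]
  rw [← actionHomRight_comp _ (x.iso e.snd).hom, ← FixedPt.val_comm]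
  simp

lemma reduceIso_tensor (e : SuperSemi) (g : SuperAut) (x : FixedPt inclJ W) :
    (reduceIso (e ⊗ inclJ.obj g) x).hom =
      (αₗ e (inclJ.obj g) x.pt).hom ≫ e ⊴ₗ (x.iso g).hom ≫ (reduceIso e x).hom ≫
        inclL.map ((ρ_ e.fst).inv ≫ e.fst ◁ ε e.snd.functor) ⊵ₗ x.pt := by
  refine reduce_tensor (semiIso e) (semiIso (e ⊗ inclJ.obj g)) (μ inclJ e.snd g) _
    (semiIso_tensor e g) ?_
  have h : μ inclJ e.snd g ⊵ₗ x.pt ≫ (x.iso (e.snd ⊗ g)).hom =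
      (αₗ (inclJ.obj e.snd) (inclJ.obj g) x.pt).hom ≫ inclJ.obj e.snd ⊴ₗ (x.iso g).hom ≫
        (x.iso e.snd).hom := by
    rw [x.mul, ← comp_actionHomLeft_assoc, Functor.Monoidal.μ_δ, id_actionHomLeft,
      Category.id_comp]
  exact h

end Coherence

section Lineator

open MonoidalCategory MonoidalLeftAction

variable {E : Type u} [Category.{v} E] [MonoidalCategory E] {V : Type u₁} [Category.{v₁} V]
  [MonoidalLeftAction E V] {V' : Type u₂} [Category.{v₂} V'] [MonoidalLeftAction E V']
  (H : V ⥤ V') (m : ∀ (e : E) (w : V), e ⊙ₗ H.obj w ⟶ H.obj (e ⊙ₗ w))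
  (hm : ∀ (e : E) {w w' : V} (f : w ⟶ w'),
    e ⊴ₗ H.map f ≫ m e w' = m e w ≫ H.map (e ⊴ₗ f))
  {x : V} {y : V'} (σ : ∀ e : E, H.obj (e ⊙ₗ x) ⟶ e ⊙ₗ y)
  (hl : ∀ {e e' : E} (f : e ⟶ e'), H.map (f ⊵ₗ x) ≫ σ e' = σ e ≫ f ⊵ₗ y)

include hm hl

/-- `σ` is compatible with `m` at an isomorphic object if it is so at the object. -/
lemma lineator_of_iso {e e₁ e₂ : E} (s : e₁ ≅ e₂)
    (h : m e (e₁ ⊙ₗ x) ≫ H.map (αₗ e e₁ x).inv ≫ σ (e ⊗ e₁) ≫ (αₗ e e₁ y).hom = e ⊴ₗ σ e₁) :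
    m e (e₂ ⊙ₗ x) ≫ H.map (αₗ e e₂ x).inv ≫ σ (e ⊗ e₂) ≫ (αₗ e e₂ y).hom = e ⊴ₗ σ e₂ := by
  have p : (e ◁ s.inv) ⊵ₗ y ≫ (αₗ e e₁ y).hom = (αₗ e e₂ y).hom ≫ e ⊴ₗ s.inv ⊵ₗ y := by simp
  have q : e ⊴ₗ s.inv ⊵ₗ x ≫ (αₗ e e₁ x).inv = (αₗ e e₂ x).inv ≫ (e ◁ s.inv) ⊵ₗ x := by simp
  rw [← cancel_mono (e ⊴ₗ s.inv ⊵ₗ y)]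
  simp only [Category.assoc]
  rw [← actionHomRight_comp, ← hl, actionHomRight_comp, ← h, reassoc_of% hm, ← p,
    ← reassoc_of% hl, ← H.map_comp_assoc, ← H.map_comp_assoc, q]

/-- `σ` is compatible with `m` at `e' ⊗ g` if it is so at `e'` and `g` fixes `x` and `y`. -/
lemma lineator_of_fixed {e e' g : E} (a : g ⊙ₗ x ⟶ x) (b : g ⊙ₗ y ⟶ y) [IsIso b]
    (hg : ∀ e : E, H.map (e ⊴ₗ a) ≫ σ e =
      H.map (αₗ e g x).inv ≫ σ (e ⊗ g) ≫ (αₗ e g y).hom ≫ e ⊴ₗ b)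
    (h : m e (e' ⊙ₗ x) ≫ H.map (αₗ e e' x).inv ≫ σ (e ⊗ e') ≫ (αₗ e e' y).hom = e ⊴ₗ σ e') :
    m e ((e' ⊗ g) ⊙ₗ x) ≫ H.map (αₗ e (e' ⊗ g) x).inv ≫ σ (e ⊗ e' ⊗ g) ≫
      (αₗ e (e' ⊗ g) y).hom = e ⊴ₗ σ (e' ⊗ g) := by
  have hg' (e : E) : H.map ((αₗ e g x).hom ≫ e ⊴ₗ a) ≫ σ e =
      σ (e ⊗ g) ≫ (αₗ e g y).hom ≫ e ⊴ₗ b := by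
    rw [H.map_comp_assoc, hg, ← H.map_comp_assoc, Iso.hom_inv_id, H.map_id, Category.id_comp]
  have p : e ⊴ₗ ((αₗ e' g x).hom ≫ e' ⊴ₗ a) ≫ (αₗ e e' x).inv = (αₗ e (e' ⊗ g) x).inv ≫
      (α_ e e' g).inv ⊵ₗ x ≫ (αₗ (e ⊗ e') g x).hom ≫ (e ⊗ e') ⊴ₗ a := by
    have p₁ := associator_actionHom e e' g x
    have p₂ : (e ⊗ e') ⊴ₗ a ≫ (αₗ e e' x).hom = (αₗ e e' (g ⊙ₗ x)).hom ≫ e ⊴ₗ e' ⊴ₗ a := by simp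
    rw [Iso.eq_inv_comp, ← cancel_mono (αₗ e e' x).hom]
    simp only [Category.assoc, Iso.inv_hom_id, Category.comp_id]
    rw [p₂, ← reassoc_of% p₁, ← comp_actionHomLeft_assoc, Iso.inv_hom_id, id_actionHomLeft,
      Category.id_comp, actionHomRight_comp]
  have q : (α_ e e' g).inv ⊵ₗ y ≫ (αₗ (e ⊗ e') g y).hom ≫ (e ⊗ e') ⊴ₗ b ≫ (αₗ e e' y).hom =
      (αₗ e (e' ⊗ g) y).hom ≫ e ⊴ₗ ((αₗ e' g y).hom ≫ e' ⊴ₗ b) := by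
    have p₁ := associator_actionHom e e' g y
    have p₂ : (e ⊗ e') ⊴ₗ b ≫ (αₗ e e' y).hom = (αₗ e e' (g ⊙ₗ y)).hom ≫ e ⊴ₗ e' ⊴ₗ b := by simp
    rw [p₂, ← reassoc_of% p₁, ← comp_actionHomLeft_assoc, Iso.inv_hom_id, id_actionHomLeft,
      Category.id_comp, actionHomRight_comp]
  rw [← cancel_mono (e ⊴ₗ ((αₗ e' g y).hom ≫ e' ⊴ₗ b))]
  simp only [Category.assoc]
  rw [← q, ← reassoc_of% hl, ← actionHomRight_comp, ← hg', actionHomRight_comp, ← h,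
    reassoc_of% hm, ← H.map_comp_assoc (e ⊴ₗ _), p, ← reassoc_of% hg']
  simp only [H.map_comp, Category.assoc]

variable (key : ∀ e e' : E, m e (e' ⊙ₗ x) ≫ H.map (αₗ e e' x).inv ≫ σ (e ⊗ e') ≫
  (αₗ e e' y).hom = e ⊴ₗ σ e') [∀ e, IsIso (σ e)]

include key

omit hm in
lemma lineator_natural {e e' : E} (f : e ⟶ e') (k : E) :
    f ⊵ₗ H.obj (k ⊙ₗ x) ≫ m e' (k ⊙ₗ x) = m e (k ⊙ₗ x) ≫ H.map (f ⊵ₗ (k ⊙ₗ x)) := by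
  have p : f ⊵ₗ (k ⊙ₗ x) ≫ (αₗ e' k x).inv = (αₗ e k x).inv ≫ (f ▷ k) ⊵ₗ x := by simp
  have q : (f ▷ k) ⊵ₗ y ≫ (αₗ e' k y).hom = (αₗ e k y).hom ≫ f ⊵ₗ (k ⊙ₗ y) := by simp
  rw [← cancel_mono (H.map (αₗ e' k x).inv ≫ σ (e' ⊗ k) ≫ (αₗ e' k y).hom), Category.assoc, key,
    Category.assoc, ← H.map_comp_assoc, p, H.map_comp_assoc, reassoc_of% hl, q,
    ← action_exchange, ← key]
  simp only [Category.assoc]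

lemma lineator_assoc (e e' k : E) : m (e ⊗ e') (k ⊙ₗ x) ≫ H.map (αₗ e e' (k ⊙ₗ x)).hom =
    (αₗ e e' (H.obj (k ⊙ₗ x))).hom ≫ e ⊴ₗ m e' (k ⊙ₗ x) ≫ m e (e' ⊙ₗ k ⊙ₗ x) := by
  have p : (αₗ e e' (k ⊙ₗ x)).hom ≫ e ⊴ₗ (αₗ e' k x).inv ≫ (αₗ e (e' ⊗ k) x).inv =
      (αₗ (e ⊗ e') k x).inv ≫ (α_ e e' k).hom ⊵ₗ x := by
    have p₁ := associator_actionHom e e' k x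
    rw [Iso.eq_inv_comp, ← reassoc_of% p₁, ← actionHomRight_comp_assoc, Iso.hom_inv_id,
      actionHomRight_id, Category.id_comp, Iso.hom_inv_id, Category.comp_id]
  have q := associator_actionHom e e' k y
  have hr : (e ⊗ e') ⊴ₗ σ k ≫ (αₗ e e' (k ⊙ₗ y)).hom =
    (αₗ e e' (H.obj (k ⊙ₗ x))).hom ≫ e ⊴ₗ e' ⊴ₗ σ k := by simp
  rw [← cancel_mono (H.map (e ⊴ₗ (αₗ e' k x).inv ≫ (αₗ e (e' ⊗ k) x).inv) ≫ σ (e ⊗ e' ⊗ k) ≫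
    (αₗ e (e' ⊗ k) y).hom ≫ e ⊴ₗ (αₗ e' k y).hom)]
  trans (e ⊗ e') ⊴ₗ σ k ≫ (αₗ e e' (k ⊙ₗ y)).hom
  · rw [Category.assoc, ← H.map_comp_assoc, p, H.map_comp_assoc, reassoc_of% hl, q, ← key]
    simp only [Category.assoc]
  · rw [hr, ← key e' k]
    simp only [Category.assoc, H.map_comp, actionHomRight_comp, reassoc_of% key e (e' ⊗ k),
      ← reassoc_of% hm]

omit hm in
lemma lineator_unit (k : E) :
    (λₗ (H.obj (k ⊙ₗ x))).hom = m (𝟙_ E) (k ⊙ₗ x) ≫ H.map (λₗ (k ⊙ₗ x)).hom := by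
  have p (z : V) : (λₗ (k ⊙ₗ z)).hom = (αₗ (𝟙_ E) k z).inv ≫ (λ_ k).hom ⊵ₗ z := by simp
  have p' (z : V') : (λₗ (k ⊙ₗ z)).hom = (αₗ (𝟙_ E) k z).inv ≫ (λ_ k).hom ⊵ₗ z := by simp
  have q : (λₗ (H.obj (k ⊙ₗ x))).hom ≫ σ k = 𝟙_ E ⊴ₗ σ k ≫ (λₗ (k ⊙ₗ y)).hom := by simp
  rw [← cancel_mono (σ k), q, ← key, p, p', H.map_comp]
  simp only [Category.assoc, Iso.hom_inv_id_assoc, hl]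

omit [∀ e, IsIso (σ e)] in
lemma lineator_unitIso (e : E) :
    e ⊴ₗ (H.map (λₗ[E] x).inv ≫ σ (𝟙_ E) ≫ (λₗ[E] y).hom) = m e x ≫ σ e := by
  have p : e ⊴ₗ (λₗ[E] x).inv ≫ (αₗ e (𝟙_ E) x).inv = (ρ_ e).inv ⊵ₗ x := by
    have h : (ρ_ e).hom ⊵ₗ x ≫ (ρ_ e).inv ⊵ₗ x = 𝟙 _ := by
      rw [← comp_actionHomLeft, Iso.hom_inv_id, id_actionHomLeft]
    rw [← cancel_epi ((ρ_ e).hom ⊵ₗ x), h, rightUnitor_actionHom, Category.assoc,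
      ← actionHomRight_comp_assoc, Iso.hom_inv_id, actionHomRight_id, Category.id_comp,
      Iso.hom_inv_id]
  have q : (ρ_ e).inv ⊵ₗ y ≫ (αₗ e (𝟙_ E) y).hom ≫ e ⊴ₗ (λₗ[E] y).hom = 𝟙 _ := by
    rw [← rightUnitor_actionHom, ← comp_actionHomLeft, Iso.inv_hom_id, id_actionHomLeft]
  rw [actionHomRight_comp, actionHomRight_comp, ← key e (𝟙_ E), Category.assoc, Category.assoc,
    Category.assoc, reassoc_of% hm, ← H.map_comp_assoc, p, reassoc_of% hl, q, Category.comp_id]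

omit key [∀ e, IsIso (σ e)] hm in
lemma fixed_unitIso {g : E} (a : g ⊙ₗ x ⟶ x) (b : g ⊙ₗ y ⟶ y)
    (hg : ∀ e : E, H.map (e ⊴ₗ a) ≫ σ e =
      H.map (αₗ e g x).inv ≫ σ (e ⊗ g) ≫ (αₗ e g y).hom ≫ e ⊴ₗ b) :
    σ g ≫ b = H.map a ≫ H.map (λₗ[E] x).inv ≫ σ (𝟙_ E) ≫ (λₗ[E] y).hom := by
  have p : a ≫ (λₗ[E] x).inv = (λₗ[E] (g ⊙ₗ x)).inv ≫ 𝟙_ E ⊴ₗ a := by simp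
  have q : (λₗ[E] (g ⊙ₗ x)).inv ≫ (αₗ (𝟙_ E) g x).inv = (λ_ g).inv ⊵ₗ x := by
    have h : (λ_ g).hom ⊵ₗ x ≫ (λ_ g).inv ⊵ₗ x = 𝟙 _ := by
      rw [← comp_actionHomLeft, Iso.hom_inv_id, id_actionHomLeft]
    rw [← cancel_epi ((λ_ g).hom ⊵ₗ x), h, leftUnitor_actionHom, Category.assoc,
      Iso.hom_inv_id_assoc, Iso.hom_inv_id]
  have r : (λ_ g).inv ⊵ₗ y ≫ (αₗ (𝟙_ E) g y).hom ≫ 𝟙_ E ⊴ₗ b ≫ (λₗ[E] y).hom = b := by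
    rw [← actionUnitIso_hom_naturality (C := E), ← Category.assoc (αₗ (𝟙_ E) g y).hom,
      ← leftUnitor_actionHom, ← comp_actionHomLeft_assoc, Iso.inv_hom_id, id_actionHomLeft,
      Category.id_comp]
  rw [← H.map_comp_assoc, p, H.map_comp_assoc, reassoc_of% hg, ← H.map_comp_assoc, q,
    reassoc_of% hl, r]

end Lineator

section Extend

open MonoidalCategory MonoidalLeftAction SemiProd SuperVect SuperAut Functor.LaxLeftLinear

variable {W W' : LinMod SuperSemi} (hW : IsSuperMod W) (hW' : IsSuperMod W')
  [HasBinaryBiproducts W.carrier] [IsIdempotentComplete W.carrier]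
  {H : W.carrier ⥤ W'.carrier} (hH : IsCocontLinear H) {K : FixedPt inclJ W ⥤ FixedPt inclJ W'}
  (σ : ∀ (e : SuperSemi) (x : FixedPt inclJ W), H.obj (e ⊙ₗ x.pt) ≅ e ⊙ₗ (K.obj x).pt)
  (hl : ∀ {e e' : SuperSemi} (f : e ⟶ e') (x : FixedPt inclJ W),
    H.map (f ⊵ₗ x.pt) ≫ (σ e' x).hom = (σ e x).hom ≫ f ⊵ₗ (K.obj x).pt)
  (hr : ∀ (e : SuperSemi) {x y : FixedPt inclJ W} (f : x ⟶ y),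
    H.map (e ⊴ₗ FixedPt.val f) ≫ (σ e y).hom = (σ e x).hom ≫ e ⊴ₗ FixedPt.val (K.map f))
  (hg : ∀ (e : SuperSemi) (g : SuperAut) (x : FixedPt inclJ W),
    H.map (e ⊴ₗ (x.iso g).hom) ≫ (σ e x).hom = H.map (αₗ e (inclJ.obj g) x.pt).inv ≫
      (σ (e ⊗ inclJ.obj g) x).hom ≫ (αₗ e (inclJ.obj g) (K.obj x).pt).hom ≫
        e ⊴ₗ ((K.obj x).iso g).hom)

include hW hW' hH hl hr in
lemma exists_lineator : ∃ m : ∀ (e : SuperSemi) (w : W.carrier), e ⊙ₗ H.obj w ≅ H.obj (e ⊙ₗ w),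
    (∀ e {w w'} (f : w ⟶ w'), e ⊴ₗ H.map f ≫ (m e w').hom = (m e w).hom ≫ H.map (e ⊴ₗ f)) ∧
    ∀ e d x, (m e (inclL.obj d ⊙ₗ x.pt)).hom ≫ H.map (αₗ e (inclL.obj d) x.pt).inv ≫
      (σ (e ⊗ inclL.obj d) x).hom ≫ (αₗ e (inclL.obj d) (K.obj x).pt).hom =
        e ⊴ₗ (σ (inclL.obj d) x).hom := by
  let τ (e : SuperSemi) (d : SuperVect) (x : FixedPt inclJ W) :
      e ⊙ₗ H.obj (inclL.obj d ⊙ₗ x.pt) ≅ H.obj (e ⊙ₗ inclL.obj d ⊙ₗ x.pt) :=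
    rightIso e (σ (inclL.obj d) x) ≪≫ (αₗ e (inclL.obj d) (K.obj x).pt).symm ≪≫
      (σ (e ⊗ inclL.obj d) x).symm ≪≫ H.mapIso (αₗ e (inclL.obj d) x.pt)
  have hτ (e : SuperSemi) (d : SuperVect) (x : FixedPt inclJ W) : (τ e d x).hom ≫
      H.map (αₗ e (inclL.obj d) x.pt).inv ≫ (σ (e ⊗ inclL.obj d) x).hom ≫
        (αₗ e (inclL.obj d) (K.obj x).pt).hom = e ⊴ₗ (σ (inclL.obj d) x).hom := by
    simp [τ, ← H.map_comp_assoc]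
  have hi (e : SuperSemi) (d : SuperVect) (x : FixedPt inclJ W) :
      IsIso (H.map (αₗ e (inclL.obj d) x.pt).inv ≫ (σ (e ⊗ inclL.obj d) x).hom ≫
        (αₗ e (inclL.obj d) (K.obj x).pt).hom) := inferInstance
  choose m hm using fun e => superMod_exists_natIso hW (𝟭 (FixedPt inclJ W)) (hH.comp (hW'.act e))
    ((hW.act e).comp hH) (fun d x => τ e d x)
    (fun d {x y} f => by
      change e ⊴ₗ H.map (inclL.obj d ⊴ₗ FixedPt.val f) ≫ (τ e d y).hom =
        (τ e d x).hom ≫ H.map (e ⊴ₗ inclL.obj d ⊴ₗ FixedPt.val f)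
      have h : H.map (e ⊴ₗ inclL.obj d ⊴ₗ FixedPt.val f) ≫ H.map (αₗ e (inclL.obj d) y.pt).inv =
          H.map (αₗ e (inclL.obj d) x.pt).inv ≫ H.map ((e ⊗ inclL.obj d) ⊴ₗ FixedPt.val f) := by
        rw [← H.map_comp, ← H.map_comp]
        simp
      rw [← cancel_mono (H.map (αₗ e (inclL.obj d) y.pt).inv ≫ (σ (e ⊗ inclL.obj d) y).hom ≫
        (αₗ e (inclL.obj d) (K.obj y).pt).hom), Category.assoc, hτ, Category.assoc, reassoc_of% h,
        reassoc_of% hr (e ⊗ inclL.obj d), ← actionHomRight_comp, hr, actionHomRight_comp, ← hτ]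
      simp only [Category.assoc]
      congr 3
      simp)
    (fun {d d'} f x => by
      change e ⊴ₗ H.map (inclL.map f ⊵ₗ x.pt) ≫ (τ e d' x).hom =
        (τ e d x).hom ≫ H.map (e ⊴ₗ inclL.map f ⊵ₗ x.pt)
      have h : H.map (e ⊴ₗ inclL.map f ⊵ₗ x.pt) ≫ H.map (αₗ e (inclL.obj d') x.pt).inv =
          H.map (αₗ e (inclL.obj d) x.pt).inv ≫ H.map ((e ◁ inclL.map f) ⊵ₗ x.pt) := by
        rw [← H.map_comp, ← H.map_comp]
        simp
      rw [← cancel_mono (H.map (αₗ e (inclL.obj d') x.pt).inv ≫ (σ (e ⊗ inclL.obj d') x).hom ≫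
        (αₗ e (inclL.obj d') (K.obj x).pt).hom), Category.assoc, hτ, Category.assoc, reassoc_of% h,
        reassoc_of% hl (e ◁ inclL.map f), ← actionHomRight_comp, hl, actionHomRight_comp, ← hτ]
      simp only [Category.assoc]
      congr 3
      simp)
  refine ⟨fun e w => (m e).app w, fun e w w' f => (m e).hom.naturality f, fun e d x => ?_⟩
  refine Eq.trans ?_ (hτ e d x)
  exact congrArg (· ≫ _) (hm e d x)

include hW hW' hH hl hr hg in
/-- A functor whose values on twists of fixed points are twists of fixed points is a module
functor. -/
lemma exists_leftLinear : ∃ i : H.LeftLinear SuperSemi, ∀ e e' x,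
    i.toLaxLeftLinear.μₗ e (e' ⊙ₗ x.pt) ≫ H.map (αₗ e e' x.pt).inv ≫ (σ (e ⊗ e') x).hom ≫
      (αₗ e e' (K.obj x).pt).hom = e ⊴ₗ (σ e' x).hom := by
  obtain ⟨m, hm, hm'⟩ := exists_lineator hW hW' hH σ hl hr
  have key (e e' : SuperSemi) (x : FixedPt inclJ W) : (m e (e' ⊙ₗ x.pt)).hom ≫
      H.map (αₗ e e' x.pt).inv ≫ (σ (e ⊗ e') x).hom ≫ (αₗ e e' (K.obj x).pt).hom =
        e ⊴ₗ (σ e' x).hom :=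
    lineator_of_iso H (fun e w => (m e w).hom) hm (fun e => (σ e x).hom) (fun f => hl f x)
      (semiIso e') (lineator_of_fixed H (fun e w => (m e w).hom) hm (fun e => (σ e x).hom)
        (fun f => hl f x) (x.iso e'.snd).hom ((K.obj x).iso e'.snd).hom (fun e => hg e e'.snd x)
        (hm' e e'.fst x))
  have hact (e : SuperSemi) := (hW.act e).additive
  have hact' (e : SuperSemi) := (hW'.act e).additive
  have hH' := hH.additive
  refine ⟨leftLinearMk H m (fun {e e'} f w => ?_) hm (fun e e' w => ?_) fun w => ?_, key⟩
  · let α : H ⋙ act W' e ⟶ act W e' ⋙ H :=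
      { app := fun w => f ⊵ₗ H.obj w ≫ (m e' w).hom
        naturality := fun w w' k => by
          change e ⊴ₗ H.map k ≫ f ⊵ₗ H.obj w' ≫ (m e' w').hom =
            (f ⊵ₗ H.obj w ≫ (m e' w).hom) ≫ H.map (e' ⊴ₗ k)
          rw [action_exchange_assoc, hm, Category.assoc] }
    let β : H ⋙ act W' e ⟶ act W e' ⋙ H :=
      { app := fun w => (m e w).hom ≫ H.map (f ⊵ₗ w)
        naturality := fun w w' k => by
          change e ⊴ₗ H.map k ≫ (m e w').hom ≫ H.map (f ⊵ₗ w') =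
            ((m e w).hom ≫ H.map (f ⊵ₗ w)) ≫ H.map (e' ⊴ₗ k)
          rw [reassoc_of% hm, Category.assoc, ← H.map_comp, ← H.map_comp, action_exchange] }
    have h (d : SuperVect) (x : FixedPt inclJ W) :
        α.app (inclL.obj d ⊙ₗ x.pt) = β.app (inclL.obj d ⊙ₗ x.pt) :=
      lineator_natural H (fun e w => (m e w).hom) (fun e => (σ e x).hom) (fun f => hl f x)
        (fun e e' => key e e' x) f (inclL.obj d)
    exact congrArg (fun t => t.app w) (superMod_natTrans_ext hW (𝟭 (FixedPt inclJ W)) (h _) (h _))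
  · let α : H ⋙ act W' (e ⊗ e') ⟶ (act W e' ⋙ act W e) ⋙ H :=
      { app := fun w => (m (e ⊗ e') w).hom ≫ H.map (αₗ e e' w).hom
        naturality := fun w w' k => by
          change (e ⊗ e') ⊴ₗ H.map k ≫ (m (e ⊗ e') w').hom ≫ H.map (αₗ e e' w').hom =
            ((m (e ⊗ e') w).hom ≫ H.map (αₗ e e' w).hom) ≫ H.map (e ⊴ₗ e' ⊴ₗ k)
          rw [reassoc_of% hm, Category.assoc, ← H.map_comp, ← H.map_comp]
          simp }
    let β : H ⋙ act W' (e ⊗ e') ⟶ (act W e' ⋙ act W e) ⋙ H :=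
      { app := fun w => (αₗ e e' (H.obj w)).hom ≫ e ⊴ₗ (m e' w).hom ≫ (m e (e' ⊙ₗ w)).hom
        naturality := fun w w' k => by
          change (e ⊗ e') ⊴ₗ H.map k ≫ (αₗ e e' (H.obj w')).hom ≫ e ⊴ₗ (m e' w').hom ≫
              (m e (e' ⊙ₗ w')).hom =
            ((αₗ e e' (H.obj w)).hom ≫ e ⊴ₗ (m e' w).hom ≫ (m e (e' ⊙ₗ w)).hom) ≫
              H.map (e ⊴ₗ e' ⊴ₗ k)
          have p : (e ⊗ e') ⊴ₗ H.map k ≫ (αₗ e e' (H.obj w')).hom =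
            (αₗ e e' (H.obj w)).hom ≫ e ⊴ₗ e' ⊴ₗ H.map k := by simp
          rw [reassoc_of% p, ← actionHomRight_comp_assoc, hm, actionHomRight_comp_assoc, hm]
          simp only [Category.assoc] }
    have h (d : SuperVect) (x : FixedPt inclJ W) :
        α.app (inclL.obj d ⊙ₗ x.pt) = β.app (inclL.obj d ⊙ₗ x.pt) :=
      lineator_assoc H (fun e w => (m e w).hom) hm (fun e => (σ e x).hom) (fun f => hl f x)
        (fun e e' => key e e' x) e e' (inclL.obj d)
    exact congrArg (fun t => t.app w) (superMod_natTrans_ext hW (𝟭 (FixedPt inclJ W)) (h _) (h _))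
  · let α : H ⋙ act W' (𝟙_ SuperSemi) ⟶ H :=
      { app := fun w => (λₗ[SuperSemi] (H.obj w)).hom
        naturality := fun w w' k => (actionUnitIso_hom_naturality (C := SuperSemi) (H.map k)).symm }
    let β : H ⋙ act W' (𝟙_ SuperSemi) ⟶ H :=
      { app := fun w => (m (𝟙_ SuperSemi) w).hom ≫ H.map (λₗ[SuperSemi] w).hom
        naturality := fun w w' k => by
          change 𝟙_ SuperSemi ⊴ₗ H.map k ≫ (m _ w').hom ≫ H.map (λₗ[SuperSemi] w').hom =
            ((m _ w).hom ≫ H.map (λₗ[SuperSemi] w).hom) ≫ H.map k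
          rw [reassoc_of% hm, Category.assoc, ← H.map_comp, ← H.map_comp,
            actionUnitIso_hom_naturality (C := SuperSemi)] }
    have h (d : SuperVect) (x : FixedPt inclJ W) :
        α.app (inclL.obj d ⊙ₗ x.pt) = β.app (inclL.obj d ⊙ₗ x.pt) :=
      lineator_unit H (fun e w => (m e w).hom) (fun e => (σ e x).hom) (fun f => hl f x)
        (fun e e' => key e e' x) (inclL.obj d)
    exact congrArg (fun t => t.app w) (superMod_natTrans_ext hW (𝟭 (FixedPt inclJ W)) (h _) (h _))

end Extend

section

open MonoidalCategory MonoidalLeftAction SemiProd SuperVect SuperAut Functor.LaxLeftLinear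
  Functor.LaxMonoidal

variable {W W' : LinMod SuperSemi} (hW : IsSuperMod W) (hW' : IsSuperMod W')
  [HasColimitsOfSize.{0, 0} W.carrier] [HasColimitsOfSize.{0, 0} W'.carrier]
  [HasBinaryBiproducts W.carrier] [IsIdempotentComplete W.carrier]
  [HasBinaryBiproducts W'.carrier] [IsIdempotentComplete W'.carrier]

omit [HasColimitsOfSize.{0, 0} W.carrier] in
include hW hW' in
/-- A cocontinuous functor between fixed points comes from a module functor. -/
lemma exists_fixMap (h : fixObj (commutation vectToSuperVect) W ⟶
      fixObj (commutation vectToSuperVect) W') (hh : IsCocontLinear h.functor) :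
    ∃ F : W ⟶ W', IsCocontLinear F.functor ∧
      Nonempty (fixMap (commutation vectToSuperVect) F ≅ h) := by
  let K : FixedPt inclJ W ⥤ FixedPt inclJ W' := h.functor
  let B := (canonicalBal (i := vectToSuperVect) (L := SemiProd.inclD vectToSuperVect) h)
  have hB := isAdmissible_canonicalBal hW' h hh
  obtain ⟨H, hH, τ, hτ, hτ'⟩ := exists_lift_of_biadditive hW (G := 𝟭 (FixedPt inclJ W))
    IsCocontLinear.id B.bi hB.left hB.right
  let τ' (d : SuperVect) (x : FixedPt inclJ W) : H.obj (inclL.obj d ⊙ₗ x.pt) ≅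
    inclL.obj d ⊙ₗ (K.obj x).pt := τ d x
  have hτ₁ (d : SuperVect) {x y : FixedPt inclJ W} (f : x ⟶ y) :
    H.map (inclL.obj d ⊴ₗ FixedPt.val f) ≫ (τ' d y).hom =
      (τ' d x).hom ≫ inclL.obj d ⊴ₗ FixedPt.val (K.map f) := hτ d f
  have hτ₂ {d d' : SuperVect} (f : d ⟶ d') (x : FixedPt inclJ W) :
    H.map (inclL.map f ⊵ₗ x.pt) ≫ (τ' d' x).hom =
      (τ' d x).hom ≫ inclL.map f ⊵ₗ (K.obj x).pt := hτ' f x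
  let σ (e : SuperSemi) (x : FixedPt inclJ W) : H.obj (e ⊙ₗ x.pt) ≅ e ⊙ₗ (K.obj x).pt :=
    H.mapIso (reduceIso e x) ≪≫ τ' e.fst x ≪≫ (reduceIso e (K.obj x)).symm
  have hσ (e : SuperSemi) (x : FixedPt inclJ W) : (σ e x).hom ≫ (reduceIso e (K.obj x)).hom =
      H.map (reduceIso e x).hom ≫ (τ' e.fst x).hom := by simp [σ]
  have hl {e e' : SuperSemi} (f : e ⟶ e') (x : FixedPt inclJ W) :
      H.map (f ⊵ₗ x.pt) ≫ (σ e' x).hom = (σ e x).hom ≫ f ⊵ₗ (K.obj x).pt := by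
    rw [← cancel_mono (reduceIso e' (K.obj x)).hom, Category.assoc, hσ, Category.assoc,
      reduceIso_natural_left, reassoc_of% hσ, ← hτ₂, ← H.map_comp_assoc, reduceIso_natural_left,
      H.map_comp_assoc]
  have hr (e : SuperSemi) {x y : FixedPt inclJ W} (f : x ⟶ y) :
      H.map (e ⊴ₗ FixedPt.val f) ≫ (σ e y).hom =
        (σ e x).hom ≫ e ⊴ₗ FixedPt.val (K.map f) := by
    rw [← cancel_mono (reduceIso e (K.obj y)).hom, Category.assoc, hσ, Category.assoc,
      reduceIso_natural_right, reassoc_of% hσ, ← hτ₁, ← H.map_comp_assoc, reduceIso_natural_right,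
      H.map_comp_assoc]
  have hg (e : SuperSemi) (g : SuperAut) (x : FixedPt inclJ W) :
      H.map (e ⊴ₗ (x.iso g).hom) ≫ (σ e x).hom = H.map (αₗ e (inclJ.obj g) x.pt).inv ≫
        (σ (e ⊗ inclJ.obj g) x).hom ≫ (αₗ e (inclJ.obj g) (K.obj x).pt).hom ≫
          e ⊴ₗ ((K.obj x).iso g).hom := by
    let r : e.fst ⟶ (e ⊗ inclJ.obj g).fst := (ρ_ e.fst).inv ≫ e.fst ◁ ε e.snd.functor
    have hr : IsIso r := inferInstanceAs (IsIso ((ρ_ e.fst).inv ≫ e.fst ◁ ε e.snd.functor))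
    have h₁ (z : W'.carrier) : Mono (inclL.map r ⊵ₗ z) := inferInstance
    have h₂ (x : FixedPt inclJ W) := reduceIso_tensor e g x
    have h₃ (x : FixedPt inclJ W') : (αₗ e (inclJ.obj g) x.pt).hom ≫ e ⊴ₗ (x.iso g).hom ≫
      (reduceIso e x).hom ≫ inclL.map r ⊵ₗ x.pt = (reduceIso (e ⊗ inclJ.obj g) x).hom :=
      (reduceIso_tensor e g x).symm
    have h₄ : (αₗ e (inclJ.obj g) x.pt).inv ≫ (reduceIso (e ⊗ inclJ.obj g) x).hom =
        e ⊴ₗ (x.iso g).hom ≫ (reduceIso e x).hom ≫ inclL.map r ⊵ₗ x.pt := by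
      rw [Iso.inv_comp_eq]
      exact reduceIso_tensor e g x
    rw [← cancel_mono ((reduceIso e (K.obj x)).hom ≫ inclL.map r ⊵ₗ (K.obj x).pt)]
    simp only [Category.assoc]
    rw [h₃, hσ, reassoc_of% hσ, ← hτ₂, ← H.map_comp_assoc (αₗ e (inclJ.obj g) x.pt).inv, h₄]
    simp only [H.map_comp, Category.assoc]
  obtain ⟨i, hi⟩ := exists_leftLinear hW hW' hH σ hl hr hg
  let F : W ⟶ W' := LinMod.Hom.mk H
  have hF : IsCocontLinear F.functor := hH
  refine ⟨F, hF, ⟨?_⟩⟩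
  let ν (x : FixedPt inclJ W) : H.obj x.pt ≅ (K.obj x).pt :=
    H.mapIso (λₗ[SuperSemi] x.pt).symm ≪≫ σ (𝟙_ SuperSemi) x ≪≫ λₗ[SuperSemi] (K.obj x).pt
  have hν (g : SuperAut) (x : FixedPt inclJ W) :
      inclJ.obj g ⊴ₗ (ν x).hom ≫ ((K.obj x).iso g).hom =
        (i.toLaxLeftLinear.μₗ (inclJ.obj g) x.pt ≫ H.map (x.iso g).hom) ≫ (ν x).hom := by
    have h₁ : inclJ.obj g ⊴ₗ (ν x).hom =
        i.toLaxLeftLinear.μₗ (inclJ.obj g) x.pt ≫ (σ (inclJ.obj g) x).hom :=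
      lineator_unitIso H (fun e w => i.toLaxLeftLinear.μₗ e w)
        (fun e w w' f => i.toLaxLeftLinear.μₗ_naturality_right e f)
        (fun e => (σ e x).hom) (fun f => hl f x) (fun e e' => hi e e' x) _
    have h₂ : (σ (inclJ.obj g) x).hom ≫ ((K.obj x).iso g).hom = H.map (x.iso g).hom ≫ (ν x).hom :=
      fixed_unitIso H (fun e => (σ e x).hom) (fun f => hl f x) _ _ (fun e => hg e g x)
    rw [h₁, Category.assoc, Category.assoc, h₂]
  have hν' {x y : FixedPt inclJ W} (f : x ⟶ y) :
      H.map (FixedPt.val f) ≫ (ν y).hom = (ν x).hom ≫ FixedPt.val (K.map f) := by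
    have h₁ : H.map (FixedPt.val f) ≫ H.map (λₗ[SuperSemi] y.pt).inv =
        H.map (λₗ[SuperSemi] x.pt).inv ≫ H.map (𝟙_ SuperSemi ⊴ₗ FixedPt.val f) := by
      rw [← H.map_comp, ← H.map_comp, actionUnitIso_inv_naturality (C := SuperSemi)]
    change H.map (FixedPt.val f) ≫ H.map (λₗ[SuperSemi] y.pt).inv ≫ (σ (𝟙_ SuperSemi) y).hom ≫
      (λₗ[SuperSemi] (K.obj y).pt).hom = (H.map (λₗ[SuperSemi] x.pt).inv ≫
      (σ (𝟙_ SuperSemi) x).hom ≫ (λₗ[SuperSemi] (K.obj x).pt).hom) ≫ FixedPt.val (K.map f)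
    rw [reassoc_of% h₁, reassoc_of% hr, ← actionUnitIso_hom_naturality (C := SuperSemi)]
    simp only [Category.assoc]
  exact vectModIso (V := fixObj (commutation vectToSuperVect) W)
    (W := fixObj (commutation vectToSuperVect) W') (fun x => orbit_fixObj hW' x) (NatIso.ofComponents
    (F := (fixMap (commutation vectToSuperVect) F).functor) (G := h.functor)
    (fun x => FixedPt.isoMk (X := fixMapPt F x) (Y := K.obj x) (ν x) (fun g => hν g x))
    (fun {x y} f => FixedPt.hom_ext (hν' f)))

end

section Galois

open MonoidalCategory SuperVect Bicategory
open scoped Pseudofunctor.StrongTrans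

variable {V W : LinMod (ModuleCat.{0} ℝ)}

/-- A cocontinuous equivalence of modules over real vector spaces is an equivalence in the
bicategory of modules. -/
lemma isEquiv_of_isEquivalence {Q : LinCat → Prop} {V W : MOD (ModuleCat.{0} ℝ) Q} (f : V ⟶ W)
    [f.of.functor.IsEquivalence] : IsEquiv f := by
  have hV : IsVectMod V.of := V.mem.2.2
  have hW : IsVectMod W.of := W.mem.2.2
  have hf : IsCocontLinear f.of.functor := f.mem
  obtain ⟨g, hg⟩ := exists_vectModHom hW hV f.of.functor.inv hf.inv
  let g' : W ⟶ V := SubBicategory.Hom.mk g (show IsCocontLinear g.functor from hg ▸ hf.inv)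
  let s : (𝟙 V.of : V.of ⟶ V.of).functor ≅ (f.of ≫ g).functor :=
    f.of.functor.asEquivalence.unitIso ≪≫ Functor.isoWhiskerLeft f.of.functor (eqToIso hg.symm)
  let t : (g ≫ f.of).functor ≅ (𝟙 W.of : W.of ⟶ W.of).functor :=
    Functor.isoWhiskerRight (eqToIso hg) f.of.functor ≪≫ f.of.functor.asEquivalence.counitIso
  exact ⟨g', ⟨SubBicategory.isoMk (f := 𝟙 V) (g := f ≫ g') (vectModIso hV s)⟩,
    ⟨SubBicategory.isoMk (f := g' ≫ f) (g := 𝟙 W) (vectModIso hW t)⟩⟩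

lemma isEquivalence_functor_of_isEquiv {Q : LinCat → Prop} {V W : MOD (ModuleCat.{0} ℝ) Q}
    {f : V ⟶ W} (hf : IsEquiv f) : f.of.functor.IsEquivalence := by
  obtain ⟨g, ⟨s⟩, ⟨t⟩⟩ := hf
  let s' : 𝟭 V.of.carrier ≅ f.of.functor ⋙ g.of.functor :=
    { hom := s.hom.of.trans
      inv := s.inv.of.trans
      hom_inv_id := congrArg (fun a => a.of.trans) s.hom_inv_id
      inv_hom_id := congrArg (fun a => a.of.trans) s.inv_hom_id }
  let t' : g.of.functor ⋙ f.of.functor ≅ 𝟭 W.of.carrier :=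
    { hom := t.hom.of.trans
      inv := t.inv.of.trans
      hom_inv_id := congrArg (fun a => a.of.trans) t.hom_inv_id
      inv_hom_id := congrArg (fun a => a.of.trans) t.inv_hom_id }
  exact (CategoryTheory.Equivalence.mk f.of.functor g.of.functor s' t').isEquivalence_functor

variable {Q : LinCat → Prop} (hQ : ∀ V, Q V → IsPres V)
  (hfix : ∀ W : LinMod SuperSemi, IsSuperMod W → Q W.toLinCat →
    Q (fixObj (SemiProd.commutation vectToSuperVect) W).toLinCat)

include hQ hfix in
lemma fixObj_mem (W : LinMod SuperSemi)
    (h : (cocontMod (SemiProd.inclD vectToSuperVect) Q).obj W) :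
    (cocontMod (𝟭 (ModuleCat.{0} ℝ)) Q).obj
      (fixObj (SemiProd.commutation vectToSuperVect) W) := by
  have hW := isSuperMod_of_mem h
  have := IsPres.hasColimits (hQ _ h.1)
  exact ⟨hfix W hW h.1, act_fixObj hW, orbit_fixObj hW⟩

include hQ in
lemma fixMap_mem {W W' : LinMod SuperSemi} (f : W ⟶ W')
    (h : (cocontMod (SemiProd.inclD vectToSuperVect) Q).obj W)
    (h' : (cocontMod (SemiProd.inclD vectToSuperVect) Q).obj W')
    (hf : (cocontMod (SemiProd.inclD vectToSuperVect) Q).hom f) :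
    (cocontMod (𝟭 (ModuleCat.{0} ℝ)) Q).hom
      (fixMap (SemiProd.commutation vectToSuperVect) f) := by
  have := IsPres.hasColimits (hQ _ h.1)
  have := IsPres.hasColimits (hQ _ h'.1)
  exact fixMap_isCocontLinear (isSuperMod_of_mem h) (isSuperMod_of_mem h') f hf

include hQ hfix in
/-- Taking fixed points is an equivalence of bicategories, and base change is its inverse, if every
module is the category of fixed points of some module. -/
theorem isGalois_of_exists (hbase : ∀ V : MOD (ModuleCat.{0} ℝ) Q,
      ∃ (W : EquivariantMOD vectToSuperVect Q)
        (ι : V.of ⟶ fixObj (SemiProd.commutation vectToSuperVect) W.of),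
        IsCocontLinear ι.functor ∧ ι.functor.IsEquivalence) :
    IsGalois vectToSuperVect Q := by
  refine ⟨fixObj_mem hQ hfix, fixMap_mem hQ, ?_⟩
  intro Φ
  have hΦ (W W' : EquivariantMOD vectToSuperVect Q) : (Φ.mapFunctor W W').IsEquivalence := by
    have hW := isSuperMod_of_mem W.mem
    have hW' := isSuperMod_of_mem W'.mem
    have h₁ := hQ _ W.mem.1
    have h₂ := hQ _ W'.mem.1
    have := h₁.hasColimits
    have := h₁.hasBinaryBiproducts
    have := h₁.isIdempotentComplete
    have := h₂.hasColimits
    have := h₂.hasBinaryBiproducts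
    have := h₂.isIdempotentComplete
    have : (Φ.mapFunctor W W').Faithful := ⟨fun {f f' a b} h => by
      exact SubBicategory.hom₂_ext (fixMap₂_injective hW f.mem
        (congrArg SubBicategory.Hom₂.of h))⟩
    have : (Φ.mapFunctor W W').Full := ⟨fun {f f'} b => by
      obtain ⟨a, ha⟩ := fixMap₂_surjective hW hW' f.mem f'.mem b.of
      exact ⟨SubBicategory.mk₂ a, SubBicategory.hom₂_ext ha⟩⟩
    have : (Φ.mapFunctor W W').EssSurj := ⟨fun h => by
      obtain ⟨F, hF, ⟨e⟩⟩ := exists_fixMap hW hW' h.of h.mem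
      let F' : W ⟶ W' := SubBicategory.Hom.mk F hF
      exact ⟨F', ⟨SubBicategory.isoMk (f := Φ.map F') (g := h) e⟩⟩⟩
    exact { }
  obtain ⟨F, unit, h⟩ := Inverse.exists_inverse Φ hΦ fun V => by
    obtain ⟨W, ι, hι, hι'⟩ := hbase V
    let f : V ⟶ Φ.obj W := SubBicategory.Hom.mk ι hι
    have : f.of.functor.IsEquivalence := hι'
    exact ⟨W, f, isEquiv_of_isEquivalence f⟩
  refine ⟨F, unit, fun V => ?_, h⟩
  have hV : IsVectMod V.of := V.mem.2.2
  let f : V ⟶ Φ.obj (F.obj V) := unit.hom.app V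
  have hf : IsEquiv f := (isEquivalence_of_equivalence unit).app V
  have hι := isEquivalence_functor_of_isEquiv hf
  have h₁ := hQ _ (F.obj V).mem.1
  have := h₁.hasColimits
  have := h₁.hasBinaryBiproducts
  have := h₁.isIdempotentComplete
  exact @isRelTensor_canonicalBal V.of hV (F.obj V).of (isSuperMod_of_mem (F.obj V).mem) _ _ _ f.of
    f.mem hι

end Galois

section Division

open MonoidalCategory MonoidalRightAction Functor.LaxMonoidal Functor.OplaxMonoidal

variable {C : Type 1} [Category.{0} C] [MonoidalCategory C]
  {D : Type 1} [Category.{0} D] [MonoidalCategory D]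

namespace SemiProd

lemma divAssoc_natural_aux {F F' : D ⥤ D} [F.Monoidal] [F'.Monoidal] (γ : F ⟶ F')
    [NatTrans.IsMonoidal γ] {x x' y y' d₁ d₁' d₂ d₂' z : D} (p : y ⟶ y') (q : d₂ ⟶ d₂')
    (f : x ⟶ x') (f₁ : d₁ ⟶ d₁') (c : F.obj y ⟶ x ⊗ d₁) (c' : F'.obj y' ⟶ x' ⊗ d₁')
    (h : γ.app y ≫ F'.map p ≫ c' = c ≫ (f ⊗ₘ f₁)) (k : z ⟶ y ⊗ d₂) :
    γ.app z ≫ F'.map (k ≫ (p ⊗ₘ q)) ≫ δ F' y' d₂' ≫ c' ▷ F'.obj d₂' ≫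
        (α_ x' d₁' (F'.obj d₂')).hom =
      F.map k ≫ δ F y d₂ ≫ c ▷ F.obj d₂ ≫ (α_ x d₁ (F.obj d₂)).hom ≫
        (f ⊗ₘ (f₁ ⊗ₘ (γ.app d₂ ≫ F'.map q))) := by
  have h₁ : c ▷ F.obj d₂ ≫ ((f ⊗ₘ f₁) ⊗ₘ (γ.app d₂ ≫ F'.map q)) =
      (γ.app y ⊗ₘ γ.app d₂) ≫ (F'.map p ⊗ₘ F'.map q) ≫ c' ▷ F'.obj d₂' := by
    rw [← tensorHom_id, ← tensorHom_id, tensorHom_comp_tensorHom, tensorHom_comp_tensorHom,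
      tensorHom_comp_tensorHom, h, Category.id_comp, Category.comp_id]
  rw [← associator_naturality, reassoc_of% h₁, ← reassoc_of% IsMonoidal_δ γ y d₂,
    δ_natural_assoc, F'.map_comp, Category.assoc, γ.naturality_assoc]

lemma divAssoc_pentagon_aux (F G : D ⥤ D) [F.Monoidal] [G.Monoidal] {x y z w d₁ d₂ : D} (d₃ : D)
    (c₁ : F.obj x ⟶ w ⊗ d₁) (c₂ : G.obj y ⟶ x ⊗ d₂) (a : z ⟶ y)
    (c₁₂ : F.obj (G.obj z) ⟶ w ⊗ d₁ ⊗ F.obj d₂)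
    (h : F.map (G.map a) ≫ F.map c₂ ≫ δ F x d₂ ≫ c₁ ▷ F.obj d₂ ≫ (α_ w d₁ (F.obj d₂)).hom = c₁₂) :
    F.map (G.map (a ▷ d₃)) ≫ F.map (δ G y d₃) ≫ F.map (c₂ ▷ G.obj d₃) ≫
        F.map (α_ x d₂ (G.obj d₃)).hom ≫ δ F x (d₂ ⊗ G.obj d₃) ≫ c₁ ▷ F.obj (d₂ ⊗ G.obj d₃) ≫
        (α_ w d₁ (F.obj (d₂ ⊗ G.obj d₃))).hom =
      F.map (δ G z d₃) ≫ δ F (G.obj z) (G.obj d₃) ≫ c₁₂ ▷ F.obj (G.obj d₃) ≫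
        (α_ w (d₁ ⊗ F.obj d₂) (F.obj (G.obj d₃))).hom ≫
        w ◁ ((α_ d₁ (F.obj d₂) (F.obj (G.obj d₃))).hom ≫ d₁ ◁ μ F d₂ (G.obj d₃)) := by
  have h₁ : F.map (α_ x d₂ (G.obj d₃)).hom ≫ δ F x (d₂ ⊗ G.obj d₃) =
      δ F (x ⊗ d₂) (G.obj d₃) ≫ δ F x d₂ ▷ F.obj (G.obj d₃) ≫
        (α_ (F.obj x) (F.obj d₂) (F.obj (G.obj d₃))).hom ≫ F.obj x ◁ μ F d₂ (G.obj d₃) := by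
    have h := Functor.OplaxMonoidal.associativity F x d₂ (G.obj d₃)
    rw [reassoc_of% h, Functor.Monoidal.whiskerLeft_δ_μ, Category.comp_id]
  have h₂ : F.map (G.map (a ▷ d₃)) ≫ F.map (δ G y d₃) =
      F.map (δ G z d₃) ≫ F.map (G.map a ▷ G.obj d₃) := by
    rw [← F.map_comp, ← F.map_comp, δ_natural_left]
  rw [reassoc_of% h₂, reassoc_of% h₁, ← δ_natural_left_assoc, ← δ_natural_left_assoc, ← h]
  congr 2
  simp only [comp_whiskerRight, Category.assoc, MonoidalCategory.whiskerLeft_comp]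
  rw [pentagon_assoc, whisker_exchange_assoc]
  simp

variable [BraidedCategory D] [Preadditive D] [Linear ℝ D] {i : C ⥤ D} [i.Monoidal]

/-- The object `g⁻¹(x ⊗ d)`, for `e = (d, g)`. -/
def div (x : D) (e : SemiProd i) : D := e.snd.functor.inv.obj (x ⊗ e.fst)

/-- The isomorphism `g(g⁻¹(x ⊗ d)) ≅ x ⊗ d`. -/
def divIso (x : D) (e : SemiProd i) : e.snd.functor.obj (div x e) ≅ x ⊗ e.fst :=
  e.snd.functor.asEquivalence.counitIso.app _

lemma div_ext {x y : D} {e : SemiProd i} {a b : y ⟶ div x e}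
    (h : e.snd.functor.map a ≫ (divIso x e).hom = e.snd.functor.map b ≫ (divIso x e).hom) :
    a = b := e.snd.functor.map_injective ((cancel_mono _).1 h)

/-- The functoriality of `g⁻¹(x ⊗ d)`. -/
def divHom {x x' : D} {e e' : SemiProd i} (f : x ⟶ x') (φ : e ⟶ e') : div x e ⟶ div x' e' :=
  e'.snd.functor.preimage (inv (φ.snd.trans.app (div x e)) ≫ (divIso x e).hom ≫
    (f ⊗ₘ φ.fst) ≫ (divIso x' e').inv)

lemma divHom_spec {x x' : D} {e e' : SemiProd i} (f : x ⟶ x') (φ : e ⟶ e') :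
    φ.snd.trans.app (div x e) ≫ e'.snd.functor.map (divHom f φ) ≫ (divIso x' e').hom =
      (divIso x e).hom ≫ (f ⊗ₘ φ.fst) := by
  simp [divHom]

lemma divHom_id (x : D) (e : SemiProd i) : divHom (𝟙 x) (𝟙 e) = 𝟙 _ := by
  refine div_ext ?_
  have h := divHom_spec (𝟙 x) (𝟙 e)
  simpa using h

lemma divHom_comp {x x' x'' : D} {e e' e'' : SemiProd i} (f : x ⟶ x') (f' : x' ⟶ x'')
    (φ : e ⟶ e') (φ' : e' ⟶ e'') : divHom (f ≫ f') (φ ≫ φ') = divHom f φ ≫ divHom f' φ' := by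
  refine div_ext ?_
  rw [← cancel_epi ((φ ≫ φ').snd.trans.app (div x e)), divHom_spec]
  have h : (φ ≫ φ').snd.trans.app (div x e) =
    φ.snd.trans.app (div x e) ≫ φ'.snd.trans.app (div x e) := rfl
  rw [h, Functor.map_comp, Category.assoc, Category.assoc, ← φ'.snd.trans.naturality_assoc,
    divHom_spec, reassoc_of% divHom_spec f φ, tensorHom_comp_tensorHom]
  rfl

/-- The isomorphism `(g g')⁻¹(x ⊗ d ⊗ g d') ≅ g'⁻¹(g⁻¹(x ⊗ d) ⊗ d')`. -/
def divAssoc (x : D) (e e' : SemiProd i) : div x (e ⊗ e') ≅ div (div x e) e' :=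
  (e'.snd.functor ⋙ e.snd.functor).preimageIso
    (divIso x (e ⊗ e') ≪≫ (α_ x e.fst (e.snd.functor.obj e'.fst)).symm ≪≫
      whiskerRightIso (divIso x e).symm (e.snd.functor.obj e'.fst) ≪≫
      Functor.Monoidal.μIso e.snd.functor (div x e) e'.fst ≪≫
      e.snd.functor.mapIso (divIso (div x e) e').symm)

lemma divAssoc_spec (x : D) (e e' : SemiProd i) :
    e.snd.functor.map (e'.snd.functor.map (divAssoc x e e').hom) ≫
      e.snd.functor.map (divIso (div x e) e').hom ≫ δ e.snd.functor (div x e) e'.fst ≫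
      (divIso x e).hom ▷ e.snd.functor.obj e'.fst ≫
      (α_ x e.fst (e.snd.functor.obj e'.fst)).hom = (divIso x (e ⊗ e')).hom := by
  have h : e.snd.functor.map (e'.snd.functor.map (divAssoc x e e').hom) =
      (divIso x (e ⊗ e')).hom ≫ (α_ x e.fst (e.snd.functor.obj e'.fst)).inv ≫
      (divIso x e).inv ▷ (e.snd.functor.obj e'.fst) ≫
      μ e.snd.functor (div x e) e'.fst ≫ e.snd.functor.map (divIso (div x e) e').inv :=
    (e'.snd.functor ⋙ e.snd.functor).map_preimage _
  rw [h]
  simp [← Functor.map_comp_assoc, ← comp_whiskerRight_assoc]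

lemma divAssoc_ext {x y : D} {e e' : SemiProd i} {a b : y ⟶ div (div x e) e'}
    (h : e.snd.functor.map (e'.snd.functor.map a) ≫
      e.snd.functor.map (divIso (div x e) e').hom ≫ δ e.snd.functor (div x e) e'.fst ≫
      (divIso x e).hom ▷ e.snd.functor.obj e'.fst ≫
      (α_ x e.fst (e.snd.functor.obj e'.fst)).hom =
      e.snd.functor.map (e'.snd.functor.map b) ≫
      e.snd.functor.map (divIso (div x e) e').hom ≫ δ e.snd.functor (div x e) e'.fst ≫
      (divIso x e).hom ▷ e.snd.functor.obj e'.fst ≫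
      (α_ x e.fst (e.snd.functor.obj e'.fst)).hom) : a = b :=
  e'.snd.functor.map_injective (e.snd.functor.map_injective ((cancel_mono _).1 h))

lemma divAssoc_natural {x x' : D} {e e' k k' : SemiProd i} (f : x ⟶ x') (φ : e ⟶ e')
    (ψ : k ⟶ k') : divHom f (φ ⊗ₘ ψ) ≫ (divAssoc x' e' k').hom =
      (divAssoc x e k).hom ≫ divHom (divHom f φ) ψ := by
  refine divAssoc_ext ?_
  have h : (φ ⊗ₘ ψ).snd.trans.app (div x (e ⊗ k)) =
    φ.snd.trans.app (k.snd.functor.obj (div x (e ⊗ k))) ≫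
      e'.snd.functor.map (ψ.snd.trans.app (div x (e ⊗ k))) := rfl
  have hi : IsIso ((φ ⊗ₘ ψ).snd.trans.app (div x (e ⊗ k))) := inferInstance
  rw [h] at hi
  rw [← cancel_epi (φ.snd.trans.app (k.snd.functor.obj (div x (e ⊗ k))) ≫
      e'.snd.functor.map (ψ.snd.trans.app (div x (e ⊗ k))))]
  trans (divIso x (e ⊗ k)).hom ≫
    (f ⊗ₘ (φ.fst ⊗ₘ (φ.snd.trans.app k.fst ≫ e'.snd.functor.map ψ.fst)))
  · simp only [Functor.map_comp, Category.assoc]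
    rw [divAssoc_spec]
    exact (Category.assoc _ _ _).symm.trans (divHom_spec f (φ ⊗ₘ ψ))
  · rw [← divAssoc_spec]
    simp only [Category.assoc]
    rw [← divAssoc_natural_aux φ.snd.trans (divHom f φ) ψ.fst f φ.fst (divIso x e).hom
      (divIso x' e').hom (divHom_spec f φ), ← divHom_spec]
    simp only [Functor.map_comp, Category.assoc, NatTrans.naturality_assoc]
    rw [← Functor.map_comp_assoc, ← Functor.map_comp_assoc (e'.snd.functor) (ψ.snd.trans.app _),
      ψ.snd.trans.naturality]

/-- The isomorphism `1⁻¹(x ⊗ 1) ≅ x`. -/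
def divUnit (x : D) : div x (𝟙_ (SemiProd i)) ≅ x := divIso x (𝟙_ (SemiProd i)) ≪≫ ρ_ x

lemma divUnit_natural {x x' : D} (f : x ⟶ x') : (divUnit (i := i) x).hom ≫ f =
    divHom f (𝟙 (𝟙_ (SemiProd i))) ≫ (divUnit x').hom := by
  have h : 𝟙 _ ≫ divHom f (𝟙 (𝟙_ (SemiProd i))) ≫ (divIso x' (𝟙_ (SemiProd i))).hom =
    (divIso x (𝟙_ (SemiProd i))).hom ≫ (f ⊗ₘ 𝟙 (𝟙_ D)) := divHom_spec f (𝟙 (𝟙_ (SemiProd i)))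
  rw [Category.id_comp] at h
  change ((divIso x (𝟙_ (SemiProd i))).hom ≫ (ρ_ x).hom) ≫ f = divHom f (𝟙 (𝟙_ (SemiProd i))) ≫
    (divIso x' (𝟙_ (SemiProd i))).hom ≫ (ρ_ x').hom
  have h' : (ρ_ x).hom ≫ f = (f ⊗ₘ 𝟙 (𝟙_ D)) ≫ (ρ_ x').hom := by simp
  rw [reassoc_of% h, Category.assoc, h']

lemma divHom_assoc_spec (e₁ e₂ e₃ : SemiProd i) (x : D) :
    e₁.snd.functor.map (e₂.snd.functor.map (e₃.snd.functor.map
        (divHom (𝟙 x) (α_ e₁ e₂ e₃).hom))) ≫ (divIso x (e₁ ⊗ e₂ ⊗ e₃)).hom =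
      (divIso x ((e₁ ⊗ e₂) ⊗ e₃)).hom ≫ x ◁ ((α_ e₁.fst (e₁.snd.functor.obj e₂.fst)
        (e₁.snd.functor.obj (e₂.snd.functor.obj e₃.fst))).hom ≫
        e₁.fst ◁ μ e₁.snd.functor e₂.fst (e₂.snd.functor.obj e₃.fst)) := by
  have h := divHom_spec (𝟙 x) (α_ e₁ e₂ e₃).hom
  rw [id_tensorHom] at h
  exact (Category.id_comp _).symm.trans h

lemma divHom_id_spec {x x' : D} (f : x ⟶ x') (e : SemiProd i) :
    e.snd.functor.map (divHom f (𝟙 e)) ≫ (divIso x' e).hom = (divIso x e).hom ≫ f ▷ e.fst := by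
  have h := divHom_spec f (𝟙 e)
  rw [id_fst, tensorHom_id] at h
  exact (Category.id_comp _).symm.trans h

lemma divAssoc_pentagon (e₁ e₂ e₃ : SemiProd i) (x : D) :
    divHom (𝟙 x) (α_ e₁ e₂ e₃).hom ≫ (divAssoc x e₁ (e₂ ⊗ e₃)).hom ≫
      (divAssoc (div x e₁) e₂ e₃).hom =
      (divAssoc x (e₁ ⊗ e₂) e₃).hom ≫ divHom (divAssoc x e₁ e₂).hom (𝟙 e₃) := by
  have h₂ := divAssoc_spec (div x e₁) e₂ e₃
  have h₁ : e₁.snd.functor.map (e₂.snd.functor.map (e₃.snd.functor.map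
      (divAssoc x e₁ (e₂ ⊗ e₃)).hom)) ≫ e₁.snd.functor.map (divIso (div x e₁) (e₂ ⊗ e₃)).hom ≫
      δ e₁.snd.functor (div x e₁) (e₂.fst ⊗ e₂.snd.functor.obj e₃.fst) ≫
      (divIso x e₁).hom ▷ e₁.snd.functor.obj (e₂.fst ⊗ e₂.snd.functor.obj e₃.fst) ≫
      (α_ x e₁.fst (e₁.snd.functor.obj (e₂.fst ⊗ e₂.snd.functor.obj e₃.fst))).hom =
      (divIso x (e₁ ⊗ e₂ ⊗ e₃)).hom := divAssoc_spec x e₁ (e₂ ⊗ e₃)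
  have h₃ : e₁.snd.functor.map (e₂.snd.functor.map (e₃.snd.functor.map
      (divAssoc x (e₁ ⊗ e₂) e₃).hom)) ≫
      e₁.snd.functor.map (e₂.snd.functor.map (divIso (div x (e₁ ⊗ e₂)) e₃).hom) ≫
      (e₁.snd.functor.map (δ e₂.snd.functor (div x (e₁ ⊗ e₂)) e₃.fst) ≫
        δ e₁.snd.functor (e₂.snd.functor.obj (div x (e₁ ⊗ e₂))) (e₂.snd.functor.obj e₃.fst)) ≫
      (divIso x (e₁ ⊗ e₂)).hom ▷ e₁.snd.functor.obj (e₂.snd.functor.obj e₃.fst) ≫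
      (α_ x (e₁.fst ⊗ e₁.snd.functor.obj e₂.fst)
        (e₁.snd.functor.obj (e₂.snd.functor.obj e₃.fst))).hom =
      (divIso x ((e₁ ⊗ e₂) ⊗ e₃)).hom := divAssoc_spec x (e₁ ⊗ e₂) e₃
  have h₄ := divAssoc_pentagon_aux e₁.snd.functor e₂.snd.functor e₃.fst (divIso x e₁).hom
    (divIso (div x e₁) e₂).hom (divAssoc x e₁ e₂).hom (divIso x (e₁ ⊗ e₂)).hom
    (divAssoc_spec x e₁ e₂)
  have h₅ := divHom_id_spec (divAssoc x e₁ e₂).hom e₃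
  refine e₃.snd.functor.map_injective (e₂.snd.functor.map_injective
    (e₁.snd.functor.map_injective ?_))
  rw [← cancel_mono (e₁.snd.functor.map (e₂.snd.functor.map (divIso (div (div x e₁) e₂) e₃).hom ≫
      δ e₂.snd.functor (div (div x e₁) e₂) e₃.fst ≫
      (divIso (div x e₁) e₂).hom ▷ e₂.snd.functor.obj e₃.fst ≫
      (α_ (div x e₁) e₂.fst (e₂.snd.functor.obj e₃.fst)).hom) ≫
      δ e₁.snd.functor (div x e₁) (e₂.fst ⊗ e₂.snd.functor.obj e₃.fst) ≫
      (divIso x e₁).hom ▷ e₁.snd.functor.obj (e₂.fst ⊗ e₂.snd.functor.obj e₃.fst) ≫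
      (α_ x e₁.fst (e₁.snd.functor.obj (e₂.fst ⊗ e₂.snd.functor.obj e₃.fst))).hom)]
  trans (divIso x ((e₁ ⊗ e₂) ⊗ e₃)).hom ≫ x ◁ ((α_ e₁.fst (e₁.snd.functor.obj e₂.fst)
        (e₁.snd.functor.obj (e₂.snd.functor.obj e₃.fst))).hom ≫
        e₁.fst ◁ μ e₁.snd.functor e₂.fst (e₂.snd.functor.obj e₃.fst))
  · rw [← divHom_assoc_spec, ← h₁, ← h₂]
    simp only [Functor.map_comp, Category.assoc]
  · rw [← h₃]
    simp only [Functor.map_comp, Category.assoc] at h₄ ⊢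
    rw [← Functor.map_comp_assoc _ (e₂.snd.functor.map (e₃.snd.functor.map (divHom _ _))),
      ← Functor.map_comp _ (e₃.snd.functor.map (divHom _ _)), h₅]
    simp only [Functor.map_comp, Category.assoc, h₄]

lemma divHom_rightUnitor (e : SemiProd i) (x : D) : divHom (𝟙 x) (ρ_ e).hom =
    (divAssoc x e (𝟙_ _)).hom ≫ (divUnit (div x e)).hom := by
  have h₁ := divHom_spec (𝟙 x) (ρ_ e).hom
  rw [id_tensorHom] at h₁
  replace h₁ : e.snd.functor.map (divHom (𝟙 x) (ρ_ e).hom) ≫ (divIso x e).hom =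
    (divIso x (e ⊗ 𝟙_ _)).hom ≫ x ◁ (e.fst ◁ η e.snd.functor ≫ (ρ_ e.fst).hom) :=
    (Category.id_comp _).symm.trans h₁
  have h₂ : e.snd.functor.map (divAssoc x e (𝟙_ _)).hom ≫
      e.snd.functor.map (divIso (div x e) (𝟙_ _)).hom ≫ δ e.snd.functor (div x e) (𝟙_ D) ≫
      (divIso x e).hom ▷ e.snd.functor.obj (𝟙_ D) ≫
      (α_ x e.fst (e.snd.functor.obj (𝟙_ D))).hom = (divIso x (e ⊗ 𝟙_ _)).hom :=
    divAssoc_spec x e (𝟙_ _)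
  have h₃ : e.snd.functor.map (ρ_ (div x e)).hom =
      δ e.snd.functor (div x e) (𝟙_ D) ≫ _ ◁ η e.snd.functor ≫ (ρ_ _).hom := by
    rw [Functor.OplaxMonoidal.right_unitality_hom]
  have h₄ : δ e.snd.functor (div x e) (𝟙_ D) ≫ (divIso x e).hom ▷ e.snd.functor.obj (𝟙_ D) ≫
      (α_ x e.fst (e.snd.functor.obj (𝟙_ D))).hom ≫
      x ◁ (e.fst ◁ η e.snd.functor ≫ (ρ_ e.fst).hom) =
      e.snd.functor.map (ρ_ (div x e)).hom ≫ (divIso x e).hom := by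
    rw [h₃, MonoidalCategory.whiskerLeft_comp, ← associator_naturality_right_assoc,
      whiskerLeft_rightUnitor, Iso.hom_inv_id_assoc, ← whisker_exchange_assoc,
      rightUnitor_naturality]
    simp only [Category.assoc]
  refine div_ext ?_
  rw [h₁, ← h₂]
  simp only [Category.assoc]
  refine (congrArg (_ ≫ _ ≫ ·) h₄).trans ?_
  refine (congrArg (_ ≫ ·) (Functor.map_comp_assoc _ _ _ _).symm).trans
    (Functor.map_comp_assoc _ _ _ _).symm

lemma divHom_leftUnitor (e : SemiProd i) (x : D) : divHom (𝟙 x) (λ_ e).hom =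
    (divAssoc x (𝟙_ _) e).hom ≫ divHom (divUnit x).hom (𝟙 e) := by
  have h₁ := divHom_spec (𝟙 x) (λ_ e).hom
  rw [id_tensorHom] at h₁
  replace h₁ : e.snd.functor.map (divHom (𝟙 x) (λ_ e).hom) ≫ (divIso x e).hom =
    (divIso x (𝟙_ _ ⊗ e)).hom ≫ x ◁ (λ_ e.fst).hom := (Category.id_comp _).symm.trans h₁
  have h₂ : e.snd.functor.map (divAssoc x (𝟙_ _) e).hom ≫ (divIso (div x (𝟙_ _)) e).hom ≫
      𝟙 _ ≫ (divIso x (𝟙_ (SemiProd i))).hom ▷ e.fst ≫ (α_ x (𝟙_ D) e.fst).hom =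
      (divIso x (𝟙_ _ ⊗ e)).hom := divAssoc_spec x (𝟙_ _) e
  have h₃ : (divUnit (i := i) x).hom ▷ e.fst = (divIso x (𝟙_ (SemiProd i))).hom ▷ e.fst ≫
    (ρ_ x).hom ▷ e.fst := comp_whiskerRight _ _ _
  have h₄ : (divIso x (𝟙_ (SemiProd i))).hom ▷ e.fst ≫ (α_ x (𝟙_ D) e.fst).hom ≫
      x ◁ (λ_ e.fst).hom = (divUnit (i := i) x).hom ▷ e.fst := by rw [h₃, ← triangle]
  refine div_ext ?_
  have h₅ := (divHom_id_spec (divUnit (i := i) x).hom e).symm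
  rw [← h₄] at h₅
  refine Eq.trans ?_ ((congrArg (_ ≫ ·) h₅).trans (Functor.map_comp_assoc _ _ _ _).symm)
  rw [h₁, ← h₂]
  simp only [Category.assoc, Category.id_comp]

/-- The right action of `D ⋊ Aut` on `D` by `(x, (d, g)) ↦ g⁻¹(x ⊗ d)`. -/
instance divAction : MonoidalRightAction (SemiProd i) D where
  actionObj x e := div x e
  actionHomLeft f e := divHom f (𝟙 e)
  actionHomRight x _ _ φ := divHom (𝟙 x) φ
  actionHom f φ := divHom f φ
  actionAssocIso x e e' := divAssoc x e e'
  actionUnitIso x := divUnit x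
  actionHom_def f φ := by rw [← divHom_comp, Category.comp_id, Category.id_comp]
  actionHomRight_id e x := divHom_id x e
  id_actionHomLeft e x := divHom_id x e
  actionHom_comp f f' φ φ' := divHom_comp f f' φ φ'
  actionAssocIso_hom_naturality f φ ψ := divAssoc_natural f φ ψ
  actionUnitIso_hom_naturality f := divUnit_natural f
  actionHomRight_whiskerRight φ e x := by
    rw [← Category.assoc, Iso.eq_comp_inv, ← divAssoc_natural, tensorHom_id]
  whiskerRight_actionHomLeft e _ _ φ x := by
    rw [← Category.assoc, Iso.eq_comp_inv, ← divHom_id, ← divAssoc_natural, id_tensorHom]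
  actionHom_associator e₁ e₂ e₃ x := divAssoc_pentagon e₁ e₂ e₃ x
  actionHom_leftUnitor e x := divHom_leftUnitor e x
  actionHom_rightUnitor e x := divHom_rightUnitor e x

end SemiProd

end Division

section Transport

open MonoidalCategory MonoidalLeftAction MonoidalRightAction

variable {E : Type u} [Category.{v} E] [MonoidalCategory E]

/-- A right action on `D` induces a left action on the functors `D ⥤ V`, by precomposition. -/
@[reducible]
def precompAction (D : Type u₁) [Category.{v₁} D] [MonoidalRightAction E D] (V : Type u₂)
    [Category.{v₂} V] : MonoidalLeftAction E (D ⥤ V) where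
  actionObj e F :=
    { obj := fun x => F.obj (x ⊙ᵣ e)
      map := fun f => F.map (f ⊵ᵣ e)
      map_id := fun x => by simp
      map_comp := fun f f' => by simp }
  actionHomLeft {e e'} φ F :=
    { app := fun x => F.map (x ⊴ᵣ φ)
      naturality := fun x x' f => by
        dsimp only
        rw [← F.map_comp, ← F.map_comp, MonoidalRightAction.action_exchange] }
  actionHomRight e {F F'} α :=
    { app := fun x => α.app (x ⊙ᵣ e)
      naturality := fun x x' f => α.naturality _ }
  actionAssocIso e e' F := NatIso.ofComponents (fun x => F.mapIso (αᵣ x e e')) fun f => by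
    dsimp only [Functor.mapIso_hom]
    rw [← F.map_comp, ← F.map_comp]
    simp
  actionUnitIso F := NatIso.ofComponents (fun x => F.mapIso (ρᵣ x)) fun f => by
    dsimp only [Functor.mapIso_hom]
    rw [← F.map_comp, ← F.map_comp, MonoidalRightAction.actionUnitIso_hom_naturality]
  actionHom_def _ _ := rfl
  actionHomRight_id e F := by ext; simp
  id_actionHomLeft e F := by ext; simp
  actionHom_comp f f' α α' := by ext x; simp
  actionAssocIso_hom_naturality φ ψ α := by
    ext x
    simp [← Functor.map_comp, MonoidalCategory.tensorHom_def]
  actionUnitIso_hom_naturality α := by ext x; simp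
  whiskerLeft_actionHomLeft e _ _ φ F := by
    ext x
    simp [← Functor.map_comp]
  whiskerRight_actionHomLeft φ e F := by
    ext x
    simp [← Functor.map_comp]
  associator_actionHom e e' e'' F := by
    ext x
    simp [← Functor.map_comp]
  leftUnitor_actionHom e F := by
    ext x
    simp [← Functor.map_comp]
  rightUnitor_actionHom e F := by
    ext x
    simp [← Functor.map_comp]

variable {X : Type u₁} [Category.{v₁} X] [MonoidalLeftAction E X] {Y : Type u₂} [Category.{v₂} Y]
  (inc : Y ⥤ X) [inc.Full] [inc.Faithful] (obj : E → Y → Y)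
  (iso : ∀ e y, inc.obj (obj e y) ≅ e ⊙ₗ inc.obj y)

/-- The restriction of an action to a full subcategory that is stable under it. -/
@[reducible]
def inducedAction : MonoidalLeftAction E Y where
  actionObj := obj
  actionHomLeft {e e'} f y := inc.preimage ((iso e y).hom ≫ f ⊵ₗ inc.obj y ≫ (iso e' y).inv)
  actionHomRight e {y y'} f := inc.preimage ((iso e y).hom ≫ e ⊴ₗ inc.map f ≫ (iso e y').inv)
  actionAssocIso e e' y := inc.preimageIso (iso (e ⊗ e') y ≪≫ αₗ e e' (inc.obj y) ≪≫
    rightIso e (iso e' y).symm ≪≫ (iso e (obj e' y)).symm)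
  actionUnitIso y := inc.preimageIso (iso (𝟙_ E) y ≪≫ λₗ (inc.obj y))
  actionHom_def _ _ := rfl
  actionHomRight_id e y := inc.map_injective (by simp)
  id_actionHomLeft e y := inc.map_injective (by simp)
  actionHom_comp f f' g g' := inc.map_injective (by simp [MonoidalLeftAction.action_exchange_assoc])
  actionAssocIso_hom_naturality f g h := inc.map_injective (by
    simp [MonoidalLeftAction.action_exchange_assoc, MonoidalCategory.tensorHom_def])
  actionUnitIso_hom_naturality f := inc.map_injective (by simp)
  whiskerLeft_actionHomLeft e _ _ φ y := inc.map_injective (by simp)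
  whiskerRight_actionHomLeft φ e y := inc.map_injective (by
    simp [MonoidalLeftAction.action_exchange_assoc])
  associator_actionHom e e' e'' y := inc.map_injective (by simp)
  leftUnitor_actionHom e y := inc.map_injective (by simp)
  rightUnitor_actionHom e y := inc.map_injective (by simp)

end Transport

section SuperFun

open MonoidalCategory SuperVect

/-- The cocontinuous linear functors on super vector spaces. -/
structure SuperFun (V : Type 1) [Category.{0} V] [Preadditive V] [Linear ℝ V] where
  functor : SuperVect ⥤ V
  property : IsCocontLinear functor

namespace SuperFun

variable {V : Type 1} [Category.{0} V] [Preadditive V] [Linear ℝ V]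

/-- Natural transformations, determined by their components at the two simple objects. -/
def homs (F G : SuperFun V) : Submodule ℝ ((F.functor.obj (𝟙_ SuperVect) ⟶
    G.functor.obj (𝟙_ SuperVect)) × (F.functor.obj oddLine ⟶ G.functor.obj oddLine)) where
  carrier := {f | ∃ α : F.functor ⟶ G.functor, (α.app (𝟙_ SuperVect), α.app oddLine) = f}
  zero_mem' := ⟨0, rfl⟩
  add_mem' := by
    rintro _ _ ⟨α, rfl⟩ ⟨β, rfl⟩
    exact ⟨α + β, rfl⟩
  smul_mem' := by
    rintro r _ ⟨α, rfl⟩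
    exact ⟨r • α, rfl⟩

instance : Category (SuperFun V) where
  Hom F G := homs F G
  id F := ⟨(𝟙 _, 𝟙 _), 𝟙 F.functor, rfl⟩
  comp f g := ⟨(f.1.1 ≫ g.1.1, f.1.2 ≫ g.1.2), by
    obtain ⟨_, α, rfl⟩ := f
    obtain ⟨_, β, rfl⟩ := g
    exact ⟨α ≫ β, rfl⟩⟩
  id_comp f := Subtype.ext (Prod.ext (Category.id_comp _) (Category.id_comp _))
  comp_id f := Subtype.ext (Prod.ext (Category.comp_id _) (Category.comp_id _))
  assoc f g h := Subtype.ext (Prod.ext (Category.assoc _ _ _) (Category.assoc _ _ _))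

instance : Preadditive (SuperFun V) where
  homGroup F G := inferInstanceAs (AddCommGroup (homs F G))
  add_comp _ _ _ _ _ _ := Subtype.ext (Prod.ext (Preadditive.add_comp _ _ _ _ _ _)
    (Preadditive.add_comp _ _ _ _ _ _))
  comp_add _ _ _ _ _ _ := Subtype.ext (Prod.ext (Preadditive.comp_add _ _ _ _ _ _)
    (Preadditive.comp_add _ _ _ _ _ _))

instance : Linear ℝ (SuperFun V) where
  homModule F G := inferInstanceAs (Module ℝ (homs F G))
  smul_comp _ _ _ _ _ _ := Subtype.ext (Prod.ext (Linear.smul_comp _ _ _ _ _ _)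
    (Linear.smul_comp _ _ _ _ _ _))
  comp_smul _ _ _ _ _ _ := Subtype.ext (Prod.ext (Linear.comp_smul _ _ _ _ _ _)
    (Linear.comp_smul _ _ _ _ _ _))

/-- The natural transformation given by a morphism. -/
def trans {F G : SuperFun V} (f : F ⟶ G) : F.functor ⟶ G.functor := f.2.choose

lemma trans_unit {F G : SuperFun V} (f : F ⟶ G) : (trans f).app (𝟙_ SuperVect) = f.1.1 :=
  congrArg Prod.fst f.2.choose_spec

lemma trans_odd {F G : SuperFun V} (f : F ⟶ G) : (trans f).app oddLine = f.1.2 :=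
  congrArg Prod.snd f.2.choose_spec

/-- The morphism given by a natural transformation. -/
def ofTrans {F G : SuperFun V} (α : F.functor ⟶ G.functor) : F ⟶ G :=
  ⟨(α.app (𝟙_ SuperVect), α.app oddLine), α, rfl⟩

lemma trans_ofTrans {F G : SuperFun V} (α : F.functor ⟶ G.functor) : trans (ofTrans α) = α :=
  natTrans_ext F.property (trans_unit _) (trans_odd _)

lemma ofTrans_trans {F G : SuperFun V} (f : F ⟶ G) : ofTrans (trans f) = f :=
  Subtype.ext (Prod.ext (trans_unit f) (trans_odd f))

/-- The underlying functor. -/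
def forget : SuperFun V ⥤ SuperVect ⥤ V where
  obj F := F.functor
  map f := trans f
  map_id F := natTrans_ext F.property (trans_unit _) (trans_odd _)
  map_comp {F _ _} f g := natTrans_ext F.property
    ((trans_unit _).trans (congrArg₂ (· ≫ ·) (trans_unit f).symm (trans_unit g).symm))
    ((trans_odd _).trans (congrArg₂ (· ≫ ·) (trans_odd f).symm (trans_odd g).symm))

instance : (forget (V := V)).Full := ⟨fun α => ⟨ofTrans α, trans_ofTrans α⟩⟩

instance : (forget (V := V)).Faithful := ⟨fun {F G f g} h => by
  rw [← ofTrans_trans f, ← ofTrans_trans g]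
  exact congrArg ofTrans h⟩

/-- Evaluation at a super vector space. -/
def ev (d : SuperVect) : SuperFun V ⥤ V := forget ⋙ (evaluation SuperVect V).obj d

lemma hom_ext {F G : SuperFun V} {f g : F ⟶ G}
    (h₀ : (ev (𝟙_ SuperVect)).map f = (ev (𝟙_ SuperVect)).map g)
    (h₁ : (ev oddLine).map f = (ev oddLine).map g) : f = g :=
  forget.map_injective (natTrans_ext F.property h₀ h₁)

instance : (forget (V := V)).Additive := ⟨fun {F _ f g} =>
  natTrans_ext F.property
    ((trans_unit _).trans (congrArg₂ (· + ·) (trans_unit f).symm (trans_unit g).symm))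
    ((trans_odd _).trans (congrArg₂ (· + ·) (trans_odd f).symm (trans_odd g).symm))⟩

instance : (forget (V := V)).Linear ℝ := ⟨fun {F _} f r =>
  natTrans_ext F.property
    ((trans_unit _).trans (congrArg (r • ·) (trans_unit f).symm))
    ((trans_odd _).trans (congrArg (r • ·) (trans_odd f).symm))⟩

instance (d : SuperVect) : (ev (V := V) d).Additive where
  map_add {_ _ f g} := congrArg (fun α => α.app d) (forget.map_add (f := f) (g := g))

instance (d : SuperVect) : (ev (V := V) d).Linear ℝ where
  map_smul f r := congrArg (fun α => α.app d) (forget.map_smul r f)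

section Colimits

variable [HasColimitsOfSize.{0, 0} V]

/-- A pointwise colimit of cocontinuous linear functors is cocontinuous and linear. -/
lemma isCocontLinear_colimit {J : Type} [Category.{0} J] (K : J ⥤ SuperVect ⥤ V)
    (hK : ∀ j, IsCocontLinear (K.obj j)) : IsCocontLinear (colimit K) := by
  have h₁ (j) := (hK j).additive
  have h₂ (j) := (hK j).linear
  have h₃ (j) := (hK j).cocontinuous
  have e {x y : SuperVect} {a b : (colimit K).obj x ⟶ (colimit K).obj y}
      (h : ∀ j, (colimit.ι K j).app x ≫ a = (colimit.ι K j).app x ≫ b) : a = b :=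
    (isColimitOfPreserves ((evaluation _ _).obj x) (colimit.isColimit K)).hom_ext h
  refine ⟨⟨fun {x y f g} => e fun j => ?_⟩, ⟨fun {x y} f r => e fun j => ?_⟩,
    ⟨fun {J' _} => ?_⟩⟩
  · rw [Preadditive.comp_add, ← NatTrans.naturality, ← NatTrans.naturality, ← NatTrans.naturality,
      (K.obj j).map_add, Preadditive.add_comp]
  · rw [Linear.comp_smul, ← NatTrans.naturality, ← NatTrans.naturality,
      (K.obj j).map_smul, Linear.smul_comp]
  · have : PreservesColimitsOfShape J' K.flip := preservesColimitsOfShape_of_evaluation _ _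
      fun j => inferInstanceAs (PreservesColimitsOfShape J' (K.obj j))
    exact preservesColimitsOfShape_of_natIso (colimitIsoFlipCompColim K).symm

instance : CreatesColimitsOfSize.{0, 0} (forget (V := V)) where
  CreatesColimitsOfShape {_ _} := ⟨fun {K} => createsColimitOfFullyFaithfulOfIso
    ⟨colimit (K ⋙ forget), isCocontLinear_colimit _ fun j => (K.obj j).property⟩ (Iso.refl _)⟩

instance : HasColimitsOfSize.{0, 0} (SuperFun V) :=
  hasColimits_of_hasColimits_createsColimits forget

instance : PreservesColimitsOfSize.{0, 0} (forget (V := V)) := inferInstance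

instance (d : SuperVect) : PreservesColimitsOfSize.{0, 0} (ev (V := V) d) :=
  comp_preservesColimits _ _

lemma isCocontLinear_ev (d : SuperVect) : IsCocontLinear (ev (V := V) d) :=
  ⟨inferInstance, inferInstance, inferInstance⟩

variable {A : Type u₁} [Category.{v₁} A] [Preadditive A] [Linear ℝ A] {T : A ⥤ SuperFun V}

omit [HasColimitsOfSize.{0, 0} V] in
/-- A functor with values in functors is cocontinuous and linear if it is so pointwise. -/
lemma isCocontLinear_of_ev (h : ∀ d, IsCocontLinear (T ⋙ ev d)) : IsCocontLinear T := by
  have h₁ (d) := (h d).additive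
  have h₂ (d) := (h d).linear
  have h₃ (d) := (h d).cocontinuous
  refine ⟨⟨fun {x y f g} => hom_ext ?_ ?_⟩, ⟨fun {x y} f r => hom_ext ?_ ?_⟩,
    ⟨fun {J _} => ?_⟩⟩
  · exact ((T ⋙ ev (𝟙_ SuperVect)).map_add (f := f) (g := g)).trans
      ((ev (𝟙_ SuperVect)).map_add (f := T.map f) (g := T.map g)).symm
  · exact ((T ⋙ ev oddLine).map_add (f := f) (g := g)).trans
      ((ev oddLine).map_add (f := T.map f) (g := T.map g)).symm
  · exact ((T ⋙ ev (𝟙_ SuperVect)).map_smul r f).trans ((ev (𝟙_ SuperVect)).map_smul r (T.map f)).symm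
  · exact ((T ⋙ ev oddLine).map_smul r f).trans ((ev oddLine).map_smul r (T.map f)).symm
  · have : PreservesColimitsOfShape J (T ⋙ forget) := preservesColimitsOfShape_of_evaluation _ _
      fun d => inferInstanceAs (PreservesColimitsOfShape J (T ⋙ ev d))
    exact preservesColimitsOfShape_of_reflects_of_preserves T forget

end Colimits

end SuperFun

end SuperFun

section SuperFunMod

open MonoidalCategory MonoidalLeftAction MonoidalRightAction SuperVect SemiProd SuperAut

/-- The functor `x ↦ g⁻¹(x ⊗ d)`. -/
def divFunctor (e : SuperSemi) : SuperVect ⥤ SuperVect where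
  obj x := x ⊙ᵣ e
  map f := f ⊵ᵣ e
  map_id x := by simp
  map_comp f f' := by simp

lemma isCocontLinear_divFunctor (e : SuperSemi) : IsCocontLinear (divFunctor e) := by
  have h : IsCocontLinear e.snd.functor :=
    ⟨inferInstance, inferInstance, inferInstance⟩
  let i : tensorRight e.fst ⋙ e.snd.functor.inv ≅ divFunctor e :=
    NatIso.ofComponents (F := tensorRight e.fst ⋙ e.snd.functor.inv) (G := divFunctor e)
      (fun x => Iso.refl _) fun {x y} f => by
        refine (Category.comp_id _).trans (Eq.trans ?_ (Category.id_comp _).symm)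
        refine (div_ext (i := vectToSuperVect) (a := divHom f (𝟙 e)) ?_).symm
        refine (divHom_id_spec (i := vectToSuperVect) f e).trans ?_
        exact (e.snd.functor.asEquivalence.counit.naturality (f ▷ e.fst)).symm
  exact ((isCocontLinear_tensorRight e.fst).comp h.inv).of_iso i

/-- The functor `d ↦ x ⊙ (d, 1)`. -/
def divIncl (x : SuperVect) : SuperVect ⥤ SuperVect where
  obj d := x ⊙ᵣ inclL.obj d
  map f := x ⊴ᵣ inclL.map f
  map_id d := by
    rw [CategoryTheory.Functor.map_id]
    exact MonoidalRightAction.actionHomRight_id (inclL.obj d) x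
  map_comp f f' := by
    rw [CategoryTheory.Functor.map_comp]
    exact MonoidalRightAction.actionHomRight_comp _ _ _

/-- The isomorphism `x ⊙ (d, 1) ≅ x ⊗ d`. -/
def divInclIso (x : SuperVect) : divIncl x ≅ tensorLeft x :=
  NatIso.ofComponents (F := divIncl x) (fun d => divIso (i := vectToSuperVect) x (inclL.obj d))
    fun {d d'} f => by
      have h := divHom_spec (i := vectToSuperVect) (𝟙 x) (inclL.map f)
      rw [id_tensorHom] at h
      exact (Category.id_comp _).symm.trans h

namespace SuperFun

section

variable {V : Type 1} [Category.{0} V] [Preadditive V] [Linear ℝ V]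

/-- The action of `e` on functors. -/
def smul (e : SuperSemi) (F : SuperFun V) : SuperFun V :=
  letI := precompAction (E := SuperSemi) SuperVect V
  ⟨e ⊙ₗ F.functor, (isCocontLinear_divFunctor e).comp F.property⟩

instance : MonoidalLeftAction SuperSemi (SuperFun V) :=
  letI := precompAction (E := SuperSemi) SuperVect V
  inducedAction (E := SuperSemi) (forget (V := V)) smul (fun _ _ => Iso.refl _)

lemma forget_actionHomRight (e : SuperSemi) {F G : SuperFun V} (f : F ⟶ G) (x : SuperVect) :
    (forget.map (e ⊴ₗ f)).app x = (forget.map f).app (x ⊙ᵣ e) := by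
  let := precompAction (E := SuperSemi) SuperVect V
  have h : forget.map (e ⊴ₗ f) = 𝟙 _ ≫ e ⊴ₗ forget.map f ≫ 𝟙 _ := forget.map_preimage _
  rw [h]
  exact (Category.id_comp _).trans (Category.comp_id _)

lemma forget_actionHomLeft {e e' : SuperSemi} (φ : e ⟶ e') (F : SuperFun V) (x : SuperVect) :
    (forget.map (φ ⊵ₗ F)).app x = F.functor.map (x ⊴ᵣ φ) := by
  let := precompAction (E := SuperSemi) SuperVect V
  have h : forget.map (φ ⊵ₗ F) = 𝟙 _ ≫ φ ⊵ₗ F.functor ≫ 𝟙 _ := forget.map_preimage _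
  rw [h]
  exact (Category.id_comp _).trans (Category.comp_id _)

lemma forget_actionAssocIso (e e' : SuperSemi) (F : SuperFun V) (x : SuperVect) :
    (forget.map (αₗ e e' F).hom).app x = F.functor.map (αᵣ x e e').hom := by
  let := precompAction (E := SuperSemi) SuperVect V
  have h : forget.map (αₗ e e' F).hom = 𝟙 _ ≫ (αₗ e e' F.functor).hom ≫ e ⊴ₗ 𝟙 _ ≫ 𝟙 _ :=
    forget.map_preimage _
  rw [h]
  refine (Category.id_comp _).trans ?_
  refine (congrArg (F.functor.map (αᵣ x e e').hom ≫ ·) (Category.comp_id (𝟙 _))).trans ?_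
  exact Category.comp_id _

lemma forget_actionUnitIso (F : SuperFun V) (x : SuperVect) :
    (forget.map (λₗ[SuperSemi] F).hom).app x = F.functor.map (ρᵣ[SuperSemi] x).hom := by
  let := precompAction (E := SuperSemi) SuperVect V
  have h : forget.map (λₗ[SuperSemi] F).hom = 𝟙 _ ≫ (λₗ[SuperSemi] F.functor).hom :=
    forget.map_preimage _
  rw [h]
  exact Category.id_comp _

lemma hom_ext' {F G : SuperFun V} {f g : F ⟶ G}
    (h : ∀ x, (forget.map f).app x = (forget.map g).app x) : f = g :=
  forget.map_injective (NatTrans.ext (funext h))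

variable (V) in
/-- The module of functors on super vector spaces. -/
def mod : LinMod SuperSemi where
  carrier := SuperFun V
  action_add e F G f g := hom_ext' fun x => by
    rw [forget_actionHomRight, forget.map_add, forget.map_add, NatTrans.app_add,
      NatTrans.app_add, forget_actionHomRight, forget_actionHomRight]
    rfl
  action_smul e F G r f := hom_ext' fun x => by
    rw [forget_actionHomRight, forget.map_smul, forget.map_smul, NatTrans.app_smul,
      NatTrans.app_smul, forget_actionHomRight]
    rfl

variable (V) in
lemma isSuperMod_mod [HasColimitsOfSize.{0, 0} V] : IsSuperMod (mod V) where
  act e := by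
    refine isCocontLinear_of_ev (V := V) fun d => (isCocontLinear_ev (d ⊙ᵣ e)).of_iso ?_
    exact NatIso.ofComponents (F := ev (d ⊙ᵣ e)) (G := act (mod V) e ⋙ ev d) (fun F => Iso.refl _)
      fun {F G} f => (Category.comp_id _).trans ((forget_actionHomRight e f d).symm.trans
        (Category.id_comp _).symm)
  orbit F := by
    refine isCocontLinear_of_ev (V := V) fun d =>
      (((isCocontLinear_tensorLeft d).of_iso (divInclIso d).symm).comp F.property).of_iso ?_
    exact NatIso.ofComponents (F := divIncl d ⋙ F.functor) (G := orbit inclL (mod V) F ⋙ ev d)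
      (fun F => Iso.refl _)
      fun {e e'} f => (Category.comp_id _).trans ((forget_actionHomLeft (inclL.map f) F d).symm.trans
        (Category.id_comp _).symm)

end

end SuperFun

end SuperFunMod

section RealForm

variable {U : Type u} [Category.{v} U] [Preadditive U]

/-- The object `a` is a real form of `x` with its complex structure `J`. -/
structure IsRealForm {a x : U} (J : x ⟶ x) (i : a ⟶ x) (r : x ⟶ a) : Prop where
  sq : J ≫ J = -𝟙 x
  ret : i ≫ r = 𝟙 a
  zero : i ≫ J ≫ r = 0
  total : r ≫ i - J ≫ r ≫ i ≫ J = 𝟙 x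

namespace IsRealForm

variable {a x y : U} {J : x ⟶ x} {i : a ⟶ x} {r : x ⟶ a} (h : IsRealForm J i r)

include h

lemma hom_ext {J' : y ⟶ y} {f g : x ⟶ y} (hf : J ≫ f = f ≫ J') (hg : J ≫ g = g ≫ J')
    (hfg : i ≫ f = i ≫ g) : f = g := by
  rw [← Category.id_comp f, ← Category.id_comp g, ← h.total]
  simp only [Preadditive.sub_comp, Category.assoc, hf, hg, reassoc_of% hfg, hfg]

lemma hom_ext_right {z : U} {f g : z ⟶ x} (h₀ : f ≫ r = g ≫ r) (h₁ : f ≫ J ≫ r = g ≫ J ≫ r) :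
    f = g := by
  rw [← Category.comp_id f, ← Category.comp_id g, ← h.total]
  simp only [Preadditive.comp_sub, reassoc_of% h₀, reassoc_of% h₁]

lemma exists_lift {J' : y ⟶ y} (hJ' : J' ≫ J' = -𝟙 y) (f : a ⟶ y) :
    ∃ g : x ⟶ y, g = r ≫ f - J ≫ r ≫ f ≫ J' ∧ J ≫ g = g ≫ J' ∧ i ≫ g = f := by
  refine ⟨_, rfl, ?_, ?_⟩
  · simp only [Preadditive.sub_comp, Preadditive.comp_sub, Category.assoc, hJ',
      reassoc_of% h.sq, Preadditive.neg_comp, Preadditive.comp_neg, Category.comp_id]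
    simp only [Category.id_comp]
    abel
  · rw [Preadditive.comp_sub, reassoc_of% h.ret, reassoc_of% h.zero, zero_comp, sub_zero]

lemma of_iso {b : U} (e : b ≅ a) : IsRealForm J (e.hom ≫ i) (r ≫ e.inv) where
  sq := h.sq
  ret := by simp [reassoc_of% h.ret]
  zero := by simp [reassoc_of% h.zero]
  total := by simpa using h.total

lemma map {U' : Type u₁} [Category.{v₁} U'] [Preadditive U'] (F : U ⥤ U') [F.Additive] :
    IsRealForm (F.map J) (F.map i) (F.map r) where
  sq := by rw [← F.map_comp, h.sq, F.map_neg, F.map_id]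
  ret := by rw [← F.map_comp, h.ret, F.map_id]
  zero := by rw [← F.map_comp, ← F.map_comp, h.zero, F.map_zero]
  total := by
    simp only [← F.map_comp, ← F.map_sub, h.total, F.map_id]

lemma conj_eq {c : x ⟶ x} (hc : J ≫ c = -c ≫ J) (hi : i ≫ c = i) :
    c = r ≫ i + J ≫ r ≫ i ≫ J := by
  have h₁ := Category.id_comp c
  rw [← h.total, Preadditive.sub_comp, Category.assoc, hi] at h₁
  simp only [Category.assoc, hc, reassoc_of% hi, Preadditive.comp_neg] at h₁
  rw [← h₁, sub_neg_eq_add]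

lemma ret_incl [Linear ℝ U] {c : x ⟶ x} (hc : J ≫ c = -c ≫ J) (hi : i ≫ c = i) {z : U} {f : z ⟶ x}
    (hf : f ≫ c = f) : f ≫ r ≫ i = f := by
  have h₁ : r ≫ i = (1 / 2 : ℝ) • (𝟙 x + c) := by
    rw [h.conj_eq hc hi, ← h.total]
    module
  rw [h₁, Linear.comp_smul, Preadditive.comp_add, hf, Category.comp_id]
  module

lemma lift_conj {c : x ⟶ x} (hc : J ≫ c = -c ≫ J) (hi : i ≫ c = i) {J' c' : y ⟶ y}
    (hc' : J' ≫ c' = -c' ≫ J') {f : a ⟶ y} (hf : f ≫ c' = f) {g : x ⟶ y}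
    (hg : g = r ≫ f - J ≫ r ≫ f ≫ J') (hJ : J ≫ g = g ≫ J') (hg' : i ≫ g = f) :
    c ≫ g = g ≫ c' := by
  have h₁ : g ≫ c' = r ≫ f + J ≫ r ≫ f ≫ J' := by
    rw [hg]
    simp only [Preadditive.sub_comp, Category.assoc, hc', hf, Preadditive.comp_neg,
      reassoc_of% hf, sub_neg_eq_add]
  rw [h₁, h.conj_eq hc hi, Preadditive.add_comp]
  simp only [Category.assoc, hJ, hg', reassoc_of% hg']

end IsRealForm

lemma exists_isRealForm [Linear ℝ U] [IsIdempotentComplete U] {x : U} {J c : x ⟶ x} (hJ : J ≫ J = -𝟙 x)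
    (hc : J ≫ c = -c ≫ J) (hcc : c ≫ c = 𝟙 x) :
    ∃ (a : U) (i : a ⟶ x) (r : x ⟶ a), IsRealForm J i r ∧ i ≫ c = i := by
  obtain ⟨a, i, r, hir, hri⟩ := IsIdempotentComplete.idempotents_split x
    ((1 / 2 : ℝ) • (𝟙 x + c)) (by
      simp only [Linear.comp_smul, Linear.smul_comp, Preadditive.comp_add, Preadditive.add_comp,
        Category.id_comp, Category.comp_id, hcc]
      module)
  have h₁ : i ≫ c = i := by
    have h₂ : ((1 / 2 : ℝ) • (𝟙 x + c)) ≫ c = (1 / 2 : ℝ) • (𝟙 x + c) := by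
      simp only [Linear.smul_comp, Preadditive.add_comp, Category.id_comp, hcc, add_comm]
    rw [← hri, Category.assoc] at h₂
    rw [← Category.id_comp (i ≫ c), ← hir, Category.assoc, h₂, reassoc_of% hir]
  refine ⟨a, i, r, ⟨hJ, hir, ?_, ?_⟩, h₁⟩
  · have h₂ : c ≫ r = r := by
      have h₂ : c ≫ ((1 / 2 : ℝ) • (𝟙 x + c)) = (1 / 2 : ℝ) • (𝟙 x + c) := by
        simp only [Linear.comp_smul, Preadditive.comp_add, Category.comp_id, hcc, add_comm]
      rw [← hri] at h₂
      rw [← Category.comp_id (c ≫ r), ← hir, Category.assoc, reassoc_of% h₂, hir, Category.comp_id]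
    have h₃ : i ≫ J ≫ r = -(i ≫ J ≫ r) := by
      conv_lhs => rw [← h₂, reassoc_of% hc]
      simp [reassoc_of% h₁]
    have h₄ : i ≫ J ≫ r = (1 / 2 : ℝ) • (i ≫ J ≫ r - -(i ≫ J ≫ r)) := by module
    rw [h₄, ← h₃, sub_self, smul_zero]
  · rw [reassoc_of% hri, hri]
    simp only [Linear.comp_smul, Linear.smul_comp, Preadditive.comp_add, Preadditive.add_comp,
      Category.id_comp, hJ]
    have h₂ : J ≫ c ≫ J = c := by
      rw [reassoc_of% hc]
      simp [hJ]
    rw [h₂]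
    module

end RealForm

section SuperFunFree

open MonoidalCategory MonoidalLeftAction SuperVect

/-- The underlying real vector space of a supervector space. -/
def realSpace : SuperVect ⥤ ModuleCat.{0} ℝ := space ⋙ ModuleCat.restrictScalars (algebraMap ℝ ℂ)

lemma isCocontLinear_realSpace : IsCocontLinear realSpace where
  additive := ⟨rfl⟩
  linear := ⟨fun _ _ => rfl⟩
  cocontinuous := by
    have : PreservesColimitsOfSize.{0, 0} (ModuleCat.restrictScalars.{0} (algebraMap ℝ ℂ)) :=
      (ModuleCat.restrictCoextendScalarsAdj.{0} (algebraMap ℝ ℂ)).leftAdjoint_preservesColimits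
    exact comp_preservesColimits space (ModuleCat.restrictScalars (algebraMap ℝ ℂ))

/-- The real part. -/
def realPartUnit : realSpace.obj (𝟙_ SuperVect) ⟶ 𝟙_ (ModuleCat.{0} ℝ) :=
  ModuleCat.ofHom (X := realSpace.obj (𝟙_ SuperVect)) (Y := ℝ)
    { toFun := fun z : ℂ => z.re
      map_add' := fun _ _ => rfl
      map_smul' := fun r z => Complex.re_ofReal_mul r z }

/-- The real part. -/
def realPartOdd : realSpace.obj oddLine ⟶ 𝟙_ (ModuleCat.{0} ℝ) := realPartUnit

/-- The inclusion of the real line. -/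
def realInclUnit : 𝟙_ (ModuleCat.{0} ℝ) ⟶ realSpace.obj (𝟙_ SuperVect) :=
  elemHom (m := realSpace.obj (𝟙_ SuperVect)) (1 : ℂ)

/-- The inclusion of the real line. -/
def realInclOdd : 𝟙_ (ModuleCat.{0} ℝ) ⟶ realSpace.obj oddLine := realInclUnit

/-- Complex conjugation. -/
def conjUnitReal : realSpace.obj (𝟙_ SuperVect) ⟶ realSpace.obj (𝟙_ SuperVect) :=
  ModuleCat.ofHom (X := realSpace.obj (𝟙_ SuperVect)) (Y := realSpace.obj (𝟙_ SuperVect))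
    { toFun := fun z : ℂ => (starRingEnd ℂ z : ℂ)
      map_add' := fun z w => map_add (starRingEnd ℂ) z w
      map_smul' := fun r (z : ℂ) => by
        change starRingEnd ℂ ((r : ℂ) * z : ℂ) = ((r : ℂ) * (starRingEnd ℂ z : ℂ) : ℂ)
        rw [map_mul, Complex.conj_ofReal] }

lemma realSpace_hom_ext {X : SuperVect} {m : ModuleCat.{0} ℝ} {f g : realSpace.obj X ⟶ m}
    (h : ∀ z : X.V, f.hom z = g.hom z) : f = g := ModuleCat.hom_ext (LinearMap.ext h)

lemma isRealForm_unit :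
    IsRealForm (realSpace.map (imag (𝟙_ SuperVect))) realInclUnit realPartUnit where
  sq := realSpace_hom_ext fun (z : ℂ) => by
    change Complex.I * (Complex.I * z) = -z
    rw [← mul_assoc, Complex.I_mul_I, neg_one_mul]
  ret := ModuleCat.hom_ext (LinearMap.ext fun (r : ℝ) => by
    change ((r : ℂ) * 1).re = r
    simp)
  zero := ModuleCat.hom_ext (LinearMap.ext fun (r : ℝ) => by
    change (Complex.I * ((r : ℂ) * 1)).re = 0
    simp)
  total := realSpace_hom_ext fun (z : ℂ) => by
    change ((z.re : ℝ) : ℂ) * 1 - Complex.I * (((Complex.I * z).re : ℝ) * 1) = z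
    apply Complex.ext <;> simp

lemma isRealForm_odd : IsRealForm (realSpace.map (imag oddLine)) realInclOdd realPartOdd :=
  isRealForm_unit

lemma conjUnitReal_sq : conjUnitReal ≫ conjUnitReal = 𝟙 _ :=
  realSpace_hom_ext fun (z : ℂ) => Complex.conj_conj z

lemma imag_conjUnitReal : realSpace.map (imag (𝟙_ SuperVect)) ≫ conjUnitReal =
    -conjUnitReal ≫ realSpace.map (imag (𝟙_ SuperVect)) := realSpace_hom_ext fun (z : ℂ) => by
  change starRingEnd ℂ (Complex.I * z) = -(Complex.I * starRingEnd ℂ z)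
  simp

lemma realInclUnit_conj : realInclUnit ≫ conjUnitReal = realInclUnit :=
  ModuleCat.hom_ext (LinearMap.ext fun (r : ℝ) => by
    change starRingEnd ℂ ((r : ℂ) * 1 : ℂ) = ((r : ℂ) * 1 : ℂ)
    simp)

end SuperFunFree

section Biprod

variable {U : Type u} [Category.{v} U]

lemma conj_inv {a b : U} {f : a ⟶ b} (_ : IsIso f) {J : a ⟶ a} {J' : b ⟶ b} (h : J ≫ f = f ≫ J') :
    J' ≫ inv f = inv f ≫ J := by
  rw [IsIso.comp_inv_eq, Category.assoc, h, IsIso.inv_hom_id_assoc]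

variable [Preadditive U] [HasBinaryBiproducts U]

lemma biprod_map_id {a b : U} : biprod.map (𝟙 a) (𝟙 b) = 𝟙 (a ⊞ b) := by
  apply biprod.hom_ext <;> simp

lemma biprod_map_comp {a b a' b' a'' b'' : U} (f : a ⟶ a') (g : b ⟶ b') (f' : a' ⟶ a'')
    (g' : b' ⟶ b'') : biprod.map (f ≫ f') (g ≫ g') = biprod.map f g ≫ biprod.map f' g' := by
  apply biprod.hom_ext <;> simp

lemma biprod_lift_map {x a b a' b' : U} (s : x ⟶ a) (t : x ⟶ b) (f : a ⟶ a') (g : b ⟶ b') :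
    biprod.lift s t ≫ biprod.map f g = biprod.lift (s ≫ f) (t ≫ g) := by
  apply biprod.hom_ext <;> simp

lemma isIso_of_biprod_map {a b a' b' : U} (f : a ⟶ a') (g : b ⟶ b')
    (h : IsIso (biprod.map f g)) : IsIso f ∧ IsIso g := by
  obtain ⟨n, e₁, e₂⟩ := h.out
  refine ⟨⟨biprod.inl ≫ n ≫ biprod.fst, ?_, ?_⟩,
    ⟨biprod.inr ≫ n ≫ biprod.snd, ?_, ?_⟩⟩
  · have := congrArg (fun t => biprod.inl ≫ t ≫ biprod.fst) e₁
    simpa using this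
  · have := congrArg (fun t => biprod.inl ≫ t ≫ biprod.fst) e₂
    simpa using this
  · have := congrArg (fun t => biprod.inr ≫ t ≫ biprod.snd) e₁
    simpa using this
  · have := congrArg (fun t => biprod.inr ≫ t ≫ biprod.snd) e₂
    simpa using this

end Biprod

namespace SuperFun

open MonoidalCategory MonoidalLeftAction SuperVect

section

variable {U : Type 1} [Category.{0} U] [Preadditive U] [Linear ℝ U]

lemma map_imag_sq {A : Type u₁} [Category.{v₁} A] [Preadditive A] {F : SuperVect ⥤ A} [F.Additive]
    (X : SuperVect) : F.map (imag X) ≫ F.map (imag X) = -𝟙 _ := by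
  rw [← F.map_comp, imag_imag, F.map_neg, F.map_id]

lemma ev_imag {F G : SuperFun U} (f : F ⟶ G) (X : SuperVect) :
    F.functor.map (imag X) ≫ (ev X).map f = (ev X).map f ≫ G.functor.map (imag X) :=
  (forget.map f).naturality _

lemma exists_hom {F G : SuperFun U}
    (t₀ : F.functor.obj (𝟙_ SuperVect) ⟶ G.functor.obj (𝟙_ SuperVect))
    (t₁ : F.functor.obj oddLine ⟶ G.functor.obj oddLine)
    (h₀ : F.functor.map (imag (𝟙_ SuperVect)) ≫ t₀ = t₀ ≫ G.functor.map (imag (𝟙_ SuperVect)))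
    (h₁ : F.functor.map (imag oddLine) ≫ t₁ = t₁ ≫ G.functor.map (imag oddLine)) :
    ∃ f : F ⟶ G, (ev (𝟙_ SuperVect)).map f = t₀ ∧ (ev oddLine).map f = t₁ := by
  obtain ⟨α, hα, hα'⟩ := exists_natTrans F.property G.property t₀ t₁ h₀ h₁
  refine ⟨ofTrans α, ?_, ?_⟩
  · rw [← hα]
    exact congrArg (fun α => α.app (𝟙_ SuperVect)) (trans_ofTrans α)
  · rw [← hα']
    exact congrArg (fun α => α.app oddLine) (trans_ofTrans α)

lemma isIso_of_ev {F G : SuperFun U} (f : F ⟶ G) (h₀ : IsIso ((ev (𝟙_ SuperVect)).map f))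
    (h₁ : IsIso ((ev oddLine).map f)) : IsIso f := by
  obtain ⟨g, hg, hg'⟩ := exists_hom (F := G) (G := F)
    (show (ev (𝟙_ SuperVect)).obj G ⟶ (ev (𝟙_ SuperVect)).obj F from
      inv ((ev (𝟙_ SuperVect)).map f))
    (show (ev oddLine).obj G ⟶ (ev oddLine).obj F from inv ((ev oddLine).map f))
    (conj_inv h₀ (ev_imag f (𝟙_ SuperVect))) (conj_inv h₁ (ev_imag f oddLine))
  refine ⟨g, hom_ext ?_ ?_, hom_ext ?_ ?_⟩
  · rw [Functor.map_comp, CategoryTheory.Functor.map_id, hg]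
    exact IsIso.hom_inv_id _
  · rw [Functor.map_comp, CategoryTheory.Functor.map_id, hg']
    exact IsIso.hom_inv_id _
  · rw [Functor.map_comp, CategoryTheory.Functor.map_id, hg]
    exact IsIso.inv_hom_id _
  · rw [Functor.map_comp, CategoryTheory.Functor.map_id, hg']
    exact IsIso.inv_hom_id _

end

variable {V : LinMod (ModuleCat.{0} ℝ)} (hV : IsVectMod V)

lemma isRealForm_orbit (hV : IsVectMod V) {m : ModuleCat.{0} ℝ} {J : m ⟶ m}
    {i : 𝟙_ (ModuleCat.{0} ℝ) ⟶ m} {r : m ⟶ 𝟙_ (ModuleCat.{0} ℝ)} (h : IsRealForm J i r)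
    (v : V.carrier) : IsRealForm ((orbit (𝟭 _) V v).map J)
      ((λₗ[ModuleCat.{0} ℝ] v).inv ≫ (orbit (𝟭 _) V v).map i)
      ((orbit (𝟭 _) V v).map r ≫ (λₗ[ModuleCat.{0} ℝ] v).hom) := by
  have := (hV v).additive
  exact (h.map (orbit (𝟭 _) V v)).of_iso (λₗ[ModuleCat.{0} ℝ] v).symm

/-- The free functor on an object. -/
def free (v : V.carrier) : SuperFun V.carrier :=
  ⟨realSpace ⋙ orbit (𝟭 _) V v, isCocontLinear_realSpace.comp (hV v)⟩

/-- The inclusion in the even part of the free functor. -/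
def inclUnit (v : V.carrier) : v ⟶ (free hV v).functor.obj (𝟙_ SuperVect) :=
  (λₗ[ModuleCat.{0} ℝ] v).inv ≫ (orbit (𝟭 _) V v).map realInclUnit

/-- The retraction of the even part of the free functor. -/
def retUnit (v : V.carrier) : (free hV v).functor.obj (𝟙_ SuperVect) ⟶ v :=
  (orbit (𝟭 _) V v).map realPartUnit ≫ (λₗ[ModuleCat.{0} ℝ] v).hom

/-- The inclusion in the odd part of the free functor. -/
def inclOdd (v : V.carrier) : v ⟶ (free hV v).functor.obj oddLine :=
  (λₗ[ModuleCat.{0} ℝ] v).inv ≫ (orbit (𝟭 _) V v).map realInclOdd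

/-- The retraction of the odd part of the free functor. -/
def retOdd (v : V.carrier) : (free hV v).functor.obj oddLine ⟶ v :=
  (orbit (𝟭 _) V v).map realPartOdd ≫ (λₗ[ModuleCat.{0} ℝ] v).hom

lemma isRealForm_free_unit (v : V.carrier) : IsRealForm
    ((free hV v).functor.map (imag (𝟙_ SuperVect))) (inclUnit hV v) (retUnit hV v) :=
  isRealForm_orbit hV isRealForm_unit v

lemma isRealForm_free_odd (v : V.carrier) : IsRealForm
    ((free hV v).functor.map (imag oddLine)) (inclOdd hV v) (retOdd hV v) :=
  isRealForm_orbit hV isRealForm_odd v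

section

variable [HasBinaryBiproducts V.carrier]

variable (V) in
/-- The sum of the two evaluations. -/
def evSum : SuperFun V.carrier ⥤ V.carrier where
  obj F := F.functor.obj (𝟙_ SuperVect) ⊞ F.functor.obj oddLine
  map f := biprod.map ((ev (𝟙_ SuperVect)).map f) ((ev oddLine).map f)
  map_id F := by
    rw [CategoryTheory.Functor.map_id, CategoryTheory.Functor.map_id]
    exact biprod_map_id
  map_comp f g := by
    rw [Functor.map_comp, Functor.map_comp]
    exact biprod_map_comp _ _ _ _

instance : (evSum V).Faithful := ⟨fun {F G f g} h => by
  have h' : biprod.map ((ev (𝟙_ SuperVect)).map f) ((ev oddLine).map f) =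
    biprod.map ((ev (𝟙_ SuperVect)).map g) ((ev oddLine).map g) := h
  refine hom_ext ?_ ?_
  · have := congrArg (fun t => biprod.inl ≫ t ≫ biprod.fst) h'
    simpa using this
  · have := congrArg (fun t => biprod.inr ≫ t ≫ biprod.snd) h'
    simpa using this⟩

instance : (evSum V).ReflectsIsomorphisms := ⟨fun f h =>
  have h' := isIso_of_biprod_map ((ev (𝟙_ SuperVect)).map f) ((ev oddLine).map f) h
  isIso_of_ev f h'.1 h'.2⟩

variable (V) in
lemma isCocontLinear_evSum [HasColimitsOfSize.{0, 0} V.carrier] : IsCocontLinear (evSum V) :=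
  .of_sum (F := evSum V) (K₀ := ev (𝟙_ SuperVect)) (K₁ := ev oddLine) (isCocontLinear_ev _)
    (isCocontLinear_ev _)
    { app := fun _ => biprod.fst, naturality := fun _ _ _ => biprod.map_fst _ _ }
    { app := fun _ => biprod.inl, naturality := fun _ _ _ => (biprod.inl_map _ _).symm }
    { app := fun _ => biprod.snd, naturality := fun _ _ _ => biprod.map_snd _ _ }
    { app := fun _ => biprod.inr, naturality := fun _ _ _ => (biprod.inr_map _ _).symm }
    fun _ => biprod.total

/-- The universal property of the free functor. -/
def freeEquiv (v : V.carrier) (F : SuperFun V.carrier) :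
    (free hV v ⟶ F) ≃ (v ⟶ (evSum V).obj F) :=
  Equiv.ofBijective
    (fun f => biprod.lift (inclUnit hV v ≫ (ev (𝟙_ SuperVect)).map f)
      (inclOdd hV v ≫ (ev oddLine).map f))
    ⟨fun f g h => by
      have h₀ := congrArg (· ≫ biprod.fst) h
      have h₁ := congrArg (· ≫ biprod.snd) h
      simp only [biprod.lift_fst, biprod.lift_snd] at h₀ h₁
      exact hom_ext
        ((isRealForm_free_unit hV v).hom_ext (ev_imag f _) (ev_imag g _) h₀)
        ((isRealForm_free_odd hV v).hom_ext (ev_imag f _) (ev_imag g _) h₁),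
    fun a => by
      have := F.property.additive
      let a' : v ⟶ F.functor.obj (𝟙_ SuperVect) ⊞ F.functor.obj oddLine := a
      obtain ⟨t₀, -, h₀, h₀'⟩ := (isRealForm_free_unit hV v).exists_lift
        (map_imag_sq (F := F.functor) _) (a' ≫ biprod.fst)
      obtain ⟨t₁, -, h₁, h₁'⟩ := (isRealForm_free_odd hV v).exists_lift
        (map_imag_sq (F := F.functor) _) (a' ≫ biprod.snd)
      obtain ⟨f, hf, hf'⟩ := exists_hom t₀ t₁ h₀ h₁
      refine ⟨f, biprod.hom_ext _ _ ?_ ?_⟩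
      · refine (biprod.lift_fst _ _).trans ?_
        rw [hf, h₀']
      · refine (biprod.lift_snd _ _).trans ?_
        rw [hf', h₁']⟩

lemma freeEquiv_comp (v : V.carrier) (F G : SuperFun V.carrier) (g : F ⟶ G)
    (f : free hV v ⟶ F) : freeEquiv hV v G (f ≫ g) = freeEquiv hV v F f ≫ (evSum V).map g := by
  change biprod.lift (inclUnit hV v ≫ (ev (𝟙_ SuperVect)).map (f ≫ g))
      (inclOdd hV v ≫ (ev oddLine).map (f ≫ g)) =
    biprod.lift (inclUnit hV v ≫ (ev (𝟙_ SuperVect)).map f)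
      (inclOdd hV v ≫ (ev oddLine).map f) ≫
        biprod.map ((ev (𝟙_ SuperVect)).map g) ((ev oddLine).map g)
  rw [Functor.map_comp, Functor.map_comp, biprod_lift_map]
  exact congrArg₂ biprod.lift (Category.assoc _ _ _).symm (Category.assoc _ _ _).symm

/-- Free functors are left adjoint to the sum of the evaluations. -/
def freeAdj : Adjunction.leftAdjointOfEquiv (freeEquiv hV) (freeEquiv_comp hV) ⊣ evSum V :=
  Adjunction.adjunctionOfEquivLeft _ _

end

include hV

lemma isPres_mod (h : IsPres V.toLinCat) : IsPres (mod V.carrier).toLinCat := by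
  have := h.hasColimits
  have := h.hasBinaryBiproducts
  have : IsLocallyPresentable.{0} V.carrier := h
  have : PreservesColimitsOfSize.{0, 0} (evSum V) := (isCocontLinear_evSum V).cocontinuous
  have h' : IsLocallyPresentable.{0} (SuperFun V.carrier) :=
    isLocallyPresentable_of_adjunction (freeAdj hV)
  exact h'

lemma isFinDim_mod (h : IsFinDim V.toLinCat) : IsFinDim (mod V.carrier).toLinCat := by
  have := IsPres.hasColimits h.1
  have := IsPres.hasBinaryBiproducts h.1
  let Y : LinCat := { carrier := SuperFun V.carrier }
  have : HasColimitsOfSize.{0, 0} Y.carrier :=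
    inferInstanceAs (HasColimitsOfSize.{0, 0} (SuperFun V.carrier))
  have : Functor.Faithful (C := Y.carrier) (evSum V) := inferInstanceAs (evSum V).Faithful
  have : Functor.ReflectsIsomorphisms (C := Y.carrier) (evSum V) :=
    inferInstanceAs (evSum V).ReflectsIsomorphisms
  refine isFinDim_of_adjunction (X := V.toLinCat) (Y := Y) (freeAdj hV)
    (isCocontLinear_evSum V) h fun H s t hs ht => ?_
  have := H s t hs ht
  let ψ {x : V.carrier} (b : x ⟶ t) : (s ⟶ x) →ₗ[ℝ] (s ⟶ t) := Linear.rightComp ℝ s b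
  let J₀ := (free hV t).functor.map (imag (𝟙_ SuperVect))
  let J₁ := (free hV t).functor.map (imag oddLine)
  let p₀ : (free hV t).functor.obj (𝟙_ SuperVect) ⊞ (free hV t).functor.obj oddLine ⟶ _ :=
    biprod.fst
  let p₁ : (free hV t).functor.obj (𝟙_ SuperVect) ⊞ (free hV t).functor.obj oddLine ⟶ _ :=
    biprod.snd
  let φ : (s ⟶ (free hV t).functor.obj (𝟙_ SuperVect) ⊞ (free hV t).functor.obj oddLine) →ₗ[ℝ]
      ((s ⟶ t) × (s ⟶ t)) × ((s ⟶ t) × (s ⟶ t)) :=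
    ((ψ (p₀ ≫ retUnit hV t)).prod (ψ (p₀ ≫ J₀ ≫ retUnit hV t))).prod
      ((ψ (p₁ ≫ retOdd hV t)).prod (ψ (p₁ ≫ J₁ ≫ retOdd hV t)))
  refine Module.Finite.of_injective φ fun f g hfg => ?_
  have h₁ : f ≫ p₀ ≫ retUnit hV t = g ≫ p₀ ≫ retUnit hV t := congrArg (fun z => z.1.1) hfg
  have h₂ : f ≫ p₀ ≫ J₀ ≫ retUnit hV t = g ≫ p₀ ≫ J₀ ≫ retUnit hV t :=
    congrArg (fun z => z.1.2) hfg
  have h₃ : f ≫ p₁ ≫ retOdd hV t = g ≫ p₁ ≫ retOdd hV t := congrArg (fun z => z.2.1) hfg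
  have h₄ : f ≫ p₁ ≫ J₁ ≫ retOdd hV t = g ≫ p₁ ≫ J₁ ≫ retOdd hV t :=
    congrArg (fun z => z.2.2) hfg
  exact biprod.hom_ext _ _
    ((isRealForm_free_unit hV t).hom_ext_right
      ((Category.assoc _ _ _).trans (h₁.trans (Category.assoc _ _ _).symm))
      ((Category.assoc _ _ _).trans (h₂.trans (Category.assoc _ _ _).symm)))
    ((isRealForm_free_odd hV t).hom_ext_right
      ((Category.assoc _ _ _).trans (h₃.trans (Category.assoc _ _ _).symm))
      ((Category.assoc _ _ _).trans (h₄.trans (Category.assoc _ _ _).symm)))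

end SuperFun

section ConjDiv

open MonoidalCategory MonoidalLeftAction MonoidalRightAction SuperVect SemiProd SuperAut
  Functor.LaxMonoidal Functor.OplaxMonoidal

/-- The isomorphism `c(c⁻¹(x ⊗ 1)) ≅ x ⊗ 1`, for the complex conjugation `c`. -/
def conjDivIso (x : SuperVect) :
    conjFunctor.obj (x ⊙ᵣ inclJ.obj conj) ≅ x ⊗ 𝟙_ SuperVect :=
  divIso x (inclJ.obj conj)

/-- Division of the unit by complex conjugation. -/
def conjDiv : (𝟙_ SuperVect) ⊙ᵣ (inclJ.obj conj) ≅ 𝟙_ SuperVect :=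
  conjFunctor.preimageIso (conjDivIso (𝟙_ SuperVect) ≪≫ ρ_ (𝟙_ SuperVect) ≪≫
    Functor.Monoidal.εIso conjFunctor)

lemma conj_map_conjDiv : conjFunctor.map conjDiv.hom =
    (conjDivIso (𝟙_ SuperVect)).hom ≫ (ρ_ (𝟙_ SuperVect)).hom ≫ ε conjFunctor :=
  conjFunctor.map_preimage _

lemma conj_map_divHom {x x' : SuperVect} (f : x ⟶ x') :
    conjFunctor.map (f ⊵ᵣ inclJ.obj conj) ≫ (conjDivIso x').hom =
      (conjDivIso x).hom ≫ f ▷ 𝟙_ SuperVect :=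
  divHom_id_spec (i := vectToSuperVect) f (inclJ.obj conj)

lemma imag_divHom (x : SuperVect) :
    imag x ⊵ᵣ inclJ.obj conj = -imag (x ⊙ᵣ inclJ.obj conj) := by
  have h : conjFunctor.map (-imag (x ⊙ᵣ inclJ.obj conj)) ≫ (conjDivIso x).hom =
      (conjDivIso x).hom ≫ imag x ▷ 𝟙_ SuperVect := by
    rw [conjFunctor.map_neg, conj_imag, neg_neg, imag_whiskerRight, imag_natural]
  exact conjFunctor.map_injective ((cancel_mono (conjDivIso x).hom).1
    ((conj_map_divHom (imag x)).trans h.symm))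

lemma divParity (x : SuperVect) : (ρᵣ[SuperSemi] x).inv ≫ x ⊴ᵣ parityEnd ≫ (ρᵣ[SuperSemi] x).hom =
    parityHom x := by
  have h : parityHom (x ⊙ᵣ 𝟙_ SuperSemi) ≫ x ⊴ᵣ parityEnd ≫
      (divIso (i := vectToSuperVect) x (𝟙_ SuperSemi)).hom =
      (divIso (i := vectToSuperVect) x (𝟙_ SuperSemi)).hom ≫ (𝟙 x ⊗ₘ 𝟙 (𝟙_ SuperVect)) :=
    divHom_spec (i := vectToSuperVect) (𝟙 x) parityEnd
  have h' : x ⊴ᵣ parityEnd ≫ (divIso (i := vectToSuperVect) x (𝟙_ SuperSemi)).hom =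
      parityHom (x ⊙ᵣ 𝟙_ SuperSemi) ≫ (divIso (i := vectToSuperVect) x (𝟙_ SuperSemi)).hom := by
    have h₁ := congrArg (parityHom (x ⊙ᵣ 𝟙_ SuperSemi) ≫ ·) h
    rw [← Category.assoc, parityHom_parityHom, Category.id_comp] at h₁
    refine h₁.trans (congrArg (_ ≫ ·) ?_)
    exact (congrArg (_ ≫ ·) (id_tensorHom_id x (𝟙_ SuperVect))).trans (Category.comp_id _)
  have h'' : x ⊴ᵣ parityEnd ≫ (ρᵣ[SuperSemi] x).hom =
      parityHom (x ⊙ᵣ 𝟙_ SuperSemi) ≫ (ρᵣ[SuperSemi] x).hom := by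
    refine (Category.assoc _ _ _).symm.trans ?_
    exact (congrArg (· ≫ (ρ_ x).hom) h').trans (Category.assoc _ _ _)
  rw [h'', ← parityHom_natural, Iso.inv_hom_id_assoc]

lemma conjDiv_conjDiv : (αᵣ (𝟙_ SuperVect) (inclJ.obj conj) (inclJ.obj conj)).hom ≫
    conjDiv.hom ⊵ᵣ inclJ.obj conj ≫ conjDiv.hom =
      (𝟙_ SuperVect) ⊴ᵣ conjSqSemi.hom ≫ (ρᵣ[SuperSemi] (𝟙_ SuperVect)).hom := by
  refine conjFunctor.map_injective (conjFunctor.map_injective ?_)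
  have hcc : ε conjFunctor ≫ conjFunctor.map (ε conjFunctor) ≫ conjConj.hom.app (𝟙_ SuperVect) =
      𝟙 _ := (Category.assoc _ _ _).symm.trans (NatTrans.IsMonoidal.unit (τ := conjConj.hom))
  rw [← cancel_mono (conjConj.hom.app (𝟙_ SuperVect))]
  let t : conjFunctor.obj (conjFunctor.obj ((𝟙_ SuperVect) ⊙ᵣ (inclJ.obj conj ⊗ inclJ.obj conj))) ≅
      𝟙_ SuperVect ⊗ 𝟙_ SuperVect ⊗ conjFunctor.obj (𝟙_ SuperVect) :=
    divIso (𝟙_ SuperVect) (inclJ.obj conj ⊗ inclJ.obj conj)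
  let s : (𝟙_ SuperVect) ⊙ᵣ 𝟙_ SuperSemi ≅ 𝟙_ SuperVect ⊗ 𝟙_ SuperVect :=
    divIso (i := vectToSuperVect) (𝟙_ SuperVect) (𝟙_ SuperSemi)
  have h₁ : conjFunctor.map (conjFunctor.map (αᵣ (𝟙_ SuperVect) (inclJ.obj conj)
      (inclJ.obj conj)).hom) ≫
      conjFunctor.map (conjDivIso ((𝟙_ SuperVect) ⊙ᵣ inclJ.obj conj)).hom ≫
      δ conjFunctor ((𝟙_ SuperVect) ⊙ᵣ inclJ.obj conj) (𝟙_ SuperVect) ≫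
      (conjDivIso (𝟙_ SuperVect)).hom ▷ conjFunctor.obj (𝟙_ SuperVect) ≫
      (α_ (𝟙_ SuperVect) (𝟙_ SuperVect) (conjFunctor.obj (𝟙_ SuperVect))).hom = t.hom :=
    divAssoc_spec (i := vectToSuperVect) (𝟙_ SuperVect) (inclJ.obj conj) (inclJ.obj conj)
  have h₂ : conjConj.hom.app ((𝟙_ SuperVect) ⊙ᵣ (inclJ.obj conj ⊗ inclJ.obj conj)) ≫
      (𝟙_ SuperVect) ⊴ᵣ conjSqSemi.hom ≫ s.hom =
      t.hom ≫ (𝟙_ SuperVect ◁ ((λ_ (conjFunctor.obj (𝟙_ SuperVect))).hom ≫ η conjFunctor)) := by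
    have h := divHom_spec (i := vectToSuperVect) (𝟙 (𝟙_ SuperVect)) conjSqSemi.hom
    have h' : (conjSqSemi.hom : inclJ.obj conj ⊗ inclJ.obj conj ⟶ 𝟙_ SuperSemi).snd.trans.app
        ((𝟙_ SuperVect) ⊙ᵣ (inclJ.obj conj ⊗ inclJ.obj conj)) = conjConj.hom.app _ :=
      Category.id_comp _
    have h₃ : conjSqSemi.hom.fst = (λ_ (conjFunctor.obj (𝟙_ SuperVect))).hom ≫ η conjFunctor :=
      Category.comp_id _
    refine (congrArg (· ≫ _) h'.symm).trans (h.trans (congrArg (t.hom ≫ ·) ?_))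
    exact (id_tensorHom _ _).trans (congrArg (𝟙_ SuperVect ◁ ·) h₃)
  have h₄ : conjFunctor.map (conjFunctor.map (conjDiv.hom ⊵ᵣ inclJ.obj conj) ≫
      conjFunctor.map conjDiv.hom) ≫ conjConj.hom.app (𝟙_ SuperVect) =
      conjFunctor.map (conjDivIso ((𝟙_ SuperVect) ⊙ᵣ inclJ.obj conj)).hom ≫
      conjFunctor.map (ρ_ ((𝟙_ SuperVect) ⊙ᵣ inclJ.obj conj)).hom ≫
      (conjDivIso (𝟙_ SuperVect)).hom ≫ (ρ_ (𝟙_ SuperVect)).hom := by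
    have h : conjFunctor.map (conjDiv.hom ⊵ᵣ inclJ.obj conj) ≫ conjFunctor.map conjDiv.hom =
        (conjDivIso ((𝟙_ SuperVect) ⊙ᵣ inclJ.obj conj)).hom ≫
          (ρ_ ((𝟙_ SuperVect) ⊙ᵣ inclJ.obj conj)).hom ≫ conjDiv.hom ≫ ε conjFunctor := by
      rw [conj_map_conjDiv, reassoc_of% conj_map_divHom, rightUnitor_naturality_assoc]
    rw [h]
    simp only [Functor.map_comp, Category.assoc, conj_map_conjDiv, hcc, Category.comp_id]
  have h₅ {a b : SuperVect} (d : conjFunctor.obj a ⟶ b ⊗ 𝟙_ SuperVect) :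
      conjFunctor.map (ρ_ a).hom ≫ d ≫ (ρ_ b).hom =
      δ conjFunctor a (𝟙_ SuperVect) ≫ d ▷ conjFunctor.obj (𝟙_ SuperVect) ≫
      (α_ b (𝟙_ SuperVect) (conjFunctor.obj (𝟙_ SuperVect))).hom ≫
      b ◁ ((λ_ (conjFunctor.obj (𝟙_ SuperVect))).hom ≫ η conjFunctor) ≫ (ρ_ b).hom := by
    rw [← Functor.OplaxMonoidal.right_unitality_hom conjFunctor a]
    simp only [Category.assoc, MonoidalCategory.whiskerLeft_comp, triangle_assoc]
    have e : d ▷ conjFunctor.obj (𝟙_ SuperVect) ≫ (ρ_ b).hom ▷ conjFunctor.obj (𝟙_ SuperVect) ≫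
        b ◁ η conjFunctor ≫ (ρ_ b).hom = conjFunctor.obj a ◁ η conjFunctor ≫
        d ▷ 𝟙_ SuperVect ≫ (ρ_ b).hom ▷ 𝟙_ SuperVect ≫ (ρ_ b).hom := by
      rw [whisker_exchange_assoc, whisker_exchange_assoc]
    rw [e, rightUnitor_naturality, rightUnitor_naturality_assoc]
  have h₆ : conjConj.hom.app ((𝟙_ SuperVect) ⊙ᵣ (inclJ.obj conj ⊗ inclJ.obj conj)) ≫
      (𝟙_ SuperVect) ⊴ᵣ conjSqSemi.hom ≫ (ρᵣ[SuperSemi] (𝟙_ SuperVect)).hom =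
      t.hom ≫ (𝟙_ SuperVect ◁ ((λ_ (conjFunctor.obj (𝟙_ SuperVect))).hom ≫ η conjFunctor)) ≫
        (ρ_ (𝟙_ SuperVect)).hom := by
    refine Eq.trans ?_ ((congrArg (· ≫ (ρ_ (𝟙_ SuperVect)).hom) h₂).trans (Category.assoc _ _ _))
    exact ((Category.assoc _ _ _).trans (congrArg (_ ≫ ·) (Category.assoc _ _ _))).symm
  refine Eq.trans ?_ (h₆.symm.trans (conjConj.hom.naturality _).symm)
  rw [← h₁]
  simp only [Functor.map_comp, Category.assoc] at h₄ ⊢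
  rw [h₄, h₅]

end ConjDiv

namespace SuperFun

open MonoidalCategory MonoidalLeftAction MonoidalRightAction SuperVect SemiProd SuperAut

variable {V : Type 1} [Category.{0} V] [Preadditive V] [Linear ℝ V]

lemma forget_comp_app {F G H : SuperFun V} (f : F ⟶ G) (g : G ⟶ H) (x : SuperVect) :
    (forget.map (f ≫ g)).app x = (forget.map f).app x ≫ (forget.map g).app x := by
  rw [forget.map_comp]
  rfl

lemma forget_parityEndo (F : SuperFun V) (x : SuperVect) :
    (forget.map (parityEndo (W := mod V) F)).app x = F.functor.map (parityHom x) := by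
  have h : (λₗ[SuperSemi] F).hom ≫ unitEnd parityEnd F = parityEnd ⊵ₗ F ≫
    (λₗ[SuperSemi] F).hom := by rw [unitEnd, Iso.hom_inv_id_assoc]
  have h₁ := congrArg (fun t => (forget.map t).app x) h
  rw [forget_comp_app, forget_comp_app, forget_actionUnitIso, forget_actionHomLeft] at h₁
  have h₂ := h₁.trans (F.functor.map_comp _ _).symm
  have h₃ : F.functor.map (ρᵣ[SuperSemi] x).hom ≫ F.functor.map (parityHom x) =
      F.functor.map (x ⊴ᵣ parityEnd ≫ (ρᵣ[SuperSemi] x).hom) := by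
    rw [← F.functor.map_comp, ← divParity, Iso.hom_inv_id_assoc]
  exact (cancel_epi (F.functor.map (ρᵣ[SuperSemi] x).hom)).1 (h₂.trans h₃.symm)

lemma forget_conjInv (F : SuperFun V) (x : SuperVect) :
    F.functor.map (αᵣ x (inclJ.obj conj) (inclJ.obj conj)).hom ≫
      (forget.map (conjInv (W := mod V) F).hom).app x =
    F.functor.map (x ⊴ᵣ conjSqSemi.hom ≫ (ρᵣ[SuperSemi] x).hom) := by
  have h : (αₗ (inclJ.obj conj) (inclJ.obj conj) F).hom ≫ (actInv conjSqSemi F).hom =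
      conjSqSemi.hom ⊵ₗ F ≫ (λₗ[SuperSemi] F).hom :=
    (congrArg (_ ≫ ·) (actInv_hom _ _)).trans (Iso.hom_inv_id_assoc _ _)
  have h₁ := congrArg (fun t => (forget.map t).app x) h
  rw [forget_comp_app, forget_comp_app, forget_actionUnitIso, forget_actionHomLeft,
    forget_actionAssocIso] at h₁
  exact h₁.trans (F.functor.map_comp _ _).symm

end SuperFun

lemma IsRealForm.conj_iso {U : Type u} [Category.{v} U] [Preadditive U] {a x y : U} {J : x ⟶ x}
    {i : a ⟶ x} {r : x ⟶ a} (h : IsRealForm J i r) (e : y ≅ x) {J' : y ⟶ y}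
    (hJ : J' ≫ e.hom = e.hom ≫ J) : IsRealForm J' (i ≫ e.inv) (e.hom ≫ r) := by
  have hJ' : J' = e.hom ≫ J ≫ e.inv := by
    rw [← reassoc_of% hJ, e.hom_inv_id, Category.comp_id]
  subst hJ'
  refine ⟨?_, ?_, ?_, ?_⟩
  · simp [reassoc_of% h.sq]
  · simp [h.ret]
  · simp [h.zero]
  · have := congrArg (fun t => e.hom ≫ t ≫ e.inv) h.total
    simpa using this

namespace SuperFun

open MonoidalCategory MonoidalLeftAction MonoidalRightAction SuperVect SemiProd SuperAut

variable {V : Type 1} [Category.{0} V] [Preadditive V] [Linear ℝ V]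

section

variable {F G : SuperFun V} (φ : inclJ.obj conj ⊙ₗ F ⟶ F) (ψ : inclJ.obj conj ⊙ₗ G ⟶ G)

/-- The components of a morphism from the conjugate. -/
def conjApp (x : SuperVect) : F.functor.obj (x ⊙ᵣ inclJ.obj conj) ⟶ F.functor.obj x :=
  (forget.map φ).app x

lemma conjApp_natural {x y : SuperVect} (f : x ⟶ y) :
    F.functor.map (f ⊵ᵣ inclJ.obj conj) ≫ conjApp φ y = conjApp φ x ≫ F.functor.map f :=
  (forget.map φ).naturality f

/-- The antilinear endomorphism given by a morphism from the conjugate. -/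
def conjEnd : F.functor.obj (𝟙_ SuperVect) ⟶ F.functor.obj (𝟙_ SuperVect) :=
  F.functor.map conjDiv.inv ≫ conjApp φ (𝟙_ SuperVect)

lemma conjApp_unit : conjApp φ (𝟙_ SuperVect) = F.functor.map conjDiv.hom ≫ conjEnd φ := by
  rw [conjEnd, ← F.functor.map_comp_assoc, Iso.hom_inv_id, F.functor.map_id, Category.id_comp]

lemma imag_conjEnd : F.functor.map (imag (𝟙_ SuperVect)) ≫ conjEnd φ =
    -conjEnd φ ≫ F.functor.map (imag (𝟙_ SuperVect)) := by
  have := F.property.additive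
  have h := conjApp_natural φ (imag (𝟙_ SuperVect))
  rw [imag_divHom, F.functor.map_neg] at h
  rw [conjEnd, ← F.functor.map_comp_assoc, ← imag_natural, F.functor.map_comp, Category.assoc,
    Category.assoc, ← h]
  simp

lemma conjApp_conj : conjApp φ ((𝟙_ SuperVect) ⊙ᵣ inclJ.obj conj) =
    F.functor.map (conjDiv.hom ⊵ᵣ inclJ.obj conj) ≫ F.functor.map conjDiv.hom ≫ conjEnd φ ≫
      F.functor.map conjDiv.inv := by
  have h := conjApp_natural φ conjDiv.hom
  rw [conjApp_unit] at h
  rw [reassoc_of% h, ← F.functor.map_comp, Iso.hom_inv_id, F.functor.map_id, Category.comp_id]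

lemma conj_comp_unit (f : F ⟶ G) :
    (ev (𝟙_ SuperVect)).map (inclJ.obj conj ⊴ₗ f ≫ ψ) =
      F.functor.map conjDiv.hom ≫ (ev (𝟙_ SuperVect)).map f ≫ conjEnd ψ := by
  have h : (ev (𝟙_ SuperVect)).map (inclJ.obj conj ⊴ₗ f ≫ ψ) =
      (forget.map f).app ((𝟙_ SuperVect) ⊙ᵣ inclJ.obj conj) ≫ conjApp ψ (𝟙_ SuperVect) :=
    (forget_comp_app _ _ _).trans (congrArg (· ≫ conjApp ψ (𝟙_ SuperVect))
      (forget_actionHomRight (inclJ.obj conj) f (𝟙_ SuperVect)))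
  rw [h, conjApp_unit]
  exact ((forget.map f).naturality_assoc conjDiv.hom (conjEnd ψ)).symm

lemma comp_unit (f : F ⟶ G) : (ev (𝟙_ SuperVect)).map (φ ≫ f) =
      F.functor.map conjDiv.hom ≫ conjEnd φ ≫ (ev (𝟙_ SuperVect)).map f := by
  have h : (ev (𝟙_ SuperVect)).map (φ ≫ f) =
      conjApp φ (𝟙_ SuperVect) ≫ (forget.map f).app (𝟙_ SuperVect) := forget_comp_app _ _ _
  rw [h, conjApp_unit]
  exact Category.assoc _ _ _

lemma conj_comp_iff (f : F ⟶ G) :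
    (ev (𝟙_ SuperVect)).map (inclJ.obj conj ⊴ₗ f ≫ ψ) = (ev (𝟙_ SuperVect)).map (φ ≫ f) ↔
      (ev (𝟙_ SuperVect)).map f ≫ conjEnd ψ = conjEnd φ ≫ (ev (𝟙_ SuperVect)).map f := by
  rw [conj_comp_unit, comp_unit]
  exact cancel_epi (F.functor.map conjDiv.hom)

lemma conjInv_unit : (ev (𝟙_ SuperVect)).map (conjInv (W := mod V) F).hom =
    F.functor.map (conjDiv.hom ⊵ᵣ inclJ.obj conj) ≫ F.functor.map conjDiv.hom := by
  have h := forget_conjInv F (𝟙_ SuperVect)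
  rw [← conjDiv_conjDiv, F.functor.map_comp] at h
  exact ((cancel_epi _).1 h).trans (F.functor.map_comp _ _)

lemma sq_iff : (ev (𝟙_ SuperVect)).map (inclJ.obj conj ⊴ₗ φ ≫ φ) =
    (ev (𝟙_ SuperVect)).map (conjInv (W := mod V) F).hom ↔ conjEnd φ ≫ conjEnd φ = 𝟙 _ := by
  have h : (ev (𝟙_ SuperVect)).map (inclJ.obj conj ⊴ₗ φ ≫ φ) =
      conjApp φ ((𝟙_ SuperVect) ⊙ᵣ inclJ.obj conj) ≫ conjApp φ (𝟙_ SuperVect) :=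
    (forget_comp_app _ _ _).trans (congrArg (· ≫ conjApp φ (𝟙_ SuperVect))
      (forget_actionHomRight (inclJ.obj conj) φ (𝟙_ SuperVect)))
  have h₁ : F.functor.map conjDiv.inv ≫ F.functor.map conjDiv.hom ≫ conjEnd φ = conjEnd φ := by
    rw [← F.functor.map_comp_assoc, Iso.inv_hom_id, F.functor.map_id, Category.id_comp]
  rw [h, conjInv_unit, conjApp_conj, conjApp_unit]
  simp only [Category.assoc, h₁]
  have h₂ := cancel_epi (F.functor.map (conjDiv.hom ⊵ᵣ inclJ.obj conj) ≫ F.functor.map conjDiv.hom)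
    (g := conjEnd φ ≫ conjEnd φ) (h := 𝟙 _)
  rw [Category.comp_id, Category.assoc] at h₂
  exact h₂

lemma isZero_odd (h : parityEndo (W := mod V) F = 𝟙 F) : IsZero (F.functor.obj oddLine) := by
  have := F.property.additive
  have h₁ : F.functor.map (parityHom oddLine) = 𝟙 _ := by
    rw [← forget_parityEndo]
    exact (congrArg (fun t => (forget.map t).app oddLine) h).trans
      (congrArg (fun t => t.app oddLine) (forget.map_id F))
  rw [show parityHom oddLine = -𝟙 _ from parityHom_odd _, F.functor.map_neg, F.functor.map_id] at h₁
  rw [IsZero.iff_id_eq_zero]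
  have h₂ : 𝟙 (F.functor.obj oddLine) = (1 / 2 : ℝ) • (𝟙 _ - -𝟙 _) := by module
  rw [h₂, h₁, sub_self, smul_zero]

end

lemma exists_isDescent {F : SuperFun V} (h : parityEndo (W := mod V) F = 𝟙 F)
    {c : F.functor.obj (𝟙_ SuperVect) ⟶ F.functor.obj (𝟙_ SuperVect)}
    (hc : F.functor.map (imag (𝟙_ SuperVect)) ≫ c = -c ≫ F.functor.map (imag (𝟙_ SuperVect)))
    (hcc : c ≫ c = 𝟙 _) :
    ∃ φ : inclJ.obj conj ⊙ₗ F ⟶ F, IsDescent (W := mod V) F φ ∧ conjEnd φ = c := by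
  have := F.property.additive
  have hz := isZero_odd h
  have h₀ : F.functor.map (imag (𝟙_ SuperVect) ⊵ᵣ inclJ.obj conj) ≫ F.functor.map conjDiv.hom ≫ c =
      (F.functor.map conjDiv.hom ≫ c) ≫ F.functor.map (imag (𝟙_ SuperVect)) := by
    rw [imag_divHom, F.functor.map_neg, Preadditive.neg_comp, ← F.functor.map_comp_assoc,
      ← imag_natural, F.functor.map_comp, Category.assoc, hc]
    simp
  obtain ⟨φ, hφ, -⟩ := exists_hom (F := (inclJ.obj conj ⊙ₗ F : SuperFun V)) (G := F)
    (F.functor.map conjDiv.hom ≫ c) 0 h₀ (hz.eq_of_tgt _ _)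
  have hφ' : conjEnd φ = c := by
    have e : conjApp φ (𝟙_ SuperVect) = F.functor.map conjDiv.hom ≫ c := hφ
    rw [conjEnd, e, ← F.functor.map_comp_assoc, Iso.inv_hom_id, F.functor.map_id, Category.id_comp]
  refine ⟨φ, ⟨h, hom_ext ?_ (hz.eq_of_tgt _ _)⟩, hφ'⟩
  rw [← hφ'] at hcc
  exact (sq_iff φ).2 hcc

section FixedPoints

/-- The functor underlying a fixed point. -/
def fixFun (M : FixedPt inclJ (mod V)) : SuperFun V := M.pt

/-- The conjugation of a fixed point. -/
def fixConj (M : FixedPt inclJ (mod V)) :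
    (fixFun M).functor.obj (𝟙_ SuperVect) ⟶ (fixFun M).functor.obj (𝟙_ SuperVect) :=
  conjEnd (F := fixFun M) M.conjHom

/-- The imaginary unit of a fixed point. -/
def fixImag (M : FixedPt inclJ (mod V)) :
    (fixFun M).functor.obj (𝟙_ SuperVect) ⟶ (fixFun M).functor.obj (𝟙_ SuperVect) :=
  (fixFun M).functor.map (imag (𝟙_ SuperVect))

/-- The component at the unit of a morphism of fixed points. -/
def fixVal {M N : FixedPt inclJ (mod V)} (f : M ⟶ N) :
    (fixFun M).functor.obj (𝟙_ SuperVect) ⟶ (fixFun N).functor.obj (𝟙_ SuperVect) :=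
  (ev (V := V) (𝟙_ SuperVect)).map (X := fixFun M) (Y := fixFun N) (FixedPt.val f)

variable (M N : FixedPt inclJ (mod V))

lemma fixImag_sq : fixImag M ≫ fixImag M = -𝟙 _ := by
  have := (fixFun M).property.additive
  exact map_imag_sq (F := (fixFun M).functor) _

lemma fixImag_conj : fixImag M ≫ fixConj M = -fixConj M ≫ fixImag M := imag_conjEnd _

lemma fixConj_sq : fixConj M ≫ fixConj M = 𝟙 _ :=
  (sq_iff (F := fixFun M) M.conjHom).1 (congrArg (ev (V := V) (𝟙_ SuperVect)).map M.isDescent.sq)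

lemma isZero_fixFun : IsZero ((fixFun M).functor.obj oddLine) := isZero_odd M.isDescent.parity

variable {M N}

lemma fixVal_imag (f : M ⟶ N) : fixImag M ≫ fixVal f = fixVal f ≫ fixImag N :=
  (forget.map (X := fixFun M) (Y := fixFun N) (FixedPt.val f)).naturality _

lemma fixVal_conj (f : M ⟶ N) : fixVal f ≫ fixConj N = fixConj M ≫ fixVal f :=
  (conj_comp_iff (F := fixFun M) (G := fixFun N) M.conjHom N.conjHom (FixedPt.val f)).1
    (congrArg (ev (V := V) (𝟙_ SuperVect)).map (FixedPt.conjHom_comm f))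

lemma fixVal_injective {f g : M ⟶ N} (h : fixVal f = fixVal g) : f = g :=
  FixedPt.hom_ext (hom_ext (F := fixFun M) (G := fixFun N) h ((isZero_fixFun N).eq_of_tgt _ _))

lemma exists_fixVal (t : (fixFun M).functor.obj (𝟙_ SuperVect) ⟶
    (fixFun N).functor.obj (𝟙_ SuperVect)) (h : fixImag M ≫ t = t ≫ fixImag N)
    (h' : t ≫ fixConj N = fixConj M ≫ t) : ∃ f : M ⟶ N, fixVal f = t := by
  obtain ⟨f, hf, -⟩ := exists_hom (F := fixFun M) (G := fixFun N) t 0 h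
    ((isZero_fixFun N).eq_of_tgt _ _)
  refine ⟨FixedPt.homOfConj f (hom_ext (F := (inclJ.obj conj ⊙ₗ fixFun M : SuperFun V))
    (G := fixFun N) ?_ ((isZero_fixFun N).eq_of_tgt _ _)), hf⟩
  rw [← hf] at h'
  exact (conj_comp_iff (F := fixFun M) (G := fixFun N) M.conjHom N.conjHom f).2 h'

lemma fixVal_id : fixVal (𝟙 M) = 𝟙 _ := (ev (V := V) (𝟙_ SuperVect)).map_id (fixFun M)

lemma fixVal_comp {M N P : FixedPt inclJ (mod V)} (f : M ⟶ N) (g : N ⟶ P) :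
    fixVal (f ≫ g) = fixVal f ≫ fixVal g :=
  (ev (V := V) (𝟙_ SuperVect)).map_comp (X := fixFun M) (Y := fixFun N) (Z := fixFun P)
    (FixedPt.val f) (FixedPt.val g)

variable [IsIdempotentComplete V]

variable (M) in
lemma exists_fixReal : ∃ (a : V) (i : a ⟶ (fixFun M).functor.obj (𝟙_ SuperVect))
    (r : (fixFun M).functor.obj (𝟙_ SuperVect) ⟶ a),
    IsRealForm (fixImag M) i r ∧ i ≫ fixConj M = i :=
  exists_isRealForm (fixImag_sq M) (fixImag_conj M) (fixConj_sq M)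

variable (M) in
/-- The real form of a fixed point. -/
def fixReal : V := (exists_fixReal M).choose

variable (M) in
/-- The inclusion of the real form of a fixed point. -/
def fixIncl : fixReal M ⟶ (fixFun M).functor.obj (𝟙_ SuperVect) :=
  (exists_fixReal M).choose_spec.choose

variable (M) in
/-- The retraction to the real form of a fixed point. -/
def fixRet : (fixFun M).functor.obj (𝟙_ SuperVect) ⟶ fixReal M :=
  (exists_fixReal M).choose_spec.choose_spec.choose

variable (M) in
lemma isRealForm_fix : IsRealForm (fixImag M) (fixIncl M) (fixRet M) :=
  (exists_fixReal M).choose_spec.choose_spec.choose_spec.1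

variable (M) in
lemma fixIncl_conj : fixIncl M ≫ fixConj M = fixIncl M :=
  (exists_fixReal M).choose_spec.choose_spec.choose_spec.2

lemma fixIncl_val (f : M ⟶ N) :
    fixIncl M ≫ fixVal f ≫ fixRet N ≫ fixIncl N = fixIncl M ≫ fixVal f := by
  have h := (isRealForm_fix N).ret_incl (fixImag_conj N) (fixIncl_conj N)
    (f := fixIncl M ≫ fixVal f)
    (by rw [Category.assoc, fixVal_conj, reassoc_of% (fixIncl_conj M)])
  rwa [Category.assoc] at h

variable (V) in
/-- The real form of a fixed point. -/
def realForm : FixedPt inclJ (mod V) ⥤ V where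
  obj M := fixReal M
  map {M N} f := fixIncl M ≫ fixVal f ≫ fixRet N
  map_id M := by rw [fixVal_id, Category.id_comp, (isRealForm_fix M).ret]
  map_comp {M N P} f g := by
    have h := fixIncl_val f
    rw [fixVal_comp]
    simp only [Category.assoc]
    rw [reassoc_of% h]

instance : (realForm V).Faithful := ⟨fun {M N f g} h => by
  have h' : fixIncl M ≫ fixVal f ≫ fixRet N = fixIncl M ≫ fixVal g ≫ fixRet N := h
  refine fixVal_injective ((isRealForm_fix M).hom_ext (fixVal_imag f) (fixVal_imag g) ?_)
  rw [← fixIncl_val f, ← fixIncl_val g, reassoc_of% h']⟩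

instance : (realForm V).Full := ⟨fun {M N} a => by
  let a' : fixReal M ⟶ fixReal N := a
  obtain ⟨t, ht, hJ, hi⟩ := (isRealForm_fix M).exists_lift (fixImag_sq N) (a' ≫ fixIncl N)
  obtain ⟨f, rfl⟩ := exists_fixVal t hJ ((isRealForm_fix M).lift_conj (fixImag_conj M)
    (fixIncl_conj M) (fixImag_conj N) (by rw [Category.assoc, fixIncl_conj]) ht hJ hi).symm
  refine ⟨f, ?_⟩
  change fixIncl M ≫ fixVal f ≫ fixRet N = a'
  rw [reassoc_of% hi, (isRealForm_fix N).ret, Category.comp_id]⟩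

lemma nonempty_realForm_iso {a : V} {i : a ⟶ (fixFun M).functor.obj (𝟙_ SuperVect)}
    {r : (fixFun M).functor.obj (𝟙_ SuperVect) ⟶ a} (h : IsRealForm (fixImag M) i r)
    (hi : i ≫ fixConj M = i) : Nonempty ((realForm V).obj M ≅ a) :=
  let e : fixReal M ≅ a :=
    { hom := fixIncl M ≫ r
      inv := i ≫ fixRet M
      hom_inv_id := by
        have h₁ := h.ret_incl (fixImag_conj M) hi (fixIncl_conj M)
        rw [Category.assoc, reassoc_of% h₁, (isRealForm_fix M).ret]
      inv_hom_id := by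
        have h₁ := (isRealForm_fix M).ret_incl (fixImag_conj M) (fixIncl_conj M) hi
        rw [Category.assoc, reassoc_of% h₁, h.ret] }
  ⟨e⟩

end FixedPoints

end SuperFun

namespace SuperFun

open MonoidalCategory MonoidalLeftAction MonoidalRightAction SuperVect SemiProd SuperAut

section

variable {V : Type 1} [Category.{0} V] [Preadditive V] [Linear ℝ V]

lemma isCocontLinear_realForm [IsIdempotentComplete V] [(realForm V).IsEquivalence] :
    IsCocontLinear (realForm V) where
  additive := ⟨fun {M N f g} => by
    have h : fixVal (f + g) = fixVal f + fixVal g :=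
      (ev (V := V) (𝟙_ SuperVect)).map_add (X := fixFun M) (Y := fixFun N)
        (f := FixedPt.val f) (g := FixedPt.val g)
    change fixIncl M ≫ fixVal (f + g) ≫ fixRet N =
      fixIncl M ≫ fixVal f ≫ fixRet N + fixIncl M ≫ fixVal g ≫ fixRet N
    rw [h, Preadditive.add_comp, Preadditive.comp_add]⟩
  linear := ⟨fun {M N} f r => by
    have h : fixVal (r • f) = r • fixVal f :=
      (ev (V := V) (𝟙_ SuperVect)).map_smul (X := fixFun M) (Y := fixFun N) r (FixedPt.val f)
    change fixIncl M ≫ fixVal (r • f) ≫ fixRet N = r • (fixIncl M ≫ fixVal f ≫ fixRet N)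
    rw [h, Linear.smul_comp, Linear.comp_smul]⟩
  cocontinuous := inferInstance

/-- The even part splits off from a functor on supervector spaces. -/
lemma exists_evenPart [HasColimitsOfSize.{0, 0} V] (F : SuperFun V) : ∃ (G : SuperFun V) (i : G ⟶ F) (p : F ⟶ G),
    parityEndo (W := mod V) G = 𝟙 G ∧ i ≫ p = 𝟙 G ∧
      (ev (𝟙_ SuperVect)).map p ≫ (ev (𝟙_ SuperVect)).map i = 𝟙 _ := by
  have : IsIdempotentComplete (SuperFun V) := isIdempotentComplete_of_hasCoequalizers
  let P : F ⟶ F := parityEndo (W := mod V) F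
  have hP : P ≫ P = 𝟙 F := parityEndo_parityEndo (W := mod V) F
  obtain ⟨G, i, p, hip, hpi⟩ := IsIdempotentComplete.idempotents_split F
    ((1 / 2 : ℝ) • (𝟙 F + P)) (by
      simp only [Linear.comp_smul, Linear.smul_comp, Preadditive.comp_add, Preadditive.add_comp,
        Category.id_comp, Category.comp_id, hP]
      module)
  refine ⟨G, i, p, ?_, hip, ?_⟩
  · have h₁ : ((1 / 2 : ℝ) • (𝟙 F + P)) ≫ P = (1 / 2 : ℝ) • (𝟙 F + P) := by
      simp only [Linear.smul_comp, Preadditive.add_comp, Category.id_comp, hP, add_comm]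
    have h₂ : i ≫ P = i := by
      rw [← hpi, Category.assoc] at h₁
      rw [← Category.id_comp (i ≫ P), ← hip, Category.assoc, h₁, reassoc_of% hip]
    let PG : G ⟶ G := parityEndo (W := mod V) G
    have h₃ : i ≫ P = PG ≫ i := parityEndo_natural (W := mod V) i
    have h₄ : PG = 𝟙 G := by
      rw [← Category.comp_id PG, ← hip, ← reassoc_of% h₃, reassoc_of% h₂]
    exact h₄
  · have hP₀ : (ev (𝟙_ SuperVect)).map P = 𝟙 _ := by
      refine (forget_parityEndo F (𝟙_ SuperVect)).trans ?_
      rw [show parityHom (𝟙_ SuperVect) = 𝟙 _ from rfl]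
      exact F.functor.map_id _
    rw [← Functor.map_comp, hpi, Functor.map_smul, Functor.map_add, hP₀,
      CategoryTheory.Functor.map_id]
    module

end

variable {V : LinMod (ModuleCat.{0} ℝ)}

lemma exists_fixedPt (hV : IsVectMod V) [HasColimitsOfSize.{0, 0} V.carrier] (v : V.carrier) :
    ∃ (M : FixedPt inclJ (mod V.carrier)) (i : v ⟶ (fixFun M).functor.obj (𝟙_ SuperVect))
      (r : (fixFun M).functor.obj (𝟙_ SuperVect) ⟶ v),
      IsRealForm (fixImag M) i r ∧ i ≫ fixConj M = i := by
  have := (hV v).additive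
  obtain ⟨G, i, p, hG, hip, hpi⟩ := exists_evenPart (free hV v)
  let e : G.functor.obj (𝟙_ SuperVect) ≅ (free hV v).functor.obj (𝟙_ SuperVect) :=
    { hom := (ev (𝟙_ SuperVect)).map i
      inv := (ev (𝟙_ SuperVect)).map p
      hom_inv_id := by
        refine ((ev (𝟙_ SuperVect)).map_comp i p).symm.trans ?_
        rw [hip]
        exact (ev (𝟙_ SuperVect)).map_id G
      inv_hom_id := hpi }
  have he : G.functor.map (imag (𝟙_ SuperVect)) ≫ e.hom =
    e.hom ≫ (free hV v).functor.map (imag (𝟙_ SuperVect)) := ev_imag i _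
  let c : (free hV v).functor.obj (𝟙_ SuperVect) ⟶ (free hV v).functor.obj (𝟙_ SuperVect) :=
    (orbit (𝟭 _) V v).map conjUnitReal
  have hc : (free hV v).functor.map (imag (𝟙_ SuperVect)) ≫ c =
      -c ≫ (free hV v).functor.map (imag (𝟙_ SuperVect)) := by
    refine ((orbit (𝟭 _) V v).map_comp _ _).symm.trans ?_
    rw [imag_conjUnitReal, Functor.map_neg, Functor.map_comp]
    rfl
  have hcc : c ≫ c = 𝟙 _ := by
    refine ((orbit (𝟭 _) V v).map_comp _ _).symm.trans ?_
    rw [conjUnitReal_sq]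
    exact (orbit (𝟭 _) V v).map_id _
  have hic : inclUnit hV v ≫ c = inclUnit hV v := by
    have h : (orbit (𝟭 _) V v).map realInclUnit ≫ (orbit (𝟭 _) V v).map conjUnitReal =
      (orbit (𝟭 _) V v).map realInclUnit := by rw [← Functor.map_comp, realInclUnit_conj]
    exact (Category.assoc _ _ _).trans (congrArg (_ ≫ ·) h)
  have he' : G.functor.map (imag (𝟙_ SuperVect)) =
      e.hom ≫ (free hV v).functor.map (imag (𝟙_ SuperVect)) ≫ e.inv := by
    rw [← reassoc_of% he, e.hom_inv_id, Category.comp_id]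
  obtain ⟨φ, hφ, hφ'⟩ := exists_isDescent hG (c := e.hom ≫ c ≫ e.inv)
    (by
      rw [he']
      simp [reassoc_of% hc])
    (by simp [reassoc_of% hcc])
  have hM : fixConj hφ.fixedPt = e.hom ≫ c ≫ e.inv :=
    (congrArg (conjEnd (F := G)) hφ.fixedPt_conjHom).trans hφ'
  refine ⟨hφ.fixedPt, inclUnit hV v ≫ e.inv, e.hom ≫ retUnit hV v,
    (isRealForm_free_unit hV v).conj_iso e he, ?_⟩
  have h : (inclUnit hV v ≫ e.inv) ≫ e.hom ≫ c ≫ e.inv = inclUnit hV v ≫ e.inv := by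
    rw [Category.assoc, e.inv_hom_id_assoc, reassoc_of% hic]
  exact (congrArg ((inclUnit hV v ≫ e.inv) ≫ ·) hM).trans h

lemma isEquivalence_realForm (hV : IsVectMod V) [HasColimitsOfSize.{0, 0} V.carrier]
    [IsIdempotentComplete V.carrier] : (realForm V.carrier).IsEquivalence where
  essSurj := ⟨fun v => by
    obtain ⟨M, i, r, h, hi⟩ := exists_fixedPt hV v
    exact ⟨M, nonempty_realForm_iso h hi⟩⟩

end SuperFun

section BaseChange

open SuperFun

/-- Every module is the category of fixed points of a module. -/
lemma exists_baseChange {Q : LinCat → Prop} (hQ : ∀ V, Q V → IsPres V)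
    (hmod : ∀ V : LinMod (ModuleCat.{0} ℝ), IsVectMod V → Q V.toLinCat →
      Q (mod V.carrier).toLinCat) (V : MOD (ModuleCat.{0} ℝ) Q) :
    ∃ (W : EquivariantMOD vectToSuperVect Q)
      (ι : V.of ⟶ fixObj (SemiProd.commutation vectToSuperVect) W.of),
      IsCocontLinear ι.functor ∧ ι.functor.IsEquivalence := by
  have hV : IsVectMod V.of := V.mem.2.2
  have h := hQ _ V.mem.1
  have := h.hasColimits
  have := h.isIdempotentComplete
  have hW : IsSuperMod (mod V.of.carrier) := isSuperMod_mod V.of.carrier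
  have := isEquivalence_realForm hV
  let R : V.of.carrier ⥤ FixedPt inclJ (mod V.of.carrier) := (realForm V.of.carrier).inv
  have hF : IsCocontLinear R := (isCocontLinear_realForm (V := V.of.carrier)).inv
  have hR : R.IsEquivalence := Functor.isEquivalence_inv _
  have : HasColimitsOfSize.{0, 0} (mod V.of.carrier).carrier :=
    inferInstanceAs (HasColimitsOfSize.{0, 0} (SuperFun V.of.carrier))
  obtain ⟨ι, hι⟩ := exists_vectModHom
    (W := fixObj (SemiProd.commutation vectToSuperVect) (mod V.of.carrier)) hV (orbit_fixObj hW)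
    R hF
  refine ⟨⟨mod V.of.carrier, hmod _ hV V.mem.1, hW.act, hW.orbit⟩, ι, ?_, ?_⟩
  · rw [hι]
    exact hF
  · rw [hι]
    exact hR

theorem isGalois_isPres : IsGalois vectToSuperVect IsPres :=
  isGalois_of_exists (fun _ h => h)
    (fun _ => isPres_fixObj) (exists_baseChange (fun _ h => h) fun _ hV h => isPres_mod hV h)

theorem isGalois_isFinDim : IsGalois vectToSuperVect IsFinDim :=
  isGalois_of_exists (fun _ h => h.1)
    (fun _ => isFinDim_fixObj) (exists_baseChange (fun _ h => h.1) fun _ hV h => isFinDim_mod hV h)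

end BaseChange

end CatGalois

end

theorem theorem1p8 :
    CatGalois.IsGalois CatGalois.vectToSuperVect CatGalois.IsPres ∧
      CatGalois.IsGalois CatGalois.vectToSuperVect CatGalois.IsFinDim :=
  ⟨CatGalois.isGalois_isPres, CatGalois.isGalois_isFinDim⟩
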